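/- Let $d,N\ge 1$ be integers, let $|\cdot|$ denote the Euclidean (Frobenius) norm, and let $W:\mathbb R^{d\times N}\to[0,\infty)$ and $\psi:\mathbb R^d\times S^{N-1}\to[0,\infty)$ be continuous functions with the following properties. There are constants $c_W,C_W,c_\psi,C_\psi,c>0$ and $\alpha\in(0,1)$ such that for all $A\in\mathbb R^{d\times N}$, $\lambda,\lambda_1,\lambda_2\in\mathbb R^d$, $\nu\in S^{N-1}$: * $c_W|A|\le W(A)\le C_W(1+|A|)$; * $W$ is globally Lipschitz continuous; * $\left|W^\infty(A)-\frac{W(tA)}{t}\right|\le \frac{c|A|^{1-\alpha}}{t^\alpha}$ whenever $t>0$ and $t|A|\ge 1$, where $W^\infty(A):=\limsup_{t\to+\infty}\frac{W(tA)}{t}$; * $c_\psi|\lambda|\le\psi(\lambda,\nu)\le C_\psi|\lambda|$; * $\psi(t\lambda,\nu)=t\psi(\lambda,\nu)$ for $t>0$, and $\psi(-\lambda,-\nu)=\psi(\lambda,\nu)$; * $\psi(\lambda_1+\lambda_2,\nu)\le\psi(\lambda_1,\nu)+\psi(\lambda_2,\nu)$. For an open set $U\subset\mathbb R^N$ and $u\in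 SBV(U;\mathbb R^d)$, with $Du=\nabla u\,\mathcal L^N+[u]\otimes\nu_u\,\mathcal H^{N-1}\llcorner S_u$, put $$E(u;U):=\int_U W(\nabla u)\,dx+\int_{U\cap S_u}\psi([u],\nu_u)\,d\mathcal H^{N-1},\qquad E^\infty(u;U):=\int_U W^\infty(\nabla u)\,dx+\int_{U\cap S_u}\psi([u],\nu_u)\,d\mathcal H^{N-1}.$$ Let $Q=(-\tfrac12,\tfrac12)^N$. For an orthonormal basis $b$ of $\mathbb R^N$ let $Q_b$ be the open unit cube centred at the origin with faces perpendicular to the vectors of $b$; if $\nu\in S^{N-1}$ is one of the vectors of $b$, then $Q_b$ is called a cube $Q_\nu$. For $A,B\in\mathbb R^{d\times N}$, $\lambda\in\mathbb R^d$, $\nu\in S^{N-1}$ and a cube $P$ of this kind, let, with boundary values understood in the sense of traces, $$\mathcal C^{\rm bulk}(A,B;P):=\Big\{u\in SBV(P;\mathbb R^d): u(x)=Ax\text{ on }\partial P,\ \frac{1}{|P|}\int_{P}\nabla u\,dx=B\Big\},$$ $$\mathcal C^{\rm surface}(\lambda,B;Q_\nu):=\Big\{u\in SBV(Q_\nu;\mathbb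 R^d): u=s_{\lambda,\nu}\text{ on }\partial Q_\nu,\ \frac{1}{|Q_\nu|}\int_{Q_\nu}\nabla u\,dx=B\Big\},\qquad s_{\lambda,\nu}(x):=\tfrac12\lambda(\operatorname{sgn}(x\cdot\nu)+1),$$ and define $$H(A,B):=\inf\{E(u;Q):u\in\mathcal C^{\rm bulk}(A,B;Q)\},\qquad h^c(A,B):=\inf\{E^\infty(u;Q):u\in\mathcal C^{\rm bulk}(A,B;Q)\},$$ $$h^c_b(A,B):=\inf\{E^\infty(u;Q_b):u\in\mathcal C^{\rm bulk}(A,B;Q_b)\},\qquad h^j(\lambda,B,\nu):=\inf\{E^\infty(u;Q_\nu):u\in\mathcal C^{\rm surface}(\lambda,B;Q_\nu)\},$$ and let $h^c_\nu:=h^c_b$ when $Q_\nu=Q_b$. Then the following hold. 1. For all $A,B\in\mathbb R^{d\times N}$ the limit $H^\infty(A,B):=\lim_{t\to+\infty}\frac{H(tA,tB)}{t}$ exists and $H^\infty(A,B)=h^c(A,B)$. 2. The cell formula for $h^c$ does not depend on the orientation of the cube: $h^c(A,B)=h^c_b(A,B)$ for all $A,B\in\mathbb R^{d\times N}$ and all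 orthonormal bases $b$. 3. For all $B\in\mathbb R^{d\times N}$, $\lambda\in\mathbb R^d$, $\nu\in S^{N-1}$, and every choice of the cube $Q_\nu$ (the same one for $h^c_\nu$ and $h^j$), $$h^c(\lambda\otimes\nu,B)=h^c_\nu(\lambda\otimes\nu,B)=h^j(\lambda,B,\nu).$$ -/

import Mathlib

open MeasureTheory Filter Topology
open scoped ContDiff ENNReal NNReal

noncomputable section

namespace StructuredDeformation

/-- `ℝⁿ` with the Euclidean norm. -/
abbrev Vec (n : ℕ) := EuclideanSpace ℝ (Fin n)

/-- `ℝ^{d×N}` with the Frobenius (Euclidean) norm; the entry in row `i` and column `j` of `A` is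
`A (i, j)`. -/
abbrev Mat (d N : ℕ) := EuclideanSpace ℝ (Fin d × Fin N)

variable {d N : ℕ}

/-- The matrix-vector product `A x`. -/
def mulVec (A : Mat d N) (x : Vec N) : Vec d :=
  WithLp.toLp 2 fun i => ∑ j, A (i, j) * x j

/-- The rank-one matrix `a ⊗ n`, with entries `a i * n j`. -/
def tensor (a : Vec d) (n : Vec N) : Mat d N :=
  WithLp.toLp 2 fun p => a p.1 * n p.2

/-! ### Energy densities -/

/-- The recession function `W^∞(A) = limsup_{t → +∞} W(tA)/t`. -/
def recession (W : Mat d N → ℝ) (A : Mat d N) : ℝ :=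
  limsup (fun t : ℝ => W (t • A) / t) atTop

/-- The assumptions on the bulk density `W : ℝ^{d×N} → [0,∞)`
(nonnegativity is part of `growth`). -/
structure IsBulkDensity (W : Mat d N → ℝ) : Prop where
  continuous : Continuous W
  growth : ∃ c C : ℝ, 0 < c ∧ 0 < C ∧ ∀ A, c * ‖A‖ ≤ W A ∧ W A ≤ C * (1 + ‖A‖)
  lipschitz : ∃ K : ℝ≥0, LipschitzWith K W
  recession_rate : ∃ c α : ℝ, 0 < c ∧ 0 < α ∧ α < 1 ∧
    ∀ (A : Mat d N) (t : ℝ), 0 < t → 1 ≤ t * ‖A‖ →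
      |recession W A - W (t • A) / t| ≤ c * ‖A‖ ^ (1 - α) / t ^ α

/-- The assumptions on the surface density `ψ : ℝ^d × S^{N-1} → [0,∞)`. Only the values
`ψ a n` with `‖n‖ = 1` matter (nonnegativity is part of `growth`). -/
structure IsSurfaceDensity (ψ : Vec d → Vec N → ℝ) : Prop where
  continuousOn : ContinuousOn (fun p : Vec d × Vec N => ψ p.1 p.2) {p | ‖p.2‖ = 1}
  growth : ∃ c C : ℝ, 0 < c ∧ 0 < C ∧
    ∀ (a : Vec d) (n : Vec N), ‖n‖ = 1 → c * ‖a‖ ≤ ψ a n ∧ ψ a n ≤ C * ‖a‖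
  homogeneous : ∀ (t : ℝ) (a : Vec d) (n : Vec N), 0 < t → ‖n‖ = 1 → ψ (t • a) n = t * ψ a n
  symmetric : ∀ (a : Vec d) (n : Vec N), ‖n‖ = 1 → ψ (-a) (-n) = ψ a n
  subadditive : ∀ (a₁ a₂ : Vec d) (n : Vec N), ‖n‖ = 1 → ψ (a₁ + a₂) n ≤ ψ a₁ n + ψ a₂ n

/-! ### Approximate jump points -/

/-- The open half ball `{y : |y - x| < r, (y - x) · n > 0}`. -/
def halfBall (x n : Vec N) (r : ℝ) : Set (Vec N) :=
  {y | y ∈ Metric.ball x r ∧ 0 < inner ℝ (y - x) n}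

/-- `a` is the one-sided approximate limit of `u` at `x` from the side to which `n` points. -/
def HasOneSidedLimit (u : Vec N → Vec d) (x n : Vec N) (a : Vec d) : Prop :=
  Tendsto (fun r : ℝ => ⨍⁻ y in halfBall x n r, ‖u y - a‖ₑ ∂volume) (𝓝[>] 0) (𝓝 0)

/-- `x` is an approximate jump point of `u`, with `u⁺(x) = p.1`, `u⁻(x) = p.2.1` and
`ν_u(x) = p.2.2`. The triple is unique up to exchanging `u⁺, u⁻` and changing the sign
of `ν_u`. -/
def IsJumpTriple (u : Vec N → Vec d) (x : Vec N) (p : Vec d × Vec d × Vec N) : Prop :=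
  p.1 ≠ p.2.1 ∧ ‖p.2.2‖ = 1 ∧
    HasOneSidedLimit u x p.2.2 p.1 ∧ HasOneSidedLimit u x (-p.2.2) p.2.1

/-- The jump set `S_u`. -/
def jumpSet (u : Vec N → Vec d) : Set (Vec N) :=
  {x | ∃ p, IsJumpTriple u x p}

open Classical in
/-- A choice of `(u⁺, u⁻, ν_u)` at the jump points of `u`. -/
def jumpTriple (u : Vec N → Vec d) (x : Vec N) : Vec d × Vec d × Vec N :=
  if h : ∃ p, IsJumpTriple u x p then h.choose else 0

/-- The jump `[u] = u⁺ - u⁻`. -/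
def jump (u : Vec N → Vec d) (x : Vec N) : Vec d :=
  (jumpTriple u x).1 - (jumpTriple u x).2.1

/-- The jump normal `ν_u`. -/
def jumpNormal (u : Vec N → Vec d) (x : Vec N) : Vec N :=
  (jumpTriple u x).2.2

/-! ### Special functions of bounded variation

Functions on an open set `U` are represented by functions on the whole space, whose values outside
`U` play no role. `μHE[N - 1]` is the `(N-1)`-dimensional Hausdorff measure, normalized so that it
is the Lebesgue measure on hyperplanes. -/

/-- `u ∈ L¹(U; ℝ^d)` and its distributional derivative on `U` is the finite measure
`Du = G 𝓛^N + [u] ⊗ ν_u 𝓗^{N-1}⌞S_u`. -/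
def HasSBVDerivative (U : Set (Vec N)) (u : Vec N → Vec d) (G : Vec N → Mat d N) : Prop :=
  IntegrableOn u U ∧ IntegrableOn G U ∧
  IntegrableOn (fun x => tensor (jump u x) (jumpNormal u x)) (U ∩ jumpSet u) μHE[N - 1] ∧
  ∀ φ : Vec N → ℝ, ContDiff ℝ ∞ φ → HasCompactSupport φ → tsupport φ ⊆ U →
    ∫ x in U, tensor (u x) (gradient φ x) =
      -((∫ x in U, φ x • G x) +
        ∫ x in U ∩ jumpSet u, φ x • tensor (jump u x) (jumpNormal u x) ∂μHE[N - 1])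

/-- `u ∈ SBV(U; ℝ^d)`: the distributional derivative of `u` is a finite measure without Cantor
part. -/
def IsSBV (U : Set (Vec N)) (u : Vec N → Vec d) : Prop :=
  ∃ G : Vec N → Mat d N, HasSBVDerivative U u G

open Classical in
/-- `∇u`, the density of the absolutely continuous part of `Du` (unique almost everywhere
in `U`). -/
def approxGradient (U : Set (Vec N)) (u : Vec N → Vec d) : Vec N → Mat d N :=
  if h : ∃ G : Vec N → Mat d N, HasSBVDerivative U u G then h.choose else 0

/-- The energy `∫_U W(∇u) dx + ∫_{U ∩ S_u} ψ([u], ν_u) d𝓗^{N-1}`. -/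
def energy (W : Mat d N → ℝ) (ψ : Vec d → Vec N → ℝ) (U : Set (Vec N)) (u : Vec N → Vec d) : ℝ :=
  (∫ x in U, W (approxGradient U u x)) +
    ∫ x in U ∩ jumpSet u, ψ (jump u x) (jumpNormal u x) ∂μHE[N - 1]

/-! ### Unit cubes and traces on their boundaries -/

/-- The open unit cube centred at the origin with faces perpendicular to the vectors of the
orthonormal basis `b`. -/
def cube (b : OrthonormalBasis (Fin N) ℝ (Vec N)) : Set (Vec N) :=
  {x | ∀ i, |inner ℝ (b i) x| < 1 / 2}

/-- The standard frame, whose cube is `Q = (-1/2, 1/2)^N`. -/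
def stdFrame (N : ℕ) : OrthonormalBasis (Fin N) ℝ (Vec N) := EuclideanSpace.basisFun (Fin N) ℝ

/-- The outer unit normal of `cube b` at a boundary point in the relative interior of a face.
(Its values at the points common to several faces, a null set, are irrelevant.) -/
def outerNormal (b : OrthonormalBasis (Fin N) ℝ (Vec N)) (x : Vec N) : Vec N :=
  ∑ i, if |inner ℝ (b i) x| = 1 / 2 then (2 * inner ℝ (b i) x) • b i else 0

/-- `u ∈ SBV(cube b; ℝ^d)` has trace `g` on the boundary of the cube: the trace is the function
in `L¹(∂Q; 𝓗^{N-1})` for which the Gauss-Green formula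
`∫_Q u ⊗ ∇φ dx + ∫_Q φ dDu = ∫_{∂Q} φ g ⊗ n d𝓗^{N-1}` holds for all smooth `φ`, with no
condition on `φ` at the boundary of the cube. -/
def HasTrace (b : OrthonormalBasis (Fin N) ℝ (Vec N)) (u g : Vec N → Vec d) : Prop :=
  IntegrableOn g (frontier (cube b)) μHE[N - 1] ∧
  ∀ φ : Vec N → ℝ, ContDiff ℝ ∞ φ → HasCompactSupport φ →
    (∫ x in cube b, tensor (u x) (gradient φ x)) +
      ((∫ x in cube b, φ x • approxGradient (cube b) u x) +
        ∫ x in cube b ∩ jumpSet u, φ x • tensor (jump u x) (jumpNormal u x) ∂μHE[N - 1]) =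
      ∫ x in frontier (cube b), φ x • tensor (g x) (outerNormal b x) ∂μHE[N - 1]

/-! ### Competitors and relaxed densities -/

/-- The competitors `u ∈ SBV(Q_b; ℝ^d)` with `u = A x` on `∂Q_b` and `⨍_{Q_b} ∇u dx = B`. -/
def bulkCompetitors (b : OrthonormalBasis (Fin N) ℝ (Vec N)) (A B : Mat d N) :
    Set (Vec N → Vec d) :=
  {u | IsSBV (cube b) u ∧ HasTrace b u (fun x => mulVec A x) ∧
    ⨍ x in cube b, approxGradient (cube b) u x = B}

/-- The elementary jump function `s_{a,n}(x) = ½ a (sgn(x · n) + 1)`. -/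
def elementaryJump (a : Vec d) (n x : Vec N) : Vec d :=
  ((1 / 2 : ℝ) * (Real.sign (inner ℝ x n) + 1)) • a

/-- The competitors `u ∈ SBV(Q_b; ℝ^d)` with `u = s_{a,n}` on `∂Q_b` and
`⨍_{Q_b} ∇u dx = B`. -/
def surfaceCompetitors (b : OrthonormalBasis (Fin N) ℝ (Vec N)) (a : Vec d) (B : Mat d N)
    (n : Vec N) : Set (Vec N → Vec d) :=
  {u | IsSBV (cube b) u ∧ HasTrace b u (elementaryJump a n) ∧
    ⨍ x in cube b, approxGradient (cube b) u x = B}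

/-- The relaxed bulk density `H`. -/
def bulkDensity (W : Mat d N → ℝ) (ψ : Vec d → Vec N → ℝ) (A B : Mat d N) : ℝ :=
  sInf (energy W ψ (cube (stdFrame N)) '' bulkCompetitors (stdFrame N) A B)

/-- The Cantor density computed on the unit cube with frame `b`: the infimum of
`E^∞(u; Q_b)`. If `ν` is a vector of `b`, then `Q_b` is a cube `Q_ν` and this is `h^c_ν`. -/
def cantorDensityOn (b : OrthonormalBasis (Fin N) ℝ (Vec N)) (W : Mat d N → ℝ)
    (ψ : Vec d → Vec N → ℝ) (A B : Mat d N) : ℝ :=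
  sInf (energy (recession W) ψ (cube b) '' bulkCompetitors b A B)

/-- The Cantor density `h^c`, computed on the standard unit cube. -/
def cantorDensity (W : Mat d N → ℝ) (ψ : Vec d → Vec N → ℝ) (A B : Mat d N) : ℝ :=
  cantorDensityOn (stdFrame N) W ψ A B

/-- The jump density `h^j(a, B, n)`, computed on the unit cube `Q_n` with frame `b`, where `n`
is one of the vectors of `b`. -/
def jumpDensityOn (b : OrthonormalBasis (Fin N) ℝ (Vec N)) (W : Mat d N → ℝ)
    (ψ : Vec d → Vec N → ℝ) (a : Vec d) (B : Mat d N) (n : Vec N) : ℝ :=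
  sInf (energy (recession W) ψ (cube b) '' surfaceCompetitors b a B n)

end StructuredDeformation

end

open StructuredDeformation

noncomputable section

namespace StructuredDeformation

variable {d N : ℕ}

/-! ### Linear algebra -/

/-! For the recession claim, the competitors for H(tA, tB) are exactly the functions t·v with v a
competitor for (A, B). The surface term is one-homogeneous, and the recession rate gives |W(tG)/t −
W^∞(G)| ≤ ε(t)(1 + |G|) with ε(t) → 0. Since W^∞ is coercive, ∫|G| is controlled by the energy of v,
so the two energies differ by at most ε(t)(1 + E^∞(v)/κ) and the infima converge
(`abs_densityEnergy_smul_sub_le`, `tendsto_sInf_energies`).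

The other claims are inequalities between infima of E^∞, and all of them come from one
transplantation principle. Let g be a base function with the target trace which, on finitely many
disjoint small cubes, is up to a constant a copy y ↦ t·m((y − x)/r) of a function m with the source
trace. Replace each copy by the same rescaling of a competitor u. Both parts of E^∞ are multiplied
by t·r^(N−1), because both densities are one-homogeneous. If the weights t·r^(N−1) add up to nearly
1 and |Dg| is small outside the cubes, then the new function has nearly the energy and the mean
gradient of u. One exceptional cube is reserved for correcting the mean gradient exactly, at a cost
linear in the error (`exists_competitor`, `exists_transplant`). `HasFillings` records the existence
of such base functions, and `HasFillings.sInf_le` is the resulting inequality.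

Three base functions suffice. An affine function is filled by lattice cubes of another orientation,
which gives independence of the frame (`hasFillings_mulVec`). The elementary jump is replaced by a
ramp of width 1/m, filled by one layer of cubes on which it is affine, which gives h^j ≤ h^c
(`hasFillings_elementaryJump`). The affine function with gradient λ⊗ν is replaced by a staircase of
step 1/m, filled by cubes each of which sees one elementary jump, which gives h^c ≤ h^j
(`hasFillings_mulVec_tensor`). In the last two cases a cutoff restores the exact trace in a thin
collar.

The delicate point is that the replacement must not create jumps on the boundaries of the small
cubes: traces agree only in the weak sense of the Green formula, while the jump set is defined
pointwise. The Green identity shows that the derivative of the glued function does not charge the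
interfaces. Differentiation of measures on a hyperplane then gives vanishing (N−1)-density at almost
every interface point, and a blow-up excludes a jump there (`hausdorff_inter_jumpSet_eq_zero`,
`HasSBVDerivative.glued`). Since traces and normal at a jump point are selected by choice,
everything is phrased through the tensor [u]⊗ν, which does not depend on the selection. -/

@[simp] lemma tensor_apply (a : Vec d) (n : Vec N) (p : Fin d × Fin N) :
    tensor a n p = a p.1 * n p.2 := rfl

@[simp] lemma mulVec_apply (A : Mat d N) (x : Vec N) (i : Fin d) :
    mulVec A x i = ∑ j, A (i, j) * x j := rfl

lemma norm_tensor (a : Vec d) (n : Vec N) : ‖tensor a n‖ = ‖a‖ * ‖n‖ := by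
  rw [EuclideanSpace.norm_eq, EuclideanSpace.norm_eq, EuclideanSpace.norm_eq,
    ← Real.sqrt_mul (by positivity), Fintype.sum_prod_type, Finset.sum_mul_sum]
  simp [mul_pow]

/-- The tensor product as a continuous bilinear map. -/
def tensorL : Vec d →L[ℝ] Vec N →L[ℝ] Mat d N :=
  LinearMap.mkContinuous₂
    (LinearMap.mk₂ ℝ tensor
      (fun a b n => by ext p; simp [add_mul])
      (fun c a n => by ext p; simp [mul_assoc])
      (fun a n m => by ext p; simp [mul_add])
      (fun c a n => by ext p; simp [mul_left_comm])) 1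
    (fun a n => by simp [norm_tensor])

lemma tensorL_apply (a : Vec d) (n : Vec N) : tensorL a n = tensor a n := rfl

lemma tensor_add_left (a b : Vec d) (n : Vec N) : tensor (a + b) n = tensor a n + tensor b n := by
  simp [← tensorL_apply]

lemma tensor_sub_left (a b : Vec d) (n : Vec N) : tensor (a - b) n = tensor a n - tensor b n := by
  simp [← tensorL_apply]

lemma tensor_smul_left (c : ℝ) (a : Vec d) (n : Vec N) : tensor (c • a) n = c • tensor a n := by
  simp [← tensorL_apply]

lemma tensor_smul_right (c : ℝ) (a : Vec d) (n : Vec N) : tensor a (c • n) = c • tensor a n := by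
  simp [← tensorL_apply]

lemma tensor_add_right (a : Vec d) (n m : Vec N) : tensor a (n + m) = tensor a n + tensor a m := by
  simp [← tensorL_apply]

lemma tensor_neg_left (a : Vec d) (n : Vec N) : tensor (-a) n = -tensor a n := by
  simp [← tensorL_apply]

lemma tensor_neg_right (a : Vec d) (n : Vec N) : tensor a (-n) = -tensor a n := by
  simp [← tensorL_apply]

@[simp] lemma tensor_zero_left (n : Vec N) : tensor (0 : Vec d) n = 0 := by
  simp [← tensorL_apply]

@[simp] lemma tensor_zero_right (a : Vec d) : tensor a (0 : Vec N) = 0 := by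
  simp [← tensorL_apply]

lemma tensor_sum_right {ι : Type*} (s : Finset ι) (a : Vec d) (n : ι → Vec N) :
    tensor a (∑ i ∈ s, n i) = ∑ i ∈ s, tensor a (n i) := by
  simp [← tensorL_apply]

lemma tensor_sum_left {ι : Type*} (s : Finset ι) (a : ι → Vec d) (n : Vec N) :
    tensor (∑ i ∈ s, a i) n = ∑ i ∈ s, tensor (a i) n := by
  simp [← tensorL_apply]

/-- The matrix-vector product as a bilinear map. -/
def mulVecL : Mat d N →ₗ[ℝ] Vec N →ₗ[ℝ] Vec d :=
  LinearMap.mk₂ ℝ mulVec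
      (fun a b n => by ext p; simp [add_mul, Finset.sum_add_distrib])
      (fun c a n => by ext p; simp [mul_assoc, Finset.mul_sum])
      (fun a n m => by ext p; simp [mul_add, Finset.sum_add_distrib])
      (fun c a n => by ext p; simp [mul_left_comm, Finset.mul_sum])

lemma mulVecL_apply (A : Mat d N) (x : Vec N) : mulVecL A x = mulVec A x := rfl

/-- The continuous linear map `x ↦ A x`. -/
def matCLM (A : Mat d N) : Vec N →L[ℝ] Vec d := LinearMap.toContinuousLinearMap (mulVecL A)

lemma mulVec_smul (A : Mat d N) (c : ℝ) (x : Vec N) : mulVec A (c • x) = c • mulVec A x := by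
  simp [← mulVecL_apply]

lemma smul_mulVec (A : Mat d N) (c : ℝ) (x : Vec N) : mulVec (c • A) x = c • mulVec A x := by
  simp [← mulVecL_apply]

lemma mulVec_add (A : Mat d N) (x y : Vec N) : mulVec A (x + y) = mulVec A x + mulVec A y := by
  simp [← mulVecL_apply]

@[simp] lemma zero_mulVec (x : Vec N) : mulVec (0 : Mat d N) x = 0 := by
  simp [← mulVecL_apply]

lemma mulVec_tensor (a : Vec d) (n x : Vec N) : mulVec (tensor a n) x = inner ℝ x n • a := by
  ext i
  simp [PiLp.inner_apply, mul_assoc, mul_comm, Finset.mul_sum]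

lemma continuous_mulVec (A : Mat d N) : Continuous (mulVec A) := (matCLM A).continuous

lemma norm_mulVec_le (A : Mat d N) (x : Vec N) : ‖mulVec A x‖ ≤ ‖A‖ * ‖x‖ := by
  rw [EuclideanSpace.norm_eq, EuclideanSpace.norm_eq, EuclideanSpace.norm_eq,
    ← Real.sqrt_mul (by positivity), Fintype.sum_prod_type, Finset.sum_mul]
  refine Real.sqrt_le_sqrt (Finset.sum_le_sum fun i _ => ?_)
  simp only [mulVec_apply, Real.norm_eq_abs, sq_abs]
  exact Finset.sum_mul_sq_le_sq_mul_sq _ _ _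

lemma mat_ext_mulVec {A B : Mat d N} (h : ∀ x, mulVec A x = mulVec B x) : A = B := by
  ext ⟨i, j⟩
  have := congrArg (fun v : Vec d => v i) (h (EuclideanSpace.single j 1))
  simpa [mulVec_apply] using this

/-- The identity is the sum of the projections b i ⊗ b i, so every matrix splits into rank-one
pieces along the frame. This is how `exists_competitor` reaches an arbitrary mean gradient with
corrections of the form a ⊗ b i. -/
lemma sum_tensor_mulVec (b : OrthonormalBasis (Fin N) ℝ (Vec N)) (M : Mat d N) :
    ∑ i, tensor (mulVec M (b i)) (b i) = M := by
  apply mat_ext_mulVec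
  intro x
  have h : mulVec (∑ i, tensor (mulVec M (b i)) (b i)) x
      = ∑ i, mulVec (tensor (mulVec M (b i)) (b i)) x := by
    simp [← mulVecL_apply]
  rw [h]
  simp_rw [mulVec_tensor]
  conv_rhs => rw [← b.sum_repr' x]
  simp [← mulVecL_apply, real_inner_comm]

/-! ### Test functions and the Green form -/

/-- Smooth compactly supported functions on `ℝᴺ`. -/
structure IsTest (φ : Vec N → ℝ) : Prop where
  contDiff : ContDiff ℝ ∞ φ
  hasCompactSupport : HasCompactSupport φ

lemma IsTest.continuous {φ : Vec N → ℝ} (h : IsTest φ) : Continuous φ := h.contDiff.continuous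

lemma IsTest.differentiable {φ : Vec N → ℝ} (h : IsTest φ) : Differentiable ℝ φ :=
  h.contDiff.differentiable (by simp)

lemma IsTest.continuous_gradient {φ : Vec N → ℝ} (h : IsTest φ) : Continuous (gradient φ) :=
  (InnerProductSpace.toDual ℝ (Vec N)).symm.continuous.comp (h.contDiff.continuous_fderiv (by simp))

lemma IsTest.gradient_hasCompactSupport {φ : Vec N → ℝ} (h : IsTest φ) :
    HasCompactSupport (gradient φ) :=
  (h.hasCompactSupport.fderiv (𝕜 := ℝ)).comp_left
    (g := (InnerProductSpace.toDual ℝ (Vec N)).symm) (by simp)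

lemma IsTest.exists_bound {φ : Vec N → ℝ} (h : IsTest φ) : ∃ C, ∀ x, ‖φ x‖ ≤ C :=
  h.hasCompactSupport.exists_bound_of_continuous h.continuous

lemma IsTest.exists_gradient_bound {φ : Vec N → ℝ} (h : IsTest φ) :
    ∃ C, ∀ x, ‖gradient φ x‖ ≤ C :=
  h.gradient_hasCompactSupport.exists_bound_of_continuous h.continuous_gradient

lemma inner_gradient {φ : Vec N → ℝ} (x v : Vec N) :
    inner ℝ (gradient φ x) v = fderiv ℝ φ x v := by
  simp [gradient]

lemma IsTest.integrableOn_smul {φ : Vec N → ℝ} (h : IsTest φ) {E : Type*} [NormedAddCommGroup E]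
    [NormedSpace ℝ E] {μ : Measure (Vec N)} {f : Vec N → E} {s : Set (Vec N)}
    (hf : IntegrableOn f s μ) : IntegrableOn (fun x => φ x • f x) s μ := by
  obtain ⟨C, hC⟩ := h.exists_bound
  exact Integrable.bdd_smul hf C h.continuous.aestronglyMeasurable (.of_forall hC)

lemma IsTest.integrableOn_tensor {φ : Vec N → ℝ} (h : IsTest φ) {μ : Measure (Vec N)}
    {u : Vec N → Vec d} {s : Set (Vec N)}
    (hf : IntegrableOn u s μ) : IntegrableOn (fun x => tensor (u x) (gradient φ x)) s μ := by
  obtain ⟨C, hC⟩ := h.exists_gradient_bound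
  refine Integrable.mono' (hf.norm.mul_const C) ?_ ?_
  · exact (tensorL (d := d) (N := N)).aestronglyMeasurable_comp₂ hf.aestronglyMeasurable
      h.continuous_gradient.aestronglyMeasurable
  · filter_upwards with x
    rw [norm_tensor]
    gcongr
    exact hC x

/-- The density `[u] ⊗ ν_u` of the jump part of the derivative. -/
def jumpTensor (u : Vec N → Vec d) (x : Vec N) : Mat d N := tensor (jump u x) (jumpNormal u x)

/-- The Green form `∫_U u ⊗ ∇φ dx + ∫_U φ dDu`. -/
def greenForm (U : Set (Vec N)) (u : Vec N → Vec d) (G : Vec N → Mat d N) (φ : Vec N → ℝ) :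
    Mat d N :=
  (∫ x in U, tensor (u x) (gradient φ x)) +
    ((∫ x in U, φ x • G x) + ∫ x in U ∩ jumpSet u, φ x • jumpTensor u x ∂μHE[N - 1])

/-- Membership in SBV becomes the vanishing of the Green form on test functions supported in `U`.
The same form on unrestricted test functions encodes the trace, so that both conditions are
propagated by identities between Green forms. -/
lemma hasSBVDerivative_iff {U : Set (Vec N)} {u : Vec N → Vec d} {G : Vec N → Mat d N} :
    HasSBVDerivative U u G ↔ IntegrableOn u U ∧ IntegrableOn G U ∧
      IntegrableOn (jumpTensor u) (U ∩ jumpSet u) μHE[N - 1] ∧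
      ∀ φ : Vec N → ℝ, IsTest φ → tsupport φ ⊆ U → greenForm U u G φ = 0 := by
  unfold HasSBVDerivative greenForm jumpTensor
  refine and_congr_right fun _ => and_congr_right fun _ => and_congr_right fun _ => ?_
  refine forall_congr' fun φ => ⟨fun h hφ hs => ?_, fun h h1 h2 hs => ?_⟩
  · rw [h hφ.1 hφ.2 hs]; simp
  · exact eq_neg_of_add_eq_zero_left (h ⟨h1, h2⟩ hs)

/-- The jump term depends on `u` alone, so it cancels between the two Green identities, and the
fundamental lemma of the calculus of variations applies to the difference of the gradients. -/
lemma HasSBVDerivative.ae_eq {U : Set (Vec N)} (hU : IsOpen U) {u : Vec N → Vec d}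
    {G G' : Vec N → Mat d N} (h : HasSBVDerivative U u G) (h' : HasSBVDerivative U u G') :
    G =ᵐ[volume.restrict U] G' := by
  rw [Filter.EventuallyEq, ae_restrict_iff' hU.measurableSet]
  have key := hU.ae_eq_zero_of_integral_contDiff_smul_eq_zero (μ := volume)
    (f := U.indicator (G - G')) ?_ ?_
  · filter_upwards [key] with x hx hxU
    have := hx hxU
    rw [Set.indicator_of_mem hxU] at this
    exact sub_eq_zero.1 this
  · exact ((integrable_indicator_iff hU.measurableSet).2
      (h.2.1.sub h'.2.1)).locallyIntegrable.locallyIntegrableOn U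
  · intro g hg hgc hgs
    have ht : IsTest g := ⟨hg, hgc⟩
    have e1 := (hasSBVDerivative_iff.1 h).2.2.2 g ht hgs
    have e2 := (hasSBVDerivative_iff.1 h').2.2.2 g ht hgs
    have : ∫ x in U, g x • G x = ∫ x in U, g x • G' x := by
      have := e1.trans e2.symm
      simpa [greenForm] using this
    have e3 : (fun x => g x • U.indicator (G - G') x) = U.indicator fun x => g x • (G x - G' x) := by
      ext x : 1
      by_cases hx : x ∈ U <;> simp [hx]
    rw [e3, integral_indicator hU.measurableSet]
    simp_rw [smul_sub]
    rw [integral_sub (ht.integrableOn_smul h.2.1) (ht.integrableOn_smul h'.2.1), this, sub_self]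

lemma HasSBVDerivative.approxGradient_ae {U : Set (Vec N)} (hU : IsOpen U) {u : Vec N → Vec d}
    {G : Vec N → Mat d N} (h : HasSBVDerivative U u G) :
    approxGradient U u =ᵐ[volume.restrict U] G := by
  have h' : ∃ G : Vec N → Mat d N, HasSBVDerivative U u G := ⟨G, h⟩
  have : approxGradient U u = h'.choose := by rw [approxGradient, dif_pos h']
  rw [this]
  exact HasSBVDerivative.ae_eq hU h'.choose_spec h

lemma IsSBV.hasSBVDerivative {U : Set (Vec N)} {u : Vec N → Vec d} (h : IsSBV U u) :
    HasSBVDerivative U u (approxGradient U u) := by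
  have h' : ∃ G : Vec N → Mat d N, HasSBVDerivative U u G := h
  rw [approxGradient, dif_pos h']
  exact h'.choose_spec

lemma greenForm_congr_gradient {U : Set (Vec N)} {u : Vec N → Vec d}
    {G G' : Vec N → Mat d N} (h : G =ᵐ[volume.restrict U] G') (φ : Vec N → ℝ) :
    greenForm U u G φ = greenForm U u G' φ := by
  unfold greenForm
  congr 2
  apply integral_congr_ae
  filter_upwards [h] with x hx
  rw [hx]

/-! ### One-sided approximate limits -/

lemma isOpen_halfBall (x n : Vec N) (r : ℝ) : IsOpen (halfBall x n r) := by
  have : halfBall x n r = Metric.ball x r ∩ {y | 0 < inner ℝ (y - x) n} := rfl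
  rw [this]
  exact Metric.isOpen_ball.inter (isOpen_lt continuous_const (by fun_prop))

lemma halfBall_subset_ball (x n : Vec N) (r : ℝ) : halfBall x n r ⊆ Metric.ball x r :=
  fun _ hy => hy.1

lemma eventually_ball_subset {x : Vec N} {s : Set (Vec N)} (hs : s ∈ 𝓝 x) :
    ∀ᶠ r : ℝ in 𝓝[>] 0, Metric.ball x r ⊆ s := by
  obtain ⟨ε, hε, h⟩ := Metric.mem_nhds_iff.1 hs
  filter_upwards [Ioo_mem_nhdsGT hε] with r hr
  exact (Metric.ball_subset_ball hr.2.le).trans h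

lemma setLAverage_le_const {s : Set (Vec N)} (hs : MeasurableSet s) {f : Vec N → ℝ≥0∞} {ε : ℝ≥0∞}
    (h : ∀ y ∈ s, f y ≤ ε) : ⨍⁻ y in s, f y ∂volume ≤ ε := by
  rw [setLAverage_eq]
  apply ENNReal.div_le_of_le_mul
  calc ∫⁻ y in s, f y ≤ ∫⁻ y in s, ε := setLIntegral_mono' hs h
    _ = ε * volume s := by simp

lemma HasOneSidedLimit.of_tendsto {u : Vec N → Vec d} {x n : Vec N} {a : Vec d}
    (h : Tendsto u (𝓝[{y | 0 < inner ℝ (y - x) n}] x) (𝓝 a)) : HasOneSidedLimit u x n a := by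
  rw [HasOneSidedLimit, ENNReal.tendsto_nhds_zero]
  intro ε hε
  have h1 : ∀ᶠ y in 𝓝[{y | 0 < inner ℝ (y - x) n}] x, ‖u y - a‖ₑ ≤ ε := by
    have : Tendsto (fun y => ‖u y - a‖ₑ) (𝓝[{y | 0 < inner ℝ (y - x) n}] x) (𝓝 0) := by
      have := (h.sub_const a).enorm
      simpa using this
    exact (ENNReal.tendsto_nhds_zero.1 this) ε hε
  rw [eventually_nhdsWithin_iff] at h1
  filter_upwards [eventually_ball_subset h1] with r hr
  exact setLAverage_le_const (isOpen_halfBall x n r).measurableSet fun y hy => hr hy.1 hy.2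

lemma HasOneSidedLimit.congr {u v : Vec N → Vec d} {x n : Vec N} {a : Vec d}
    (h : HasOneSidedLimit u x n a) (huv : u =ᶠ[𝓝 x] v) : HasOneSidedLimit v x n a := by
  refine Tendsto.congr' ?_ h
  filter_upwards [eventually_ball_subset huv] with r hr
  rw [setLAverage_eq, setLAverage_eq]
  congr 1
  refine setLIntegral_congr_fun (isOpen_halfBall x n r).measurableSet fun y hy => ?_
  have : u y = v y := hr hy.1
  simp only [this]

lemma isJumpTriple_congr {u v : Vec N → Vec d} {x : Vec N} (huv : u =ᶠ[𝓝 x] v) :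
    IsJumpTriple u x = IsJumpTriple v x := by
  ext p
  exact ⟨fun h => ⟨h.1, h.2.1, h.2.2.1.congr huv, h.2.2.2.congr huv⟩,
    fun h => ⟨h.1, h.2.1, h.2.2.1.congr huv.symm, h.2.2.2.congr huv.symm⟩⟩

lemma mem_jumpSet_congr {u v : Vec N → Vec d} {x : Vec N} (huv : u =ᶠ[𝓝 x] v) :
    x ∈ jumpSet u ↔ x ∈ jumpSet v := by
  simp [jumpSet, isJumpTriple_congr huv]

/-- The choice depends only on the predicate `IsJumpTriple u x`, which is local. Functions that
agree near `x` therefore have literally the same selected triple. -/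
lemma jumpTriple_congr {u v : Vec N → Vec d} {x : Vec N} (huv : u =ᶠ[𝓝 x] v) :
    jumpTriple u x = jumpTriple v x := by
  have key : ∀ P Q : Vec d × Vec d × Vec N → Prop, P = Q →
      (open Classical in if h : ∃ p, P p then h.choose else 0) =
      (open Classical in if h : ∃ p, Q p then h.choose else 0) := by
    rintro P _ rfl; rfl
  exact key _ _ (isJumpTriple_congr huv)

lemma jump_congr {u v : Vec N → Vec d} {x : Vec N} (huv : u =ᶠ[𝓝 x] v) :
    jump u x = jump v x := by
  simp [jump, jumpTriple_congr huv]

lemma jumpNormal_congr {u v : Vec N → Vec d} {x : Vec N} (huv : u =ᶠ[𝓝 x] v) :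
    jumpNormal u x = jumpNormal v x := by
  simp [jumpNormal, jumpTriple_congr huv]

lemma jumpTensor_congr {u v : Vec N → Vec d} {x : Vec N} (huv : u =ᶠ[𝓝 x] v) :
    jumpTensor u x = jumpTensor v x := by
  simp [jumpTensor, jump_congr huv, jumpNormal_congr huv]

lemma isJumpTriple_jumpTriple {u : Vec N → Vec d} {x : Vec N} (hx : x ∈ jumpSet u) :
    IsJumpTriple u x (jumpTriple u x) := by
  have hx' : ∃ p, IsJumpTriple u x p := hx
  rw [jumpTriple, dif_pos hx']
  exact hx'.choose_spec

lemma jumpTriple_of_notMem {u : Vec N → Vec d} {x : Vec N} (hx : x ∉ jumpSet u) :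
    jumpTriple u x = 0 := by
  have hx' : ¬ ∃ p, IsJumpTriple u x p := hx
  rw [jumpTriple, dif_neg hx']

lemma jumpTensor_of_notMem {u : Vec N → Vec d} {x : Vec N} (hx : x ∉ jumpSet u) :
    jumpTensor u x = 0 := by
  simp [jumpTensor, jump, jumpNormal, jumpTriple_of_notMem hx]

lemma norm_jumpNormal {u : Vec N → Vec d} {x : Vec N} (hx : x ∈ jumpSet u) :
    ‖jumpNormal u x‖ = 1 := (isJumpTriple_jumpTriple hx).2.1

lemma jump_ne_zero {u : Vec N → Vec d} {x : Vec N} (hx : x ∈ jumpSet u) :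
    jump u x ≠ 0 := sub_ne_zero.2 (isJumpTriple_jumpTriple hx).1

lemma jumpTensor_ne_zero {u : Vec N → Vec d} {x : Vec N} (hx : x ∈ jumpSet u) :
    jumpTensor u x ≠ 0 := by
  rw [← norm_ne_zero_iff, jumpTensor, norm_tensor, norm_jumpNormal hx, mul_one, norm_ne_zero_iff]
  exact jump_ne_zero hx

lemma setLAverage_le_mul {s t : Set (Vec N)} (hst : s ⊆ t) {K : ℝ≥0∞}
    (h0 : volume s ≠ 0) (h : volume t ≤ K * volume s) (ht : volume t ≠ ⊤) (f : Vec N → ℝ≥0∞) :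
    ⨍⁻ y in s, f y ∂volume ≤ K * ⨍⁻ y in t, f y ∂volume := by
  rw [setLAverage_eq, setLAverage_eq]
  have hs : volume s ≠ ⊤ := ne_top_of_le_ne_top ht (measure_mono hst)
  have ht0 : volume t ≠ 0 := fun h' => h0 (measure_mono_null hst h')
  apply ENNReal.div_le_of_le_mul
  calc ∫⁻ y in s, f y ≤ ∫⁻ y in t, f y := lintegral_mono_set hst
    _ = (∫⁻ y in t, f y) / volume t * volume t := (ENNReal.div_mul_cancel ht0 ht).symm
    _ ≤ (∫⁻ y in t, f y) / volume t * (K * volume s) := by gcongr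
    _ = _ := by ring

/-- When the directions are not opposite, the two half balls of radius r contain a common ball of
radius proportional to r. On it the mean of |a − a'| is bounded by a multiple of the two averages
that tend to zero. The case `n' = n` is included and gives uniqueness of the limit; measurability
serves to split the integral of a sum. -/
lemma HasOneSidedLimit.unique {u : Vec N → Vec d} {x n n' : Vec N} {a a' : Vec d}
    {U : Set (Vec N)} (hU : U ∈ 𝓝 x) (hu : AEStronglyMeasurable u (volume.restrict U))
    (hn : ‖n‖ = 1) (hn' : ‖n'‖ = 1) (hnn : n' ≠ -n)
    (h : HasOneSidedLimit u x n a) (h' : HasOneSidedLimit u x n' a') : a = a' := by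
  have hin : -1 < inner ℝ n n' := by
    have h1 := abs_real_inner_le_norm n n'
    rw [hn, hn', mul_one] at h1
    rcases (neg_le_of_abs_le h1).lt_or_eq with h2 | h2
    · exact h2
    · exfalso
      apply hnn
      have : ‖n + n'‖ ^ 2 = 0 := by
        rw [norm_add_sq_real, hn, hn', ← h2]; norm_num
      have h3 : n + n' = 0 := by simpa using this
      exact (neg_eq_of_add_eq_zero_right h3).symm
  have hin1 : inner ℝ n n' ≤ 1 := by
    have := real_inner_le_norm n n'
    rwa [hn, hn', mul_one] at this
  -- The vector `m` below satisfies m·n = m·n' = 2κ. Hence the ball of radius rκ about x + r m keeps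
  -- distance at least rκ from both bounding hyperplanes; the bounds |m| ≤ 1/2 and κ ≤ 1/4 keep it
  -- inside the ball of radius r.
  set κ : ℝ := (1 + inner ℝ n n') / 8 with hκ
  have hκ0 : 0 < κ := by rw [hκ]; linarith
  have hκ1 : κ ≤ 1 / 4 := by rw [hκ]; linarith
  set m : Vec N := (1 / 4 : ℝ) • (n + n') with hm
  have hmn : inner ℝ m n = 2 * κ := by
    rw [hm, inner_smul_left, inner_add_left, real_inner_self_eq_norm_sq, hn, real_inner_comm, hκ]
    simp; ring
  have hmn' : inner ℝ m n' = 2 * κ := by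
    rw [hm, inner_smul_left, inner_add_left, real_inner_self_eq_norm_sq, hn', hκ]
    simp; ring
  have hmnorm : ‖m‖ ≤ 1 / 2 := by
    rw [hm, norm_smul]
    have := norm_add_le n n'
    rw [hn, hn'] at this
    norm_num; linarith
  have hsub : ∀ r : ℝ, 0 < r → ∀ e : Vec N, ‖e‖ = 1 → inner ℝ m e = 2 * κ →
      Metric.ball (x + r • m) (r * κ) ⊆ halfBall x e r := by
    intro r hr e he hme y hy
    rw [mem_ball_iff_norm] at hy
    have hy' : y - x = r • m + (y - (x + r • m)) := by abel
    constructor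
    · rw [mem_ball_iff_norm, hy']
      calc ‖r • m + (y - (x + r • m))‖ ≤ ‖r • m‖ + ‖y - (x + r • m)‖ := norm_add_le _ _
        _ < r * (1 / 2) + r * κ := by
          rw [norm_smul, Real.norm_of_nonneg hr.le]
          have := mul_le_mul_of_nonneg_left hmnorm hr.le
          linarith
        _ ≤ r * (1 / 2) + r * (1 / 4) := by gcongr
        _ ≤ r := by linarith
    · rw [hy', inner_add_left, inner_smul_left, hme]
      have := abs_real_inner_le_norm (y - (x + r • m)) e
      rw [he, mul_one] at this
      have := neg_le_of_abs_le this
      have h3 : r * κ > 0 := by positivity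
      simp only [conj_trivial]
      linarith
  set K : ℝ≥0∞ := ENNReal.ofReal ((κ ^ N)⁻¹) with hK
  have hvol : ∀ r : ℝ, 0 < r → volume (Metric.ball x r)
      = K * volume (Metric.ball (x + r • m) (r * κ)) := by
    intro r hr
    rw [Measure.addHaar_ball_of_pos _ _ hr, Measure.addHaar_ball_of_pos _ _ (mul_pos hr hκ0), hK,
      ← mul_assoc, ← ENNReal.ofReal_mul (by positivity)]
    congr 2
    rw [finrank_euclideanSpace, Fintype.card_fin, mul_pow]
    field_simp
  have key : ∀ᶠ r : ℝ in 𝓝[>] 0, ‖a - a'‖ₑ ≤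
      K * (⨍⁻ y in halfBall x n r, ‖u y - a‖ₑ ∂volume) +
      K * (⨍⁻ y in halfBall x n' r, ‖u y - a'‖ₑ ∂volume) := by
    filter_upwards [eventually_ball_subset hU, self_mem_nhdsWithin] with r hr hr0
    have hr0 : 0 < r := hr0
    set S := Metric.ball (x + r • m) (r * κ) with hS
    have hS1 := hsub r hr0 n hn hmn
    have hS2 := hsub r hr0 n' hn' hmn'
    have hS0 : volume S ≠ 0 := (Metric.measure_ball_pos _ _ (mul_pos hr0 hκ0)).ne'
    have hSt : volume S ≠ ⊤ := measure_ball_lt_top.ne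
    have bd : ∀ e : Vec N, S ⊆ halfBall x e r → ∀ f : Vec N → ℝ≥0∞, ⨍⁻ y in S, f y ∂volume ≤
        K * ⨍⁻ y in halfBall x e r, f y ∂volume := by
      intro e he f
      refine setLAverage_le_mul he hS0 ?_ ?_ f
      · rw [← hvol r hr0]; exact measure_mono (halfBall_subset_ball _ _ _)
      · exact ne_top_of_le_ne_top measure_ball_lt_top.ne
          (measure_mono (halfBall_subset_ball x e r))
    refine le_trans ?_ (add_le_add (bd n hS1 _) (bd n' hS2 _))
    have hSU : S ⊆ U := (hS1.trans (halfBall_subset_ball _ _ _)).trans hr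
    have hum : AEStronglyMeasurable u (volume.restrict S) := hu.mono_set hSU
    have hum' : AEMeasurable (fun y => ‖u y - a‖ₑ) (volume.restrict S) :=
      (hum.sub aestronglyMeasurable_const).enorm
    rw [setLAverage_eq, setLAverage_eq, ENNReal.div_add_div_same, ← lintegral_add_left' hum']
    rw [ENNReal.le_div_iff_mul_le (Or.inl hS0) (Or.inl hSt)]
    calc ‖a - a'‖ₑ * volume S = ∫⁻ y in S, ‖a - a'‖ₑ := by simp
      _ ≤ _ := by
        apply lintegral_mono
        intro y
        have : a - a' = (u y - a') - (u y - a) := by abel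
        simp only [this]
        calc ‖(u y - a') - (u y - a)‖ₑ ≤ ‖u y - a'‖ₑ + ‖u y - a‖ₑ := enorm_sub_le
          _ = _ := add_comm _ _
  have lim := (ENNReal.Tendsto.const_mul (a := K) h (Or.inr ENNReal.ofReal_ne_top)).add
    (ENNReal.Tendsto.const_mul (a := K) h' (Or.inr ENNReal.ofReal_ne_top))
  have := ge_of_tendsto lim key
  simp only [mul_zero, add_zero, nonpos_iff_eq_zero, enorm_eq_zero] at this
  exact sub_eq_zero.1 this

lemma ne_neg_self_of_norm {n : Vec N} (hn : ‖n‖ = 1) : n ≠ -n := by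
  intro h
  have h2 : (2 : ℝ) • n = 0 := by
    rw [two_smul]
    nth_rewrite 2 [h]
    simp
  have : n = 0 := by simpa using h2
  rw [this] at hn
  simp at hn

/-- If `n'` were different from both `n` and `-n`, uniqueness of one-sided limits would identify
both traces of the second triple with `a`, although they are different. -/
lemma IsJumpTriple.unique {u : Vec N → Vec d} {x : Vec N} {U : Set (Vec N)} (hU : U ∈ 𝓝 x)
    (hu : AEStronglyMeasurable u (volume.restrict U)) {p q : Vec d × Vec d × Vec N}
    (hp : IsJumpTriple u x p) (hq : IsJumpTriple u x q) :
    q = p ∨ q = (p.2.1, p.1, -p.2.2) := by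
  obtain ⟨a, b, n⟩ := p
  obtain ⟨a', b', n'⟩ := q
  obtain ⟨hab, hn, ha, hb⟩ := hp
  obtain ⟨hab', hn', ha', hb'⟩ := hq
  simp only at *
  have hnn := ne_neg_self_of_norm hn
  have hm : ‖-n‖ = 1 := by rwa [norm_neg]
  have hm' : ‖-n'‖ = 1 := by rwa [norm_neg]
  by_cases h1 : n' = n
  · subst h1
    left
    rw [ha.unique hU hu hn hn hnn ha', hb.unique hU hu hm hm (by simpa using hnn.symm) hb']
  · by_cases h2 : n' = -n
    · subst h2
      right
      rw [neg_neg] at hb'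
      rw [ha.unique hU hu hn hn hnn hb', hb.unique hU hu hm hm (by simpa using hnn.symm) ha']
    · exfalso
      apply hab'
      rw [← ha.unique hU hu hn hn' h2 ha',
        ha.unique hU hu hn hm' (by rw [ne_eq, neg_inj]; exact h1) hb']

lemma notMem_jumpSet_of_oneSided {u : Vec N → Vec d} {x n : Vec N} {a : Vec d} {U : Set (Vec N)}
    (hU : U ∈ 𝓝 x) (hu : AEStronglyMeasurable u (volume.restrict U)) (hn : ‖n‖ = 1)
    (h1 : HasOneSidedLimit u x n a) (h2 : HasOneSidedLimit u x (-n) a) : x ∉ jumpSet u := by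
  rintro ⟨⟨a', b', m⟩, hab, hm, ha, hb⟩
  simp only at *
  have hn' : ‖-n‖ = 1 := by rwa [norm_neg]
  have key : ∀ m' : Vec N, ‖m'‖ = 1 → ∀ c, HasOneSidedLimit u x m' c → c = a := by
    intro m' hm' c hc
    by_cases h : m' = -n
    · subst h
      exact (h2.unique hU hu hn' hn' (ne_neg_self_of_norm hn') hc).symm
    · exact (h1.unique hU hu hn hm' h hc).symm
  exact hab ((key m hm a' ha).trans (key (-m) (by rwa [norm_neg]) b' hb).symm)

lemma notMem_jumpSet_of_continuousAt {u : Vec N → Vec d} {x : Vec N} {U : Set (Vec N)}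
    (hU : U ∈ 𝓝 x) (hu : AEStronglyMeasurable u (volume.restrict U)) (h : ContinuousAt u x) :
    x ∉ jumpSet u := by
  intro hx
  have hp := isJumpTriple_jumpTriple hx
  exact notMem_jumpSet_of_oneSided hU hu hp.2.1
    (.of_tendsto (h.tendsto.mono_left nhdsWithin_le_nhds))
    (.of_tendsto (h.tendsto.mono_left nhdsWithin_le_nhds)) hx

/-- Exchanging the traces and reversing the normal produces two signs, which cancel in the tensor
product. The tensor is thus computable from any admissible triple, not only from the selected one.
-/
lemma IsJumpTriple.jumpTensor_eq {u : Vec N → Vec d} {x : Vec N} {U : Set (Vec N)} (hU : U ∈ 𝓝 x)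
    (hu : AEStronglyMeasurable u (volume.restrict U)) {p : Vec d × Vec d × Vec N}
    (hp : IsJumpTriple u x p) : jumpTensor u x = tensor (p.1 - p.2.1) p.2.2 := by
  have hx : x ∈ jumpSet u := ⟨p, hp⟩
  rcases hp.unique hU hu (isJumpTriple_jumpTriple hx) with h | h
  · simp [jumpTensor, jump, jumpNormal, h]
  · simp only [jumpTensor, jump, jumpNormal, h]
    rw [tensor_neg_right, ← tensor_neg_left, neg_sub]

/-! ### Dilations -/

/-- The map `y ↦ (y - x₀) / r`. -/
def zoom (x₀ : Vec N) (r : ℝ) (y : Vec N) : Vec N := r⁻¹ • (y - x₀)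

lemma continuous_zoom (x₀ : Vec N) (r : ℝ) : Continuous (zoom x₀ r) := by
  unfold zoom; fun_prop

lemma zoom_add_smul (x₀ : Vec N) {r : ℝ} (hr : 0 < r) (x : Vec N) :
    zoom x₀ r (x₀ + r • x) = x := by
  simp [zoom, smul_smul, hr.ne']

lemma add_smul_zoom (x₀ : Vec N) {r : ℝ} (hr : 0 < r) (y : Vec N) :
    x₀ + r • zoom x₀ r y = y := by
  simp [zoom, smul_smul, hr.ne']

lemma zoom_sub (x₀ : Vec N) (r : ℝ) (y z : Vec N) :
    zoom x₀ r y - zoom x₀ r z = r⁻¹ • (y - z) := by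
  simp [zoom, ← smul_sub]

/-- `zoom` as a homeomorphism. -/
def zoomHomeomorph (x₀ : Vec N) {r : ℝ} (hr : 0 < r) : Vec N ≃ₜ Vec N where
  toFun := zoom x₀ r
  invFun x := x₀ + r • x
  left_inv := add_smul_zoom x₀ hr
  right_inv := zoom_add_smul x₀ hr
  continuous_toFun := continuous_zoom x₀ r
  continuous_invFun := by fun_prop

lemma measurableEmbedding_zoom (x₀ : Vec N) {r : ℝ} (hr : 0 < r) :
    MeasurableEmbedding (zoom x₀ r) := (zoomHomeomorph x₀ hr).measurableEmbedding

lemma map_zoom_volume (x₀ : Vec N) {r : ℝ} (hr : 0 < r) :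
    (volume : Measure (Vec N)).map (zoom x₀ r) = ENNReal.ofReal (r ^ N) • volume := by
  have h1 : zoom x₀ r = (fun y => r⁻¹ • y) ∘ fun y => y - x₀ := rfl
  rw [h1, ← Measure.map_map (by fun_prop) (by fun_prop),
    (measurePreserving_sub_right volume x₀).map_eq, Measure.map_addHaar_smul _ (inv_ne_zero hr.ne')]
  congr 2
  rw [finrank_euclideanSpace, Fintype.card_fin, inv_pow, inv_inv, abs_of_pos (by positivity)]

lemma map_zoom_hausdorff (k : ℕ) (x₀ : Vec N) {r : ℝ} (hr : 0 < r) :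
    (μHE[k] : Measure (Vec N)).map (zoom x₀ r) = ENNReal.ofReal (r ^ k) • μHE[k] := by
  have h1 : zoom x₀ r = (fun y => r⁻¹ • y) ∘ fun y => y - x₀ := rfl
  rw [h1, ← Measure.map_map (by fun_prop) (by fun_prop),
    (measurePreserving_sub_right μHE[k] x₀).map_eq]
  ext s hs
  rw [Measure.map_apply (by fun_prop) hs, Set.preimage_smul_inv₀ hr.ne',
    Measure.euclideanHausdorffMeasure_smul₀ k hr.ne']
  rw [Measure.smul_apply, ENNReal.smul_def, ENNReal.ofReal]
  congr 2
  rw [Real.toNNReal_pow hr.le]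
  congr 2
  ext; simp [hr.le]

lemma halfBall_eq_preimage_zoom (x₀ : Vec N) {r : ℝ} (hr : 0 < r) (y n : Vec N) (ρ : ℝ) :
    halfBall y n ρ = zoom x₀ r ⁻¹' halfBall (zoom x₀ r y) n (ρ / r) := by
  ext z
  simp only [halfBall, Set.mem_ofPred_eq, Set.mem_preimage, mem_ball_iff_norm, zoom_sub,
    inner_smul_left, norm_smul, norm_inv, Real.norm_of_nonneg hr.le, conj_trivial]
  rw [inv_mul_eq_div, div_lt_div_iff_of_pos_right hr, mul_pos_iff_of_pos_left (inv_pos.2 hr)]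

/-- The rescaled function `y ↦ t u((y - x₀) / r) + c`. -/
def rescale (x₀ : Vec N) (r t : ℝ) (c : Vec d) (u : Vec N → Vec d) (y : Vec N) : Vec d :=
  t • u (zoom x₀ r y) + c

lemma HasOneSidedLimit.rescale {u : Vec N → Vec d} {x₀ y n : Vec N} {r : ℝ} (hr : 0 < r) (t : ℝ)
    (c : Vec d) {a : Vec d} (h : HasOneSidedLimit u (zoom x₀ r y) n a) :
    HasOneSidedLimit (rescale x₀ r t c u) y n (t • a + c) := by
  have hlim : Tendsto (fun ρ : ℝ => ρ / r) (𝓝[>] 0) (𝓝[>] 0) := by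
    apply tendsto_nhdsWithin_of_tendsto_nhds_of_eventually_within
    · have : Tendsto (fun ρ : ℝ => ρ / r) (𝓝 0) (𝓝 (0 / r)) := (continuous_id.div_const r).tendsto 0
      rw [zero_div] at this
      exact this.mono_left nhdsWithin_le_nhds
    · filter_upwards [self_mem_nhdsWithin] with ρ hρ
      exact div_pos hρ hr
  have := ENNReal.Tendsto.const_mul (a := ‖t‖ₑ) (h.comp hlim) (Or.inr (by simp))
  rw [mul_zero] at this
  refine this.congr fun ρ => ?_
  have he := measurableEmbedding_zoom x₀ hr
  simp only [Function.comp]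
  rw [halfBall_eq_preimage_zoom x₀ hr y n ρ]
  set S := halfBall (zoom x₀ r y) n (ρ / r)
  have e1 : ∀ z, ‖StructuredDeformation.rescale x₀ r t c u z - (t • a + c)‖ₑ
      = ‖t‖ₑ * ‖u (zoom x₀ r z) - a‖ₑ := by
    intro z
    rw [StructuredDeformation.rescale, add_sub_add_right_eq_sub, ← smul_sub, enorm_smul]
  simp_rw [e1]
  rw [setLAverage_eq, setLAverage_eq, lintegral_const_mul' _ _ (by simp), mul_div_assoc]
  congr 1
  have hk0 : ENNReal.ofReal (r ^ N) ≠ 0 := by simp; positivity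
  have e2 : ∫⁻ z in zoom x₀ r ⁻¹' S, ‖u (zoom x₀ r z) - a‖ₑ
      = ENNReal.ofReal (r ^ N) * ∫⁻ z in S, ‖u z - a‖ₑ := by
    rw [← he.lintegral_map (fun z => ‖u z - a‖ₑ), ← he.restrict_map, map_zoom_volume x₀ hr,
      Measure.restrict_smul, lintegral_smul_measure, smul_eq_mul]
  have e3 : volume (zoom x₀ r ⁻¹' S) = ENNReal.ofReal (r ^ N) * volume S := by
    rw [← he.map_apply, map_zoom_volume x₀ hr]; rfl
  rw [e2, e3, ENNReal.mul_div_mul_left _ _ hk0 ENNReal.ofReal_ne_top]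

lemma IsJumpTriple.rescale {u : Vec N → Vec d} {x₀ y : Vec N} {r t : ℝ} (hr : 0 < r) (ht : 0 < t)
    (c : Vec d) {p : Vec d × Vec d × Vec N} (h : IsJumpTriple u (zoom x₀ r y) p) :
    IsJumpTriple (rescale x₀ r t c u) y (t • p.1 + c, t • p.2.1 + c, p.2.2) := by
  refine ⟨?_, h.2.1, h.2.2.1.rescale hr t c, h.2.2.2.rescale hr t c⟩
  intro h'
  exact h.1 (smul_right_injective _ ht.ne' (add_right_cancel h'))

lemma rescale_rescale_inv (x₀ : Vec N) {r t : ℝ} (hr : 0 < r) (ht : 0 < t) (c : Vec d)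
    (u : Vec N → Vec d) :
    rescale (-(r⁻¹ • x₀)) r⁻¹ t⁻¹ (-(t⁻¹ • c)) (rescale x₀ r t c u) = u := by
  ext1 x
  have : zoom x₀ r (zoom (-(r⁻¹ • x₀)) r⁻¹ x) = x := by
    simp [zoom, smul_smul, hr.ne']
  simp [rescale, this, smul_smul, ht.ne']

/-- The inverse of a rescaling is again a rescaling, so the converse direction is the direct one
applied to the inverse. -/
lemma mem_jumpSet_rescale {u : Vec N → Vec d} {x₀ y : Vec N} {r t : ℝ} (hr : 0 < r) (ht : 0 < t)
    (c : Vec d) : y ∈ jumpSet (rescale x₀ r t c u) ↔ zoom x₀ r y ∈ jumpSet u := by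
  constructor
  · rintro ⟨p, hp⟩
    have e : zoom (-(r⁻¹ • x₀)) r⁻¹ (zoom x₀ r y) = y := by
      simp [zoom, smul_smul, hr.ne']
    rw [← e] at hp
    have := hp.rescale (inv_pos.2 hr) (inv_pos.2 ht) (-(t⁻¹ • c))
    rw [rescale_rescale_inv x₀ hr ht c u] at this
    exact ⟨_, this⟩
  · rintro ⟨p, hp⟩
    exact ⟨_, hp.rescale hr ht c⟩

/-! ### Coordinates adapted to a frame -/

section Coordinates

variable {n : ℕ}

/-- The point with `i`-th coordinate `s` and remaining coordinates `y` in the frame `b`. -/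
def coord (b : OrthonormalBasis (Fin (n + 1)) ℝ (Vec (n + 1))) (i : Fin (n + 1)) (s : ℝ)
    (y : Vec n) : Vec (n + 1) :=
  s • b i + ∑ j, y j • b (i.succAbove j)

/-- The hyperplane `{x | x · bᵢ = s}`. -/
def plane (b : OrthonormalBasis (Fin N) ℝ (Vec N)) (i : Fin N) (s : ℝ) : Set (Vec N) :=
  {x | inner ℝ (b i) x = s}

/-- The open unit cube of `ℝⁿ`. -/
def unitCube (n : ℕ) : Set (Vec n) := {y | ∀ j, |y j| < 1 / 2}

/-- The closed unit cube with frame `b`. -/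
def closedCube (b : OrthonormalBasis (Fin N) ℝ (Vec N)) : Set (Vec N) :=
  {x | ∀ i, |inner ℝ (b i) x| ≤ 1 / 2}

variable (b : OrthonormalBasis (Fin (n + 1)) ℝ (Vec (n + 1))) (i : Fin (n + 1))

lemma orthonormal_inner_self (b : OrthonormalBasis (Fin N) ℝ (Vec N)) (i : Fin N) :
    inner ℝ (b i) (b i) = 1 := by
  rw [real_inner_self_eq_norm_sq, b.norm_eq_one, one_pow]

@[simp] lemma inner_coord_self (s : ℝ) (y : Vec n) : inner ℝ (b i) (coord b i s y) = s := by
  rw [coord, inner_add_right, inner_smul_right, orthonormal_inner_self, inner_sum]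
  have : ∀ j, inner ℝ (b i) (y j • b (i.succAbove j)) = 0 := by
    intro j
    rw [inner_smul_right, b.inner_eq_zero (i.succAbove_ne j).symm, mul_zero]
  simp [this]

@[simp] lemma inner_coord_succAbove (s : ℝ) (y : Vec n) (j : Fin n) :
    inner ℝ (b (i.succAbove j)) (coord b i s y) = y j := by
  rw [coord, inner_add_right, inner_smul_right, b.inner_eq_zero (i.succAbove_ne j), inner_sum,
    Finset.sum_eq_single j]
  · rw [inner_smul_right, orthonormal_inner_self]; simp
  · intro k _ hk
    rw [inner_smul_right, b.inner_eq_zero (by simpa using hk.symm), mul_zero]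
  · simp

lemma coord_inner (x : Vec (n + 1)) :
    coord b i (inner ℝ (b i) x) (WithLp.toLp 2 fun j => inner ℝ (b (i.succAbove j)) x) = x := by
  conv_rhs => rw [← b.sum_repr' x, Fin.sum_univ_succAbove _ i]
  rfl

lemma coord_eq_repr_symm (s : ℝ) (y : Vec n) :
    coord b i s y = b.repr.symm (WithLp.toLp 2 (i.insertNth s fun j => y j)) := by
  apply b.repr.injective
  rw [LinearIsometryEquiv.apply_symm_apply]
  ext k
  rw [b.repr_apply_apply]
  rcases Fin.eq_self_or_eq_succAbove i k with rfl | ⟨j, rfl⟩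
  · simp
  · simp

lemma continuous_coord : Continuous fun p : ℝ × Vec n => coord b i p.1 p.2 := by
  unfold coord; fun_prop

lemma isometry_coord (s : ℝ) : Isometry (coord b i s) := by
  apply Isometry.of_dist_eq
  intro y z
  rw [dist_eq_norm, dist_eq_norm]
  have : ‖coord b i s y - coord b i s z‖ ^ 2 = ‖y - z‖ ^ 2 := by
    rw [← b.sum_sq_norm_inner_right, Fin.sum_univ_succAbove _ i, EuclideanSpace.norm_sq_eq]
    simp [inner_sub_right]
  exact (sq_eq_sq₀ (norm_nonneg _) (norm_nonneg _)).1 this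

lemma measurePreserving_coord :
    MeasurePreserving (fun p : ℝ × Vec n => coord b i p.1 p.2) (volume.prod volume) volume := by
  have e1 : MeasurePreserving (Prod.map id (WithLp.ofLp : Vec n → (Fin n → ℝ)))
      ((volume : Measure ℝ).prod volume) (volume.prod volume) :=
    (MeasurePreserving.id volume).prod (PiLp.volume_preserving_ofLp (Fin n))
  have e2 := (volume_preserving_piFinSuccAbove (fun _ : Fin (n + 1) => ℝ) i).symm _
  have e3 := PiLp.volume_preserving_toLp (Fin (n + 1))
  have e4 := b.measurePreserving_repr_symm
  have := e4.comp (e3.comp (e2.comp e1))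
  convert! this using 1
  ext1 p
  rw [coord_eq_repr_symm]
  rfl

lemma range_coord (s : ℝ) : Set.range (coord b i s) = plane b i s := by
  ext x
  constructor
  · rintro ⟨y, rfl⟩
    exact inner_coord_self b i s y
  · intro hx
    have hx : inner ℝ (b i) x = s := hx
    exact ⟨_, by rw [← hx]; exact coord_inner b i x⟩

/-- An isometry transports the normalized Hausdorff measure, so integrals over hyperplanes and faces
turn into Lebesgue integrals over ℝⁿ. The exponent stays in the form `n + 1 - 1` to match the `N -
1` of the definitions. -/
lemma map_coord (s : ℝ) : (volume : Measure (Vec n)).map (coord b i s) =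
    (μHE[n + 1 - 1] : Measure (Vec (n + 1))).restrict (plane b i s) := by
  rw [← EuclideanSpace.euclideanHausdorffMeasure_eq_volume n,
    (isometry_coord b i s).map_euclideanHausdorffMeasure, range_coord]
  rfl

lemma measurableEmbedding_coord (s : ℝ) : MeasurableEmbedding (coord b i s) :=
  (isometry_coord b i s).isClosedEmbedding.measurableEmbedding

lemma isClosed_plane (b : OrthonormalBasis (Fin N) ℝ (Vec N)) (i : Fin N) (s : ℝ) :
    IsClosed (plane b i s) := isClosed_eq (by fun_prop) continuous_const

lemma measurableSet_plane (b : OrthonormalBasis (Fin N) ℝ (Vec N)) (i : Fin N) (s : ℝ) :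
    MeasurableSet (plane b i s) := (isClosed_plane b i s).measurableSet

lemma restrict_plane_inter (s : ℝ) {S : Set (Vec (n + 1))} (hS : MeasurableSet S) :
    (μHE[n + 1 - 1] : Measure (Vec (n + 1))).restrict (plane b i s ∩ S) =
      ((volume : Measure (Vec n)).restrict (coord b i s ⁻¹' S)).map (coord b i s) := by
  rw [Set.inter_comm, ← Measure.restrict_restrict hS, ← map_coord,
    (measurableEmbedding_coord b i s).restrict_map]

lemma setIntegral_plane {E : Type*} [NormedAddCommGroup E] [NormedSpace ℝ E] (s : ℝ)
    {S : Set (Vec (n + 1))} (hS : MeasurableSet S) (F : Vec (n + 1) → E) :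
    ∫ x in plane b i s ∩ S, F x ∂μHE[n + 1 - 1] =
      ∫ y in coord b i s ⁻¹' S, F (coord b i s y) := by
  rw [restrict_plane_inter b i s hS, (measurableEmbedding_coord b i s).integral_map]

lemma integrableOn_plane {E : Type*} [NormedAddCommGroup E] (s : ℝ)
    {S : Set (Vec (n + 1))} (hS : MeasurableSet S) {F : Vec (n + 1) → E} :
    IntegrableOn F (plane b i s ∩ S) μHE[n + 1 - 1] ↔
      IntegrableOn (fun y => F (coord b i s y)) (coord b i s ⁻¹' S) := by
  rw [IntegrableOn, restrict_plane_inter b i s hS,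
    (measurableEmbedding_coord b i s).integrable_map_iff]
  rfl

lemma hausdorff_plane_inter (s : ℝ) {S : Set (Vec (n + 1))} (hS : MeasurableSet S) :
    (μHE[n + 1 - 1] : Measure (Vec (n + 1))) (plane b i s ∩ S) =
      volume (coord b i s ⁻¹' S) := by
  rw [Set.inter_comm, ← Measure.restrict_apply hS, ← map_coord,
    (measurableEmbedding_coord b i s).map_apply]

lemma volume_coordinate_eq (j : Fin n) (s : ℝ) : volume {y : Vec n | y j = s} = 0 := by
  have h := (PiLp.volume_preserving_ofLp (Fin n)).measure_preimage
    (s := {f : Fin n → ℝ | f j = s})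
    (measurableSet_eq_fun (measurable_pi_apply j) measurable_const).nullMeasurableSet
  have h2 : volume {f : Fin n → ℝ | f j = s} = 0 := by
    rw [volume_pi]
    exact Measure.pi_hyperplane (fun _ : Fin n => (volume : Measure ℝ)) j s
  rw [h2] at h
  exact h

lemma hausdorff_plane_inter_plane {i j : Fin (n + 1)} (hij : i ≠ j) (s t : ℝ) :
    (μHE[n + 1 - 1] : Measure (Vec (n + 1))) (plane b i s ∩ plane b j t) = 0 := by
  rw [hausdorff_plane_inter b i s (measurableSet_plane b j t)]
  obtain ⟨k, rfl⟩ := Fin.exists_succAbove_eq hij.symm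
  convert! volume_coordinate_eq k t using 2
  ext y
  simp [plane]

lemma volume_plane (s : ℝ) : volume (plane b i s) = 0 := by
  rw [← (measurePreserving_coord b i).measure_preimage
    (measurableSet_plane b i s).nullMeasurableSet]
  have : (fun p : ℝ × Vec n => coord b i p.1 p.2) ⁻¹' plane b i s = {s} ×ˢ Set.univ := by
    ext ⟨t, y⟩
    simp [plane]
  rw [this, Measure.prod_prod]
  simp

/-! ### Cubes, their closures, slices and faces -/

lemma isOpen_cube (b : OrthonormalBasis (Fin N) ℝ (Vec N)) : IsOpen (cube b) := by
  have : cube b = ⋂ i, {x | |inner ℝ (b i) x| < 1 / 2} := by ext; simp [cube]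
  rw [this]
  exact isOpen_iInter_of_finite fun i => isOpen_lt (by fun_prop) continuous_const

lemma isClosed_closedCube (b : OrthonormalBasis (Fin N) ℝ (Vec N)) : IsClosed (closedCube b) := by
  have : closedCube b = ⋂ i, {x | |inner ℝ (b i) x| ≤ 1 / 2} := by ext; simp [closedCube]
  rw [this]
  exact isClosed_iInter fun i => isClosed_le (by fun_prop) continuous_const

lemma isOpen_unitCube (n : ℕ) : IsOpen (unitCube n) := by
  have : unitCube n = ⋂ i, {x | |x i| < 1 / 2} := by ext; simp [unitCube]
  rw [this]
  exact isOpen_iInter_of_finite fun i => isOpen_lt (by fun_prop) continuous_const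

lemma cube_subset_closedCube (b : OrthonormalBasis (Fin N) ℝ (Vec N)) : cube b ⊆ closedCube b :=
  fun _ hx i => (hx i).le

lemma norm_le_of_mem_closedCube {b : OrthonormalBasis (Fin N) ℝ (Vec N)} {x : Vec N}
    (hx : x ∈ closedCube b) : ‖x‖ ≤ N := by
  rw [← b.sum_repr' x]
  refine (norm_sum_le _ _).trans ?_
  calc ∑ i, ‖inner ℝ (b i) x • b i‖ ≤ ∑ _i : Fin N, (1 : ℝ) := by
        refine Finset.sum_le_sum fun i _ => ?_
        rw [norm_smul, b.norm_eq_one, mul_one]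
        exact (hx i).trans (by norm_num)
    _ = N := by simp

lemma isCompact_closedCube (b : OrthonormalBasis (Fin N) ℝ (Vec N)) : IsCompact (closedCube b) :=
  (ProperSpace.isCompact_closedBall (0 : Vec N) N).of_isClosed_subset (isClosed_closedCube b)
    fun _ hx => mem_closedBall_zero_iff.2 (norm_le_of_mem_closedCube hx)

lemma closure_cube (b : OrthonormalBasis (Fin N) ℝ (Vec N)) : closure (cube b) = closedCube b := by
  apply Set.Subset.antisymm
  · exact closure_minimal (cube_subset_closedCube b) (isClosed_closedCube b)
  · intro x hx
    have hlim : Tendsto (fun t : ℝ => t • x) (𝓝[<] 1) (𝓝 x) := by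
      have : Tendsto (fun t : ℝ => t • x) (𝓝 1) (𝓝 ((1 : ℝ) • x)) :=
        (continuous_id.smul continuous_const).tendsto 1
      rw [one_smul] at this
      exact this.mono_left nhdsWithin_le_nhds
    refine mem_closure_of_tendsto hlim ?_
    filter_upwards [Ioo_mem_nhdsLT (show (0 : ℝ) < 1 by norm_num)] with t ht i
    rw [inner_smul_right, abs_mul, abs_of_pos ht.1]
    have := hx i
    nlinarith [ht.1, ht.2, abs_nonneg (inner ℝ (b i) x)]

lemma frontier_cube (b : OrthonormalBasis (Fin N) ℝ (Vec N)) :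
    frontier (cube b) = closedCube b \ cube b := by
  rw [(isOpen_cube b).frontier_eq, closure_cube]

lemma preimage_coord_cube {s : ℝ} (hs : |s| < 1 / 2) : coord b i s ⁻¹' cube b = unitCube n := by
  ext y
  simp only [cube, unitCube, Set.mem_preimage, Set.mem_ofPred_eq]
  rw [Fin.forall_iff_succAbove i]
  simp only [inner_coord_self, inner_coord_succAbove]
  exact and_iff_right hs

lemma preimage_prod_cube : (fun p : ℝ × Vec n => coord b i p.1 p.2) ⁻¹' cube b =
    Set.Ioo (-(1 / 2)) (1 / 2) ×ˢ unitCube n := by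
  ext ⟨s, y⟩
  simp only [cube, unitCube, Set.mem_preimage, Set.mem_ofPred_eq, Set.mem_prod, Set.mem_Ioo,
    ← abs_lt]
  rw [Fin.forall_iff_succAbove i]
  simp only [inner_coord_self, inner_coord_succAbove]

lemma volume_unitCube (n : ℕ) : volume (unitCube n) = 1 := by
  have h := (PiLp.volume_preserving_ofLp (Fin n)).measure_preimage
    (s := Set.univ.pi fun _ => Set.Ioo (-(1 / 2) : ℝ) (1 / 2))
    (MeasurableSet.univ_pi fun _ => measurableSet_Ioo).nullMeasurableSet
  have e : WithLp.ofLp ⁻¹' (Set.univ.pi fun _ => Set.Ioo (-(1 / 2) : ℝ) (1 / 2)) = unitCube n := by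
    ext y
    simp [unitCube, abs_lt]
  rw [e, Real.volume_pi_Ioo] at h
  rw [h]
  norm_num

lemma volume_cube (b : OrthonormalBasis (Fin N) ℝ (Vec N)) : volume (cube b) = 1 := by
  rw [← volume_unitCube N, ← b.measurePreserving_repr.measure_preimage
    (isOpen_unitCube N).measurableSet.nullMeasurableSet]
  congr 1
  ext x
  simp only [cube, unitCube, Set.mem_preimage, Set.mem_ofPred_eq, b.repr_apply_apply]

lemma integrableOn_cube_iff {E : Type*} [NormedAddCommGroup E] {F : Vec (n + 1) → E} :
    IntegrableOn F (cube b) ↔ IntegrableOn (fun p : ℝ × Vec n => F (coord b i p.1 p.2))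
      (Set.Ioo (-(1 / 2)) (1 / 2) ×ˢ unitCube n) (volume.prod volume) := by
  rw [← preimage_prod_cube b i]
  have hemb : MeasurableEmbedding fun p : ℝ × Vec n => coord b i p.1 p.2 :=
    (continuous_coord b i).measurable.measurableEmbedding fun p q h => by
      have h1 := congrArg (fun x => inner ℝ (b i) x) h
      simp only [inner_coord_self] at h1
      refine Prod.ext h1 ?_
      have h' : coord b i p.1 p.2 = coord b i q.1 q.2 := h
      rw [h1] at h'
      exact (isometry_coord b i _).injective h'
  exact ((measurePreserving_coord b i).integrableOn_comp_preimage hemb).symm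

lemma integral_cube {E : Type*} [NormedAddCommGroup E] [NormedSpace ℝ E] [CompleteSpace E]
    {F : Vec (n + 1) → E} (hF : IntegrableOn F (cube b)) :
    ∫ x in cube b, F x =
      ∫ y in unitCube n, ∫ s in Set.Ioo (-(1 / 2)) (1 / 2), F (coord b i s y) := by
  have h2 := (integrableOn_cube_iff b i).1 hF
  have hemb : MeasurableEmbedding fun p : ℝ × Vec n => coord b i p.1 p.2 :=
    (continuous_coord b i).measurable.measurableEmbedding fun p q h => by
      have h1 := congrArg (fun x => inner ℝ (b i) x) h
      simp only [inner_coord_self] at h1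
      refine Prod.ext h1 ?_
      have h' : coord b i p.1 p.2 = coord b i q.1 q.2 := h
      rw [h1] at h'
      exact (isometry_coord b i _).injective h'
  rw [← (measurePreserving_coord b i).setIntegral_preimage_emb hemb, preimage_prod_cube,
    ← Measure.prod_restrict]
  rw [IntegrableOn, ← Measure.prod_restrict] at h2
  rw [integral_prod_symm _ h2]

/-- The relative interior of a face of a cube. -/
def face (b : OrthonormalBasis (Fin N) ℝ (Vec N)) (i : Fin N) (s : ℝ) : Set (Vec N) :=
  plane b i s ∩ {x | ∀ j, j ≠ i → |inner ℝ (b j) x| < 1 / 2}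

/-- The position of a face. -/
def faceSign (σ : Bool) : ℝ := if σ then 1 / 2 else -(1 / 2)

lemma abs_faceSign (σ : Bool) : |faceSign σ| = 1 / 2 := by
  cases σ <;> norm_num [faceSign, abs_of_pos]

lemma isOpen_faceSlab (b : OrthonormalBasis (Fin N) ℝ (Vec N)) (i : Fin N) :
    IsOpen {x | ∀ j, j ≠ i → |inner ℝ (b j) x| < 1 / 2} := by
  have : {x | ∀ j, j ≠ i → |inner ℝ (b j) x| < 1 / 2}
      = ⋂ j, {x | j ≠ i → |inner ℝ (b j) x| < 1 / 2} := by ext; simp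
  rw [this]
  refine isOpen_iInter_of_finite fun j => ?_
  by_cases h : j = i
  · simp [h]
  · simp only [ne_eq, h, not_false_eq_true, forall_const]
    exact isOpen_lt (by fun_prop) continuous_const

lemma measurableSet_face (b : OrthonormalBasis (Fin N) ℝ (Vec N)) (i : Fin N) (s : ℝ) :
    MeasurableSet (face b i s) :=
  (measurableSet_plane b i s).inter (isOpen_faceSlab b i).measurableSet

lemma preimage_coord_faceSlab (s : ℝ) :
    coord b i s ⁻¹' {x | ∀ j, j ≠ i → |inner ℝ (b j) x| < 1 / 2} = unitCube n := by
  ext y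
  simp only [unitCube, Set.mem_preimage, Set.mem_ofPred_eq]
  rw [Fin.forall_iff_succAbove i]
  simp

lemma abs_eq_half_iff (t : ℝ) : |t| = 1 / 2 ↔ ∃ σ, t = faceSign σ := by
  rw [abs_eq (by norm_num)]
  simp [faceSign, or_comm]

lemma face_subset_frontier (b : OrthonormalBasis (Fin N) ℝ (Vec N)) (i : Fin N) (σ : Bool) :
    face b i (faceSign σ) ⊆ frontier (cube b) := by
  rintro x ⟨hx, hx'⟩
  have hx : inner ℝ (b i) x = faceSign σ := hx
  rw [frontier_cube]
  constructor
  · intro j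
    by_cases h : j = i
    · rw [h, hx, abs_faceSign]
    · exact (hx' j h).le
  · intro h
    have := h i
    rw [hx, abs_faceSign] at this
    exact lt_irrefl _ this

lemma exists_abs_eq_half_of_mem_frontier {b : OrthonormalBasis (Fin N) ℝ (Vec N)} {x : Vec N}
    (hx : x ∈ frontier (cube b)) : ∃ i σ, x ∈ plane b i (faceSign σ) := by
  rw [frontier_cube] at hx
  have h2 : ¬ ∀ i, |inner ℝ (b i) x| < 1 / 2 := hx.2
  push Not at h2
  obtain ⟨i, hi⟩ := h2
  obtain ⟨σ, hσ⟩ := (abs_eq_half_iff _).1 (le_antisymm (hx.1 i) hi)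
  exact ⟨i, σ, hσ⟩

/-- A boundary point outside the open faces has two coordinates of absolute value 1/2. It lies in
the intersection of two different coordinate hyperplanes, which is negligible. -/
lemma frontier_diff_faces :
    (μHE[n + 1 - 1] : Measure (Vec (n + 1)))
      (frontier (cube b) \ ⋃ k : Fin (n + 1) × Bool, face b k.1 (faceSign k.2)) = 0 := by
  have hsub : frontier (cube b) \ (⋃ k : Fin (n + 1) × Bool, face b k.1 (faceSign k.2)) ⊆
      ⋃ i, ⋃ j, ⋃ (_ : i ≠ j), ⋃ σ, ⋃ τ, plane b i (faceSign σ) ∩ plane b j (faceSign τ) := by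
    rintro x ⟨hx, hx'⟩
    obtain ⟨i, σ, hi⟩ := exists_abs_eq_half_of_mem_frontier hx
    have : ¬ ∀ j, j ≠ i → |inner ℝ (b j) x| < 1 / 2 := by
      intro h
      exact hx' (Set.mem_iUnion.2 ⟨(i, σ), hi, h⟩)
    push Not at this
    obtain ⟨j, hji, hj⟩ := this
    rw [frontier_cube] at hx
    obtain ⟨τ, hτ⟩ := (abs_eq_half_iff _).1 (le_antisymm (hx.1 j) hj)
    simp only [Set.mem_iUnion]
    exact ⟨i, j, hji.symm, σ, τ, hi, hτ⟩
  refine measure_mono_null hsub ?_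
  simp only [measure_iUnion_null_iff]
  intro i j hij σ τ
  exact hausdorff_plane_inter_plane b hij _ _

lemma frontier_ae_eq_faces :
    frontier (cube b) =ᵐ[(μHE[n + 1 - 1] : Measure (Vec (n + 1)))]
      ⋃ k : Fin (n + 1) × Bool, face b k.1 (faceSign k.2) := by
  apply Filter.EventuallyLE.antisymm
  · exact ae_le_set.2 (frontier_diff_faces b)
  · exact Filter.Eventually.of_forall fun x hx => by
      obtain ⟨k, hk⟩ := Set.mem_iUnion.1 hx
      exact face_subset_frontier b k.1 k.2 hk

lemma integrableOn_frontier {E : Type*} [NormedAddCommGroup E] [NormedSpace ℝ E]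
    {F : Vec (n + 1) → E}
    (hF : ∀ i σ, IntegrableOn (fun y => F (coord b i (faceSign σ) y)) (unitCube n)) :
    IntegrableOn F (frontier (cube b)) μHE[n + 1 - 1] := by
  rw [integrableOn_congr_set_ae (frontier_ae_eq_faces b), integrableOn_finite_iUnion]
  intro k
  rw [face, integrableOn_plane b k.1 _ (isOpen_faceSlab b k.1).measurableSet,
    preimage_coord_faceSlab]
  exact hF k.1 k.2

lemma integral_frontier {E : Type*} [NormedAddCommGroup E] [NormedSpace ℝ E]
    {F : Vec (n + 1) → E}
    (hF : ∀ i σ, IntegrableOn (fun y => F (coord b i (faceSign σ) y)) (unitCube n)) :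
    ∫ x in frontier (cube b), F x ∂μHE[n + 1 - 1] =
      ∑ i, ((∫ y in unitCube n, F (coord b i (1 / 2) y)) +
        ∫ y in unitCube n, F (coord b i (-(1 / 2)) y)) := by
  rw [setIntegral_congr_set (frontier_ae_eq_faces b), integral_iUnion_fintype]
  · rw [Fintype.sum_prod_type]
    refine Finset.sum_congr rfl fun i _ => ?_
    rw [Fintype.sum_bool]
    congr 1 <;>
    · rw [face, setIntegral_plane b i _ (isOpen_faceSlab b i).measurableSet,
        preimage_coord_faceSlab]
      rfl
  · exact fun k => measurableSet_face b _ _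
  · rintro ⟨i, σ⟩ ⟨j, τ⟩ h
    rw [Function.onFun, Set.disjoint_left]
    rintro x ⟨h1, h2⟩ ⟨h3, h4⟩
    have h1 : inner ℝ (b i) x = faceSign σ := h1
    have h3 : inner ℝ (b j) x = faceSign τ := h3
    by_cases hij : i = j
    · subst hij
      have : faceSign σ = faceSign τ := h1.symm.trans h3
      apply h
      revert this
      cases σ <;> cases τ <;> norm_num [faceSign]
    · have := h2 j (Ne.symm hij)
      simp only [h3, abs_faceSign] at this
      exact lt_irrefl _ this
  · intro k
    rw [face, integrableOn_plane b k.1 _ (isOpen_faceSlab b k.1).measurableSet,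
      preimage_coord_faceSlab]
    exact hF k.1 k.2

lemma outerNormal_of_mem_face {i : Fin (n + 1)} {σ : Bool} {x : Vec (n + 1)}
    (hx : x ∈ face b i (faceSign σ)) : outerNormal b x = (2 * faceSign σ) • b i := by
  obtain ⟨h1, h2⟩ := hx
  have h1 : inner ℝ (b i) x = faceSign σ := h1
  rw [outerNormal, Finset.sum_eq_single i]
  · rw [h1, if_pos (abs_faceSign σ)]
  · intro j _ hj
    rw [if_neg (h2 j hj).ne]
  · simp

lemma coord_mem_face {s : ℝ} {y : Vec n} (hy : y ∈ unitCube n) : coord b i s y ∈ face b i s := by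
  refine ⟨inner_coord_self b i s y, ?_⟩
  have : y ∈ coord b i s ⁻¹' {x | ∀ j, j ≠ i → |inner ℝ (b j) x| < 1 / 2} := by
    rwa [preimage_coord_faceSlab]
  exact this

lemma hausdorff_plane_closedBall (s : ℝ) {x : Vec (n + 1)} (hx : x ∈ plane b i s) (r : ℝ) :
    (μHE[n + 1 - 1] : Measure (Vec (n + 1))) (plane b i s ∩ Metric.closedBall x r) =
      volume (Metric.closedBall (0 : Vec n) r) := by
  rw [hausdorff_plane_inter b i s Metric.isClosed_closedBall.measurableSet]
  rw [← range_coord] at hx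
  obtain ⟨y, rfl⟩ := hx
  rw [(isometry_coord b i s).preimage_closedBall, Measure.addHaar_closedBall_center]

end Coordinates

/-! ### Laminates: smooth functions plus smooth jumps across parallel hyperplanes -/

section Laminate

/-- The Heaviside function, with value `1/2` at `0`. -/
def heav (t : ℝ) : ℝ := (1 / 2 : ℝ) * (Real.sign t + 1)

lemma heav_of_pos {t : ℝ} (h : 0 < t) : heav t = 1 := by
  rw [heav, Real.sign_of_pos h]; norm_num

lemma heav_of_neg {t : ℝ} (h : t < 0) : heav t = 0 := by
  rw [heav, Real.sign_of_neg h]; norm_num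

lemma heav_nonneg (t : ℝ) : 0 ≤ heav t := by
  rcases lt_trichotomy t 0 with h | rfl | h
  · rw [heav_of_neg h]
  · simp [heav]
  · rw [heav_of_pos h]; norm_num

lemma heav_le_one (t : ℝ) : heav t ≤ 1 := by
  rcases lt_trichotomy t 0 with h | rfl | h
  · rw [heav_of_neg h]; norm_num
  · simp [heav]; norm_num
  · rw [heav_of_pos h]

lemma measurable_heav : Measurable heav := by
  have : heav = fun t => if 0 < t then 1 else if t = 0 then 1 / 2 else 0 := by
    ext t
    rcases lt_trichotomy t 0 with h | rfl | h
    · rw [heav_of_neg h, if_neg h.not_gt, if_neg h.ne]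
    · simp [heav]
    · rw [heav_of_pos h, if_pos h]
  rw [this]
  exact Measurable.ite measurableSet_Ioi measurable_const
    (Measurable.ite (measurableSet_singleton 0) measurable_const measurable_const)

/-- The derivative of `f`, as a matrix written in the frame `b`. -/
def jac (b : OrthonormalBasis (Fin N) ℝ (Vec N)) (f : Vec N → Vec d) (x : Vec N) : Mat d N :=
  ∑ i, tensor (fderiv ℝ f x (b i)) (b i)

variable {b : OrthonormalBasis (Fin N) ℝ (Vec N)}

lemma continuous_jac {f : Vec N → Vec d} (hf : ContDiff ℝ 1 f) : Continuous (jac b f) := by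
  unfold jac
  refine continuous_finsetSum _ fun i _ => ?_
  have : Continuous fun x => fderiv ℝ f x (b i) :=
    (hf.continuous_fderiv (by simp)).clm_apply continuous_const
  exact (tensorL (d := d) (N := N)).continuous₂.comp (this.prodMk continuous_const)

/-- By the product rule the Green integrand consists of directional derivatives of φ f along the
frame, so the Green formula on a cube reduces to the fundamental theorem of calculus on lines. -/
lemma tensor_gradient_add_smul_jac {f : Vec N → Vec d} (hf : ContDiff ℝ 1 f) {φ : Vec N → ℝ}
    (hφ : IsTest φ) (x : Vec N) :
    tensor (f x) (gradient φ x) + φ x • jac b f x =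
      ∑ i, tensor (fderiv ℝ (fun x => φ x • f x) x (b i)) (b i) := by
  have h1 : ∀ i, fderiv ℝ (fun x => φ x • f x) x (b i)
      = φ x • fderiv ℝ f x (b i) + inner ℝ (b i) (gradient φ x) • f x := by
    intro i
    rw [fderiv_fun_smul hφ.differentiable.differentiableAt
      (hf.differentiable (by simp)).differentiableAt, real_inner_comm, inner_gradient]
    simp
  simp_rw [h1, tensor_add_left, tensor_smul_left]
  rw [Finset.sum_add_distrib, jac, Finset.smul_sum, add_comm]
  congr 1
  conv_lhs => rw [← b.sum_repr' (gradient φ x)]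
  rw [tensor_sum_right]
  simp_rw [tensor_smul_right]

/-- The function `f₀ + ∑ₖ heav(x · bᵢ - sₖ) fₖ`. -/
def laminate {ι : Type*} [Fintype ι] (b : OrthonormalBasis (Fin N) ℝ (Vec N)) (i : Fin N)
    (s : ι → ℝ) (f₀ : Vec N → Vec d) (f : ι → Vec N → Vec d) (x : Vec N) : Vec d :=
  f₀ x + ∑ k, heav (inner ℝ (b i) x - s k) • f k x

/-- The absolutely continuous part of the derivative of a laminate. -/
def laminateGradient {ι : Type*} [Fintype ι] (b : OrthonormalBasis (Fin N) ℝ (Vec N)) (i : Fin N)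
    (s : ι → ℝ) (f₀ : Vec N → Vec d) (f : ι → Vec N → Vec d) (x : Vec N) : Mat d N :=
  jac b f₀ x + ∑ k, heav (inner ℝ (b i) x - s k) • jac b (f k) x

/-- The jump of a laminate. -/
def laminateJump {ι : Type*} [Fintype ι] (b : OrthonormalBasis (Fin N) ℝ (Vec N)) (i : Fin N)
    (s : ι → ℝ) (f : ι → Vec N → Vec d) (x : Vec N) : Vec d :=
  ∑ k, (plane b i (s k)).indicator (f k) x

variable {ι : Type*} [Fintype ι] {i : Fin N} {s : ι → ℝ} {f₀ : Vec N → Vec d}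
  {f : ι → Vec N → Vec d}

lemma measurable_heav_inner (b : OrthonormalBasis (Fin N) ℝ (Vec N)) (i : Fin N) (t : ℝ) :
    Measurable fun x => heav (inner ℝ (b i) x - t) :=
  measurable_heav.comp (by fun_prop)

lemma measurable_laminate (h₀ : Continuous f₀) (h : ∀ k, Continuous (f k)) :
    Measurable (laminate b i s f₀ f) :=
  h₀.measurable.add (Finset.measurable_sum _ fun k _ =>
    (measurable_heav_inner b i (s k)).smul (h k).measurable)

lemma tendsto_heav_pos (x : Vec N) (t : ℝ) :
    Tendsto (fun y => heav (inner ℝ (b i) y - t)) (𝓝[{y | 0 < inner ℝ (y - x) (b i)}] x)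
      (𝓝 (if inner ℝ (b i) x = t then 1 else heav (inner ℝ (b i) x - t))) := by
  have hc : Continuous fun y : Vec N => inner ℝ (b i) y - t := by fun_prop
  rcases lt_trichotomy (inner ℝ (b i) x) t with h | h | h
  · rw [if_neg h.ne, heav_of_neg (sub_neg.2 h)]
    refine tendsto_const_nhds.congr' ?_
    have : ∀ᶠ y in 𝓝 x, inner ℝ (b i) y - t < 0 :=
      hc.continuousAt.eventually_lt continuousAt_const (sub_neg.2 h)
    filter_upwards [this.filter_mono nhdsWithin_le_nhds] with y hy
    rw [heav_of_neg hy]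
  · rw [if_pos h]
    refine tendsto_const_nhds.congr' ?_
    filter_upwards [self_mem_nhdsWithin] with y hy
    have hy : 0 < inner ℝ (y - x) (b i) := hy
    rw [real_inner_comm, inner_sub_right, h] at hy
    rw [heav_of_pos hy]
  · rw [if_neg h.ne', heav_of_pos (sub_pos.2 h)]
    refine tendsto_const_nhds.congr' ?_
    have : ∀ᶠ y in 𝓝 x, 0 < inner ℝ (b i) y - t :=
      continuousAt_const.eventually_lt hc.continuousAt (sub_pos.2 h)
    filter_upwards [this.filter_mono nhdsWithin_le_nhds] with y hy
    rw [heav_of_pos hy]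

lemma tendsto_heav_neg (x : Vec N) (t : ℝ) :
    Tendsto (fun y => heav (inner ℝ (b i) y - t)) (𝓝[{y | 0 < inner ℝ (y - x) (-b i)}] x)
      (𝓝 (if inner ℝ (b i) x = t then 0 else heav (inner ℝ (b i) x - t))) := by
  by_cases h : inner ℝ (b i) x = t
  · rw [if_pos h]
    refine tendsto_const_nhds.congr' ?_
    filter_upwards [self_mem_nhdsWithin] with y hy
    have hy : 0 < inner ℝ (y - x) (-b i) := hy
    rw [real_inner_comm, inner_sub_right, inner_neg_left, inner_neg_left, h] at hy
    rw [heav_of_neg (by linarith)]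
  · have hc : Continuous fun y : Vec N => inner ℝ (b i) y - t := by fun_prop
    rw [if_neg h]
    refine tendsto_const_nhds.congr' ?_
    rcases lt_or_gt_of_ne h with h | h
    · rw [heav_of_neg (sub_neg.2 h)]
      have : ∀ᶠ y in 𝓝 x, inner ℝ (b i) y - t < 0 :=
        hc.continuousAt.eventually_lt continuousAt_const (sub_neg.2 h)
      filter_upwards [this.filter_mono nhdsWithin_le_nhds] with y hy
      rw [heav_of_neg hy]
    · rw [heav_of_pos (sub_pos.2 h)]
      have : ∀ᶠ y in 𝓝 x, 0 < inner ℝ (b i) y - t :=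
        continuousAt_const.eventually_lt hc.continuousAt (sub_pos.2 h)
      filter_upwards [this.filter_mono nhdsWithin_le_nhds] with y hy
      rw [heav_of_pos hy]

lemma laminate_oneSided (h₀ : Continuous f₀) (h : ∀ k, Continuous (f k)) (x : Vec N) :
    ∃ a c, HasOneSidedLimit (laminate b i s f₀ f) x (b i) a ∧
      HasOneSidedLimit (laminate b i s f₀ f) x (-b i) c ∧ a - c = laminateJump b i s f x := by
  refine ⟨_, _, .of_tendsto (((h₀.tendsto x).mono_left nhdsWithin_le_nhds).add
    (tendsto_finsetSum _ fun k _ => (tendsto_heav_pos x (s k)).smul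
      (((h k).tendsto x).mono_left nhdsWithin_le_nhds))),
    .of_tendsto (((h₀.tendsto x).mono_left nhdsWithin_le_nhds).add
    (tendsto_finsetSum _ fun k _ => (tendsto_heav_neg x (s k)).smul
      (((h k).tendsto x).mono_left nhdsWithin_le_nhds))), ?_⟩
  rw [add_sub_add_left_eq_sub, ← Finset.sum_sub_distrib, laminateJump]
  refine Finset.sum_congr rfl fun k _ => ?_
  by_cases hk : inner ℝ (b i) x = s k
  · have : x ∈ plane b i (s k) := hk
    rw [if_pos hk, if_pos hk, Set.indicator_of_mem this]; simp
  · have : x ∉ plane b i (s k) := hk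
    rw [if_neg hk, if_neg hk, Set.indicator_of_notMem this]; simp

lemma laminate_isJumpTriple (h₀ : Continuous f₀) (h : ∀ k, Continuous (f k)) {x : Vec N}
    (hx : laminateJump b i s f x ≠ 0) : ∃ p : Vec d × Vec d × Vec N,
      IsJumpTriple (laminate b i s f₀ f) x p ∧ p.1 - p.2.1 = laminateJump b i s f x ∧
      p.2.2 = b i := by
  obtain ⟨a, c, ha, hc, hac⟩ := laminate_oneSided (b := b) (i := i) (s := s) h₀ h x
  exact ⟨(a, c, b i), ⟨sub_ne_zero.1 (hac ▸ hx), b.norm_eq_one i, ha, hc⟩, hac, rfl⟩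

/-- Both one-sided limits in the directions ± b i exist at every point, jump point or not. If they
coincide, no other direction can produce a jump either. -/
lemma mem_jumpSet_laminate (h₀ : Continuous f₀) (h : ∀ k, Continuous (f k)) (x : Vec N) :
    x ∈ jumpSet (laminate b i s f₀ f) ↔ laminateJump b i s f x ≠ 0 := by
  constructor
  · intro hx h0
    obtain ⟨a, c, ha, hc, hac⟩ := laminate_oneSided (b := b) (i := i) (s := s) h₀ h x
    rw [h0, sub_eq_zero] at hac
    subst hac
    exact notMem_jumpSet_of_oneSided univ_mem
      (measurable_laminate h₀ h).aestronglyMeasurable (b.norm_eq_one i) ha hc hx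
  · intro hx
    obtain ⟨p, hp, -⟩ := laminate_isJumpTriple (b := b) (i := i) (s := s) h₀ h hx
    exact ⟨p, hp⟩

lemma jumpTensor_laminate (h₀ : Continuous f₀) (h : ∀ k, Continuous (f k)) (x : Vec N) :
    jumpTensor (laminate b i s f₀ f) x = tensor (laminateJump b i s f x) (b i) := by
  by_cases hx : laminateJump b i s f x = 0
  · rw [hx, tensor_zero_left, jumpTensor_of_notMem]
    rw [mem_jumpSet_laminate h₀ h]
    exact fun h => h hx
  · obtain ⟨p, hp, h1, h2⟩ := laminate_isJumpTriple (b := b) (i := i) (s := s) h₀ h hx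
    rw [hp.jumpTensor_eq univ_mem (measurable_laminate h₀ h).aestronglyMeasurable, h1, h2]

lemma measurableSet_jumpSet_laminate (h₀ : Continuous f₀) (h : ∀ k, Continuous (f k)) :
    MeasurableSet (jumpSet (laminate b i s f₀ f)) := by
  have : jumpSet (laminate b i s f₀ f) = {x | laminateJump b i s f x ≠ 0} := by
    ext x; exact mem_jumpSet_laminate h₀ h x
  rw [this]
  have hm : Measurable (laminateJump b i s f) :=
    Finset.measurable_sum _ fun k _ => (h k).measurable.indicator (measurableSet_plane b i _)
  exact (measurableSet_eq_fun hm measurable_const).compl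

lemma Continuous.integrableOn_cube {E : Type*} [NormedAddCommGroup E] {F : Vec N → E}
    (h : Continuous F) : IntegrableOn F (cube b) :=
  (h.continuousOn.integrableOn_compact (isCompact_closedCube b)).mono_set
    (cube_subset_closedCube b)

lemma isCompact_closure_unitCube (n : ℕ) : IsCompact (closure (unitCube n)) := by
  have : unitCube n = cube (stdFrame n) := by
    ext y
    simp [unitCube, cube, stdFrame, EuclideanSpace.inner_single_left]
  rw [this, closure_cube]
  exact isCompact_closedCube _

lemma Continuous.integrableOn_unitCube {n : ℕ} {E : Type*} [NormedAddCommGroup E] {F : Vec n → E}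
    (h : Continuous F) : IntegrableOn F (unitCube n) :=
  (h.continuousOn.integrableOn_compact (isCompact_closure_unitCube n)).mono_set subset_closure

lemma IntegrableOn.heav_smul {X : Type*} [MeasurableSpace X] {μ : Measure X} {E : Type*}
    [NormedAddCommGroup E] [NormedSpace ℝ E]
    {F : X → E} {S : Set X} (h : IntegrableOn F S μ) {p : X → ℝ} (hp : Measurable p) :
    IntegrableOn (fun x => heav (p x) • F x) S μ :=
  Integrable.bdd_smul h 1 (measurable_heav.comp hp).aestronglyMeasurable
    (.of_forall fun x => by
      simpa [abs_of_nonneg (heav_nonneg _)] using heav_le_one (p x))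

lemma integrableOn_laminate (h₀ : Continuous f₀) (h : ∀ k, Continuous (f k)) :
    IntegrableOn (laminate b i s f₀ f) (cube b) :=
  (Continuous.integrableOn_cube h₀).add (integrable_finsetSum _ fun k _ =>
    IntegrableOn.heav_smul (Continuous.integrableOn_cube (h k)) (by fun_prop))

lemma integrableOn_laminateGradient (h₀ : ContDiff ℝ 1 f₀) (h : ∀ k, ContDiff ℝ 1 (f k)) :
    IntegrableOn (laminateGradient b i s f₀ f) (cube b) :=
  (Continuous.integrableOn_cube (continuous_jac h₀)).add (integrable_finsetSum _ fun k _ =>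
    IntegrableOn.heav_smul (Continuous.integrableOn_cube (continuous_jac (h k))) (by fun_prop))

end Laminate

/-! ### The Gauss–Green formula for laminates -/

section LaminateGreen

variable {n : ℕ} {b : OrthonormalBasis (Fin (n + 1)) ℝ (Vec (n + 1))} {i : Fin (n + 1)}

/-- The boundary integral `∫_{∂Q} φ u ⊗ n`, written on the faces. -/
def boundaryForm (b : OrthonormalBasis (Fin (n + 1)) ℝ (Vec (n + 1))) (u : Vec (n + 1) → Vec d)
    (φ : Vec (n + 1) → ℝ) : Mat d (n + 1) :=
  ∑ i, tensor (∫ y in unitCube n, (φ (coord b i (1 / 2) y) • u (coord b i (1 / 2) y) -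
    φ (coord b i (-(1 / 2)) y) • u (coord b i (-(1 / 2)) y))) (b i)

lemma continuous_coord_right (b : OrthonormalBasis (Fin (n + 1)) ℝ (Vec (n + 1)))
    (i : Fin (n + 1)) (s : ℝ) : Continuous (coord b i s) := (isometry_coord b i s).continuous

lemma integrableOn_comp_tensor {X : Type*} [MeasurableSpace X] {μ : Measure X}
    {F : X → Vec d} {S : Set X} (h : IntegrableOn F S μ) (v : Vec N) :
    IntegrableOn (fun x => tensor (F x) v) S μ :=
  ((tensorL (d := d) (N := N)).flip v).integrable_comp h

lemma integral_tensor {X : Type*} [MeasurableSpace X] {μ : Measure X}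
    {F : X → Vec d} (h : Integrable F μ) (v : Vec N) :
    ∫ x, tensor (F x) v ∂μ = tensor (∫ x, F x ∂μ) v :=
  ((tensorL (d := d) (N := N)).flip v).integral_comp_comm h

lemma integral_frontier_eq_boundaryForm {u : Vec (n + 1) → Vec d} {φ : Vec (n + 1) → ℝ}
    (hu : ∀ i σ, IntegrableOn (fun y => φ (coord b i (faceSign σ) y) •
      u (coord b i (faceSign σ) y)) (unitCube n)) :
    ∫ x in frontier (cube b), φ x • tensor (u x) (outerNormal b x) ∂μHE[n + 1 - 1] =
      boundaryForm b u φ := by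
  have key : ∀ i σ, ∀ y ∈ unitCube n, φ (coord b i (faceSign σ) y) •
      tensor (u (coord b i (faceSign σ) y)) (outerNormal b (coord b i (faceSign σ) y)) =
      (2 * faceSign σ) • tensor (φ (coord b i (faceSign σ) y) • u (coord b i (faceSign σ) y))
        (b i) := by
    intro i σ y hy
    rw [outerNormal_of_mem_face b (coord_mem_face b i hy), tensor_smul_right, tensor_smul_left,
      smul_comm]
  have hint : ∀ i σ, IntegrableOn (fun y => φ (coord b i (faceSign σ) y) •
      tensor (u (coord b i (faceSign σ) y)) (outerNormal b (coord b i (faceSign σ) y)))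
      (unitCube n) := by
    intro i σ
    refine IntegrableOn.congr_fun ?_ (fun y hy => (key i σ y hy).symm)
      (isOpen_unitCube n).measurableSet
    exact (integrableOn_comp_tensor (hu i σ) (b i)).smul (2 * faceSign σ)
  rw [integral_frontier b hint, boundaryForm]
  refine Finset.sum_congr rfl fun i _ => ?_
  have e1 := setIntegral_congr_fun (μ := volume) (isOpen_unitCube n).measurableSet (key i true)
  have e2 := setIntegral_congr_fun (μ := volume) (isOpen_unitCube n).measurableSet (key i false)
  have h1 := hu i true
  have h2 := hu i false
  simp only [faceSign, if_true, Bool.false_eq_true, if_false] at e1 e2 h1 h2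
  rw [e1, e2, integral_smul, integral_smul, integral_tensor h1, integral_tensor h2,
    integral_sub h1 h2, tensor_sub_left]
  norm_num [sub_eq_add_neg]

lemma hasDerivAt_coord_line {E : Type*} [NormedAddCommGroup E] [NormedSpace ℝ E]
    {Ψ : Vec (n + 1) → E} (hΨ : ContDiff ℝ 1 Ψ) (i : Fin (n + 1)) (y : Vec n) (t : ℝ) :
    HasDerivAt (fun t => Ψ (coord b i t y)) (fderiv ℝ Ψ (coord b i t y) (b i)) t := by
  have h1 : HasDerivAt (fun t => coord b i t y) (b i) t := by
    unfold coord
    simpa using ((hasDerivAt_id t).smul_const (b i)).add_const (∑ j, y j • b (i.succAbove j))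
  exact ((hΨ.differentiable (by simp)) _).hasFDerivAt.comp_hasDerivAt t h1

lemma integral_line {E : Type*} [NormedAddCommGroup E] [NormedSpace ℝ E] [CompleteSpace E]
    {Ψ : Vec (n + 1) → E} (hΨ : ContDiff ℝ 1 Ψ) (i : Fin (n + 1)) (y : Vec n) {r t : ℝ}
    (hrt : r ≤ t) :
    ∫ τ in Set.Ioo r t, fderiv ℝ Ψ (coord b i τ y) (b i) =
      Ψ (coord b i t y) - Ψ (coord b i r y) := by
  rw [← integral_Ioc_eq_integral_Ioo, ← intervalIntegral.integral_of_le hrt]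
  apply intervalIntegral.integral_eq_sub_of_hasDerivAt
  · exact fun τ _ => hasDerivAt_coord_line hΨ i y τ
  · apply Continuous.intervalIntegrable
    have h2 : Continuous fun τ => coord b i τ y :=
      (continuous_coord b i).comp (continuous_id.prodMk continuous_const)
    exact ((hΨ.continuous_fderiv (by simp)).comp h2).clm_apply continuous_const

lemma integral_line_heav {E : Type*} [NormedAddCommGroup E] [NormedSpace ℝ E] [CompleteSpace E]
    {Ψ : Vec (n + 1) → E} (hΨ : ContDiff ℝ 1 Ψ) (i : Fin (n + 1)) (y : Vec n) {s : ℝ}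
    (hs : |s| < 1 / 2) :
    ∫ τ in Set.Ioo (-(1 / 2)) (1 / 2), heav (τ - s) • fderiv ℝ Ψ (coord b i τ y) (b i) =
      Ψ (coord b i (1 / 2) y) - Ψ (coord b i s y) := by
  rw [← integral_line hΨ i y (abs_lt.1 hs).2.le]
  have e : (fun τ => heav (τ - s) • fderiv ℝ Ψ (coord b i τ y) (b i)) =ᵐ[volume]
      (Set.Ioi s).indicator fun τ => fderiv ℝ Ψ (coord b i τ y) (b i) := by
    have : ∀ᵐ τ : ℝ, τ ≠ s := by simp [ae_iff]
    filter_upwards [this] with τ hτ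
    rcases lt_or_gt_of_ne hτ with h | h
    · rw [heav_of_neg (sub_neg.2 h), zero_smul, Set.indicator_of_notMem (by simpa using h.le)]
    · rw [heav_of_pos (sub_pos.2 h), one_smul, Set.indicator_of_mem (by simpa using h)]
  rw [integral_congr_ae (ae_restrict_of_ae e), setIntegral_indicator measurableSet_Ioi]
  congr 2
  ext τ
  simp only [Set.mem_inter_iff, Set.mem_Ioo, Set.mem_Ioi]
  constructor
  · exact fun h => ⟨h.2, h.1.2⟩
  · exact fun h => ⟨⟨(abs_lt.1 hs).1.trans h.1, h.2⟩, h.1⟩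

lemma integral_cube_fderiv {E : Type*} [NormedAddCommGroup E] [NormedSpace ℝ E] [CompleteSpace E]
    {Ψ : Vec (n + 1) → E} (hΨ : ContDiff ℝ 1 Ψ) (j : Fin (n + 1)) :
    ∫ x in cube b, fderiv ℝ Ψ x (b j) =
      ∫ y in unitCube n, (Ψ (coord b j (1 / 2) y) - Ψ (coord b j (-(1 / 2)) y)) := by
  rw [integral_cube b j (Continuous.integrableOn_cube
    ((hΨ.continuous_fderiv (by simp)).clm_apply continuous_const))]
  refine setIntegral_congr_fun (isOpen_unitCube n).measurableSet fun y _ => ?_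
  exact integral_line hΨ j y (by norm_num)

/-- Integrate first along the lines in direction b j. For j = i each line crosses the discontinuity
once, at height s, which yields the extra term; for j ≠ i the Heaviside factor is constant along the
line. -/
lemma integral_cube_heav_fderiv {E : Type*} [NormedAddCommGroup E] [NormedSpace ℝ E]
    [CompleteSpace E]
    {Ψ : Vec (n + 1) → E} (hΨ : ContDiff ℝ 1 Ψ) (j : Fin (n + 1)) {s : ℝ} (hs : |s| < 1 / 2) :
    ∫ x in cube b, heav (inner ℝ (b i) x - s) • fderiv ℝ Ψ x (b j) =
      (∫ y in unitCube n, (heav (inner ℝ (b i) (coord b j (1 / 2) y) - s) •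
        Ψ (coord b j (1 / 2) y) -
        heav (inner ℝ (b i) (coord b j (-(1 / 2)) y) - s) • Ψ (coord b j (-(1 / 2)) y))) -
      if j = i then ∫ y in unitCube n, Ψ (coord b i s y) else 0 := by
  have hc : Continuous fun x => fderiv ℝ Ψ x (b j) :=
    (hΨ.continuous_fderiv (by simp)).clm_apply continuous_const
  have hcoord : ∀ t, Continuous fun y => Ψ (coord b j t y) := fun t =>
    hΨ.continuous.comp (continuous_coord_right b j t)
  rw [integral_cube b j (IntegrableOn.heav_smul (Continuous.integrableOn_cube hc) (by fun_prop))]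
  have hlt := abs_lt.1 hs
  by_cases hj : j = i
  · subst hj
    rw [if_pos rfl, ← integral_sub]
    · refine setIntegral_congr_fun (isOpen_unitCube n).measurableSet fun y _ => ?_
      simp only [inner_coord_self]
      rw [integral_line_heav hΨ j y hs, heav_of_pos (by linarith), heav_of_neg (by linarith)]
      simp
    · simp only [inner_coord_self]
      exact ((Continuous.integrableOn_unitCube (hcoord _)).smul _).sub
        ((Continuous.integrableOn_unitCube (hcoord _)).smul _)
    · exact Continuous.integrableOn_unitCube (hcoord s)
  · rw [if_neg hj, sub_zero]
    refine setIntegral_congr_fun (isOpen_unitCube n).measurableSet fun y _ => ?_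
    obtain ⟨k, rfl⟩ := Fin.exists_succAbove_eq (Ne.symm hj)
    simp only [inner_coord_succAbove]
    rw [integral_smul, integral_line hΨ j y (by norm_num), smul_sub]

variable {ι : Type*} [Fintype ι] {s : ι → ℝ} {f₀ : Vec (n + 1) → Vec d}
  {f : ι → Vec (n + 1) → Vec d} {φ : Vec (n + 1) → ℝ}

lemma contDiff_test_smul (hφ : IsTest φ) {f : Vec (n + 1) → Vec d} (hf : ContDiff ℝ 1 f) :
    ContDiff ℝ 1 fun x => φ x • f x := (hφ.contDiff.of_le (by exact_mod_cast le_top)).smul hf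

lemma green_smooth (hφ : IsTest φ) {f : Vec (n + 1) → Vec d} (hf : ContDiff ℝ 1 f) :
    (∫ x in cube b, tensor (f x) (gradient φ x)) + ∫ x in cube b, φ x • jac b f x =
      boundaryForm b f φ := by
  have hΨ := contDiff_test_smul hφ hf
  rw [← integral_add (hφ.integrableOn_tensor (Continuous.integrableOn_cube hf.continuous))
    (hφ.integrableOn_smul (Continuous.integrableOn_cube (continuous_jac hf)))]
  simp_rw [tensor_gradient_add_smul_jac hf hφ]
  have hi : ∀ j, IntegrableOn (fun x => fderiv ℝ (fun x => φ x • f x) x (b j)) (cube b) := fun j =>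
    Continuous.integrableOn_cube ((hΨ.continuous_fderiv (by simp)).clm_apply continuous_const)
  rw [integral_finsetSum _ fun j _ => integrableOn_comp_tensor (hi j) (b j), boundaryForm]
  refine Finset.sum_congr rfl fun j _ => ?_
  rw [integral_tensor (hi j), integral_cube_fderiv hΨ j]

lemma green_heav (hφ : IsTest φ) {f : Vec (n + 1) → Vec d} (hf : ContDiff ℝ 1 f) {s : ℝ}
    (hs : |s| < 1 / 2) :
    (∫ x in cube b, tensor (heav (inner ℝ (b i) x - s) • f x) (gradient φ x)) +
      ∫ x in cube b, φ x • (heav (inner ℝ (b i) x - s) • jac b f x) =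
      boundaryForm b (fun x => heav (inner ℝ (b i) x - s) • f x) φ -
        tensor (∫ y in unitCube n, φ (coord b i s y) • f (coord b i s y)) (b i) := by
  have hΨ := contDiff_test_smul hφ hf
  rw [← integral_add (hφ.integrableOn_tensor
      (IntegrableOn.heav_smul (Continuous.integrableOn_cube hf.continuous) (by fun_prop)))
    (hφ.integrableOn_smul
      (IntegrableOn.heav_smul (Continuous.integrableOn_cube (continuous_jac hf)) (by fun_prop)))]
  have e : ∀ x, tensor (heav (inner ℝ (b i) x - s) • f x) (gradient φ x) +
      φ x • (heav (inner ℝ (b i) x - s) • jac b f x) =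
      ∑ j, tensor (heav (inner ℝ (b i) x - s) • fderiv ℝ (fun x => φ x • f x) x (b j)) (b j) := by
    intro x
    simp_rw [tensor_smul_left]
    rw [smul_comm (φ x), ← smul_add, tensor_gradient_add_smul_jac hf hφ, Finset.smul_sum]
  simp_rw [e]
  have hi : ∀ j, IntegrableOn (fun x => heav (inner ℝ (b i) x - s) •
      fderiv ℝ (fun x => φ x • f x) x (b j)) (cube b) := fun j =>
    IntegrableOn.heav_smul (Continuous.integrableOn_cube
      ((hΨ.continuous_fderiv (by simp)).clm_apply continuous_const)) (by fun_prop)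
  rw [integral_finsetSum _ fun j _ => integrableOn_comp_tensor (hi j) (b j), boundaryForm]
  simp_rw [fun j => integral_tensor (hi j) (b j), integral_cube_heav_fderiv hΨ _ hs,
    tensor_sub_left]
  rw [Finset.sum_sub_distrib]
  congr 1
  · refine Finset.sum_congr rfl fun j _ => ?_
    simp_rw [smul_comm (φ _)]
  · rw [Finset.sum_eq_single i]
    · rw [if_pos rfl]
    · intro j _ hj
      rw [if_neg hj, tensor_zero_left]
    · simp

lemma integral_jumpTensor_laminate (h₀ : Continuous f₀) (h : ∀ k, Continuous (f k))
    (hs : ∀ k, |s k| < 1 / 2) (hφ : Continuous φ) :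
    IntegrableOn (fun x => φ x • jumpTensor (laminate b i s f₀ f) x)
      (cube b ∩ jumpSet (laminate b i s f₀ f)) μHE[n + 1 - 1] ∧
    ∫ x in cube b ∩ jumpSet (laminate b i s f₀ f), φ x • jumpTensor (laminate b i s f₀ f) x
        ∂μHE[n + 1 - 1] =
      ∑ k, tensor (∫ y in unitCube n, φ (coord b i (s k) y) • f k (coord b i (s k) y)) (b i) := by
  have hQ := (isOpen_cube b).measurableSet
  have e1 : (fun x => φ x • jumpTensor (laminate b i s f₀ f) x) =
      fun x => ∑ k, (plane b i (s k)).indicator (fun x => tensor (φ x • f k x) (b i)) x := by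
    ext1 x
    rw [jumpTensor_laminate h₀ h, laminateJump, tensor_sum_left, Finset.smul_sum]
    refine Finset.sum_congr rfl fun k _ => ?_
    by_cases hx : x ∈ plane b i (s k)
    · rw [Set.indicator_of_mem hx, Set.indicator_of_mem hx, tensor_smul_left]
    · rw [Set.indicator_of_notMem hx, Set.indicator_of_notMem hx]; simp
  have hc : ∀ k, Continuous fun y => φ (coord b i (s k) y) • f k (coord b i (s k) y) := fun k =>
    (hφ.smul (h k)).comp (continuous_coord_right b i (s k))
  have hint : ∀ k, IntegrableOn ((plane b i (s k)).indicator
      fun x => tensor (φ x • f k x) (b i)) (cube b) μHE[n + 1 - 1] := by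
    intro k
    rw [integrableOn_indicator_iff (measurableSet_plane b i _),
      integrableOn_plane b i _ hQ, preimage_coord_cube b i (hs k)]
    exact integrableOn_comp_tensor (Continuous.integrableOn_unitCube (hc k)) (b i)
  have hI : IntegrableOn (fun x => φ x • jumpTensor (laminate b i s f₀ f) x) (cube b)
      μHE[n + 1 - 1] := by
    rw [e1]
    exact integrable_finsetSum _ fun k _ => hint k
  refine ⟨hI.mono_set Set.inter_subset_left, ?_⟩
  -- The tensor vanishes off the jump set, so the integral may be taken over the whole cube, whether
  -- or not some of the jumps f k vanish on parts of their hyperplanes.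
  rw [← setIntegral_eq_of_subset_of_forall_sdiff_eq_zero hQ Set.inter_subset_left]
  · rw [e1, integral_finsetSum _ fun k _ => hint k]
    refine Finset.sum_congr rfl fun k _ => ?_
    rw [setIntegral_indicator (measurableSet_plane b i _), Set.inter_comm,
      setIntegral_plane b i _ hQ, preimage_coord_cube b i (hs k),
      integral_tensor (Continuous.integrableOn_unitCube (hc k))]
  · intro x hx
    rw [jumpTensor_of_notMem fun h => hx.2 ⟨hx.1, h⟩, smul_zero]

lemma boundaryForm_laminate (h₀ : Continuous f₀) (h : ∀ k, Continuous (f k)) (hφ : Continuous φ) :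
    boundaryForm b (laminate b i s f₀ f) φ = boundaryForm b f₀ φ +
      ∑ k, boundaryForm b (fun x => heav (inner ℝ (b i) x - s k) • f k x) φ := by
  have i0 : ∀ j t, IntegrableOn (fun y => φ (coord b j t y) • f₀ (coord b j t y))
      (unitCube n) := fun j t =>
    Continuous.integrableOn_unitCube ((hφ.smul h₀).comp (continuous_coord_right b j t))
  have ik : ∀ k j t, IntegrableOn (fun y => φ (coord b j t y) •
      (heav (inner ℝ (b i) (coord b j t y) - s k) • f k (coord b j t y))) (unitCube n) := by
    intro k j t
    simp_rw [smul_comm (φ _)]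
    have hc := continuous_coord_right b j t
    exact IntegrableOn.heav_smul (Continuous.integrableOn_unitCube
      ((hφ.smul (h k)).comp (continuous_coord_right b j t))) (by fun_prop)
  simp only [boundaryForm]
  rw [Finset.sum_comm, ← Finset.sum_add_distrib]
  refine Finset.sum_congr rfl fun j _ => ?_
  rw [← tensor_sum_left, ← tensor_add_left]
  congr 1
  have d0 : IntegrableOn (fun y => φ (coord b j (1 / 2) y) • f₀ (coord b j (1 / 2) y) -
      φ (coord b j (-(1 / 2)) y) • f₀ (coord b j (-(1 / 2)) y)) (unitCube n) :=
    (i0 j _).sub (i0 j _)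
  have dk : ∀ k, IntegrableOn (fun y => φ (coord b j (1 / 2) y) •
      (heav (inner ℝ (b i) (coord b j (1 / 2) y) - s k) • f k (coord b j (1 / 2) y)) -
      φ (coord b j (-(1 / 2)) y) • (heav (inner ℝ (b i) (coord b j (-(1 / 2)) y) - s k) •
        f k (coord b j (-(1 / 2)) y))) (unitCube n) := fun k => (ik k j _).sub (ik k j _)
  rw [← integral_finsetSum _ fun k _ => dk k,
    ← integral_add d0 (integrable_finsetSum _ fun k _ => dk k)]
  congr 1
  ext1 y
  simp only [laminate, smul_add, Finset.smul_sum, Finset.sum_sub_distrib]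
  abel

/-- The hyperplane terms of `green_heav` cancel the jump integrals. The explicit SBV functions
needed later (affine, perturbed affine, elementary jump, ramp, staircase) are all laminates, and
this identity supplies both their derivative and their trace. -/
theorem greenForm_laminate (h₀ : ContDiff ℝ 1 f₀) (h : ∀ k, ContDiff ℝ 1 (f k))
    (hs : ∀ k, |s k| < 1 / 2) (hφ : IsTest φ) :
    greenForm (cube b) (laminate b i s f₀ f) (laminateGradient b i s f₀ f) φ =
      boundaryForm b (laminate b i s f₀ f) φ := by
  have i0 := Continuous.integrableOn_cube (b := b) h₀.continuous
  have ik := fun k => IntegrableOn.heav_smul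
    (Continuous.integrableOn_cube (b := b) (h k).continuous)
    (p := fun x => inner ℝ (b i) x - s k) (by fun_prop)
  have j0 := Continuous.integrableOn_cube (b := b) (continuous_jac (b := b) h₀)
  have jk := fun k => IntegrableOn.heav_smul
    (Continuous.integrableOn_cube (b := b) (continuous_jac (b := b) (h k)))
    (p := fun x => inner ℝ (b i) x - s k) (by fun_prop)
  rw [greenForm, (integral_jumpTensor_laminate h₀.continuous (fun k => (h k).continuous) hs
    hφ.continuous).2, boundaryForm_laminate h₀.continuous (fun k => (h k).continuous)
    hφ.continuous, ← green_smooth hφ h₀]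
  have e1 : ∫ x in cube b, tensor (laminate b i s f₀ f x) (gradient φ x) =
      (∫ x in cube b, tensor (f₀ x) (gradient φ x)) +
      ∑ k, ∫ x in cube b, tensor (heav (inner ℝ (b i) x - s k) • f k x) (gradient φ x) := by
    simp only [laminate, tensor_add_left, tensor_sum_left]
    rw [integral_add (hφ.integrableOn_tensor i0) (integrable_finsetSum _ fun k _ =>
      hφ.integrableOn_tensor (ik k)), integral_finsetSum _ fun k _ =>
      hφ.integrableOn_tensor (ik k)]
  have e2 : ∫ x in cube b, φ x • laminateGradient b i s f₀ f x =
      (∫ x in cube b, φ x • jac b f₀ x) +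
      ∑ k, ∫ x in cube b, φ x • (heav (inner ℝ (b i) x - s k) • jac b (f k) x) := by
    simp only [laminateGradient, smul_add, Finset.smul_sum]
    rw [integral_add (hφ.integrableOn_smul j0) (integrable_finsetSum _ fun k _ =>
      hφ.integrableOn_smul (jk k)), integral_finsetSum _ fun k _ =>
      hφ.integrableOn_smul (jk k)]
  rw [e1, e2]
  have e3 : ∀ k, boundaryForm b (fun x => heav (inner ℝ (b i) x - s k) • f k x) φ =
      ((∫ x in cube b, tensor (heav (inner ℝ (b i) x - s k) • f k x) (gradient φ x)) +
      ∫ x in cube b, φ x • (heav (inner ℝ (b i) x - s k) • jac b (f k) x)) +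
      tensor (∫ y in unitCube n, φ (coord b i (s k) y) • f k (coord b i (s k) y)) (b i) := by
    intro k
    rw [green_heav hφ (h k) (hs k)]; abel
  simp_rw [e3]
  rw [Finset.sum_add_distrib, Finset.sum_add_distrib]
  abel

lemma boundaryForm_eq_zero {u : Vec (n + 1) → Vec d} (hφ : tsupport φ ⊆ cube b) :
    boundaryForm b u φ = 0 := by
  have key : ∀ j σ y, y ∈ unitCube n → φ (coord b j (faceSign σ) y) = 0 := by
    intro j σ y hy
    have h1 := face_subset_frontier b j σ (coord_mem_face b j hy)
    rw [frontier_cube] at h1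
    exact image_eq_zero_of_notMem_tsupport fun h => h1.2 (hφ h)
  refine Finset.sum_eq_zero fun j _ => ?_
  rw [setIntegral_congr_fun (isOpen_unitCube n).measurableSet (g := fun _ => (0 : Vec d))]
  · simp
  · intro y hy
    have h1 := key j true y hy
    have h2 := key j false y hy
    simp only [faceSign, if_true, Bool.false_eq_true, if_false] at h1 h2
    simp only [h1, h2]
    simp

theorem hasSBVDerivative_laminate (h₀ : ContDiff ℝ 1 f₀) (h : ∀ k, ContDiff ℝ 1 (f k))
    (hs : ∀ k, |s k| < 1 / 2) :
    HasSBVDerivative (cube b) (laminate b i s f₀ f) (laminateGradient b i s f₀ f) := by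
  rw [hasSBVDerivative_iff]
  refine ⟨integrableOn_laminate h₀.continuous fun k => (h k).continuous,
    integrableOn_laminateGradient h₀ h, ?_, fun φ hφ hsupp => ?_⟩
  · simpa using (integral_jumpTensor_laminate (b := b) (i := i) (φ := fun _ => 1) h₀.continuous
      (fun k => (h k).continuous) hs continuous_const).1
  · rw [greenForm_laminate h₀ h hs hφ, boundaryForm_eq_zero hsupp]

end LaminateGreen

/-! ### Dilation of test functions -/

lemma fderiv_comp_zoom {φ : Vec N → ℝ} (hφ : Differentiable ℝ φ) (x₀ : Vec N) (r : ℝ)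
    (y v : Vec N) :
    fderiv ℝ (fun y => φ (zoom x₀ r y)) y v = r⁻¹ * fderiv ℝ φ (zoom x₀ r y) v := by
  have h1 : HasFDerivAt (zoom x₀ r) (r⁻¹ • ContinuousLinearMap.id ℝ (Vec N)) y := by
    unfold zoom
    exact ((hasFDerivAt_id y).sub_const x₀).const_smul r⁻¹
  have h2 := (hφ (zoom x₀ r y)).hasFDerivAt.comp y h1
  have h3 : fderiv ℝ (fun y => φ (zoom x₀ r y)) y = _ := h2.fderiv
  rw [h3]
  simp

lemma gradient_comp_zoom {φ : Vec N → ℝ} (hφ : Differentiable ℝ φ) (x₀ : Vec N) (r : ℝ)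
    (y : Vec N) :
    gradient (fun y => φ (zoom x₀ r y)) y = r⁻¹ • gradient φ (zoom x₀ r y) := by
  refine ext_inner_right ℝ fun v => ?_
  rw [inner_gradient, fderiv_comp_zoom hφ, inner_smul_left, inner_gradient]
  simp

lemma IsTest.comp_zoom {φ : Vec N → ℝ} (hφ : IsTest φ) (x₀ : Vec N) {r : ℝ} (hr : 0 < r) :
    IsTest fun y => φ (zoom x₀ r y) where
  contDiff := by
    refine hφ.contDiff.comp ?_
    unfold zoom
    fun_prop
  hasCompactSupport :=
    hφ.hasCompactSupport.comp_homeomorph (zoomHomeomorph x₀ hr)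

lemma tsupport_comp_zoom (φ : Vec N → ℝ) (x₀ : Vec N) (r : ℝ) :
    tsupport (fun y => φ (zoom x₀ r y)) ⊆ zoom x₀ r ⁻¹' tsupport φ :=
  tsupport_comp_subset_preimage φ (continuous_zoom x₀ r)

lemma setIntegral_comp_zoom {E : Type*} [NormedAddCommGroup E] [NormedSpace ℝ E] (x₀ : Vec N)
    {r : ℝ} (hr : 0 < r) (S : Set (Vec N)) (F : Vec N → E) :
    ∫ y in zoom x₀ r ⁻¹' S, F (zoom x₀ r y) = r ^ N • ∫ x in S, F x := by
  have he := measurableEmbedding_zoom x₀ hr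
  rw [← he.setIntegral_map F, map_zoom_volume x₀ hr, Measure.restrict_smul,
    integral_smul_measure, ENNReal.toReal_ofReal (by positivity)]

lemma setIntegral_hausdorff_comp_zoom {E : Type*} [NormedAddCommGroup E] [NormedSpace ℝ E] (k : ℕ)
    (x₀ : Vec N) {r : ℝ} (hr : 0 < r) (S : Set (Vec N)) (F : Vec N → E) :
    ∫ y in zoom x₀ r ⁻¹' S, F (zoom x₀ r y) ∂μHE[k] = r ^ k • ∫ x in S, F x ∂μHE[k] := by
  have he := measurableEmbedding_zoom x₀ hr
  rw [← he.setIntegral_map F, map_zoom_hausdorff k x₀ hr, Measure.restrict_smul,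
    integral_smul_measure, ENNReal.toReal_ofReal (by positivity)]

lemma integrableOn_comp_zoom {E : Type*} [NormedAddCommGroup E] (x₀ : Vec N) {r : ℝ} (hr : 0 < r)
    {S : Set (Vec N)} {F : Vec N → E} (h : IntegrableOn F S) :
    IntegrableOn (fun y => F (zoom x₀ r y)) (zoom x₀ r ⁻¹' S) := by
  have he := measurableEmbedding_zoom x₀ hr
  have := he.integrableOn_map_iff (f := F) (s := S) (μ := volume)
  rw [map_zoom_volume x₀ hr] at this
  refine this.1 ?_
  rw [IntegrableOn, Measure.restrict_smul]
  exact h.smul_measure ENNReal.ofReal_ne_top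

lemma integrableOn_hausdorff_comp_zoom {E : Type*} [NormedAddCommGroup E] (k : ℕ) (x₀ : Vec N)
    {r : ℝ} (hr : 0 < r) {S : Set (Vec N)} {F : Vec N → E} (h : IntegrableOn F S μHE[k]) :
    IntegrableOn (fun y => F (zoom x₀ r y)) (zoom x₀ r ⁻¹' S) μHE[k] := by
  have he := measurableEmbedding_zoom x₀ hr
  have := he.integrableOn_map_iff (f := F) (s := S) (μ := μHE[k])
  rw [map_zoom_hausdorff k x₀ hr] at this
  refine this.1 ?_
  rw [IntegrableOn, Measure.restrict_smul]
  exact h.smul_measure ENNReal.ofReal_ne_top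

/-! ### Jump points on a hyperplane that is not charged by the derivative -/

section Fine

variable {n : ℕ}

lemma exists_frame (m : Vec (n + 1)) (hm : ‖m‖ = 1) :
    ∃ e : OrthonormalBasis (Fin (n + 1)) ℝ (Vec (n + 1)), e 0 = m := by
  have hv : Orthonormal ℝ (({0} : Set (Fin (n + 1))).domRestrict fun _ => m) := by
    constructor
    · intro i; exact hm
    · intro i j hij
      exact absurd (Subsingleton.elim i j) hij
  obtain ⟨e, he⟩ := hv.exists_orthonormalBasis_extension_of_card_eq (by simp)
  exact ⟨e, he 0 rfl⟩

lemma ball_subset_cube (e : OrthonormalBasis (Fin N) ℝ (Vec N)) :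
    Metric.ball (0 : Vec N) (1 / 2) ⊆ cube e := by
  intro x hx i
  rw [mem_ball_zero_iff] at hx
  have := abs_real_inner_le_norm (e i) x
  rw [e.norm_eq_one, one_mul] at this
  exact this.trans_lt hx

/-- A test function whose derivative in the direction `m` has nonzero integral on the half space
`{y | y · m > 0}`. -/
lemma exists_probe (m : Vec (n + 1)) (hm : ‖m‖ = 1) :
    ∃ φ : Vec (n + 1) → ℝ, IsTest φ ∧ tsupport φ ⊆ Metric.ball 0 1 ∧
      ∫ y, fderiv ℝ φ y m = 0 ∧ ∫ y, heav (inner ℝ m y) * fderiv ℝ φ y m ≠ 0 := by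
  obtain ⟨e, rfl⟩ := exists_frame m hm
  -- The outer radius 1/4 puts the support in the ball of radius 1/2, hence in the unit cube of the
  -- frame, where the formulas for integrals over cubes apply without boundary terms.
  let φ : ContDiffBump (0 : Vec (n + 1)) := ⟨1 / 8, 1 / 4, by norm_num, by norm_num⟩
  have hsub : tsupport φ ⊆ Metric.ball 0 (1 / 2) := by
    rw [φ.tsupport_eq]
    exact Metric.closedBall_subset_ball (by norm_num [φ])
  have ht : IsTest φ := ⟨φ.contDiff, φ.hasCompactSupport⟩
  have hcube := hsub.trans (ball_subset_cube e)
  have hφ1 : ContDiff ℝ 1 φ := φ.contDiff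
  have hz : ∀ y, y ∉ cube e → fderiv ℝ φ y = 0 := fun y hy =>
    image_eq_zero_of_notMem_tsupport fun h =>
      hy (hcube (tsupport_fderiv_subset ℝ h))
  have hface : ∀ j σ y, y ∈ unitCube n → φ (coord e j (faceSign σ) y) = 0 := by
    intro j σ y hy
    have h1 := face_subset_frontier e j σ (coord_mem_face e j hy)
    rw [frontier_cube] at h1
    exact image_eq_zero_of_notMem_tsupport fun h => h1.2 (hcube h)
  have hb : ∀ c₁ c₂ : Vec n → ℝ, ∫ y in unitCube n, (c₁ y • φ (coord e 0 (1 / 2) y) -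
      c₂ y • φ (coord e 0 (-(1 / 2)) y)) = 0 := by
    intro c₁ c₂
    rw [setIntegral_congr_fun (isOpen_unitCube n).measurableSet (g := fun _ => (0 : ℝ))]
    · simp
    · intro y hy
      have h1 := hface 0 true y hy
      have h2 := hface 0 false y hy
      simp only [faceSign, if_true, Bool.false_eq_true, if_false] at h1 h2
      simp only [h1, h2]
      simp
  refine ⟨φ, ht, hsub.trans (Metric.ball_subset_ball (by norm_num)), ?_, ?_⟩
  · rw [← setIntegral_eq_integral_of_forall_compl_eq_zero (s := cube e)
      (fun y hy => by rw [hz y hy]; simp), integral_cube_fderiv hφ1]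
    simpa using hb (fun _ => 1) fun _ => 1
  · rw [← setIntegral_eq_integral_of_forall_compl_eq_zero (s := cube e)
      (fun y hy => by rw [hz y hy]; simp)]
    -- Integrating the normal derivative over the half space leaves minus the integral of the bump
    -- over the hyperplane through the origin. This is nonzero, because the bump is nonnegative and
    -- equals 1 at the origin.
    have h1 := integral_cube_heav_fderiv (b := e) (i := 0) hφ1 0 (s := 0) (by norm_num)
    simp only [sub_zero, if_true] at h1
    rw [hb, zero_sub] at h1
    simp only [smul_eq_mul] at h1
    rw [h1, neg_ne_zero]
    apply ne_of_gt
    have hc : Continuous fun y => φ (coord e 0 0 y) :=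
      φ.continuous.comp (continuous_coord_right e 0 0)
    rw [setIntegral_pos_iff_support_of_nonneg_ae (.of_forall fun y => φ.nonneg)
      (Continuous.integrableOn_unitCube hc)]
    refine IsOpen.measure_pos volume ((hc.isOpen_support).inter (isOpen_unitCube n)) ⟨0, ?_, ?_⟩
    · have h0 : coord e 0 0 (0 : Vec n) = 0 := by simp [coord]
      rw [Function.mem_support, h0, φ.one_of_mem_closedBall]
      · exact one_ne_zero
      · simp [φ]
    · intro j; simp

lemma plane_measure_closedBall_lt_top (b : OrthonormalBasis (Fin (n + 1)) ℝ (Vec (n + 1)))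
    (i : Fin (n + 1)) (s : ℝ) (x : Vec (n + 1)) (r : ℝ) :
    (μHE[n + 1 - 1] : Measure (Vec (n + 1))) (plane b i s ∩ Metric.closedBall x r) < ⊤ := by
  rcases (plane b i s ∩ Metric.closedBall x r).eq_empty_or_nonempty with h | ⟨z, hz, hz'⟩
  · rw [h, measure_empty]; exact ENNReal.zero_lt_top
  · refine lt_of_le_of_lt (measure_mono (Set.inter_subset_inter_right _
      (Metric.closedBall_subset_closedBall' (ε₂ := r + dist x z) (y := z) le_rfl))) ?_
    rw [hausdorff_plane_closedBall b i s hz]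
    exact measure_closedBall_lt_top

instance (b : OrthonormalBasis (Fin (n + 1)) ℝ (Vec (n + 1))) (i : Fin (n + 1)) (s : ℝ) :
    IsLocallyFiniteMeasure ((μHE[n + 1 - 1] : Measure (Vec (n + 1))).restrict (plane b i s)) where
  finiteAtNhds x := ⟨Metric.closedBall x 1, Metric.closedBall_mem_nhds x one_pos, by
    rw [Measure.restrict_apply Metric.isClosed_closedBall.measurableSet, Set.inter_comm]
    exact plane_measure_closedBall_lt_top b i s x 1⟩

/-- At points of the hyperplane the measure of a ball is that of an n-dimensional ball, which gives
the factor 3ⁿ; at other points small balls miss the closed hyperplane. This is the hypothesis of the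
Vitali differentiation theorem. -/
lemma plane_doubling (b : OrthonormalBasis (Fin (n + 1)) ℝ (Vec (n + 1))) (i : Fin (n + 1))
    (s : ℝ) (x : Vec (n + 1)) :
    ∃ᶠ r in 𝓝[>] 0, (μHE[n + 1 - 1] : Measure (Vec (n + 1))).restrict (plane b i s)
      (Metric.closedBall x (3 * r)) ≤ ((3 ^ n : ℝ≥0) : ℝ≥0∞) *
      (μHE[n + 1 - 1] : Measure (Vec (n + 1))).restrict (plane b i s) (Metric.closedBall x r) := by
  apply Eventually.frequently
  by_cases hx : x ∈ plane b i s
  · filter_upwards [self_mem_nhdsWithin] with r hr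
    have hr : 0 < r := hr
    simp_rw [Measure.restrict_apply Metric.isClosed_closedBall.measurableSet]
    rw [Set.inter_comm, hausdorff_plane_closedBall b i s hx, Set.inter_comm,
      hausdorff_plane_closedBall b i s hx, Measure.addHaar_closedBall _ _ hr.le,
      Measure.addHaar_closedBall _ _ (by positivity), finrank_euclideanSpace, Fintype.card_fin,
      mul_pow, ENNReal.ofReal_mul (by positivity), mul_assoc]
    gcongr
    rw [ENNReal.ofReal_pow (by norm_num)]
    norm_num
  · obtain ⟨ε, hε, hε'⟩ := Metric.nhds_basis_closedBall.mem_iff.1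
      ((isClosed_plane b i s).isOpen_compl.mem_nhds hx)
    filter_upwards [Ioo_mem_nhdsGT (show 0 < ε / 3 by positivity)] with r hr
    rw [Measure.restrict_apply Metric.isClosed_closedBall.measurableSet]
    have : Metric.closedBall x (3 * r) ∩ plane b i s = ∅ := by
      rw [Set.eq_empty_iff_forall_notMem]
      rintro y ⟨hy, hy'⟩
      exact hε' (Metric.closedBall_subset_closedBall (by linarith [hr.2]) hy) hy'
    rw [this, measure_empty]
    exact zero_le

/-- The ratios converge almost everywhere to the Radon–Nikodym derivative of ρ with respect to the
surface measure of the hyperplane. This derivative vanishes almost everywhere on `S`, because ρ does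
not charge `S`. -/
lemma ae_density_zero (b : OrthonormalBasis (Fin (n + 1)) ℝ (Vec (n + 1))) (i : Fin (n + 1))
    (s : ℝ) (ρ : Measure (Vec (n + 1))) [IsFiniteMeasure ρ] {S : Set (Vec (n + 1))}
    (hS : MeasurableSet S) (hρ : ρ S = 0) :
    ∀ᵐ x ∂(μHE[n + 1 - 1] : Measure (Vec (n + 1))).restrict (plane b i s), x ∈ S →
      Tendsto (fun r => ρ (Metric.closedBall x r) /
        (μHE[n + 1 - 1] : Measure (Vec (n + 1))).restrict (plane b i s) (Metric.closedBall x r))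
        (𝓝[>] 0) (𝓝 0) := by
  set σ := (μHE[n + 1 - 1] : Measure (Vec (n + 1))).restrict (plane b i s)
  let v := Vitali.vitaliFamily σ (3 ^ n) (plane_doubling b i s)
  have h0 : ∀ᵐ x ∂σ, x ∈ S → ρ.rnDeriv σ x = 0 := by
    rw [← ae_restrict_iff' hS]
    have h1 : ∫⁻ x in S, ρ.rnDeriv σ x ∂σ = 0 :=
      le_antisymm ((Measure.setLIntegral_rnDeriv_le S).trans hρ.le) zero_le
    exact (lintegral_eq_zero_iff (Measure.measurable_rnDeriv ρ σ)).1 h1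
  have hsupp : ∀ᵐ x ∂σ, x ∈ plane b i s := ae_restrict_mem (measurableSet_plane b i s)
  filter_upwards [h0, v.ae_tendsto_rnDeriv ρ, hsupp] with x hx0 hx hxp hxS
  rw [hx0 hxS] at hx
  refine hx.comp ?_
  rw [VitaliFamily.tendsto_filterAt_iff]
  constructor
  · filter_upwards [self_mem_nhdsWithin] with r hr
    have hr : 0 < r := hr
    refine ⟨Metric.isClosed_closedBall, ?_, r, subset_rfl, ?_⟩
    · exact ⟨x, Metric.ball_subset_interior_closedBall (Metric.mem_ball_self hr)⟩
    · simp_rw [σ, Measure.restrict_apply Metric.isClosed_closedBall.measurableSet]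
      rw [Set.inter_comm, hausdorff_plane_closedBall b i s hxp, Set.inter_comm,
        hausdorff_plane_closedBall b i s hxp, Measure.addHaar_closedBall _ _ hr.le,
        Measure.addHaar_closedBall _ _ (by positivity), finrank_euclideanSpace, Fintype.card_fin,
        mul_pow, ENNReal.ofReal_mul (by positivity), mul_assoc]
      gcongr
      rw [ENNReal.ofReal_pow (by norm_num)]
      norm_num
  · intro ε hε
    filter_upwards [Ioo_mem_nhdsGT hε] with r hr
    exact Metric.closedBall_subset_closedBall hr.2.le

/-- The two one-sided averages say that `w` is close in the mean to the two-valued function with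
values a and c; the hyperplane between the half balls is Lebesgue null. -/
lemma enorm_integral_sub_le {w : Vec (n + 1) → Vec d} {x m : Vec (n + 1)} {a c : Vec d} {r : ℝ}
    (hm : ‖m‖ = 1) {ε : ℝ≥0∞}
    (ha : ⨍⁻ y in halfBall x m r, ‖w y - a‖ₑ ∂volume ≤ ε)
    (hc : ⨍⁻ y in halfBall x (-m) r, ‖w y - c‖ₑ ∂volume ≤ ε) :
    ∫⁻ y in Metric.ball x r, ‖w y - (heav (inner ℝ m (y - x)) • (a - c) + c)‖ₑ ≤
      2 * (ε * volume (Metric.ball x r)) := by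
  obtain ⟨e, rfl⟩ := exists_frame m hm
  set R := fun y => ‖w y - (heav (inner ℝ (e 0) (y - x)) • (a - c) + c)‖ₑ with hR
  have hsub : Metric.ball x r ⊆ (halfBall x (e 0) r ∪ halfBall x (-e 0) r) ∪
      plane e 0 (inner ℝ (e 0) x) := by
    intro y hy
    rcases lt_trichotomy (inner ℝ (y - x) (e 0)) 0 with h | h | h
    · left; right; exact ⟨hy, by rw [inner_neg_right]; linarith⟩
    · right
      change inner ℝ (e 0) y = inner ℝ (e 0) x
      rw [real_inner_comm, inner_sub_right] at h
      linarith
    · left; left; exact ⟨hy, h⟩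
  have h0 : ∫⁻ y in plane e 0 (inner ℝ (e 0) x), R y = 0 :=
    setLIntegral_measure_zero _ _ (volume_plane e 0 _)
  have hfin : ∀ m' : Vec (n + 1), volume (halfBall x m' r) ≠ ⊤ := fun m' =>
    ne_top_of_le_ne_top measure_ball_lt_top.ne (measure_mono (halfBall_subset_ball x m' r))
  have hbd : ∀ (m' : Vec (n + 1)) (a' : Vec d),
      ⨍⁻ y in halfBall x m' r, ‖w y - a'‖ₑ ∂volume ≤ ε →
      ∫⁻ y in halfBall x m' r, ‖w y - a'‖ₑ ≤ ε * volume (Metric.ball x r) := by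
    intro m' a' h
    rw [← measure_mul_setLAverage _ (hfin m'), mul_comm]
    gcongr
    exact halfBall_subset_ball x m' r
  have h1 : ∫⁻ y in halfBall x (e 0) r, R y ≤ ε * volume (Metric.ball x r) := by
    refine le_trans (le_of_eq ?_) (hbd _ _ ha)
    refine setLIntegral_congr_fun (isOpen_halfBall _ _ _).measurableSet fun y hy => ?_
    have hy2 := hy.2
    rw [real_inner_comm] at hy2
    simp only [hR, heav_of_pos hy2]
    simp
  have h2 : ∫⁻ y in halfBall x (-e 0) r, R y ≤ ε * volume (Metric.ball x r) := by
    refine le_trans (le_of_eq ?_) (hbd _ _ hc)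
    refine setLIntegral_congr_fun (isOpen_halfBall _ _ _).measurableSet fun y hy => ?_
    have hy2 := hy.2
    rw [real_inner_comm, inner_neg_left] at hy2
    simp only [hR, heav_of_neg (show inner ℝ (e 0) (y - x) < 0 by linarith)]
    simp
  calc ∫⁻ y in Metric.ball x r, R y
      ≤ ∫⁻ y in (halfBall x (e 0) r ∪ halfBall x (-e 0) r) ∪ plane e 0 (inner ℝ (e 0) x), R y :=
        lintegral_mono_set hsub
    _ ≤ ((∫⁻ y in halfBall x (e 0) r, R y) + (∫⁻ y in halfBall x (-e 0) r, R y)) +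
        (∫⁻ y in plane e 0 (inner ℝ (e 0) x), R y) :=
        (lintegral_union_le _ _ _).trans (add_le_add (lintegral_union_le _ _ _) le_rfl)
    _ ≤ ε * volume (Metric.ball x r) + ε * volume (Metric.ball x r) + 0 := by
        rw [h0]; exact add_le_add (add_le_add h1 h2) le_rfl
    _ = _ := by ring

/-- At a point of vanishing `(N-1)`-density of the derivative there is no jump. -/
lemma notMem_jumpSet_of_density_zero {U : Set (Vec (n + 1))} (hU : IsOpen U)
    {w : Vec (n + 1) → Vec d} (hw : IntegrableOn w U) {x : Vec (n + 1)} (hx : x ∈ U)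
    {θ : ℝ → ℝ} (hθ : Tendsto (fun r => θ r / r ^ n) (𝓝[>] 0) (𝓝 0))
    (hder : ∀ φ : Vec (n + 1) → ℝ, IsTest φ → ∀ r, 0 < r → Metric.closedBall x r ⊆ U →
      tsupport φ ⊆ Metric.ball x r → ∀ C, (∀ y, ‖φ y‖ ≤ C) →
      ‖∫ y in U, tensor (w y) (gradient φ y)‖ ≤ C * θ r) : x ∉ jumpSet w := by
  rintro ⟨⟨a, c, m⟩, hac, hm, ha, hc⟩
  simp only at hac hm ha hc
  obtain ⟨φ, hφ, hsupp, hI0, hI1⟩ := exists_probe m hm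
  set β := ∫ y, heav (inner ℝ m y) * fderiv ℝ φ y m with hβ
  obtain ⟨C, hC⟩ := hφ.exists_bound
  obtain ⟨C', hC'⟩ := hφ.exists_gradient_bound
  have hC'0 : 0 ≤ C' := (norm_nonneg _).trans (hC' 0)
  have hk : ∀ y, ‖fderiv ℝ φ y m‖ ≤ C' := by
    intro y
    rw [← inner_gradient]
    have := norm_inner_le_norm (𝕜 := ℝ) (gradient φ y) m
    rw [hm, mul_one] at this
    exact this.trans (hC' y)
  set κ := (volume (Metric.ball (0 : Vec (n + 1)) 1)).toReal with hκ
  -- the main estimate at scale `r`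
  have key : ∀ ε : ℝ, 0 < ε → ∀ᶠ r in 𝓝[>] 0,
      |β| * ‖a - c‖ ≤ C * (θ r / r ^ n) + C' * (2 * (ε * κ)) := by
    intro ε hε
    have hε' : (0 : ℝ≥0∞) < ENNReal.ofReal ε := ENNReal.ofReal_pos.2 hε
    obtain ⟨ρ, hρ, hρU⟩ := Metric.nhds_basis_closedBall.mem_iff.1 (hU.mem_nhds hx)
    filter_upwards [(ENNReal.tendsto_nhds_zero.1 ha) _ hε', (ENNReal.tendsto_nhds_zero.1 hc) _ hε',
      Ioo_mem_nhdsGT hρ] with r hra hrc hr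
    have hr0 : 0 < r := hr.1
    have hBU : Metric.closedBall x r ⊆ U :=
      (Metric.closedBall_subset_closedBall hr.2.le).trans hρU
    have hbU : Metric.ball x r ⊆ U := Metric.ball_subset_closedBall.trans hBU
    -- Blow-up: tested with the rescaled probe, the derivative is at most C θ(r) = o(rⁿ), whereas a
    -- jump a − c contributes rⁿ β (a − c), up to an error of order ε rⁿ.
    set φr := fun y => φ (zoom x r y) with hφr
    have hφrt : IsTest φr := hφ.comp_zoom x hr0
    have hpre : zoom x r ⁻¹' Metric.ball 0 1 = Metric.ball x r := by
      ext y
      simp only [Set.mem_preimage, mem_ball_iff_norm, sub_zero, zoom, norm_smul, norm_inv,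
        Real.norm_of_nonneg hr0.le]
      rw [inv_mul_lt_iff₀ hr0, mul_one]
    have hsuppr : tsupport φr ⊆ Metric.ball x r := by
      rw [← hpre]
      exact (tsupport_comp_zoom φ x r).trans (Set.preimage_mono hsupp)
    have e1 := hder φr hφrt r hr0 hBU hsuppr C fun y => hC _
    -- contract with `m`
    have e2 : mulVec (∫ y in U, tensor (w y) (gradient φr y)) m =
        ∫ y in U, (r⁻¹ * fderiv ℝ φ (zoom x r y) m) • w y := by
      let L : Mat d (n + 1) →L[ℝ] Vec d := LinearMap.toContinuousLinearMap (mulVecL.flip m)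
      have : ∀ A, L A = mulVec A m := fun A => rfl
      rw [← this, ← L.integral_comp_comm (hφrt.integrableOn_tensor hw)]
      congr 1
      ext1 y
      rw [this, mulVec_tensor, real_inner_comm, inner_gradient,
        fderiv_comp_zoom hφ.differentiable]
    have hz : ∀ y, y ∉ Metric.ball x r → fderiv ℝ φ (zoom x r y) m = 0 := by
      intro y hy
      rw [← hpre] at hy
      have : fderiv ℝ φ (zoom x r y) = 0 := image_eq_zero_of_notMem_tsupport fun h =>
        hy (hsupp (tsupport_fderiv_subset ℝ h))
      rw [this]; rfl
    have e3 : ∫ y in U, (r⁻¹ * fderiv ℝ φ (zoom x r y) m) • w y =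
        ∫ y in Metric.ball x r, (r⁻¹ * fderiv ℝ φ (zoom x r y) m) • w y := by
      apply setIntegral_eq_of_subset_of_forall_sdiff_eq_zero hU.measurableSet hbU
      intro y hy
      rw [hz y hy.2]; simp
    have hkc : Continuous fun y => fderiv ℝ φ (zoom x r y) m :=
      ((hφ.contDiff.continuous_fderiv (by simp)).clm_apply continuous_const).comp
        (continuous_zoom x r)
    have hwb : IntegrableOn w (Metric.ball x r) := hw.mono_set hbU
    set R := fun y => w y - (heav (inner ℝ m (y - x)) • (a - c) + c) with hR
    have hball : IntegrableOn (fun _ : Vec (n + 1) => (1 : ℝ)) (Metric.ball x r) :=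
      integrableOn_const measure_ball_lt_top.ne
    have hhi : IntegrableOn (fun y => heav (inner ℝ m (y - x))) (Metric.ball x r) := by
      have := IntegrableOn.heav_smul hball (p := fun y => inner ℝ m (y - x)) (by fun_prop)
      simpa using this
    have hRi : IntegrableOn R (Metric.ball x r) :=
      hwb.sub ((hhi.smul_const (a - c)).add (integrableOn_const measure_ball_lt_top.ne))
    have bddmul : ∀ {E : Type} [NormedAddCommGroup E] [NormedSpace ℝ E] {F : Vec (n + 1) → E},
        IntegrableOn F (Metric.ball x r) →
        IntegrableOn (fun y => fderiv ℝ φ (zoom x r y) m • F y) (Metric.ball x r) :=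
      fun hF => Integrable.bdd_smul hF C' hkc.aestronglyMeasurable (.of_forall fun y => hk _)
    have hzoom : ∀ F : Vec (n + 1) → ℝ, (∀ y, y ∉ Metric.ball 0 1 → F y = 0) →
        ∫ y in Metric.ball x r, F (zoom x r y) = r ^ (n + 1) * ∫ y, F y := by
      intro F hF
      rw [← hpre, setIntegral_comp_zoom x hr0, smul_eq_mul,
        setIntegral_eq_integral_of_forall_compl_eq_zero hF]
    have hz0 : ∀ y, y ∉ Metric.ball (0 : Vec (n + 1)) 1 → fderiv ℝ φ y m = 0 := by
      intro y hy
      have : fderiv ℝ φ y = 0 := image_eq_zero_of_notMem_tsupport fun h =>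
        hy (hsupp (tsupport_fderiv_subset ℝ h))
      rw [this]; rfl
    have i0 : ∫ y in Metric.ball x r, fderiv ℝ φ (zoom x r y) m = 0 := by
      rw [hzoom (fun y => fderiv ℝ φ y m) hz0, hI0, mul_zero]
    have i1 : ∫ y in Metric.ball x r, fderiv ℝ φ (zoom x r y) m * heav (inner ℝ m (y - x)) =
        r ^ (n + 1) * β := by
      rw [hβ, ← hzoom (fun y => heav (inner ℝ m y) * fderiv ℝ φ y m)
        (fun y hy => by rw [hz0 y hy, mul_zero])]
      refine setIntegral_congr_fun Metric.isOpen_ball.measurableSet fun y _ => ?_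
      have : heav (inner ℝ m (zoom x r y)) = heav (inner ℝ m (y - x)) := by
        rw [zoom, inner_smul_right]
        rcases lt_trichotomy (inner ℝ m (y - x)) 0 with h | h | h
        · rw [heav_of_neg h, heav_of_neg (mul_neg_of_pos_of_neg (inv_pos.2 hr0) h)]
        · rw [h, mul_zero]
        · rw [heav_of_pos h, heav_of_pos (mul_pos (inv_pos.2 hr0) h)]
      simp only [this]
      rw [mul_comm]
    -- Decompose `w` into Heaviside part, constant and remainder. The constant drops out since the
    -- derivative of the probe has integral zero, the Heaviside part produces β, and the remainder
    -- is small in the mean.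
    have e4 : ∫ y in Metric.ball x r, (r⁻¹ * fderiv ℝ φ (zoom x r y) m) • w y =
        r⁻¹ • ((r ^ (n + 1) * β) • (a - c) +
          ∫ y in Metric.ball x r, fderiv ℝ φ (zoom x r y) m • R y) := by
      have hdec : ∀ y, (r⁻¹ * fderiv ℝ φ (zoom x r y) m) • w y = r⁻¹ •
          (((fderiv ℝ φ (zoom x r y) m * heav (inner ℝ m (y - x))) • (a - c) +
            fderiv ℝ φ (zoom x r y) m • c) + fderiv ℝ φ (zoom x r y) m • R y) := by
        intro y
        rw [mul_smul, mul_smul, ← smul_add, ← smul_add]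
        congr 2
        exact (add_sub_cancel _ _).symm
      simp_rw [hdec]
      have t1 : IntegrableOn (fun y => (fderiv ℝ φ (zoom x r y) m * heav (inner ℝ m (y - x))) •
          (a - c)) (Metric.ball x r) := Integrable.smul_const (bddmul hhi) (a - c)
      have t2 : IntegrableOn (fun y => fderiv ℝ φ (zoom x r y) m • c) (Metric.ball x r) :=
        bddmul (integrableOn_const measure_ball_lt_top.ne)
      have t12 : IntegrableOn (fun y => (fderiv ℝ φ (zoom x r y) m * heav (inner ℝ m (y - x))) •
          (a - c) + fderiv ℝ φ (zoom x r y) m • c) (Metric.ball x r) := t1.add t2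
      rw [integral_smul, integral_add t12 (bddmul hRi), integral_add t1 t2, integral_smul_const,
        integral_smul_const, i0, i1, zero_smul, add_zero]
    have e5 : ‖∫ y in Metric.ball x r, fderiv ℝ φ (zoom x r y) m • R y‖ ≤
        C' * (2 * (ε * (r ^ (n + 1) * κ))) := by
      have hvol : volume (Metric.ball x r) = ENNReal.ofReal (r ^ (n + 1) * κ) := by
        rw [Measure.addHaar_ball_of_pos _ _ hr0, finrank_euclideanSpace, Fintype.card_fin,
          ENNReal.ofReal_mul (by positivity), hκ, ENNReal.ofReal_toReal measure_ball_lt_top.ne]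
      have h1 := enorm_integral_sub_le hm hra hrc
      have h2 : ∫ y in Metric.ball x r, ‖R y‖ ≤ 2 * (ε * (r ^ (n + 1) * κ)) := by
        rw [integral_norm_eq_lintegral_enorm hRi.aestronglyMeasurable]
        refine ENNReal.toReal_le_of_le_ofReal (by positivity) (h1.trans (le_of_eq ?_))
        rw [hvol, ENNReal.ofReal_mul (zero_le_two (α := ℝ)), ENNReal.ofReal_mul hε.le]
        simp
      calc ‖∫ y in Metric.ball x r, fderiv ℝ φ (zoom x r y) m • R y‖
          ≤ ∫ y in Metric.ball x r, ‖fderiv ℝ φ (zoom x r y) m • R y‖ :=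
            norm_integral_le_integral_norm _
        _ ≤ ∫ y in Metric.ball x r, C' * ‖R y‖ := by
            refine integral_mono (bddmul hRi).norm (hRi.norm.const_mul C') fun y => ?_
            simp only [norm_smul]
            exact mul_le_mul_of_nonneg_right (hk _) (norm_nonneg _)
        _ ≤ _ := by
            rw [integral_const_mul]
            gcongr
    have e6 : ‖mulVec (∫ y in U, tensor (w y) (gradient φr y)) m‖ ≤ C * θ r := by
      refine (norm_mulVec_le _ _).trans ?_
      rwa [hm, mul_one]
    rw [e2, e3, e4, norm_smul, norm_inv, Real.norm_of_nonneg hr0.le] at e6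
    have e7 : r ^ (n + 1) * |β| * ‖a - c‖ ≤ r * (C * θ r) +
        C' * (2 * (ε * (r ^ (n + 1) * κ))) := by
      have h1 : ‖(r ^ (n + 1) * β) • (a - c)‖ = r ^ (n + 1) * |β| * ‖a - c‖ := by
        rw [norm_smul, norm_mul, Real.norm_of_nonneg (by positivity), Real.norm_eq_abs]
      rw [← h1]
      have h2 : (r ^ (n + 1) * β) • (a - c) = ((r ^ (n + 1) * β) • (a - c) +
          ∫ y in Metric.ball x r, fderiv ℝ φ (zoom x r y) m • R y) -
          ∫ y in Metric.ball x r, fderiv ℝ φ (zoom x r y) m • R y := by abel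
      rw [h2]
      refine (norm_sub_le _ _).trans (add_le_add ?_ e5)
      rwa [inv_mul_le_iff₀ hr0] at e6
    have hrn : 0 < r ^ n := by positivity
    have e8 : |β| * ‖a - c‖ * r ^ (n + 1) ≤
        (C * (θ r / r ^ n) + C' * (2 * (ε * κ))) * r ^ (n + 1) := by
      have : (C * (θ r / r ^ n) + C' * (2 * (ε * κ))) * r ^ (n + 1) =
          r * (C * θ r) + C' * (2 * (ε * (r ^ (n + 1) * κ))) := by
        rw [pow_succ]; field_simp
      rw [this]; linarith
    exact le_of_mul_le_mul_right e8 (by positivity)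
  have hfinal : ∀ ε : ℝ, 0 < ε → |β| * ‖a - c‖ ≤ C' * (2 * (ε * κ)) := by
    intro ε hε
    have lim : Tendsto (fun r => C * (θ r / r ^ n) + C' * (2 * (ε * κ))) (𝓝[>] 0)
        (𝓝 (C * 0 + C' * (2 * (ε * κ)))) := (hθ.const_mul C).add_const _
    have := ge_of_tendsto lim (key ε hε)
    simpa using this
  have hpos : 0 < |β| * ‖a - c‖ :=
    mul_pos (abs_pos.2 hI1) (norm_pos_iff.2 (sub_ne_zero.2 hac))
  have hκ0 : 0 ≤ κ := ENNReal.toReal_nonneg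
  have hden : 0 < C' * 2 * κ + 1 := by positivity
  -- For this ε the bound reads X ≤ qX with X > 0 and q < 1, a contradiction.
  have h1 := hfinal (|β| * ‖a - c‖ / (C' * 2 * κ + 1)) (div_pos hpos hden)
  have h2 : C' * (2 * (|β| * ‖a - c‖ / (C' * 2 * κ + 1) * κ)) =
      (|β| * ‖a - c‖) * ((C' * 2 * κ) / (C' * 2 * κ + 1)) := by ring
  rw [h2] at h1
  have h3 : (C' * 2 * κ) / (C' * 2 * κ + 1) < 1 := by rw [div_lt_one hden]; linarith
  nlinarith

/-- If the derivative of `w` does not charge a subset `S` of a hyperplane, then almost no point of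
`S` is a jump point of `w`. -/
theorem hausdorff_inter_jumpSet_eq_zero (b : OrthonormalBasis (Fin (n + 1)) ℝ (Vec (n + 1)))
    (i : Fin (n + 1)) (s : ℝ) {U S J : Set (Vec (n + 1))} (hU : IsOpen U) (hS : MeasurableSet S)
    (hSU : S ⊆ U) (hSp : S ⊆ plane b i s) (hJ : Disjoint S J)
    {w : Vec (n + 1) → Vec d} {G T : Vec (n + 1) → Mat d (n + 1)} (hw : IntegrableOn w U)
    (hG : IntegrableOn G U) (hT : IntegrableOn T J μHE[n + 1 - 1])
    (hder : ∀ φ : Vec (n + 1) → ℝ, IsTest φ → tsupport φ ⊆ U →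
      (∫ x in U, tensor (w x) (gradient φ x)) + ((∫ x in U, φ x • G x) +
        ∫ x in J, φ x • T x ∂μHE[n + 1 - 1]) = 0) :
    (μHE[n + 1 - 1] : Measure (Vec (n + 1))) (S ∩ jumpSet w) = 0 := by
  -- The set `J` need not be the jump set of `w`; it only has to carry, together with `G`, the whole
  -- derivative. Hence ρ below dominates the variation of Dw.
  set μ₁ := (volume.restrict U).withDensity fun x => ‖G x‖ₑ with hμ₁
  set μ₂ := ((μHE[n + 1 - 1] : Measure (Vec (n + 1))).restrict J).withDensity fun x => ‖T x‖ₑ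
    with hμ₂
  have f1 : IsFiniteMeasure μ₁ := isFiniteMeasure_withDensity hG.2.ne
  have f2 : IsFiniteMeasure μ₂ := isFiniteMeasure_withDensity hT.2.ne
  set ρ := μ₁ + μ₂ with hρ
  -- A hyperplane is Lebesgue null, so the volume part does not charge `S`, and the surface part
  -- lives on `J`, which is disjoint from `S`.
  have hρS : ρ S = 0 := by
    have h1 : μ₁ S = 0 := by
      refine withDensity_absolutelyContinuous _ _ ?_
      rw [Measure.restrict_apply hS]
      exact measure_mono_null (Set.inter_subset_left.trans hSp) (volume_plane b i s)
    have h2 : μ₂ S = 0 := by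
      refine withDensity_absolutelyContinuous _ _ ?_
      rw [Measure.restrict_apply hS, hJ.inter_eq, measure_empty]
    rw [hρ, Measure.add_apply, h1, h2, add_zero]
  have hae := ae_density_zero b i s ρ hS hρS
  have hgoal : ∀ᵐ x ∂(μHE[n + 1 - 1] : Measure (Vec (n + 1))).restrict (plane b i s),
      x ∈ S → x ∉ jumpSet w := by
    filter_upwards [hae] with x hx hxS
    have hx := hx hxS
    refine notMem_jumpSet_of_density_zero hU hw (hSU hxS)
      (θ := fun r => (ρ (Metric.closedBall x r)).toReal) ?_ ?_
    · -- density in terms of `r ^ n`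
      set κ := volume (Metric.closedBall (0 : Vec n) 1) with hκ
      have hκ0 : κ ≠ 0 := (Metric.measure_closedBall_pos _ _ one_pos).ne'
      have hκt : κ ≠ ⊤ := measure_closedBall_lt_top.ne
      have h2 := (ENNReal.tendsto_toReal ENNReal.zero_ne_top).comp hx
      have h3 := h2.mul_const κ.toReal
      simp only [ENNReal.toReal_zero, zero_mul] at h3
      refine h3.congr' ?_
      filter_upwards [self_mem_nhdsWithin] with r hr
      have hr : 0 < r := hr
      simp only [Function.comp]
      rw [Measure.restrict_apply Metric.isClosed_closedBall.measurableSet, Set.inter_comm,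
        hausdorff_plane_closedBall b i s (hSp hxS), Measure.addHaar_closedBall' (volume : Measure (Vec n)) _ hr.le,
        finrank_euclideanSpace, Fintype.card_fin, ENNReal.toReal_div, ENNReal.toReal_mul,
        ENNReal.toReal_ofReal (by positivity)]
      have : κ.toReal ≠ 0 := (ENNReal.toReal_pos hκ0 hκt).ne'
      rw [← hκ]
      field_simp
    · intro φ hφ r hr hBU hsupp C hC
      have hφU : tsupport φ ⊆ U := hsupp.trans (Metric.ball_subset_closedBall.trans hBU)
      rw [eq_neg_of_add_eq_zero_left (hder φ hφ hφU), norm_neg]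
      have hz : ∀ y, y ∉ Metric.closedBall x r → φ y = 0 := fun y hy =>
        image_eq_zero_of_notMem_tsupport fun h => hy (Metric.ball_subset_closedBall (hsupp h))
      have gen : ∀ (ν : Measure (Vec (n + 1))) (F : Vec (n + 1) → Mat d (n + 1)),
          Integrable F ν → ‖∫ y, φ y • F y ∂ν‖ ≤
            C * ((ν.withDensity fun x => ‖F x‖ₑ) (Metric.closedBall x r)).toReal := by
        intro ν F hF
        have hm : MeasurableSet (Metric.closedBall x r) := Metric.isClosed_closedBall.measurableSet
        rw [withDensity_apply _ hm, ← integral_norm_eq_lintegral_enorm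
          hF.aestronglyMeasurable.restrict, ← integral_const_mul]
        rw [← setIntegral_eq_integral_of_forall_compl_eq_zero (s := Metric.closedBall x r)
          (fun y hy => by rw [hz y hy, zero_smul])]
        refine norm_integral_le_of_norm_le (hF.norm.const_mul C).integrableOn
          (.of_forall fun y => ?_)
        rw [norm_smul]
        exact mul_le_mul_of_nonneg_right (hC y) (norm_nonneg _)
      calc _ ≤ _ := norm_add_le _ _
        _ ≤ C * (μ₁ (Metric.closedBall x r)).toReal + C * (μ₂ (Metric.closedBall x r)).toReal :=
          add_le_add (gen _ G hG) (gen _ T hT)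
        _ = C * (ρ (Metric.closedBall x r)).toReal := by
          rw [hρ, Measure.add_apply, ENNReal.toReal_add (measure_ne_top _ _) (measure_ne_top _ _),
            mul_add]
  rw [ae_iff, Measure.restrict_apply' (measurableSet_plane b i s)] at hgoal
  refine measure_mono_null ?_ hgoal
  rintro x ⟨hxS, hxJ⟩
  exact ⟨fun h => h hxS hxJ, hSp hxS⟩

end Fine

/-! ### Gluing across cubes -/

section Glue

open Classical in
/-- The function equal to `v` on `P` and to `w` elsewhere. -/
def glued {X E : Type*} (P : Set X) (v w : X → E) : X → E := P.piecewise v w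

lemma glued_of_mem {X E : Type*} {P : Set X} {v w : X → E} {x : X} (hx : x ∈ P) :
    glued P v w x = v x := by simp [glued, hx]

lemma glued_of_notMem {X E : Type*} {P : Set X} {v w : X → E} {x : X} (hx : x ∉ P) :
    glued P v w x = w x := by simp [glued, hx]

lemma glued_eventuallyEq_left {E : Type*} {P : Set (Vec N)} (hP : IsOpen P) {v w : Vec N → E}
    {x : Vec N} (hx : x ∈ P) : glued P v w =ᶠ[𝓝 x] v := by
  filter_upwards [hP.mem_nhds hx] with y hy using glued_of_mem hy

lemma glued_eventuallyEq_right {E : Type*} {P : Set (Vec N)} {v w : Vec N → E}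
    {x : Vec N} (hx : x ∉ closure P) : glued P v w =ᶠ[𝓝 x] w := by
  filter_upwards [isClosed_closure.isOpen_compl.mem_nhds hx] with y hy
  exact glued_of_notMem fun h => hy (subset_closure h)

/-! ### Integrals of piecewise defined functions -/

section Integral

variable {X : Type*} [MeasurableSpace X] {μ : Measure X} {E : Type*} [NormedAddCommGroup E]
  {P S U : Set X} {f g : X → E}

lemma setIntegral_inter_congr [NormedSpace ℝ E] (hP : MeasurableSet P) (S : Set X)
    (h : ∀ x ∈ P, f x = g x) : ∫ x in P ∩ S, f x ∂μ = ∫ x in P ∩ S, g x ∂μ := by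
  rw [← Measure.restrict_restrict hP]
  exact setIntegral_congr_fun hP h

lemma integrableOn_inter_congr (hP : MeasurableSet P) (h : ∀ x ∈ P, f x = g x)
    (hf : IntegrableOn f (P ∩ S) μ) : IntegrableOn g (P ∩ S) μ := by
  rw [IntegrableOn, ← Measure.restrict_restrict hP] at hf ⊢
  exact IntegrableOn.congr_fun hf h hP

lemma setIntegral_glued [NormedSpace ℝ E] (hP : MeasurableSet P) (hU : MeasurableSet U)
    (hPU : P ⊆ U) (hf : IntegrableOn f P μ) (hg : IntegrableOn g U μ) :
    IntegrableOn (glued P f g) U μ ∧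
      ∫ x in U, glued P f g x ∂μ = (∫ x in P, f x ∂μ) + ∫ x in U \ P, g x ∂μ := by
  have h1 : IntegrableOn (glued P f g) P μ :=
    hf.congr_fun (fun x hx => (glued_of_mem hx).symm) hP
  have h2 : IntegrableOn (glued P f g) (U \ P) μ :=
    (hg.mono_set Set.sdiff_subset).congr_fun (fun x hx => (glued_of_notMem hx.2).symm)
      (hU.diff hP)
  have h3 : IntegrableOn (glued P f g) U μ := by
    have := h1.union h2
    rwa [Set.union_sdiff_cancel hPU] at this
  refine ⟨h3, ?_⟩
  rw [← setIntegral_congr_fun hP (fun x hx => glued_of_mem (v := f) (w := g) hx),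
    ← setIntegral_congr_fun (hU.diff hP) (fun x hx => glued_of_notMem (v := f) (w := g) hx.2),
    ← integral_inter_add_sdiff hP h3, Set.inter_eq_right.2 hPU]

lemma setIntegral_split [NormedSpace ℝ E] (hP : MeasurableSet P) (hPU : P ⊆ U)
    (hg : IntegrableOn g U μ) :
    ∫ x in U, g x ∂μ = (∫ x in P, g x ∂μ) + ∫ x in U \ P, g x ∂μ := by
  rw [← integral_inter_add_sdiff hP hg, Set.inter_eq_right.2 hPU]

lemma setIntegral_inter_split [NormedSpace ℝ E] (hP : MeasurableSet P) (hPU : P ⊆ U)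
    (hg : IntegrableOn g (U ∩ S) μ) :
    ∫ x in U ∩ S, g x ∂μ = (∫ x in P ∩ S, g x ∂μ) + ∫ x in (U \ P) ∩ S, g x ∂μ := by
  rw [← integral_inter_add_sdiff hP hg]
  congr 3
  · ext x; constructor
    · rintro ⟨⟨_, h⟩, h'⟩; exact ⟨h', h⟩
    · rintro ⟨h, h'⟩; exact ⟨⟨hPU h, h'⟩, h⟩
  · ext x; constructor
    · rintro ⟨⟨h, h1⟩, h'⟩; exact ⟨⟨h, h'⟩, h1⟩
    · rintro ⟨⟨h, h1⟩, h'⟩; exact ⟨⟨h, h'⟩, h1⟩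

end Integral

variable {E : Type*} [NormedAddCommGroup E] {U P : Set (Vec N)} {v w : Vec N → Vec d}
  {μ : Measure (Vec N)}

lemma jumpSet_glued_left (hP : IsOpen P) :
    P ∩ jumpSet (glued P v w) = P ∩ jumpSet v := by
  ext x
  exact and_congr_right fun hx => mem_jumpSet_congr (glued_eventuallyEq_left hP hx)

lemma jumpSet_glued_right :
    (U \ closure P) ∩ jumpSet (glued P v w) = (U \ closure P) ∩ jumpSet w := by
  ext x
  exact and_congr_right fun hx => mem_jumpSet_congr (glued_eventuallyEq_right hx.2)

lemma sdiff_frontier_inter (hP : IsOpen P) (hPU : P ⊆ U) (S : Set (Vec N)) :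
    (U \ frontier P) ∩ S = P ∩ S ∪ (U \ closure P) ∩ S := by
  ext x
  simp only [hP.frontier_eq, Set.mem_inter_iff, Set.mem_sdiff, Set.mem_union]
  constructor
  · rintro ⟨⟨h1, h2⟩, h3⟩
    by_cases hx : x ∈ P
    · exact Or.inl ⟨hx, h3⟩
    · exact Or.inr ⟨⟨h1, fun h => h2 ⟨h, hx⟩⟩, h3⟩
  · rintro (⟨h1, h2⟩ | ⟨⟨h1, h2⟩, h3⟩)
    · exact ⟨⟨hPU h1, fun h => h.2 h1⟩, h2⟩
    · exact ⟨⟨h1, fun h => h2 h.1⟩, h3⟩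

lemma sdiff_closure_ae_eq (hP : IsOpen P) {S : Set (Vec N)} (hF : μ (U ∩ frontier P ∩ S) = 0) :
    ((U \ closure P) ∩ S : Set (Vec N)) =ᵐ[μ] ((U \ P) ∩ S : Set (Vec N)) := by
  refine (LE.le.eventuallyLE (show (U \ closure P) ∩ S ⊆ (U \ P) ∩ S from fun x hx => ?_)).antisymm ?_
  · exact ⟨⟨hx.1.1, fun h => hx.1.2 (subset_closure h)⟩, hx.2⟩
  · rw [ae_le_set]
    refine measure_mono_null (fun x hx => ?_) hF
    rw [hP.frontier_eq]
    refine ⟨⟨hx.1.1.1, ?_, hx.1.1.2⟩, hx.1.2⟩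
    by_contra h
    exact hx.2 ⟨⟨hx.1.1.1, h⟩, hx.1.2⟩

lemma sdiff_frontier_ae_eq {S : Set (Vec N)} (hF : μ (U ∩ frontier P ∩ S) = 0) :
    ((U \ frontier P) ∩ S : Set (Vec N)) =ᵐ[μ] (U ∩ S : Set (Vec N)) := by
  refine (LE.le.eventuallyLE (show (U \ frontier P) ∩ S ⊆ U ∩ S from
    fun x hx => ⟨hx.1.1, hx.2⟩)).antisymm ?_
  rw [ae_le_set]
  refine measure_mono_null (fun x hx => ?_) hF
  refine ⟨⟨hx.1.1, ?_⟩, hx.1.2⟩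
  by_contra h
  exact hx.2 ⟨⟨hx.1.1, h⟩, hx.1.2⟩

/-- Splitting of jump integrals of a glued function, away from the interface. -/
lemma setIntegral_jump_glued_sdiff [NormedSpace ℝ E] (hU : IsOpen U) (hP : IsOpen P) (hPU : P ⊆ U)
    (hF : μ (U ∩ frontier P ∩ jumpSet w) = 0) {Q : Vec N → Mat d N → E}
    (hv : IntegrableOn (fun x => Q x (jumpTensor v x)) (P ∩ jumpSet v) μ)
    (hw : IntegrableOn (fun x => Q x (jumpTensor w x)) (U ∩ jumpSet w) μ) :
    IntegrableOn (fun x => Q x (jumpTensor (glued P v w) x))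
      ((U \ frontier P) ∩ jumpSet (glued P v w)) μ ∧
    ∫ x in (U \ frontier P) ∩ jumpSet (glued P v w), Q x (jumpTensor (glued P v w) x) ∂μ =
      (∫ x in P ∩ jumpSet v, Q x (jumpTensor v x) ∂μ) +
        ∫ x in (U \ P) ∩ jumpSet w, Q x (jumpTensor w x) ∂μ := by
  have hUP : MeasurableSet (U \ closure P) := hU.measurableSet.diff isClosed_closure.measurableSet
  have e1 : ∀ x ∈ P, Q x (jumpTensor v x) = Q x (jumpTensor (glued P v w) x) := fun x hx => by
    rw [jumpTensor_congr (glued_eventuallyEq_left hP hx)]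
  have e2 : ∀ x ∈ U \ closure P, Q x (jumpTensor w x) = Q x (jumpTensor (glued P v w) x) :=
    fun x hx => by rw [jumpTensor_congr (glued_eventuallyEq_right hx.2)]
  have i1 := integrableOn_inter_congr hP.measurableSet e1 hv
  have i2 := integrableOn_inter_congr hUP e2 (S := jumpSet w)
    (hw.mono_set (Set.inter_subset_inter_left _ Set.sdiff_subset))
  rw [← jumpSet_glued_left (w := w) hP] at i1
  rw [← jumpSet_glued_right (v := v)] at i2
  have hi : IntegrableOn (fun x => Q x (jumpTensor (glued P v w) x))
      ((U \ frontier P) ∩ jumpSet (glued P v w)) μ := by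
    rw [sdiff_frontier_inter hP hPU]; exact i1.union i2
  refine ⟨hi, ?_⟩
  rw [← setIntegral_congr_set (sdiff_closure_ae_eq hP hF),
    setIntegral_inter_congr hP.measurableSet _ e1, setIntegral_inter_congr hUP _ e2,
    ← jumpSet_glued_left (w := w) hP, ← jumpSet_glued_right (v := v),
    ← integral_inter_add_sdiff hP.measurableSet hi]
  congr 3
  · rw [sdiff_frontier_inter hP hPU]
    ext x; constructor
    · rintro ⟨h | h, h'⟩
      · exact h
      · exact absurd (subset_closure h') h.1.2
    · exact fun h => ⟨Or.inl h, h.1⟩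
  · rw [sdiff_frontier_inter hP hPU]
    ext x; constructor
    · rintro ⟨h | h, h'⟩
      · exact absurd h.1 h'
      · exact h
    · exact fun h => ⟨Or.inr h, fun h' => h.1.2 (subset_closure h')⟩

lemma setIntegral_jump_glued [NormedSpace ℝ E] (hU : IsOpen U) (hP : IsOpen P) (hPU : P ⊆ U)
    (hF : μ (U ∩ frontier P ∩ jumpSet w) = 0)
    (hF' : μ (U ∩ frontier P ∩ jumpSet (glued P v w)) = 0) {Q : Vec N → Mat d N → E}
    (hv : IntegrableOn (fun x => Q x (jumpTensor v x)) (P ∩ jumpSet v) μ)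
    (hw : IntegrableOn (fun x => Q x (jumpTensor w x)) (U ∩ jumpSet w) μ) :
    IntegrableOn (fun x => Q x (jumpTensor (glued P v w) x)) (U ∩ jumpSet (glued P v w)) μ ∧
    ∫ x in U ∩ jumpSet (glued P v w), Q x (jumpTensor (glued P v w) x) ∂μ =
      (∫ x in P ∩ jumpSet v, Q x (jumpTensor v x) ∂μ) +
        ∫ x in (U \ P) ∩ jumpSet w, Q x (jumpTensor w x) ∂μ := by
  obtain ⟨h1, h2⟩ := setIntegral_jump_glued_sdiff hU hP hPU hF (Q := Q) hv hw
  have h := sdiff_frontier_ae_eq hF'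
  exact ⟨h1.congr_set_ae h.symm, by rw [← h2, setIntegral_congr_set h]⟩

lemma tensor_glued_gradient (φ : Vec N → ℝ) :
    (fun x => tensor (glued P v w x) (gradient φ x)) =
      glued P (fun x => tensor (v x) (gradient φ x)) (fun x => tensor (w x) (gradient φ x)) := by
  ext1 x
  by_cases hx : x ∈ P
  · simp [glued_of_mem hx]
  · simp [glued_of_notMem hx]

lemma smul_glued (φ : Vec N → ℝ) (G G' : Vec N → Mat d N) :
    (fun x => φ x • glued P G G' x) = glued P (fun x => φ x • G x) (fun x => φ x • G' x) := by
  ext1 x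
  by_cases hx : x ∈ P
  · simp [glued_of_mem hx]
  · simp [glued_of_notMem hx]

end Glue

/-! ### Gluing of SBV functions with equal traces -/

section GlueSBV

variable {n : ℕ} {U P : Set (Vec (n + 1))} {v w : Vec (n + 1) → Vec d}
  {Gv G : Vec (n + 1) → Mat d (n + 1)}

/-- Replacing `w` by `v` inside `P`, where `v` and `w` have the same trace on `∂P`, creates no
jump on `∂P`. -/
theorem HasSBVDerivative.glued {κ : Type*} [Finite κ]
    (b : OrthonormalBasis (Fin (n + 1)) ℝ (Vec (n + 1))) (i : κ → Fin (n + 1)) (s : κ → ℝ)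
    (hcov : frontier P ⊆ ⋃ j, plane b (i j) (s j)) (hU : IsOpen U) (hP : IsOpen P) (hPU : P ⊆ U)
    (hw : HasSBVDerivative U w G) (hv : IntegrableOn v P) (hGv : IntegrableOn Gv P)
    (hTv : IntegrableOn (jumpTensor v) (P ∩ jumpSet v) μHE[n + 1 - 1])
    (hform : ∀ φ, IsTest φ → greenForm P v Gv φ = greenForm P w G φ)
    (hF : (μHE[n + 1 - 1] : Measure (Vec (n + 1))) (U ∩ frontier P ∩ jumpSet w) = 0) :
    HasSBVDerivative U (glued P v w) (glued P Gv G) ∧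
    (∀ φ, IsTest φ → greenForm U (StructuredDeformation.glued P v w)
      (StructuredDeformation.glued P Gv G) φ = greenForm U w G φ) ∧
    (μHE[n + 1 - 1] : Measure (Vec (n + 1)))
      (U ∩ frontier P ∩ jumpSet (StructuredDeformation.glued P v w)) = 0 := by
  set w' := StructuredDeformation.glued P v w with hw'
  set G' := StructuredDeformation.glued P Gv G with hG'
  obtain ⟨hw1, hw2, hw3, hw4⟩ := hasSBVDerivative_iff.1 hw
  have hUm := hU.measurableSet
  have hPm := hP.measurableSet
  have hw'i : IntegrableOn w' U := (setIntegral_glued hPm hUm hPU hv hw1).1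
  have hG'i : IntegrableOn G' U := (setIntegral_glued hPm hUm hPU hGv hw2).1
  have hT' := setIntegral_jump_glued_sdiff (v := v) hU hP hPU hF (Q := fun _ T => T) hTv hw3
  -- The jump integral omits the interface: off the frontier the glued function coincides locally
  -- with `v` or `w`, and equality of the Green forms on `P` exchanges the contribution of `v` for
  -- that of `w`. The derivative is thus represented without knowing what happens on the frontier.
  have hform' : ∀ φ, IsTest φ → (∫ x in U, tensor (w' x) (gradient φ x)) +
      ((∫ x in U, φ x • G' x) + ∫ x in (U \ frontier P) ∩ jumpSet w',
        φ x • jumpTensor w' x ∂μHE[n + 1 - 1]) = greenForm U w G φ := by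
    intro φ hφ
    have h1 := (setIntegral_glued hPm hUm hPU (hφ.integrableOn_tensor hv)
      (hφ.integrableOn_tensor hw1)).2
    have h2 := (setIntegral_glued hPm hUm hPU (hφ.integrableOn_smul hGv)
      (hφ.integrableOn_smul hw2)).2
    have h3 := (setIntegral_jump_glued_sdiff (v := v) hU hP hPU hF (Q := fun x T => φ x • T)
      (hφ.integrableOn_smul hTv) (hφ.integrableOn_smul hw3)).2
    rw [← tensor_glued_gradient] at h1
    rw [← smul_glued] at h2
    have h4 := hform φ hφ
    rw [hw', hG', h1, h2, h3]
    rw [greenForm] at h4 ⊢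
    rw [greenForm] at h4
    rw [setIntegral_split hPm hPU (hφ.integrableOn_tensor hw1),
      setIntegral_split hPm hPU (hφ.integrableOn_smul hw2),
      setIntegral_inter_split hPm hPU (hφ.integrableOn_smul hw3)]
    linear_combination (norm := module) h4
  -- The frontier is covered by finitely many hyperplanes. On each of them the representation
  -- `hform'` charges nothing, so almost no point is a jump point, and the interface can be put back
  -- into the jump integral afterwards.
  have hnull : (μHE[n + 1 - 1] : Measure (Vec (n + 1))) (U ∩ frontier P ∩ jumpSet w') = 0 := by
    refine measure_mono_null (t := ⋃ j, (U ∩ frontier P ∩ plane b (i j) (s j)) ∩ jumpSet w') ?_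
      (measure_iUnion_null fun j => ?_)
    · rintro x ⟨hx1, hx2⟩
      obtain ⟨j, hj⟩ := Set.mem_iUnion.1 (hcov hx1.2)
      exact Set.mem_iUnion.2 ⟨j, ⟨hx1, hj⟩, hx2⟩
    · refine hausdorff_inter_jumpSet_eq_zero b (i j) (s j) hU
        ((hUm.inter isClosed_frontier.measurableSet).inter (measurableSet_plane b _ _))
        (fun x hx => hx.1.1) (fun x hx => hx.2) ?_ hw'i hG'i hT'.1 fun φ hφ hsupp => ?_
      · exact Set.disjoint_left.2 fun x hx hx' => hx'.1.2 hx.1.2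
      · rw [hform' φ hφ, hw4 φ hφ hsupp]
  have hT := setIntegral_jump_glued (v := v) hU hP hPU hF hnull (Q := fun _ T => T) hTv hw3
  have hG : ∀ φ, IsTest φ → greenForm U w' G' φ = greenForm U w G φ := by
    intro φ hφ
    rw [← hform' φ hφ, greenForm, ← setIntegral_congr_set (sdiff_frontier_ae_eq hnull)]
  refine ⟨hasSBVDerivative_iff.2 ⟨hw'i, hG'i, hT.1, fun φ hφ hsupp => ?_⟩, hG, hnull⟩
  rw [hG φ hφ, hw4 φ hφ hsupp]

end GlueSBV

/-! ### Behaviour under dilations -/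

section Rescale

variable {n : ℕ} {U : Set (Vec (n + 1))} {u : Vec (n + 1) → Vec d}
  {G : Vec (n + 1) → Mat d (n + 1)} {x₀ : Vec (n + 1)} {r t : ℝ}

lemma volume_preimage_zoom (x₀ : Vec N) (hr : 0 < r) (S : Set (Vec N)) :
    volume (zoom x₀ r ⁻¹' S) = ENNReal.ofReal (r ^ N) * volume S := by
  rw [← (measurableEmbedding_zoom x₀ hr).map_apply, map_zoom_volume x₀ hr]
  rfl

lemma isOpen_preimage_zoom (x₀ : Vec N) (r : ℝ) {S : Set (Vec N)} (hS : IsOpen S) :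
    IsOpen (zoom x₀ r ⁻¹' S) := hS.preimage (continuous_zoom x₀ r)

/-- The gradient of `rescale x₀ r t c u` in terms of the gradient `G` of `u`. -/
def rescaleGradient (x₀ : Vec N) (r t : ℝ) (G : Vec N → Mat d N) (y : Vec N) : Mat d N :=
  (t / r) • G (zoom x₀ r y)

lemma integrableOn_rescale (hr : 0 < r) (c : Vec d) (hU : volume U ≠ ⊤) (hu : IntegrableOn u U) :
    IntegrableOn (rescale x₀ r t c u) (zoom x₀ r ⁻¹' U) := by
  refine Integrable.add ((integrableOn_comp_zoom x₀ hr hu).smul t) (integrableOn_const ?_)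
  rw [volume_preimage_zoom x₀ hr]
  exact ENNReal.mul_ne_top ENNReal.ofReal_ne_top hU

lemma integrableOn_rescaleGradient (hr : 0 < r) (hG : IntegrableOn G U) :
    IntegrableOn (rescaleGradient x₀ r t G) (zoom x₀ r ⁻¹' U) :=
  (integrableOn_comp_zoom x₀ hr hG).smul (t / r)

lemma preimage_inter_jumpSet_rescale (hr : 0 < r) (ht : 0 < t) (c : Vec d) :
    zoom x₀ r ⁻¹' U ∩ jumpSet (rescale x₀ r t c u) = zoom x₀ r ⁻¹' (U ∩ jumpSet u) := by
  ext y
  exact and_congr_right fun _ => mem_jumpSet_rescale hr ht c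

lemma jumpTensor_rescale (hr : 0 < r) (ht : 0 < t) (c : Vec d) (hU : IsOpen U)
    (hUt : volume U ≠ ⊤) (hu : IntegrableOn u U) {y : Vec (n + 1)} (hy : zoom x₀ r y ∈ U) :
    jumpTensor (rescale x₀ r t c u) y = t • jumpTensor u (zoom x₀ r y) := by
  by_cases hx : zoom x₀ r y ∈ jumpSet u
  · have h := isJumpTriple_jumpTriple hx
    rw [(h.rescale hr ht c).jumpTensor_eq ((isOpen_preimage_zoom x₀ r hU).mem_nhds hy)
      (integrableOn_rescale hr c hUt hu).aestronglyMeasurable,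
      h.jumpTensor_eq (hU.mem_nhds hy) hu.aestronglyMeasurable, ← tensor_smul_left]
    simp [smul_sub]
  · rw [jumpTensor_of_notMem hx, jumpTensor_of_notMem, smul_zero]
    rwa [mem_jumpSet_rescale hr ht]

lemma integrableOn_jumpTensor_rescale (hr : 0 < r) (ht : 0 < t) (c : Vec d) (hU : IsOpen U)
    (hUt : volume U ≠ ⊤) (hu : IntegrableOn u U)
    (hT : IntegrableOn (jumpTensor u) (U ∩ jumpSet u) μHE[n + 1 - 1]) :
    IntegrableOn (jumpTensor (rescale x₀ r t c u))
      (zoom x₀ r ⁻¹' U ∩ jumpSet (rescale x₀ r t c u)) μHE[n + 1 - 1] := by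
  refine integrableOn_inter_congr (isOpen_preimage_zoom x₀ r hU).measurableSet
    (fun y hy => (jumpTensor_rescale hr ht c hU hUt hu hy).symm) ?_
  rw [preimage_inter_jumpSet_rescale hr ht]
  exact (integrableOn_hausdorff_comp_zoom _ x₀ hr hT).smul t

/-- Jumps are multiplied by t and surface measure by rⁿ. In `setIntegral_rescaleGradient`, gradients
are multiplied by t/r and volume by r^(n+1). For homogeneous integrands both parts therefore acquire
the same factor t rⁿ, the weight of a cube in a filling. -/
lemma setIntegral_jump_rescale {E : Type*} [NormedAddCommGroup E] [NormedSpace ℝ E]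
    (hr : 0 < r) (ht : 0 < t) (c : Vec d) (hU : IsOpen U)
    (hUt : volume U ≠ ⊤) (hu : IntegrableOn u U) {Q : Vec (n + 1) → Mat d (n + 1) → E}
    (hQ : ∀ x T, Q x (t • T) = t • Q x T) :
    ∫ y in zoom x₀ r ⁻¹' U ∩ jumpSet (rescale x₀ r t c u),
        Q (zoom x₀ r y) (jumpTensor (rescale x₀ r t c u) y) ∂μHE[n + 1 - 1] =
      (t * r ^ n) • ∫ x in U ∩ jumpSet u, Q x (jumpTensor u x) ∂μHE[n + 1 - 1] := by
  rw [setIntegral_inter_congr (isOpen_preimage_zoom x₀ r hU).measurableSet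
    (g := fun y => t • Q (zoom x₀ r y) (jumpTensor u (zoom x₀ r y))) _
    (fun y hy => by rw [jumpTensor_rescale hr ht c hU hUt hu hy, hQ]),
    preimage_inter_jumpSet_rescale hr ht, integral_smul,
    setIntegral_hausdorff_comp_zoom _ x₀ hr _ (fun x => Q x (jumpTensor u x)), smul_smul]
  rfl

lemma setIntegral_rescaleGradient {E : Type*} [NormedAddCommGroup E] [NormedSpace ℝ E]
    (hr : 0 < r) {Q : Vec (n + 1) → Mat d (n + 1) → E}
    (hQ : ∀ x T, Q x ((t / r) • T) = (t / r) • Q x T) :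
    ∫ y in zoom x₀ r ⁻¹' U, Q (zoom x₀ r y) (rescaleGradient x₀ r t G y) =
      (t * r ^ n) • ∫ x in U, Q x (G x) := by
  simp only [rescaleGradient, hQ]
  rw [integral_smul, setIntegral_comp_zoom x₀ hr _ (fun x => Q x (G x)), smul_smul]
  congr 1
  rw [pow_succ]; field_simp

/-- The additive constant contributes a term that depends on c and the test function but not on `u`.
It cancels when two functions with equal Green forms are rescaled in the same way. -/
lemma greenForm_rescale_comp (hr : 0 < r) (ht : 0 < t) (c : Vec d) (hU : IsOpen U)
    (hUt : volume U ≠ ⊤) (hu : IntegrableOn u U) {χ : Vec (n + 1) → ℝ} (hχ : IsTest χ) :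
    greenForm (zoom x₀ r ⁻¹' U) (rescale x₀ r t c u) (rescaleGradient x₀ r t G)
        (fun y => χ (zoom x₀ r y)) =
      (t * r ^ n) • greenForm U u G χ +
        ∫ y in zoom x₀ r ⁻¹' U, tensor c (gradient (fun y => χ (zoom x₀ r y)) y) := by
  have hχz := hχ.comp_zoom x₀ hr
  have hUt' : volume (zoom x₀ r ⁻¹' U) ≠ ⊤ := by
    rw [volume_preimage_zoom x₀ hr]
    exact ENNReal.mul_ne_top ENNReal.ofReal_ne_top hUt
  have hc : IntegrableOn (fun _ : Vec (n + 1) => c) (zoom x₀ r ⁻¹' U) := integrableOn_const hUt'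
  have h1 : ∫ y in zoom x₀ r ⁻¹' U, tensor (rescale x₀ r t c u y)
      (gradient (fun y => χ (zoom x₀ r y)) y) =
      (t * r ^ n) • (∫ x in U, tensor (u x) (gradient χ x)) +
        ∫ y in zoom x₀ r ⁻¹' U, tensor c (gradient (fun y => χ (zoom x₀ r y)) y) := by
    have hdec : ∀ y, tensor (rescale x₀ r t c u y) (gradient (fun y => χ (zoom x₀ r y)) y) =
        (t / r) • tensor (u (zoom x₀ r y)) (gradient χ (zoom x₀ r y)) +
          tensor c (gradient (fun y => χ (zoom x₀ r y)) y) := by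
      intro y
      rw [rescale, tensor_add_left, tensor_smul_left]
      congr 1
      rw [gradient_comp_zoom hχ.differentiable, tensor_smul_right, smul_smul, div_eq_mul_inv]
    simp_rw [hdec]
    have i1 : IntegrableOn (fun y => (t / r) •
        tensor (u (zoom x₀ r y)) (gradient χ (zoom x₀ r y))) (zoom x₀ r ⁻¹' U) :=
      (integrableOn_comp_zoom x₀ hr (hχ.integrableOn_tensor hu)).smul (t / r)
    rw [integral_add i1 (hχz.integrableOn_tensor hc), integral_smul,
      setIntegral_comp_zoom x₀ hr _ (fun x => tensor (u x) (gradient χ x)), smul_smul]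
    congr 2
    rw [pow_succ]; field_simp
  have h2 := setIntegral_rescaleGradient (U := U) (x₀ := x₀) (t := t) (G := G) hr
    (Q := fun x T => χ x • T) (fun x T => smul_comm _ _ _)
  have h3 := setIntegral_jump_rescale (x₀ := x₀) hr ht c hU hUt hu
    (Q := fun x T => χ x • T) (fun x T => smul_comm _ _ _)
  rw [greenForm, greenForm]
  simp only at h2 h3
  erw [h1, h2, h3]
  module

lemma exists_comp_zoom (hr : 0 < r) (x₀ : Vec N) {φ : Vec N → ℝ} (hφ : IsTest φ) :
    ∃ χ, IsTest χ ∧ φ = fun y => χ (zoom x₀ r y) := by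
  refine ⟨fun x => φ (zoom (-(r⁻¹ • x₀)) r⁻¹ x), hφ.comp_zoom _ (inv_pos.2 hr), ?_⟩
  ext1 y
  congr 1
  simp only [zoom, inv_inv, sub_neg_eq_add, smul_add, smul_sub, smul_smul, mul_inv_cancel₀ hr.ne']
  simp

/-- Functions with the same trace have rescalings with the same trace. -/
lemma greenForm_rescale_eq (hr : 0 < r) (ht : 0 < t) (c : Vec d) (hU : IsOpen U)
    (hUt : volume U ≠ ⊤) (hu : IntegrableOn u U) {v : Vec (n + 1) → Vec d}
    {G' : Vec (n + 1) → Mat d (n + 1)} (hv : IntegrableOn v U)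
    (h : ∀ φ, IsTest φ → greenForm U u G φ = greenForm U v G' φ) {φ : Vec (n + 1) → ℝ}
    (hφ : IsTest φ) :
    greenForm (zoom x₀ r ⁻¹' U) (rescale x₀ r t c u) (rescaleGradient x₀ r t G) φ =
      greenForm (zoom x₀ r ⁻¹' U) (rescale x₀ r t c v) (rescaleGradient x₀ r t G') φ := by
  obtain ⟨χ, hχ, rfl⟩ := exists_comp_zoom hr x₀ hφ
  rw [greenForm_rescale_comp hr ht c hU hUt hu hχ, greenForm_rescale_comp hr ht c hU hUt hv hχ,
    h χ hχ]

lemma zoom_zero_one : zoom (0 : Vec N) 1 = id := by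
  ext1 y
  simp [zoom]

lemma greenForm_smul (ht : 0 < t) (hU : IsOpen U) (hUt : volume U ≠ ⊤) (hu : IntegrableOn u U)
    {φ : Vec (n + 1) → ℝ} (hφ : IsTest φ) :
    greenForm U (fun x => t • u x) (fun x => t • G x) φ = t • greenForm U u G φ := by
  have h := greenForm_rescale_comp (x₀ := 0) (G := G) one_pos ht 0 hU hUt hu hφ
  have e1 : rescale 0 1 t 0 u = fun x => t • u x := by
    ext1 x; rw [rescale, zoom_zero_one]; simp
  have e2 : rescaleGradient 0 1 t G = fun x => t • G x := by
    ext1 x; rw [rescaleGradient, zoom_zero_one]; simp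
  rw [e1, e2, zoom_zero_one] at h
  simpa using h

lemma jumpTensor_smul (ht : 0 < t) (hU : IsOpen U) (hUt : volume U ≠ ⊤) (hu : IntegrableOn u U)
    {x : Vec (n + 1)} (hx : x ∈ U) :
    jumpTensor (fun x => t • u x) x = t • jumpTensor u x := by
  have h := jumpTensor_rescale (x₀ := 0) one_pos ht 0 hU hUt hu (y := x)
    (by rwa [zoom_zero_one])
  rw [zoom_zero_one] at h
  rw [← id_eq x, ← h]
  congr 1
  ext1 x; rw [rescale, zoom_zero_one]; simp

lemma jumpSet_smul (ht : 0 < t) (u : Vec (n + 1) → Vec d) :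
    jumpSet (fun x => t • u x) = jumpSet u := by
  ext x
  have h := mem_jumpSet_rescale (u := u) (x₀ := 0) (y := x) one_pos ht 0
  rw [zoom_zero_one] at h
  rw [← id_eq x, ← h, id_eq]
  have e1 : rescale 0 1 t 0 u = fun x => t • u x := by
    ext1 x; rw [rescale, zoom_zero_one]; simp
  rw [e1]

lemma HasSBVDerivative.smul (ht : 0 < t) (hU : IsOpen U) (hUt : volume U ≠ ⊤)
    (h : HasSBVDerivative U u G) : HasSBVDerivative U (fun x => t • u x) (fun x => t • G x) := by
  obtain ⟨h1, h2, h3, h4⟩ := hasSBVDerivative_iff.1 h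
  refine hasSBVDerivative_iff.2 ⟨h1.smul t, h2.smul t, ?_, fun φ hφ hsupp => ?_⟩
  · rw [jumpSet_smul ht]
    exact integrableOn_inter_congr hU.measurableSet
      (fun x hx => (jumpTensor_smul ht hU hUt h1 hx).symm) (h3.smul t)
  · rw [greenForm_smul ht hU hUt h1 hφ, h4 φ hφ hsupp, smul_zero]

end Rescale

/-! ### Energy densities as functions of matrices -/

section Densities

/-- The `i`-th row of a matrix. -/
def row (T : Mat d N) (i : Fin d) : Vec N := WithLp.toLp 2 fun j => T (i, j)

lemma continuous_row (i : Fin d) : Continuous fun T : Mat d N => row T i :=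
  (PiLp.continuous_toLp 2 _).comp (by fun_prop)

lemma row_smul (t : ℝ) (T : Mat d N) (i : Fin d) : row (t • T) i = t • row T i := by
  ext j; simp [row]

lemma row_tensor (a : Vec d) (m : Vec N) (i : Fin d) : row (tensor a m) i = a i • m := by
  ext j; simp [row]

lemma sum_norm_row_sq (T : Mat d N) : ∑ i, ‖row T i‖ ^ 2 = ‖T‖ ^ 2 := by
  simp_rw [EuclideanSpace.norm_sq_eq]
  rw [Fintype.sum_prod_type]
  rfl

/-- The unit vector in the direction of the `i`-th row of a matrix. -/
def rowDirection (T : Mat d N) (i : Fin d) : Vec N := ‖row T i‖⁻¹ • row T i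

lemma norm_rowDirection {T : Mat d N} {i : Fin d} (h : row T i ≠ 0) : ‖rowDirection T i‖ = 1 := by
  rw [rowDirection, norm_smul, norm_inv, norm_norm, inv_mul_cancel₀ (norm_ne_zero_iff.2 h)]

/-- A function of the matrix `a ⊗ m`, `|m| = 1`, with the value `ψ a m`. -/
def rankOneDensity (ψ : Vec d → Vec N → ℝ) (T : Mat d N) : ℝ :=
  ∑ i, ‖row T i‖ ^ 2 / ‖T‖ ^ 2 * ψ (mulVec T (rowDirection T i)) (rowDirection T i)

/-- Positively one-homogeneous measurable functions of linear growth. -/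
structure IsJumpDensity (Ψ : Mat d N → ℝ) : Prop where
  measurable : Measurable Ψ
  nonneg : ∀ T, 0 ≤ Ψ T
  homogeneous : ∀ t T, 0 < t → Ψ (t • T) = t * Ψ T
  growth : ∃ C, 0 < C ∧ ∀ T, Ψ T ≤ C * ‖T‖

/-- Every nonzero row of a ⊗ m points in the direction m or −m, and the symmetry of ψ gives the
value ψ(a, m) in both cases. The weights |row|²/|T|² add up to 1 and vanish on zero rows. This makes
the surface density a function of the jump tensor. -/
lemma rankOneDensity_tensor {ψ : Vec d → Vec N → ℝ} (hψ : IsSurfaceDensity ψ) {a : Vec d}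
    {m : Vec N} (hm : ‖m‖ = 1) (ha : a ≠ 0) : rankOneDensity ψ (tensor a m) = ψ a m := by
  have h : ∀ i, ‖row (tensor a m) i‖ ^ 2 / ‖tensor a m‖ ^ 2 *
      ψ (mulVec (tensor a m) (rowDirection (tensor a m) i)) (rowDirection (tensor a m) i) =
      ‖row (tensor a m) i‖ ^ 2 / ‖tensor a m‖ ^ 2 * ψ a m := by
    intro i
    rcases eq_or_ne (a i) 0 with h0 | h0
    · rw [row_tensor, h0]; simp
    congr 1
    have hn : ‖row (tensor a m) i‖ = |a i| := by rw [row_tensor, norm_smul, hm]; simp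
    have hmm : inner ℝ m m = 1 := by rw [real_inner_self_eq_norm_sq, hm, one_pow]
    rcases lt_or_gt_of_ne h0 with h1 | h1
    · have : rowDirection (tensor a m) i = -m := by
        rw [rowDirection, hn, row_tensor, smul_smul, abs_of_neg h1, inv_neg, neg_mul,
          inv_mul_cancel₀ h0, neg_smul, one_smul]
      rw [this, mulVec_tensor, inner_neg_left, hmm, neg_one_smul, hψ.symmetric _ _ hm]
    · have : rowDirection (tensor a m) i = m := by
        rw [rowDirection, hn, row_tensor, smul_smul, abs_of_pos h1, inv_mul_cancel₀ h0, one_smul]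
      rw [this, mulVec_tensor, hmm, one_smul]
  rw [rankOneDensity, Finset.sum_congr rfl fun i _ => h i, ← Finset.sum_mul, ← Finset.sum_div,
    sum_norm_row_sq, div_self, one_mul]
  rw [norm_tensor, hm, mul_one]
  exact pow_ne_zero _ (norm_ne_zero_iff.2 ha)

lemma isJumpDensity_rankOneDensity {ψ : Vec d → Vec N → ℝ} (hψ : IsSurfaceDensity ψ) :
    IsJumpDensity (rankOneDensity ψ) := by
  obtain ⟨c, C, hc, hC, hg⟩ := hψ.growth
  have hpos : ∀ (T : Mat d N) i, 0 ≤ ‖row T i‖ ^ 2 / ‖T‖ ^ 2 *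
      ψ (mulVec T (rowDirection T i)) (rowDirection T i) := by
    intro T i
    rcases eq_or_ne (row T i) 0 with h | h
    · simp [h]
    · have := (hg (mulVec T (rowDirection T i)) _ (norm_rowDirection h)).1
      have : 0 ≤ ψ (mulVec T (rowDirection T i)) (rowDirection T i) :=
        le_trans (by positivity) this
      positivity
  refine ⟨?_, fun T => Finset.sum_nonneg fun i _ => hpos T i, ?_, C, hC, ?_⟩
  · refine Finset.measurable_sum _ fun i _ => ?_
    classical
    -- Continuity of ψ is available only at unit normals, that is, where the row is nonzero; on the
    -- complement the weight of the summand is zero.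
    have hs : IsOpen {T : Mat d N | row T i ≠ 0} := isOpen_ne_fun (continuous_row i) continuous_const
    have hdir : ContinuousOn (fun T : Mat d N => rowDirection T i) {T | row T i ≠ 0} :=
      ((continuous_row i).norm.continuousOn.inv₀ fun T hT => norm_ne_zero_iff.2 hT).smul
        (continuous_row i).continuousOn
    have hmul : Continuous fun p : Mat d N × Vec N => mulVec p.1 p.2 :=
      (PiLp.continuous_toLp 2 _).comp (by fun_prop)
    have hF : ContinuousOn (fun T : Mat d N => ψ (mulVec T (rowDirection T i)) (rowDirection T i))
        {T | row T i ≠ 0} :=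
      hψ.continuousOn.comp ((hmul.comp_continuousOn (continuousOn_id.prodMk hdir)).prodMk hdir)
        fun T hT => norm_rowDirection hT
    have hm := hF.measurable_piecewise (continuousOn_const (c := (0 : ℝ))) hs.measurableSet
    convert (((continuous_row i).norm.pow 2).measurable.div
      (continuous_norm.pow 2).measurable).mul hm using 1
    ext1 T
    by_cases hT : row T i = 0
    · simp [hT]
    · simp [Set.piecewise, hT]
  · intro t T ht
    rw [rankOneDensity, rankOneDensity, Finset.mul_sum]
    refine Finset.sum_congr rfl fun i _ => ?_
    rcases eq_or_ne (row T i) 0 with h | h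
    · simp [row_smul, h]
    have hd : rowDirection (t • T) i = rowDirection T i := by
      rw [rowDirection, rowDirection, row_smul, norm_smul, Real.norm_of_nonneg ht.le, smul_smul,
        mul_inv]
      congr 1
      field_simp
    rw [hd, smul_mulVec, hψ.homogeneous t _ _ ht (norm_rowDirection h), row_smul, norm_smul,
      norm_smul, Real.norm_of_nonneg ht.le, mul_pow, mul_pow, mul_div_mul_left _ _ (pow_ne_zero 2 ht.ne')]
    ring
  · intro T
    have : ∀ i, ‖row T i‖ ^ 2 / ‖T‖ ^ 2 * ψ (mulVec T (rowDirection T i)) (rowDirection T i) ≤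
        ‖row T i‖ ^ 2 / ‖T‖ ^ 2 * (C * ‖T‖) := by
      intro i
      rcases eq_or_ne (row T i) 0 with h | h
      · simp [h]
      · refine mul_le_mul_of_nonneg_left ?_ (by positivity)
        refine ((hg _ _ (norm_rowDirection h)).2).trans ?_
        gcongr
        simpa [norm_rowDirection h] using norm_mulVec_le T (rowDirection T i)
    refine (Finset.sum_le_sum fun i _ => this i).trans ?_
    rw [← Finset.sum_mul, ← Finset.sum_div, sum_norm_row_sq]
    exact mul_le_of_le_one_left (by positivity) (div_self_le_one _)

/-- The properties of the recession function of a bulk density that are used. -/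
structure IsRecession (w : Mat d N → ℝ) : Prop where
  continuous : Continuous w
  homogeneous : ∀ t A, 0 < t → w (t • A) = t * w A
  growth : ∃ c C, 0 < c ∧ 0 < C ∧ ∀ A, c * ‖A‖ ≤ w A ∧ w A ≤ C * ‖A‖

lemma IsRecession.nonneg {w : Mat d N → ℝ} (hw : IsRecession w) (A : Mat d N) : 0 ≤ w A := by
  obtain ⟨c, C, hc, hC, h⟩ := hw.growth
  exact le_trans (by positivity) (h A).1

/-- The rate applies as soon as t ≥ 1/|A| and upgrades the upper limit to a limit. The excluded case
A = 0 is settled by W(0)/t → 0. -/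
lemma tendsto_recession {W : Mat d N → ℝ} (hW : IsBulkDensity W) (A : Mat d N) :
    Tendsto (fun t : ℝ => W (t • A) / t) atTop (𝓝 (recession W A)) := by
  rcases eq_or_ne A 0 with rfl | hA
  · have h : Tendsto (fun t : ℝ => W (t • (0 : Mat d N)) / t) atTop (𝓝 0) := by
      simp only [smul_zero]
      exact tendsto_const_nhds.div_atTop tendsto_id
    rwa [recession, h.limsup_eq]
  · obtain ⟨c, α, hc, hα, hα1, h⟩ := hW.recession_rate
    have hlim : Tendsto (fun t : ℝ => c * ‖A‖ ^ (1 - α) / t ^ α) atTop (𝓝 0) :=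
      tendsto_const_nhds.div_atTop (tendsto_rpow_atTop hα)
    rw [tendsto_iff_dist_tendsto_zero]
    refine squeeze_zero' (.of_forall fun _ => dist_nonneg) ?_ hlim
    filter_upwards [eventually_gt_atTop 0, eventually_ge_atTop ‖A‖⁻¹] with t ht ht'
    rw [dist_comm, Real.dist_eq]
    refine h A t ht ?_
    rwa [← inv_le_iff_one_le_mul₀ (norm_pos_iff.2 hA)]

lemma isRecession_recession {W : Mat d N → ℝ} (hW : IsBulkDensity W) :
    IsRecession (recession W) := by
  obtain ⟨K, hK⟩ := hW.lipschitz
  obtain ⟨c, C, hc, hC, hg⟩ := hW.growth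
  refine ⟨?_, ?_, c, C, hc, hC, fun A => ⟨?_, ?_⟩⟩
  · have : LipschitzWith K (recession W) := by
      refine LipschitzWith.of_dist_le_mul fun A B => ?_
      have h1 := ((tendsto_recession hW A).dist (tendsto_recession hW B))
      refine le_of_tendsto h1 ?_
      filter_upwards [eventually_gt_atTop 0] with t ht
      have h2 := hK.dist_le_mul (t • A) (t • B)
      rw [dist_smul₀, Real.norm_of_nonneg ht.le] at h2
      rw [Real.dist_eq, ← sub_div, abs_div, abs_of_pos ht, div_le_iff₀ ht, ← Real.dist_eq]
      linarith
    exact this.continuous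
  · intro s A hs
    refine tendsto_nhds_unique (tendsto_recession hW (s • A)) ?_
    have h1 : Tendsto (fun t : ℝ => t * s) atTop atTop := tendsto_id.atTop_mul_const hs
    have h2 := ((tendsto_recession hW A).comp h1).const_mul s
    refine h2.congr fun t => ?_
    simp only [Function.comp, mul_smul]
    field_simp
  · refine ge_of_tendsto (tendsto_recession hW A) ?_
    filter_upwards [eventually_gt_atTop 0] with t ht
    rw [le_div_iff₀ ht]
    have := (hg (t • A)).1
    rw [norm_smul, Real.norm_of_nonneg ht.le] at this
    linarith
  · have h1 : Tendsto (fun t : ℝ => C / t + C * ‖A‖) atTop (𝓝 (0 + C * ‖A‖)) :=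
      (tendsto_const_nhds.div_atTop tendsto_id).add_const _
    rw [zero_add] at h1
    refine le_of_tendsto_of_tendsto (tendsto_recession hW A) h1 ?_
    filter_upwards [eventually_gt_atTop 0] with t ht
    have := (hg (t • A)).2
    rw [norm_smul, Real.norm_of_nonneg ht.le] at this
    rw [div_le_iff₀ ht]
    have e : (C / t + C * ‖A‖) * t = C * (1 + t * ‖A‖) := by field_simp
    rwa [e]

/-- The quantitative form of the convergence of `W(t ·)/t`. -/
lemma abs_recession_sub_le {W : Mat d N → ℝ} (hW : IsBulkDensity W) :
    ∃ ε : ℝ → ℝ, Tendsto ε atTop (𝓝 0) ∧ (∀ t, 0 < t → 0 ≤ ε t) ∧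
      ∀ t A, 0 < t → |W (t • A) / t - recession W A| ≤ ε t * (1 + ‖A‖) := by
  obtain ⟨c, α, hc, hα, hα1, h⟩ := hW.recession_rate
  obtain ⟨c', C, hc', hC, hg⟩ := hW.growth
  have hrec : ∀ A, 0 ≤ recession W A ∧ recession W A ≤ C * ‖A‖ := by
    intro A
    refine ⟨(isRecession_recession hW).nonneg A, ?_⟩
    have h1 : Tendsto (fun t : ℝ => C / t + C * ‖A‖) atTop (𝓝 (0 + C * ‖A‖)) :=
      (tendsto_const_nhds.div_atTop tendsto_id).add_const _
    rw [zero_add] at h1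
    refine le_of_tendsto_of_tendsto (tendsto_recession hW A) h1 ?_
    filter_upwards [eventually_gt_atTop 0] with t ht
    have := (hg (t • A)).2
    rw [norm_smul, Real.norm_of_nonneg ht.le] at this
    rw [div_le_iff₀ ht]
    have e : (C / t + C * ‖A‖) * t = C * (1 + t * ‖A‖) := by field_simp
    rwa [e]
  -- The second summand comes from the rate when t|A| ≥ 1, with |A|^(1−α) ≤ 1 + |A|. The first
  -- covers t|A| < 1, where W(tA)/t and the recession function both lie between 0 and 2C/t by linear
  -- growth.
  refine ⟨fun t => 2 * C / t + c / t ^ α, ?_, fun t ht => ?_, fun t A ht => ?_⟩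
  · simpa using (tendsto_const_nhds.div_atTop tendsto_id).add
      (tendsto_const_nhds.div_atTop (tendsto_rpow_atTop hα))
  · have := Real.rpow_pos_of_pos ht α
    positivity
  · have htα := Real.rpow_pos_of_pos ht α
    have hA := norm_nonneg A
    rcases le_or_gt 1 (t * ‖A‖) with h1 | h1
    · rw [abs_sub_comm]
      refine (h A t ht h1).trans ?_
      have h2 : ‖A‖ ^ (1 - α) ≤ 1 + ‖A‖ := by
        calc ‖A‖ ^ (1 - α) ≤ (1 + ‖A‖) ^ (1 - α) :=
              Real.rpow_le_rpow hA (by linarith) (by linarith)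
          _ ≤ (1 + ‖A‖) ^ (1 : ℝ) := Real.rpow_le_rpow_of_exponent_le (by linarith) (by linarith)
          _ = 1 + ‖A‖ := Real.rpow_one _
      have h3 : 0 ≤ 2 * C / t * (1 + ‖A‖) := by positivity
      calc c * ‖A‖ ^ (1 - α) / t ^ α ≤ c * (1 + ‖A‖) / t ^ α := by gcongr
        _ ≤ (2 * C / t + c / t ^ α) * (1 + ‖A‖) := by
          rw [add_mul, mul_div_right_comm]; linarith
    · have h2 : W (t • A) / t ≤ 2 * C / t := by
        have := (hg (t • A)).2
        rw [norm_smul, Real.norm_of_nonneg ht.le] at this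
        gcongr
        nlinarith
      have h3 : 0 ≤ W (t • A) / t :=
        div_nonneg (le_trans (by positivity) (hg (t • A)).1) ht.le
      have h4 : recession W A ≤ 2 * C / t := by
        refine (hrec A).2.trans ?_
        rw [le_div_iff₀ ht]
        nlinarith
      have h5 := (hrec A).1
      have h6 : 2 * C / t ≤ (2 * C / t + c / t ^ α) * (1 + ‖A‖) := by
        have : 0 ≤ c / t ^ α := by positivity
        have : 0 ≤ 2 * C / t := by positivity
        nlinarith
      rw [abs_le]; constructor <;> linarith

end Densities

/-! ### Competitors and their energies -/

section Energy

variable {n : ℕ} {U : Set (Vec (n + 1))} {u : Vec (n + 1) → Vec d}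
  {G : Vec (n + 1) → Mat d (n + 1)} {w Ψ : Mat d (n + 1) → ℝ}
  {b : OrthonormalBasis (Fin (n + 1)) ℝ (Vec (n + 1))} {g : Vec (n + 1) → Vec d}
  {A B : Mat d (n + 1)}

/-- The energy as a function of the absolutely continuous gradient and the jump tensor. -/
def densityEnergy (w Ψ : Mat d N → ℝ) (U : Set (Vec N)) (u : Vec N → Vec d)
    (G : Vec N → Mat d N) : ℝ :=
  (∫ x in U, w (G x)) + ∫ x in U ∩ jumpSet u, Ψ (jumpTensor u x) ∂μHE[N - 1]

/-- Restricting a measure to a set that is not known to be measurable does not by itself put almost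
every point in that set. The jump tensor is nonzero exactly on the jump set, so the zero set of a
measurable representative of the tensor decides membership. -/
lemma ae_mem_jumpSet {μ : Measure (Vec N)} {u : Vec N → Vec d} {S : Set (Vec N)}
    (h : AEStronglyMeasurable (jumpTensor u) (μ.restrict (S ∩ jumpSet u))) :
    ∀ᵐ x ∂μ.restrict (S ∩ jumpSet u), x ∈ jumpSet u := by
  obtain ⟨T, hT, hTu⟩ := h
  have h0 : ∀ᵐ x ∂μ.restrict (S ∩ jumpSet u), T x ≠ 0 := by
    rw [ae_iff]
    simp only [not_not]
    have hm : MeasurableSet {x | T x = 0} := hT.measurable (measurableSet_singleton 0)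
    rw [Measure.restrict_apply hm]
    rw [Filter.EventuallyEq, ae_iff] at hTu
    refine measure_mono_null (fun x hx => ?_) (measure_mono_null (s := (toMeasurable _ _) ∩
      (S ∩ jumpSet u)) subset_rfl ?_) (t := toMeasurable (μ.restrict (S ∩ jumpSet u))
        {x | ¬jumpTensor u x = T x} ∩ (S ∩ jumpSet u))
    · refine ⟨subset_toMeasurable _ _ ?_, hx.2⟩
      have h1 : T x = 0 := hx.1
      simp only [Set.mem_ofPred_eq, h1]
      exact jumpTensor_ne_zero hx.2.2
    · rw [← Measure.restrict_apply (measurableSet_toMeasurable _ _), measure_toMeasurable]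
      exact hTu
  filter_upwards [h0, hTu] with x hx hx'
  by_contra hxJ
  exact hx (by rw [← hx', jumpTensor_of_notMem hxJ])

lemma rankOneDensity_jumpTensor {ψ : Vec d → Vec N → ℝ} (hψ : IsSurfaceDensity ψ)
    {u : Vec N → Vec d} {x : Vec N} (hx : x ∈ jumpSet u) :
    rankOneDensity ψ (jumpTensor u x) = ψ (jump u x) (jumpNormal u x) :=
  rankOneDensity_tensor hψ (norm_jumpNormal hx) (jump_ne_zero hx)

lemma energy_eq_densityEnergy {ψ : Vec d → Vec N → ℝ} (hψ : IsSurfaceDensity ψ)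
    {U : Set (Vec N)} (hU : IsOpen U) {u : Vec N → Vec d} {G : Vec N → Mat d N}
    (h : HasSBVDerivative U u G) (w : Mat d N → ℝ) :
    energy w ψ U u = densityEnergy w (rankOneDensity ψ) U u G := by
  rw [energy, densityEnergy]
  congr 1
  · refine integral_congr_ae ?_
    filter_upwards [h.approxGradient_ae hU] with x hx
    rw [hx]
  · refine integral_congr_ae ?_
    filter_upwards [ae_mem_jumpSet (hasSBVDerivative_iff.1 h).2.2.1.aestronglyMeasurable] with x hx
    rw [rankOneDensity_jumpTensor hψ hx]

lemma IsJumpDensity.integrable {Ψ : Mat d N → ℝ} (hΨ : IsJumpDensity Ψ) {X : Type*}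
    [MeasurableSpace X] {μ : Measure X} {T : X → Mat d N} (hT : Integrable T μ) :
    Integrable (fun x => Ψ (T x)) μ := by
  obtain ⟨C, hC, h⟩ := hΨ.growth
  refine (hT.norm.const_mul C).mono'
    (hΨ.measurable.comp_aemeasurable hT.aemeasurable).aestronglyMeasurable (.of_forall fun x => ?_)
  rw [Real.norm_of_nonneg (hΨ.nonneg _)]
  exact h _

lemma IsRecession.isJumpDensity {w : Mat d N → ℝ} (hw : IsRecession w) : IsJumpDensity w := by
  obtain ⟨c, C, hc, hC, h⟩ := hw.growth
  exact ⟨hw.continuous.measurable, hw.nonneg, hw.homogeneous, C, hC, fun T => (h T).2⟩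

/-- `g` is integrable on the faces of the cube. -/
def FaceIntegrable (b : OrthonormalBasis (Fin (n + 1)) ℝ (Vec (n + 1)))
    (g : Vec (n + 1) → Vec d) : Prop :=
  ∀ i σ, IntegrableOn (fun y => g (coord b i (faceSign σ) y)) (unitCube n)

lemma FaceIntegrable.smul_test (hg : FaceIntegrable b g) {φ : Vec (n + 1) → ℝ} (hφ : IsTest φ)
    (i : Fin (n + 1)) (σ : Bool) : IntegrableOn (fun y => φ (coord b i (faceSign σ) y) •
      g (coord b i (faceSign σ) y)) (unitCube n) := by
  obtain ⟨C, hC⟩ := hφ.exists_bound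
  exact Integrable.bdd_smul (hg i σ) C
    (hφ.continuous.comp (continuous_coord_right b i _)).aestronglyMeasurable
    (.of_forall fun y => hC _)

/-- `u ∈ SBV` with gradient `G` of mean `B` and trace `g` on the boundary of the cube. -/
structure IsCompetitor (b : OrthonormalBasis (Fin (n + 1)) ℝ (Vec (n + 1)))
    (g : Vec (n + 1) → Vec d) (B : Mat d (n + 1)) (u : Vec (n + 1) → Vec d)
    (G : Vec (n + 1) → Mat d (n + 1)) : Prop where
  sbv : HasSBVDerivative (cube b) u G
  trace : ∀ φ, IsTest φ → greenForm (cube b) u G φ = boundaryForm b g φ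
  mean : ∫ x in cube b, G x = B

lemma setAverage_cube {E : Type*} [NormedAddCommGroup E] [NormedSpace ℝ E]
    (F : Vec (n + 1) → E) : ⨍ x in cube b, F x = ∫ x in cube b, F x := by
  rw [setAverage_eq, Measure.real, volume_cube]
  simp

lemma hasTrace_iff (hg : FaceIntegrable b g) :
    HasTrace b u g ↔ ∀ φ, IsTest φ →
      greenForm (cube b) u (approxGradient (cube b) u) φ = boundaryForm b g φ := by
  rw [HasTrace]
  constructor
  · rintro ⟨_, h⟩ φ hφ
    rw [← integral_frontier_eq_boundaryForm (hg.smul_test hφ), ← h φ hφ.1 hφ.2]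
    rfl
  · intro h
    refine ⟨integrableOn_frontier b hg, fun φ h1 h2 => ?_⟩
    rw [integral_frontier_eq_boundaryForm (hg.smul_test ⟨h1, h2⟩), ← h φ ⟨h1, h2⟩]
    rfl

lemma isCompetitor_iff (hg : FaceIntegrable b g) :
    (∃ G, IsCompetitor b g B u G) ↔
      IsSBV (cube b) u ∧ HasTrace b u g ∧ ⨍ x in cube b, approxGradient (cube b) u x = B := by
  rw [hasTrace_iff hg, setAverage_cube]
  constructor
  · rintro ⟨G, h⟩
    have hae := h.sbv.approxGradient_ae (isOpen_cube b)
    refine ⟨⟨G, h.sbv⟩, fun φ hφ => ?_, ?_⟩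
    · rw [greenForm_congr_gradient hae, h.trace φ hφ]
    · rw [integral_congr_ae hae, h.mean]
  · rintro ⟨h1, h2, h3⟩
    exact ⟨_, h1.hasSBVDerivative, h2, h3⟩

lemma image_energy_eq {ψ : Vec d → Vec (n + 1) → ℝ} (hψ : IsSurfaceDensity ψ)
    (hg : FaceIntegrable b g) (w : Mat d (n + 1) → ℝ) :
    energy w ψ (cube b) '' {u | IsSBV (cube b) u ∧ HasTrace b u g ∧
        ⨍ x in cube b, approxGradient (cube b) u x = B} =
      {e | ∃ u G, IsCompetitor b g B u G ∧ densityEnergy w (rankOneDensity ψ) (cube b) u G = e} := by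
  ext e
  constructor
  · rintro ⟨u, hu, rfl⟩
    obtain ⟨G, hG⟩ := (isCompetitor_iff hg).2 hu
    exact ⟨u, G, hG, (energy_eq_densityEnergy hψ (isOpen_cube b) hG.sbv w).symm⟩
  · rintro ⟨u, G, hG, rfl⟩
    exact ⟨u, (isCompetitor_iff hg).1 ⟨G, hG⟩,
      energy_eq_densityEnergy hψ (isOpen_cube b) hG.sbv w⟩

/-- The set of energies of the competitors with trace `g` and mean gradient `B`. -/
def energies (w Ψ : Mat d (n + 1) → ℝ) (b : OrthonormalBasis (Fin (n + 1)) ℝ (Vec (n + 1)))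
    (g : Vec (n + 1) → Vec d) (B : Mat d (n + 1)) : Set ℝ :=
  {e | ∃ u G, IsCompetitor b g B u G ∧ densityEnergy w Ψ (cube b) u G = e}

lemma faceIntegrable_of_continuous (hg : Continuous g) : FaceIntegrable b g := fun i _ =>
  Continuous.integrableOn_unitCube (hg.comp (continuous_coord_right b i _))

lemma faceIntegrable_elementaryJump (a : Vec d) (m : Vec (n + 1)) :
    FaceIntegrable b (elementaryJump a m) := fun i σ => by
  refine IntegrableOn.heav_smul (F := fun _ => a) ?_
    (p := fun y => inner ℝ (coord b i (faceSign σ) y) m) ?_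
  · exact Continuous.integrableOn_unitCube continuous_const
  · exact (Continuous.inner (continuous_coord_right b i _) continuous_const).measurable

lemma bulkDensity_eq {ψ : Vec d → Vec (n + 1) → ℝ} (hψ : IsSurfaceDensity ψ)
    (W : Mat d (n + 1) → ℝ) : bulkDensity W ψ A B =
      sInf (energies W (rankOneDensity ψ) (stdFrame (n + 1)) (fun x => mulVec A x) B) :=
  congrArg sInf (image_energy_eq hψ (faceIntegrable_of_continuous (continuous_mulVec A)) W)

lemma cantorDensityOn_eq {ψ : Vec d → Vec (n + 1) → ℝ} (hψ : IsSurfaceDensity ψ)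
    (W : Mat d (n + 1) → ℝ) : cantorDensityOn b W ψ A B =
      sInf (energies (recession W) (rankOneDensity ψ) b (fun x => mulVec A x) B) :=
  congrArg sInf (image_energy_eq hψ (faceIntegrable_of_continuous (continuous_mulVec A)) _)

lemma jumpDensityOn_eq {ψ : Vec d → Vec (n + 1) → ℝ} (hψ : IsSurfaceDensity ψ)
    (W : Mat d (n + 1) → ℝ) (a : Vec d) (m : Vec (n + 1)) : jumpDensityOn b W ψ a B m =
      sInf (energies (recession W) (rankOneDensity ψ) b (elementaryJump a m) B) :=
  congrArg sInf (image_energy_eq hψ (faceIntegrable_elementaryJump a m) _)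

lemma IsCompetitor.smul {t : ℝ} (ht : 0 < t) (h : IsCompetitor b g B u G) :
    IsCompetitor b (fun x => t • g x) (t • B) (fun x => t • u x) (fun x => t • G x) := by
  have hv : volume (cube b) ≠ ⊤ := by rw [volume_cube]; simp
  refine ⟨h.sbv.smul ht (isOpen_cube b) hv, fun φ hφ => ?_, by rw [integral_smul, h.mean]⟩
  rw [greenForm_smul ht (isOpen_cube b) hv h.sbv.1 hφ, h.trace φ hφ, boundaryForm, boundaryForm,
    Finset.smul_sum]
  refine Finset.sum_congr rfl fun i _ => ?_
  rw [← tensor_smul_left, ← integral_smul]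
  simp only [smul_sub, smul_comm t]

lemma IsJumpDensity.bddBelow_energies (hw : ∀ A, 0 ≤ w A) (hΨ : IsJumpDensity Ψ) :
    BddBelow (energies w Ψ b g B) := by
  refine ⟨0, ?_⟩
  rintro e ⟨u, G, _, rfl⟩
  exact add_nonneg (integral_nonneg fun x => hw _) (integral_nonneg fun x => hΨ.nonneg _)

/-- Rescaling the values of a competitor. -/
lemma densityEnergy_smul (hΨ : IsJumpDensity Ψ) {t : ℝ} (ht : 0 < t)
    (h : HasSBVDerivative (cube b) u G) (W : Mat d (n + 1) → ℝ) :
    densityEnergy W Ψ (cube b) (fun x => t • u x) (fun x => t • G x) =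
      (∫ x in cube b, W (t • G x)) +
        t * ∫ x in cube b ∩ jumpSet u, Ψ (jumpTensor u x) ∂μHE[n + 1 - 1] := by
  have hv : volume (cube b) ≠ ⊤ := by rw [volume_cube]; simp
  rw [densityEnergy, jumpSet_smul ht, setIntegral_inter_congr (isOpen_cube b).measurableSet
    (g := fun x => t * Ψ (jumpTensor u x)) _ fun x hx => by
      rw [jumpTensor_smul ht (isOpen_cube b) hv h.1 hx, hΨ.homogeneous t _ ht],
    integral_const_mul]

/-- Surface terms cancel exactly by homogeneity. The bulk difference is at most ε∫(1 + |G|) over a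
cube of volume 1, and coercivity bounds κ∫|G| by the energy. -/
lemma abs_densityEnergy_smul_sub_le {W : Mat d (n + 1) → ℝ} (hW : Continuous W)
    (hWg : ∃ C, ∀ A, |W A| ≤ C * (1 + ‖A‖))
    (hw : IsRecession w) (hΨ : IsJumpDensity Ψ) {t ε : ℝ} (ht : 0 < t) {κ : ℝ} (hκ : 0 < κ)
    (hκw : ∀ A, κ * ‖A‖ ≤ w A) (hε : 0 ≤ ε)
    (hWw : ∀ A, |W (t • A) / t - w A| ≤ ε * (1 + ‖A‖)) (h : HasSBVDerivative (cube b) u G) :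
    |densityEnergy W Ψ (cube b) (fun x => t • u x) (fun x => t • G x) / t -
      densityEnergy w Ψ (cube b) u G| ≤ ε * (1 + densityEnergy w Ψ (cube b) u G / κ) := by
  have hv : volume (cube b) ≠ ⊤ := by rw [volume_cube]; simp
  have hG : IntegrableOn G (cube b) := h.2.1
  have h1 : IntegrableOn (fun x => 1 + ‖G x‖) (cube b) := (integrableOn_const hv).add hG.norm
  have h2 : IntegrableOn (fun x => w (G x)) (cube b) := hw.isJumpDensity.integrable hG
  have h3 : IntegrableOn (fun x => W (t • G x) / t) (cube b) := by
    obtain ⟨C, hC⟩ := hWg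
    have : IntegrableOn (fun x => C * (1 + ‖t • G x‖)) (cube b) :=
      ((integrableOn_const hv).add (hG.smul t).norm).const_mul C
    refine (Integrable.mono' this
      (hW.comp_aestronglyMeasurable (hG.smul t).aestronglyMeasurable)
      (.of_forall fun x => hC _)).div_const t
  have h4 : densityEnergy W Ψ (cube b) (fun x => t • u x) (fun x => t • G x) / t -
      densityEnergy w Ψ (cube b) u G = ∫ x in cube b, (W (t • G x) / t - w (G x)) := by
    rw [densityEnergy_smul hΨ ht h, densityEnergy, integral_sub h3 h2, integral_div]
    field_simp
    simp only [Nat.add_sub_cancel]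
    ring
  have h5 : ∫ x in cube b, ‖G x‖ ≤ densityEnergy w Ψ (cube b) u G / κ := by
    rw [le_div_iff₀ hκ, mul_comm, ← integral_const_mul]
    refine le_add_of_le_of_nonneg (integral_mono (hG.norm.const_mul κ) h2 fun x => hκw _)
      (integral_nonneg fun x => hΨ.nonneg _)
  rw [h4]
  calc |∫ x in cube b, (W (t • G x) / t - w (G x))|
      ≤ ∫ x in cube b, ε * (1 + ‖G x‖) := by
        rw [← Real.norm_eq_abs]
        exact norm_integral_le_of_norm_le (h1.const_mul ε) (.of_forall fun x => hWw _)
    _ = ε * (1 + ∫ x in cube b, ‖G x‖) := by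
        have hc : IntegrableOn (fun _ : Vec (n + 1) => (1 : ℝ)) (cube b) := integrableOn_const hv
        rw [integral_const_mul, integral_add hc hG.norm]
        congr 2
        rw [setIntegral_const, Measure.real, volume_cube]; simp
    _ ≤ _ := by gcongr

lemma energies_smul_subset {t : ℝ} (ht : 0 < t) {u : Vec (n + 1) → Vec d}
    {G : Vec (n + 1) → Mat d (n + 1)}
    (h : IsCompetitor b (fun x => mulVec (t • A) x) (t • B) u G) :
    ∃ v Gv, IsCompetitor b (fun x => mulVec A x) B v Gv ∧ u = (fun x => t • v x) ∧
      G = fun x => t • Gv x := by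
  have := h.smul (inv_pos.2 ht)
  simp only [smul_mulVec, smul_smul, inv_mul_cancel₀ ht.ne', one_smul] at this
  exact ⟨_, _, this, by simp [smul_smul, mul_inv_cancel₀ ht.ne'],
    by simp [smul_smul, mul_inv_cancel₀ ht.ne']⟩

/-- The recession function of the relaxed bulk density is the Cantor density. -/
theorem tendsto_sInf_energies {W : Mat d (n + 1) → ℝ} (hW : IsBulkDensity W)
    (hΨ : IsJumpDensity Ψ)
    (hne : (energies (recession W) Ψ b (fun x => mulVec A x) B).Nonempty) :
    Tendsto (fun t : ℝ => sInf (energies W Ψ b (fun x => mulVec (t • A) x) (t • B)) / t) atTop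
      (𝓝 (sInf (energies (recession W) Ψ b (fun x => mulVec A x) B))) := by
  have hw := isRecession_recession hW
  obtain ⟨κ, C, hκ, hC, hwg⟩ := hw.growth
  obtain ⟨c', C', hc', hC', hg⟩ := hW.growth
  obtain ⟨ε, hε, hε0, hWw⟩ := abs_recession_sub_le hW
  have hW0 : ∀ A, 0 ≤ W A := fun A => le_trans (by positivity) (hg A).1
  have hWg : ∃ C, ∀ A, |W A| ≤ C * (1 + ‖A‖) :=
    ⟨C', fun A => by rw [abs_of_nonneg (hW0 A)]; exact (hg A).2⟩
  set h := sInf (energies (recession W) Ψ b (fun x => mulVec A x) B) with hh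
  have hbdd := IsJumpDensity.bddBelow_energies (b := b) (g := fun x => mulVec A x) (B := B)
    hw.nonneg hΨ
  have lim1 : Tendsto (fun t => h + ε t * (1 + h / κ)) atTop (𝓝 h) := by
    simpa using (hε.mul_const (1 + h / κ)).const_add h
  -- The lower bound E(1 − ε/κ) − ε for a single competitor is increasing in its energy E once ε <
  -- κ, so there E may be replaced by the infimum.
  have lim2 : Tendsto (fun t => h * (1 - ε t / κ) - ε t) atTop (𝓝 h) := by
    simpa using (((hε.div_const κ).const_sub 1).const_mul h).sub hε
  refine tendsto_of_tendsto_of_tendsto_of_le_of_le' lim2 lim1 ?_ ?_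
  · filter_upwards [eventually_gt_atTop 0, hε.eventually (gt_mem_nhds hκ)] with t ht hεt
    have hne' : (energies W Ψ b (fun x => mulVec (t • A) x) (t • B)).Nonempty := by
      obtain ⟨_, u, G, hu, _⟩ := hne
      have := hu.smul ht
      simp only [← smul_mulVec] at this
      exact ⟨_, _, _, this, rfl⟩
    rw [le_div_iff₀ ht]
    refine le_csInf hne' ?_
    rintro _ ⟨u, G, hu, rfl⟩
    obtain ⟨v, Gv, hv, rfl, rfl⟩ := energies_smul_subset ht hu
    have h1 := abs_densityEnergy_smul_sub_le hW.continuous hWg hw hΨ ht hκ (fun A => (hwg A).1)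
      (hε0 t ht) (fun A => hWw t A ht) hv.sbv
    have h2 : h ≤ densityEnergy (recession W) Ψ (cube b) v Gv := csInf_le hbdd ⟨v, Gv, hv, rfl⟩
    rw [← le_div_iff₀ ht]
    have h3 := (abs_le.1 h1).1
    have h4 : 0 ≤ 1 - ε t / κ := by rw [sub_nonneg, div_le_one hκ]; exact hεt.le
    have h5 := mul_le_mul_of_nonneg_right h2 h4
    have e : ∀ X : ℝ, ε t * (1 + X / κ) = ε t + X * (ε t / κ) := fun X => by ring
    rw [e] at h3
    linarith
  · filter_upwards [eventually_gt_atTop 0] with t ht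
    refine le_of_forall_pos_le_add fun η hη => ?_
    have hden : 0 < 1 + ε t / κ := by have := hε0 t ht; positivity
    -- The excess of the almost minimizer is η divided by the factor 1 + ε/κ by which the estimate
    -- will multiply it.
    obtain ⟨_, ⟨v, Gv, hv, rfl⟩, hlt⟩ :=
      exists_lt_of_csInf_lt hne (lt_add_of_pos_right h (div_pos hη hden))
    have h1 := abs_densityEnergy_smul_sub_le hW.continuous hWg hw hΨ ht hκ (fun A => (hwg A).1)
      (hε0 t ht) (fun A => hWw t A ht) hv.sbv
    have h2 : sInf (energies W Ψ b (fun x => mulVec (t • A) x) (t • B)) ≤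
        densityEnergy W Ψ (cube b) (fun x => t • v x) (fun x => t • Gv x) := by
      refine csInf_le (IsJumpDensity.bddBelow_energies hW0 hΨ) ⟨_, _, ?_, rfl⟩
      have := hv.smul ht
      simpa only [← smul_mulVec] using this
    have h3 := (abs_le.1 h1).2
    have h4 := div_le_div_of_nonneg_right h2 ht.le
    have e : ∀ X : ℝ, ε t * (1 + X / κ) = ε t + X * (ε t / κ) := fun X => by ring
    rw [e] at h3 ⊢
    have h5 : densityEnergy (recession W) Ψ (cube b) v Gv * (1 + ε t / κ) ≤
        h * (1 + ε t / κ) + η := by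
      have := mul_le_mul_of_nonneg_right hlt.le hden.le
      rwa [add_mul, div_mul_cancel₀ _ hden.ne'] at this
    linarith

end Energy

/-! ### Fillings of a cube by smaller cubes -/

section Fill

variable {n : ℕ} {ι : Type*} [Fintype ι] {S : ι → Set (Vec (n + 1))} {U : Set (Vec (n + 1))}
  {v : Vec (n + 1) → Vec d} {Gv : Vec (n + 1) → Mat d (n + 1)} {w : Vec (n + 1) → Vec d}
  {vk : ι → Vec (n + 1) → Vec d} {Gk : ι → Vec (n + 1) → Mat d (n + 1)}

lemma frontier_iUnion_subset (hS : ∀ k, IsOpen (S k)) :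
    frontier (⋃ k, S k) ⊆ ⋃ k, frontier (S k) := by
  rw [(isOpen_iUnion hS).frontier_eq, closure_iUnion_of_finite]
  rintro x ⟨hx, hx'⟩
  obtain ⟨k, hk⟩ := Set.mem_iUnion.1 hx
  refine Set.mem_iUnion.2 ⟨k, ?_⟩
  rw [(hS k).frontier_eq]
  exact ⟨hk, fun h => hx' (Set.mem_iUnion.2 ⟨k, h⟩)⟩

/-! ### Locality of jump integrals and Green forms -/

section Local

variable {P : Set (Vec N)} {u v : Vec N → Vec d} {G G' : Vec N → Mat d N}
  {E : Type*} [NormedAddCommGroup E]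

lemma inter_jumpSet_congr (hP : IsOpen P) (h : ∀ x ∈ P, u x = v x) :
    P ∩ jumpSet u = P ∩ jumpSet v := by
  ext x
  exact and_congr_right fun hx => mem_jumpSet_congr (eventually_of_mem (hP.mem_nhds hx) h)

lemma setIntegral_jump_congr [NormedSpace ℝ E] {μ : Measure (Vec N)} (hP : IsOpen P)
    (h : ∀ x ∈ P, u x = v x) (Q : Vec N → Mat d N → E) :
    ∫ x in P ∩ jumpSet u, Q x (jumpTensor u x) ∂μ =
      ∫ x in P ∩ jumpSet v, Q x (jumpTensor v x) ∂μ := by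
  rw [← inter_jumpSet_congr hP h]
  exact setIntegral_inter_congr hP.measurableSet _ fun x hx => by
    rw [jumpTensor_congr (eventually_of_mem (hP.mem_nhds hx) h)]

lemma integrableOn_jump_congr {μ : Measure (Vec N)} (hP : IsOpen P)
    (h : ∀ x ∈ P, u x = v x) (Q : Vec N → Mat d N → E)
    (hi : IntegrableOn (fun x => Q x (jumpTensor u x)) (P ∩ jumpSet u) μ) :
    IntegrableOn (fun x => Q x (jumpTensor v x)) (P ∩ jumpSet v) μ := by
  rw [← inter_jumpSet_congr hP h]
  exact integrableOn_inter_congr hP.measurableSet (fun x hx => by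
    rw [jumpTensor_congr (eventually_of_mem (hP.mem_nhds hx) h)]) hi

lemma greenForm_congr (hP : IsOpen P) (h : ∀ x ∈ P, u x = v x) (hG : ∀ x ∈ P, G x = G' x)
    (φ : Vec N → ℝ) : greenForm P u G φ = greenForm P v G' φ := by
  rw [greenForm, greenForm, setIntegral_jump_congr hP h fun x T => φ x • T]
  congr 1
  · exact setIntegral_congr_fun hP.measurableSet fun x hx => by simp only [h x hx]
  · congr 1
    exact setIntegral_congr_fun hP.measurableSet fun x hx => by simp only [hG x hx]

end Local

lemma integrableOn_jump_iUnion {E : Type*} [NormedAddCommGroup E]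
    {μ : Measure (Vec (n + 1))} {Q : Vec (n + 1) → Mat d (n + 1) → E}
    (hi : ∀ k, IntegrableOn (fun x => Q x (jumpTensor v x)) (S k ∩ jumpSet v) μ) :
    IntegrableOn (fun x => Q x (jumpTensor v x)) ((⋃ k, S k) ∩ jumpSet v) μ := by
  rw [Set.iUnion_inter]
  exact integrableOn_finite_iUnion.2 hi

lemma setIntegral_jump_iUnion {E : Type*} [NormedAddCommGroup E] [NormedSpace ℝ E]
    (hS : ∀ k, IsOpen (S k)) (hd : Pairwise (Function.onFun Disjoint S)) {μ : Measure (Vec (n + 1))}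
    {Q : Vec (n + 1) → Mat d (n + 1) → E}
    (hi : ∀ k, IntegrableOn (fun x => Q x (jumpTensor v x)) (S k ∩ jumpSet v) μ) :
    ∫ x in (⋃ k, S k) ∩ jumpSet v, Q x (jumpTensor v x) ∂μ =
      ∑ k, ∫ x in S k ∩ jumpSet v, Q x (jumpTensor v x) ∂μ := by
  rw [← Measure.restrict_restrict (MeasurableSet.iUnion fun k => (hS k).measurableSet),
    integral_iUnion_fintype (fun k => (hS k).measurableSet) hd]
  · exact Finset.sum_congr rfl fun k _ => by rw [Measure.restrict_restrict (hS k).measurableSet]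
  · intro k
    rw [IntegrableOn, Measure.restrict_restrict (hS k).measurableSet]
    exact hi k

lemma greenForm_iUnion (hS : ∀ k, IsOpen (S k)) (hd : Pairwise (Function.onFun Disjoint S))
    (hv : ∀ k, IntegrableOn v (S k)) (hG : ∀ k, IntegrableOn Gv (S k))
    (hT : ∀ k, IntegrableOn (jumpTensor v) (S k ∩ jumpSet v) μHE[n + 1 - 1])
    {φ : Vec (n + 1) → ℝ} (hφ : IsTest φ) :
    greenForm (⋃ k, S k) v Gv φ = ∑ k, greenForm (S k) v Gv φ := by
  simp only [greenForm]
  rw [Finset.sum_add_distrib, Finset.sum_add_distrib,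
    integral_iUnion_fintype (fun k => (hS k).measurableSet) hd
      (fun k => hφ.integrableOn_tensor (hv k)),
    integral_iUnion_fintype (fun k => (hS k).measurableSet) hd
      (fun k => hφ.integrableOn_smul (hG k)),
    setIntegral_jump_iUnion hS hd (Q := fun x T => φ x • T)
      (fun k => hφ.integrableOn_smul (hT k))]

/-- A family of disjoint rescaled cubes on which a base function `g` is to be replaced. -/
structure Filling (b' b : OrthonormalBasis (Fin (n + 1)) ℝ (Vec (n + 1)))
    (g : Vec (n + 1) → Vec d) (G : Vec (n + 1) → Mat d (n + 1))
    (ι : Type*) [Fintype ι] where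
  /-- centres -/
  x : ι → Vec (n + 1)
  /-- side lengths -/
  r : ι → ℝ
  /-- scaling factors of the values -/
  t : ι → ℝ
  /-- additive constants -/
  c : ι → Vec d
  /-- the unscaled base function -/
  m : ι → Vec (n + 1) → Vec d
  /-- the gradient of the unscaled base function -/
  Gm : ι → Vec (n + 1) → Mat d (n + 1)
  hr : ∀ k, 0 < r k
  ht : ∀ k, 0 < t k
  hm : ∀ k, IntegrableOn (m k) (cube b)
  subset : ∀ k, zoom (x k) (r k) ⁻¹' cube b ⊆ cube b'
  disjoint : Pairwise (Function.onFun Disjoint fun k => zoom (x k) (r k) ⁻¹' cube b)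
  base : ∀ k, ∀ y ∈ zoom (x k) (r k) ⁻¹' cube b, g y = rescale (x k) (r k) (t k) (c k) (m k) y
  base_gradient : ∀ k, ∀ y ∈ zoom (x k) (r k) ⁻¹' cube b,
    G y = rescaleGradient (x k) (r k) (t k) (Gm k) y
  null : ∀ k, (μHE[n + 1 - 1] : Measure (Vec (n + 1)))
    (frontier (zoom (x k) (r k) ⁻¹' cube b) ∩ jumpSet g) = 0

namespace Filling

variable {b' b : OrthonormalBasis (Fin (n + 1)) ℝ (Vec (n + 1))}
  {g : Vec (n + 1) → Vec d} {G : Vec (n + 1) → Mat d (n + 1)} (F : Filling b' b g G ι)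

/-- The cubes of the filling. -/
def cell (k : ι) : Set (Vec (n + 1)) := zoom (F.x k) (F.r k) ⁻¹' cube b

/-- The union of the cubes of the filling. -/
def union : Set (Vec (n + 1)) := ⋃ k, F.cell k

lemma isOpen_cell (k : ι) : IsOpen (F.cell k) := isOpen_preimage_zoom _ _ (isOpen_cube b)

lemma isOpen_union : IsOpen F.union := isOpen_iUnion F.isOpen_cell

lemma union_subset : F.union ⊆ cube b' := Set.iUnion_subset F.subset

/-- The part of the energy of the base function outside of the cubes. -/
def residual (w Ψ : Mat d (n + 1) → ℝ) : ℝ :=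
  (∫ x in cube b' \ F.union, w (G x)) +
    ∫ x in (cube b' \ F.union) ∩ jumpSet g, Ψ (jumpTensor g x) ∂μHE[n + 1 - 1]

lemma frontier_cell_subset (k : ι) : frontier (F.cell k) ⊆
    ⋃ j : Fin (n + 1) × Bool, plane b j.1
      (inner ℝ (b j.1) (F.x k) + F.r k * faceSign j.2) := by
  intro y hy
  have h1 : zoom (F.x k) (F.r k) y ∈ frontier (cube b) := by
    have : F.cell k = (zoomHomeomorph (F.x k) (F.hr k)) ⁻¹' cube b := rfl
    rw [this, ← (zoomHomeomorph (F.x k) (F.hr k)).preimage_frontier] at hy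
    exact hy
  obtain ⟨i, σ, hσ⟩ := exists_abs_eq_half_of_mem_frontier h1
  change inner ℝ (b i) (zoom (F.x k) (F.r k) y) = faceSign σ at hσ
  refine Set.mem_iUnion.2 ⟨(i, σ), ?_⟩
  change inner ℝ (b i) y = _
  rw [← hσ, zoom, inner_smul_right, inner_sub_right]
  have := (F.hr k).ne'
  field_simp
  ring

/-- Replacing the base function in the cubes by functions with the same traces. -/
theorem exists_fill (hg : HasSBVDerivative (cube b') g G) {u : ι → Vec (n + 1) → Vec d}
    {Gu : ι → Vec (n + 1) → Mat d (n + 1)} (hu : ∀ k, HasSBVDerivative (cube b) (u k) (Gu k))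
    (hform : ∀ k φ, IsTest φ → greenForm (cube b) (u k) (Gu k) φ =
      greenForm (cube b) (F.m k) (F.Gm k) φ) :
    ∃ w G', HasSBVDerivative (cube b') w G' ∧
      (∀ φ, IsTest φ → greenForm (cube b') w G' φ = greenForm (cube b') g G φ) ∧
      (∫ x in cube b', G' x) = (∫ x in cube b' \ F.union, G x) +
        ∑ k, (F.t k * F.r k ^ n) • ∫ x in cube b, Gu k x ∧
      ∀ W Ψ, IsRecession W → IsJumpDensity Ψ → densityEnergy W Ψ (cube b') w G' =
        F.residual W Ψ + ∑ k, F.t k * F.r k ^ n * densityEnergy W Ψ (cube b) (u k) (Gu k) := by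
  classical
  have hbt : volume (cube b) ≠ ⊤ := by rw [volume_cube]; simp
  have hbo := isOpen_cube b
  obtain ⟨hg1, hg2, hg3, hg4⟩ := hasSBVDerivative_iff.1 hg
  let us := fun k => rescale (F.x k) (F.r k) (F.t k) (F.c k) (u k)
  let Gs := fun k => rescaleGradient (F.x k) (F.r k) (F.t k) (Gu k)
  -- The cells are disjoint, so on each cell the sum reduces to the corresponding rescaled function;
  -- all replacements are thereby combined in a single function on the union.
  let v := fun y => ∑ k, (F.cell k).indicator (us k) y
  let Gv := fun y => ∑ k, (F.cell k).indicator (Gs k) y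
  have hval : ∀ {E : Type} [AddCommMonoid E] (f : ι → Vec (n + 1) → E) (k : ι),
      ∀ y ∈ F.cell k, ∑ j, (F.cell j).indicator (f j) y = f k y := by
    intro E _ f k y hy
    rw [Finset.sum_eq_single k, Set.indicator_of_mem hy]
    · intro j _ hjk
      exact Set.indicator_of_notMem (fun hj => (F.disjoint hjk).le_bot ⟨hj, hy⟩) _
    · simp
  have hv : ∀ k, ∀ y ∈ F.cell k, v y = us k y := hval us
  have hGv : ∀ k, ∀ y ∈ F.cell k, Gv y = Gs k y := hval Gs
  have hmeas : ∀ k, MeasurableSet (F.cell k) := fun k => (F.isOpen_cell k).measurableSet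
  have hvk : ∀ k, IntegrableOn v (F.cell k) := fun k =>
    (integrableOn_rescale (F.hr k) (F.c k) hbt (hu k).1).congr_fun
      (fun y hy => (hv k y hy).symm) (hmeas k)
  have hGvk : ∀ k, IntegrableOn Gv (F.cell k) := fun k =>
    (integrableOn_rescaleGradient (F.hr k) (hu k).2.1).congr_fun
      (fun y hy => (hGv k y hy).symm) (hmeas k)
  have hTk : ∀ k, IntegrableOn (jumpTensor v) (F.cell k ∩ jumpSet v) μHE[n + 1 - 1] := fun k =>
    integrableOn_jump_congr (F.isOpen_cell k) (fun y hy => (hv k y hy).symm) (fun _ T => T)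
      (integrableOn_jumpTensor_rescale (F.hr k) (F.ht k) (F.c k) hbo hbt (hu k).1
        (hasSBVDerivative_iff.1 (hu k)).2.2.1)
  have hsub : ∀ k, F.cell k ⊆ cube b' := F.subset
  -- On each cell both functions are the same rescaling of functions with equal Green forms on the
  -- unit cube.
  have hforms : ∀ φ, IsTest φ → greenForm F.union v Gv φ = greenForm F.union g G φ := by
    intro φ hφ
    rw [union, greenForm_iUnion F.isOpen_cell F.disjoint hvk hGvk hTk hφ,
      greenForm_iUnion F.isOpen_cell F.disjoint (fun k => hg1.mono_set (hsub k))
        (fun k => hg2.mono_set (hsub k))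
        (fun k => hg3.mono_set (Set.inter_subset_inter_left _ (hsub k))) hφ]
    refine Finset.sum_congr rfl fun k _ => ?_
    rw [greenForm_congr (F.isOpen_cell k) (hv k) (hGv k),
      greenForm_congr (F.isOpen_cell k) (F.base k) (F.base_gradient k)]
    exact greenForm_rescale_eq (F.hr k) (F.ht k) (F.c k) hbo hbt (hu k).1 (F.hm k)
      (hform k) hφ
  have hcov : frontier F.union ⊆ ⋃ j : ι × (Fin (n + 1) × Bool), plane b j.2.1
      (inner ℝ (b j.2.1) (F.x j.1) + F.r j.1 * faceSign j.2.2) := by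
    refine (frontier_iUnion_subset F.isOpen_cell).trans ?_
    refine Set.iUnion_subset fun k => (F.frontier_cell_subset k).trans ?_
    exact Set.iUnion_subset fun j => Set.subset_iUnion_of_subset (k, j) subset_rfl
  have hnull : (μHE[n + 1 - 1] : Measure (Vec (n + 1)))
      (cube b' ∩ frontier F.union ∩ jumpSet g) = 0 := by
    refine measure_mono_null (t := ⋃ k, frontier (F.cell k) ∩ jumpSet g) ?_
      (measure_iUnion_null F.null)
    rw [← Set.iUnion_inter]
    exact Set.inter_subset_inter_left _
      (Set.inter_subset_right.trans (frontier_iUnion_subset F.isOpen_cell))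
  have hvU : IntegrableOn v F.union := integrableOn_finite_iUnion.2 hvk
  have hGvU : IntegrableOn Gv F.union := integrableOn_finite_iUnion.2 hGvk
  -- One application of gluing with the union of all cells as inner set; cells may touch, since only
  -- the hyperplanes containing their faces enter.
  obtain ⟨k1, k2, k3⟩ := HasSBVDerivative.glued b _ _ hcov (isOpen_cube b') F.isOpen_union
    F.union_subset hg hvU hGvU (integrableOn_jump_iUnion (Q := fun _ T => T) hTk) hforms hnull
  have hPm := F.isOpen_union.measurableSet
  have hUm := (isOpen_cube b').measurableSet
  have hsum : ∀ Ψ : Mat d (n + 1) → ℝ, IsJumpDensity Ψ →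
      ∫ x in F.union, Ψ (Gv x) = ∑ k, F.t k * F.r k ^ n * ∫ x in cube b, Ψ (Gu k x) := by
    intro Ψ hΨ
    rw [union, integral_iUnion_fintype hmeas F.disjoint (fun k => hΨ.integrable (hGvk k))]
    refine Finset.sum_congr rfl fun k _ => ?_
    rw [setIntegral_congr_fun (hmeas k) (g := fun y => Ψ (Gs k y))
      (fun y hy => by simp only [hGv k y hy])]
    exact setIntegral_rescaleGradient (F.hr k) (Q := fun _ T => Ψ T)
      (fun _ T => hΨ.homogeneous _ T (div_pos (F.ht k) (F.hr k)))
  have hsumJ : ∀ Ψ : Mat d (n + 1) → ℝ, IsJumpDensity Ψ →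
      ∫ x in F.union ∩ jumpSet v, Ψ (jumpTensor v x) ∂μHE[n + 1 - 1] =
        ∑ k, F.t k * F.r k ^ n *
          ∫ x in cube b ∩ jumpSet (u k), Ψ (jumpTensor (u k) x) ∂μHE[n + 1 - 1] := by
    intro Ψ hΨ
    rw [union, setIntegral_jump_iUnion F.isOpen_cell F.disjoint (Q := fun _ T => Ψ T)
      (fun k => hΨ.integrable (hTk k))]
    refine Finset.sum_congr rfl fun k _ => ?_
    rw [setIntegral_jump_congr (F.isOpen_cell k) (hv k) fun _ T => Ψ T]
    exact setIntegral_jump_rescale (F.hr k) (F.ht k) (F.c k) hbo hbt (hu k).1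
      (Q := fun _ T => Ψ T) (fun _ T => hΨ.homogeneous _ T (F.ht k))
  refine ⟨_, _, k1, k2, ?_, fun W Ψ hW hΨ => ?_⟩
  · rw [(setIntegral_glued hPm hUm F.union_subset hGvU hg2).2]
    refine (add_comm _ _).trans ?_
    congr 1
    rw [union, integral_iUnion_fintype hmeas F.disjoint hGvk]
    refine Finset.sum_congr rfl fun k _ => ?_
    rw [setIntegral_congr_fun (hmeas k) (hGv k)]
    exact setIntegral_rescaleGradient (F.hr k) (Q := fun _ T => T) (fun _ T => rfl)
  · have hWj := hW.isJumpDensity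
    have e : (fun x => W (glued F.union Gv G x)) =
        glued F.union (fun x => W (Gv x)) (fun x => W (G x)) := by
      ext1 x
      by_cases hx : x ∈ F.union
      · simp [glued_of_mem hx]
      · simp [glued_of_notMem hx]
    have h1 := (setIntegral_glued hPm hUm F.union_subset (hWj.integrable hGvU)
      (hWj.integrable hg2)).2
    have h2 := (setIntegral_jump_glued (v := v) (isOpen_cube b') F.isOpen_union F.union_subset
      hnull k3 (Q := fun _ T => Ψ T)
      (integrableOn_jump_iUnion (Q := fun _ T => Ψ T) fun k => hΨ.integrable (hTk k))
      (hΨ.integrable hg3)).2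
    rw [← e] at h1
    rw [densityEnergy, h1]
    erw [h2]
    rw [hsum W hWj, hsumJ Ψ hΨ, residual]
    simp only [densityEnergy, mul_add, Finset.sum_add_distrib]
    simp only [Nat.add_sub_cancel]
    ring

end Filling

end Fill

/-! ### Perturbed affine competitors -/

section Bump

variable {n : ℕ} {b : OrthonormalBasis (Fin (n + 1)) ℝ (Vec (n + 1))} {i : Fin (n + 1)}

/-- Smooth cutoff functions supported in a cube. -/
lemma exists_cutoff (b : OrthonormalBasis (Fin (n + 1)) ℝ (Vec (n + 1))) {K : Set (Vec (n + 1))}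
    (hK : IsClosed K) (hKb : K ⊆ cube b) :
    ∃ θ : Vec (n + 1) → ℝ, IsTest θ ∧ tsupport θ ⊆ cube b ∧ (∀ x ∈ K, θ =ᶠ[𝓝 x] 1) ∧
      ∀ x, θ x ∈ Set.Icc (0 : ℝ) 1 := by
  obtain ⟨f, h0, h1, h2⟩ := exists_contMDiffMap_zero_one_nhds_of_isClosed (n := ⊤)
    (modelWithCornersSelf ℝ (Vec (n + 1))) (isOpen_cube b).isClosed_compl hK
    (Set.disjoint_left.2 fun x hx hx' => hx (hKb hx'))
  have hts : tsupport f ⊆ cube b := by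
    intro x hx
    by_contra h
    exact notMem_tsupport_iff_eventuallyEq.2 (Filter.Eventually.filter_mono
      (nhds_le_nhdsSet (Set.mem_compl h)) h0) hx
  refine ⟨f, ⟨f.contMDiff.contDiff, ?_⟩, hts, fun x hx => ?_, h2⟩
  · exact (isCompact_closedCube b).of_isClosed_subset (isClosed_tsupport _)
      (hts.trans (cube_subset_closedCube b))
  · exact Filter.Eventually.filter_mono (nhds_le_nhdsSet hx) h1

lemma IsTest.contDiff_one {θ : Vec N → ℝ} (h : IsTest θ) : ContDiff ℝ 1 θ :=
  h.contDiff.of_le (by exact_mod_cast le_top)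

lemma sum_inner_smul (b : OrthonormalBasis (Fin N) ℝ (Vec N)) (x : Vec N) :
    ∑ i, inner ℝ x (b i) • b i = x := by
  conv_rhs => rw [← b.sum_repr' x]
  simp_rw [real_inner_comm]

lemma jac_smul_const (b : OrthonormalBasis (Fin N) ℝ (Vec N)) {p : Vec N → ℝ} {x : Vec N}
    (hp : DifferentiableAt ℝ p x) (a : Vec d) :
    jac b (fun x => p x • a) x = tensor a (gradient p x) := by
  rw [jac, ← sum_inner_smul b (gradient p x), tensor_sum_right]
  refine Finset.sum_congr rfl fun i _ => ?_
  rw [inner_gradient, tensor_smul_right, ← tensor_smul_left, fderiv_smul_const hp]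
  rfl

lemma jac_mulVec (b : OrthonormalBasis (Fin N) ℝ (Vec N)) (A : Mat d N) (x : Vec N) :
    jac b (fun x => mulVec A x) x = A := by
  have : (fun x => mulVec A x) = matCLM A := rfl
  rw [jac, this, (matCLM A).fderiv]
  exact sum_tensor_mulVec b A

lemma contDiff_mulVec (A : Mat d N) {k : WithTop ℕ∞} : ContDiff ℝ k (fun x => mulVec A x) :=
  (matCLM A).contDiff

lemma boundaryForm_congr {u v : Vec (n + 1) → Vec d} (h : ∀ x, x ∉ cube b → u x = v x)
    (φ : Vec (n + 1) → ℝ) : boundaryForm b u φ = boundaryForm b v φ := by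
  have key : ∀ j σ, ∀ y ∈ unitCube n,
      u (coord b j (faceSign σ) y) = v (coord b j (faceSign σ) y) := by
    intro j σ y hy
    have h1 := face_subset_frontier b j σ (coord_mem_face b j hy)
    rw [frontier_cube] at h1
    exact h _ h1.2
  refine Finset.sum_congr rfl fun j _ => ?_
  congr 1
  refine setIntegral_congr_fun (isOpen_unitCube n).measurableSet fun y hy => ?_
  have h1 := key j true y hy
  have h2 := key j false y hy
  simp only [faceSign, if_true, Bool.false_eq_true, if_false] at h1 h2
  simp only [h1, h2]

/-- The total derivative of a compactly supported function has integral zero, so the mean of the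
absolutely continuous part is minus the integral of the jump part. Testing the Green formula with a
cutoff equal to 1 near the support of θ expresses this. -/
lemma integral_heav_jac (hs : |(0 : ℝ)| < 1 / 2) {θ : Vec (n + 1) → ℝ} (hθ : IsTest θ)
    (hsupp : tsupport θ ⊆ cube b) (a : Vec d) :
    ∫ x in cube b, heav (inner ℝ (b i) x - 0) • jac b (fun x => θ x • a) x =
      -((∫ y in unitCube n, θ (coord b i 0 y)) • tensor a (b i)) := by
  obtain ⟨φ, hφ, hφb, hφ1, -⟩ := exists_cutoff b (isClosed_tsupport θ) hsupp
  have hf : ContDiff ℝ 1 fun x => θ x • a := hθ.contDiff_one.smul contDiff_const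
  have h := green_heav (b := b) (i := i) hφ hf hs
  rw [boundaryForm_eq_zero hφb, zero_sub] at h
  have e1 : ∀ x, tensor (heav (inner ℝ (b i) x - 0) • θ x • a) (gradient φ x) = 0 := by
    intro x
    by_cases hx : x ∈ tsupport θ
    · have : gradient φ x = 0 := by
        rw [gradient, (hφ1 x hx).fderiv_eq, Pi.one_def, fderiv_const_apply, map_zero]
      rw [this, tensor_zero_right]
    · rw [image_eq_zero_of_notMem_tsupport hx]; simp
  have e2 : ∀ x, φ x • (heav (inner ℝ (b i) x - 0) • jac b (fun x => θ x • a) x) =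
      heav (inner ℝ (b i) x - 0) • jac b (fun x => θ x • a) x := by
    intro x
    by_cases hx : x ∈ tsupport θ
    · rw [(hφ1 x hx).eq_of_nhds]; simp
    · have : gradient θ x = 0 := by
        rw [gradient, image_eq_zero_of_notMem_tsupport fun h' =>
          hx (tsupport_fderiv_subset ℝ h'), map_zero]
      rw [jac_smul_const b (hθ.differentiable x), this, tensor_zero_right]; simp
  have e3 : ∀ x, φ x • θ x • a = θ x • a := by
    intro x
    by_cases hx : x ∈ tsupport θ
    · rw [(hφ1 x hx).eq_of_nhds]; simp
    · rw [image_eq_zero_of_notMem_tsupport hx]; simp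
  simp_rw [e1, e2, e3] at h
  rw [integral_zero, zero_add] at h
  rw [h, integral_smul_const, tensor_smul_left]

lemma mulVec_notMem_jumpSet (A : Mat d (n + 1)) (x : Vec (n + 1)) :
    x ∉ jumpSet (fun x => mulVec A x) :=
  notMem_jumpSet_of_continuousAt Filter.univ_mem
    (continuous_mulVec A).aestronglyMeasurable (continuous_mulVec A).continuousAt

lemma jumpSet_mulVec (A : Mat d (n + 1)) : jumpSet (fun x => mulVec A x) = ∅ :=
  Set.eq_empty_of_forall_notMem (mulVec_notMem_jumpSet A)

lemma laminate_empty (b : OrthonormalBasis (Fin N) ℝ (Vec N)) (i : Fin N)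
    (f₀ : Vec N → Vec d) : laminate b i (Empty.elim : Empty → ℝ) f₀ (fun k => k.elim) = f₀ := by
  ext1 x; simp [laminate]

lemma laminateGradient_empty (b : OrthonormalBasis (Fin N) ℝ (Vec N)) (i : Fin N)
    (f₀ : Vec N → Vec d) :
    laminateGradient b i (Empty.elim : Empty → ℝ) f₀ (fun k => k.elim) = jac b f₀ := by
  ext1 x; simp [laminateGradient]

/-- Affine functions are competitors. -/
lemma isCompetitor_mulVec (b : OrthonormalBasis (Fin (n + 1)) ℝ (Vec (n + 1)))
    (A : Mat d (n + 1)) : IsCompetitor b (fun x => mulVec A x) A (fun x => mulVec A x)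
      fun _ => A := by
  have e : jac b (fun x => mulVec A x) = fun _ => A := funext fun x => jac_mulVec b A x
  have h1 := hasSBVDerivative_laminate (b := b) (i := 0) (s := (Empty.elim : Empty → ℝ))
    (f₀ := fun x => mulVec A x) (f := fun k => k.elim) (contDiff_mulVec A) (fun k => k.elim)
    (fun k => k.elim)
  have h2 : ∀ φ, IsTest φ → _ := fun φ hφ => greenForm_laminate (φ := φ) (b := b) (i := 0)
    (s := (Empty.elim : Empty → ℝ))
    (f₀ := fun x => mulVec A x) (f := fun k => k.elim) (contDiff_mulVec A) (fun k => k.elim)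
    (fun k => k.elim) hφ
  simp only [laminate_empty, laminateGradient_empty, e] at h1 h2
  refine ⟨h1, h2, ?_⟩
  rw [setIntegral_const, Measure.real, volume_cube]; simp

lemma IsTest.exists_tensor_bound {θ : Vec N → ℝ} (hθ : IsTest θ) :
    ∃ C, 0 ≤ C ∧ ∀ (a : Vec d) x, ‖tensor a (gradient θ x)‖ ≤ C * ‖a‖ := by
  obtain ⟨C, hC⟩ := hθ.exists_gradient_bound
  refine ⟨C, (norm_nonneg _).trans (hC 0), fun a x => ?_⟩
  rw [norm_tensor, mul_comm]
  exact mul_le_mul_of_nonneg_right (hC x) (norm_nonneg _)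

/-- Integrability need not be assumed: the integral of a non-integrable function is 0 by convention,
and `C` is nonnegative. -/
lemma setIntegral_le_of_bound {X : Type*} [MeasurableSpace X] {μ : Measure X} {S : Set X}
    {f : X → ℝ} {C : ℝ} (hS : MeasurableSet S) (hμ : μ S ≤ 1) (hC : 0 ≤ C)
    (hf : ∀ x ∈ S, f x ≤ C) : ∫ x in S, f x ∂μ ≤ C := by
  by_cases hi : IntegrableOn f S μ
  · have h1 : μ S ≠ ⊤ := ne_top_of_le_ne_top (by simp) hμ
    calc ∫ x in S, f x ∂μ ≤ ∫ _x in S, C ∂μ :=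
          setIntegral_mono_on hi (integrableOn_const h1) hS hf
      _ = μ.real S * C := by rw [setIntegral_const, smul_eq_mul]
      _ ≤ 1 * C := by
          gcongr
          exact ENNReal.toReal_le_of_le_ofReal zero_le_one (by simpa using hμ)
      _ = C := one_mul C
  · rw [integral_undef hi]; exact hC

lemma hausdorff_plane_inter_cube_le (b : OrthonormalBasis (Fin (n + 1)) ℝ (Vec (n + 1)))
    (i : Fin (n + 1)) {s : ℝ} (hs : |s| < 1 / 2) :
    (μHE[n + 1 - 1] : Measure (Vec (n + 1))) (plane b i s ∩ cube b) = 1 := by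
  rw [hausdorff_plane_inter b i s (isOpen_cube b).measurableSet, preimage_coord_cube b i hs,
    volume_unitCube]

/-- Affine functions perturbed by a jump on a hyperplane. -/
lemma exists_perturbed_affine {w Ψ : Mat d (n + 1) → ℝ} (hw : IsRecession w)
    (hΨ : IsJumpDensity Ψ) (b : OrthonormalBasis (Fin (n + 1)) ℝ (Vec (n + 1)))
    (i : Fin (n + 1)) :
    ∃ κ C : ℝ, 0 < κ ∧ 0 ≤ C ∧ ∀ (A : Mat d (n + 1)) (a : Vec d), ∃ u G,
      IsCompetitor b (fun x => mulVec A x) (A - κ • tensor a (b i)) u G ∧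
      densityEnergy w Ψ (cube b) u G ≤ C * (‖A‖ + ‖a‖) := by
  obtain ⟨θ, hθ, hsupp, h1, h01⟩ := exists_cutoff b (K := {0}) isClosed_singleton
    (by rintro x rfl; intro i; simp)
  have hs : |(0 : ℝ)| < 1 / 2 := by norm_num
  obtain ⟨C₁, hC₁, hθC⟩ := hθ.exists_tensor_bound (d := d)
  obtain ⟨_, C₂, -, hC₂, hw2⟩ := hw.growth
  obtain ⟨C₃, hC₃, hΨ3⟩ := hΨ.growth
  -- The competitor is A x + heav(x·b i) θ(x) a. It jumps by θ a across the central hyperplane, and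
  -- its mean gradient drops by κ a ⊗ b i, where κ is the integral of θ over the central section.
  refine ⟨∫ y in unitCube n, θ (coord b i 0 y), C₂ * (1 + C₁) + C₃, ?_, by positivity,
    fun A a => ?_⟩
  · have hc : Continuous fun y => θ (coord b i 0 y) :=
      hθ.continuous.comp (continuous_coord_right b i 0)
    rw [setIntegral_pos_iff_support_of_nonneg_ae (.of_forall fun y => (h01 _).1)
      (Continuous.integrableOn_unitCube hc)]
    refine IsOpen.measure_pos _ (hc.isOpen_support.inter (isOpen_unitCube n)) ⟨0, ?_, ?_⟩
    · have e : coord b i 0 0 = 0 := by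
        have := coord_inner b i 0
        simp only [inner_zero_right] at this
        exact this
      rw [Function.mem_support, e, (h1 0 rfl).eq_of_nhds]
      simp
    · intro j; simp
  let f : Unit → Vec (n + 1) → Vec d := fun _ x => θ x • a
  have hf : ∀ k, ContDiff ℝ 1 (f k) := fun _ => hθ.contDiff_one.smul contDiff_const
  have hA : ContDiff ℝ 1 fun x => mulVec A x := contDiff_mulVec A
  refine ⟨laminate b i (fun _ : Unit => 0) (fun x => mulVec A x) f,
    laminateGradient b i (fun _ : Unit => 0) (fun x => mulVec A x) f,
    ⟨hasSBVDerivative_laminate hA hf fun _ => hs, fun φ hφ => ?_, ?_⟩, ?_⟩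
  · rw [greenForm_laminate hA hf (fun _ => hs) hφ]
    refine boundaryForm_congr (fun x hx => ?_) φ
    have : θ x = 0 := image_eq_zero_of_notMem_tsupport fun h => hx (hsupp h)
    simp [laminate, f, this]
  · simp only [laminateGradient, Finset.univ_unique, Finset.sum_singleton]
    rw [integral_add (Continuous.integrableOn_cube (continuous_jac hA))
      (IntegrableOn.heav_smul (Continuous.integrableOn_cube (continuous_jac (hf ())))
        (by fun_prop)), integral_heav_jac hs hθ hsupp a]
    simp_rw [jac_mulVec]
    rw [setIntegral_const, Measure.real, volume_cube, sub_eq_add_neg]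
    simp
  · have hG : ∀ x, ‖laminateGradient b i (fun _ : Unit => 0) (fun x => mulVec A x) f x‖ ≤
        ‖A‖ + C₁ * ‖a‖ := by
      intro x
      simp only [laminateGradient, Finset.univ_unique, Finset.sum_singleton, jac_mulVec]
      refine (norm_add_le _ _).trans (add_le_add le_rfl ?_)
      rw [jac_smul_const b (hθ.differentiable x), norm_smul, Real.norm_of_nonneg (heav_nonneg _)]
      exact (mul_le_of_le_one_left (norm_nonneg _) (heav_le_one _)).trans (hθC a x)
    have b1 : ∫ x in cube b, w (laminateGradient b i (fun _ : Unit => 0)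
        (fun x => mulVec A x) f x) ≤ C₂ * (‖A‖ + C₁ * ‖a‖) :=
      setIntegral_le_of_bound (isOpen_cube b).measurableSet (by rw [volume_cube]) (by positivity)
        fun x _ => (hw2 _).2.trans (mul_le_mul_of_nonneg_left (hG x) hC₂.le)
    have b2 : ∫ x in cube b ∩ jumpSet (laminate b i (fun _ : Unit => 0)
        (fun x => mulVec A x) f), Ψ (jumpTensor (laminate b i (fun _ : Unit => 0)
        (fun x => mulVec A x) f) x) ∂μHE[n + 1 - 1] ≤ C₃ * ‖a‖ := by
      refine setIntegral_le_of_bound ((isOpen_cube b).measurableSet.inter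
        (measurableSet_jumpSet_laminate hA.continuous fun k => (hf k).continuous)) ?_
        (by positivity) fun x _ => (hΨ3 _).trans (mul_le_mul_of_nonneg_left ?_ hC₃.le)
      · rw [← hausdorff_plane_inter_cube_le b i hs]
        refine measure_mono fun x hx => ⟨?_, hx.1⟩
        have := (mem_jumpSet_laminate hA.continuous (fun k => (hf k).continuous) x).1 hx.2
        by_contra h
        exact this (by simp [laminateJump, h])
      · rw [jumpTensor_laminate hA.continuous fun k => (hf k).continuous, norm_tensor,
          b.orthonormal.1, mul_one]
        simp only [laminateJump, Finset.univ_unique, Finset.sum_singleton]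
        refine (norm_indicator_le_norm_self _ _).trans ?_
        rw [norm_smul, Real.norm_of_nonneg (h01 x).1]
        exact mul_le_of_le_one_left (norm_nonneg _) (h01 x).2
    refine (add_le_add b1 b2).trans ?_
    have := norm_nonneg A
    have := norm_nonneg a
    nlinarith [mul_nonneg hC₂.le hC₁, mul_nonneg (mul_nonneg hC₂.le hC₁) (norm_nonneg A),
      mul_nonneg hC₃.le (norm_nonneg A), mul_nonneg hC₂.le (norm_nonneg a)]

end Bump

/-! ### Transplantation of competitors -/

section Recovery

variable {n : ℕ} {b b' : OrthonormalBasis (Fin (n + 1)) ℝ (Vec (n + 1))}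

lemma mem_preimage_zoom_cube {b : OrthonormalBasis (Fin N) ℝ (Vec N)} {x y : Vec N} {r : ℝ}
    (hr : 0 < r) : y ∈ zoom x r ⁻¹' cube b ↔
      ∀ i, |inner ℝ (b i) y - inner ℝ (b i) x| < r / 2 := by
  refine forall_congr' fun i => ?_
  rw [zoom, inner_smul_right, inner_sub_right, abs_mul, abs_of_pos (inv_pos.2 hr),
    inv_mul_lt_iff₀ hr, mul_one_div]

lemma abs_le_of_mem_frontier_preimage_zoom {b : OrthonormalBasis (Fin N) ℝ (Vec N)} {x y : Vec N}
    {r : ℝ} (hr : 0 < r) (hy : y ∈ frontier (zoom x r ⁻¹' cube b)) (i : Fin N) :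
    |inner ℝ (b i) y - inner ℝ (b i) x| ≤ r / 2 := by
  have hc : IsClosed {y : Vec N | |inner ℝ (b i) y - inner ℝ (b i) x| ≤ r / 2} :=
    isClosed_le (by fun_prop) continuous_const
  exact closure_minimal (fun z hz => ((mem_preimage_zoom_cube hr).1 hz i).le) hc
    (frontier_subset_closure hy)

/-- The decomposition of an affine function on a family of disjoint cubes. -/
def Filling.ofAffine {ι : Type*} [Fintype ι] (A : Mat d (n + 1)) (x : ι → Vec (n + 1))
    (r : ι → ℝ) (hr : ∀ k, 0 < r k) (hsub : ∀ k, zoom (x k) (r k) ⁻¹' cube b ⊆ cube b')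
    (hdisj : Pairwise (Function.onFun Disjoint fun k => zoom (x k) (r k) ⁻¹' cube b)) :
    Filling b' b (fun x => mulVec A x) (fun _ => A) ι where
  x := x
  r := r
  t := r
  c k := mulVec A (x k)
  m _ x := mulVec A x
  Gm _ _ := A
  hr := hr
  ht := hr
  hm _ := Continuous.integrableOn_cube (continuous_mulVec A)
  subset := hsub
  disjoint := hdisj
  base k y _ := by
    rw [rescale, ← mulVec_smul, ← mulVec_add]
    exact congrArg (mulVec A) ((add_smul_zoom _ (hr k) y).symm.trans (add_comm _ _))
  base_gradient k y _ := by
    rw [rescaleGradient, div_self (hr k).ne', one_smul]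
  null k := by rw [jumpSet_mulVec]; simp

lemma abs_inner_le_norm (b : OrthonormalBasis (Fin N) ℝ (Vec N)) (i : Fin N) (x : Vec N) :
    |inner ℝ (b i) x| ≤ ‖x‖ := by
  have := abs_real_inner_le_norm (b i) x
  rwa [b.orthonormal.1, one_mul] at this

/-- Every mean gradient is attained by competitors, with energy of linear growth. -/
theorem exists_competitor {w Ψ : Mat d (n + 1) → ℝ} (hw : IsRecession w) (hΨ : IsJumpDensity Ψ)
    (b : OrthonormalBasis (Fin (n + 1)) ℝ (Vec (n + 1))) :
    ∃ C : ℝ, 0 ≤ C ∧ ∀ A B : Mat d (n + 1), ∃ u G,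
      IsCompetitor b (fun x => mulVec A x) B u G ∧
      densityEnergy w Ψ (cube b) u G ≤ C * (‖A‖ + ‖B‖) := by
  choose κ C hκ hC h using exists_perturbed_affine (d := d) hw hΨ b
  obtain ⟨_, C₂, -, hC₂, hw2⟩ := hw.growth
  -- A row of n + 1 disjoint cubes of side 1/(n+1) along b 0, one for each direction of the frame:
  -- the k-th cube carries the correction along b k.
  set r : ℝ := 1 / (n + 1 : ℝ) with hr
  have hn : (0 : ℝ) < n + 1 := by positivity
  have hr0 : 0 < r := by positivity
  set x : Fin (n + 1) → Vec (n + 1) := fun k => (((k : ℝ) + 1 / 2) * r - 1 / 2) • b 0 with hx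
  have hx0 : ∀ k, inner ℝ (b 0) (x k) = ((k : ℝ) + 1 / 2) * r - 1 / 2 := fun k => by
    rw [hx, inner_smul_right, orthonormal_inner_self, mul_one]
  have hxi : ∀ k i, i ≠ 0 → inner ℝ (b i) (x k) = 0 := fun k i hi => by
    rw [hx, inner_smul_right, b.orthonormal.2 hi, mul_zero]
  have hnr : (n + 1 : ℝ) * r = 1 := by rw [hr]; field_simp
  have hsub : ∀ k, zoom (x k) r ⁻¹' cube b ⊆ cube b := by
    intro k y hy i
    have h1 := (mem_preimage_zoom_cube hr0).1 hy i
    rw [abs_lt] at h1 ⊢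
    rcases eq_or_ne i 0 with rfl | hi
    · rw [hx0] at h1
      have hk : (k : ℝ) ≤ n := by exact_mod_cast Nat.lt_succ_iff.1 k.2
      have h2 : (k : ℝ) * r ≤ n * r := by gcongr
      have h3 : 0 ≤ (k : ℝ) * r := by positivity
      constructor <;> nlinarith
    · rw [hxi k i hi] at h1
      have h2 : r ≤ 1 := by rw [hr, div_le_one hn]; linarith [n.cast_nonneg (α := ℝ)]
      constructor <;> linarith
  have hdisj : Pairwise (Function.onFun Disjoint fun k => zoom (x k) r ⁻¹' cube b) := by
    have key : ∀ k l : Fin (n + 1), k < l →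
        Disjoint (zoom (x k) r ⁻¹' cube b) (zoom (x l) r ⁻¹' cube b) := by
      intro k l hkl
      refine Set.disjoint_left.2 fun y hy hy' => ?_
      have h1 := (mem_preimage_zoom_cube hr0).1 hy 0
      have h2 := (mem_preimage_zoom_cube hr0).1 hy' 0
      rw [hx0, abs_lt] at h1 h2
      have h3 : (k : ℝ) + 1 ≤ l := by exact_mod_cast hkl
      nlinarith
    intro k l hkl
    rcases lt_or_gt_of_ne hkl with h | h
    · exact key k l h
    · exact (key l k h).symm
  set W := r * r ^ n with hW
  have hW0 : 0 < W := by positivity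
  refine ⟨C₂ + ∑ k, W * (C k * (1 + (1 + (n + 1) * W + 1) / (W * κ k))),
    add_nonneg hC₂.le (Finset.sum_nonneg fun k _ => ?_), fun A B => ?_⟩
  · have := hC k
    have := hκ k
    positivity
  let F : Filling b b (fun x => mulVec A x) (fun _ => A) (Fin (n + 1)) :=
    Filling.ofAffine A x (fun _ => r) (fun _ => hr0) hsub hdisj
  set A' := (∫ x in cube b \ F.union, A) + ∑ k : Fin (n + 1), W • A with hA'
  -- With weight `W` the k-th cube lowers the mean gradient by W κ k (a k ⊗ b k) = ((A' − B) b k) ⊗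
  -- b k. These matrices add up to A' − B, where `A'` is the mean gradient before correction.
  set a : Fin (n + 1) → Vec d := fun k => (W * κ k)⁻¹ • mulVec (A' - B) (b k) with ha
  have hvol : volume (cube b \ F.union) ≤ 1 :=
    (measure_mono Set.sdiff_subset).trans (by rw [volume_cube])
  have hcst : ‖∫ x in cube b \ F.union, A‖ ≤ ‖A‖ := by
    rw [setIntegral_const, norm_smul, Real.norm_of_nonneg measureReal_nonneg]
    refine mul_le_of_le_one_left (norm_nonneg _) ?_
    exact ENNReal.toReal_le_of_le_ofReal zero_le_one (by simpa using hvol)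
  have hA'n : ‖A'‖ ≤ (1 + (n + 1) * W) * ‖A‖ := by
    refine (norm_add_le _ _).trans ?_
    rw [Finset.sum_const, Finset.card_univ, Fintype.card_fin, ← Nat.cast_smul_eq_nsmul ℝ,
      norm_smul, norm_smul, Real.norm_of_nonneg hW0.le, Real.norm_of_nonneg (by positivity)]
    push_cast
    linarith
  have han : ∀ k, ‖a k‖ ≤ (1 + (n + 1) * W + 1) / (W * κ k) * (‖A‖ + ‖B‖) := by
    intro k
    have hκk := hκ k
    rw [ha, norm_smul, norm_inv, Real.norm_of_nonneg (by positivity), inv_mul_eq_div, div_mul_eq_mul_div]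
    gcongr
    refine (norm_mulVec_le _ _).trans ?_
    rw [b.orthonormal.1, mul_one]
    refine (norm_sub_le _ _).trans ?_
    have : 0 ≤ (n + 1) * W := by positivity
    nlinarith [norm_nonneg A, norm_nonneg B, mul_nonneg this (norm_nonneg B)]
  choose u G hu hE using fun k => h k A (a k)
  obtain ⟨v, Gv, h1, h2, h3, h4⟩ := F.exists_fill (isCompetitor_mulVec b A).sbv
    (fun k => (hu k).sbv) (fun k φ hφ => by
      rw [(hu k).trace φ hφ]
      exact ((isCompetitor_mulVec b A).trace φ hφ).symm)
  refine ⟨v, Gv, ⟨h1, fun φ hφ => ?_, ?_⟩, ?_⟩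
  · rw [h2 φ hφ, (isCompetitor_mulVec b A).trace φ hφ]
  · rw [h3]
    have e : ∀ k, (F.t k * F.r k ^ n) • ∫ x in cube b, G k x =
        W • A - tensor (mulVec (A' - B) (b k)) (b k) := by
      intro k
      rw [(hu k).mean]
      change W • (A - κ k • tensor (a k) (b k)) = _
      rw [smul_sub, smul_smul, ha, tensor_smul_left, smul_smul,
        mul_inv_cancel₀ (mul_pos hW0 (hκ k)).ne', one_smul]
    simp_rw [e]
    rw [Finset.sum_sub_distrib, sum_tensor_mulVec, ← add_sub_assoc, ← hA', sub_sub_cancel]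
  · rw [h4 w Ψ hw hΨ]
    have e1 : F.residual w Ψ ≤ C₂ * (‖A‖ + ‖B‖) := by
      rw [Filling.residual, jumpSet_mulVec, Set.inter_empty, setIntegral_empty, add_zero]
      have hA0 := (hw2 A).2
      exact (setIntegral_le_of_bound ((isOpen_cube b).measurableSet.diff
        F.isOpen_union.measurableSet) hvol (by positivity) fun _ _ => hA0).trans
          (by gcongr; linarith [norm_nonneg B])
    rw [add_mul, Finset.sum_mul]
    refine add_le_add e1 (Finset.sum_le_sum fun k _ => ?_)
    change W * densityEnergy w Ψ (cube b) (u k) (G k) ≤ _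
    rw [mul_assoc W]
    refine mul_le_mul_of_nonneg_left ((hE k).trans ?_) hW0.le
    rw [mul_assoc]
    refine mul_le_mul_of_nonneg_left ?_ (hC k)
    have := han k
    rw [add_mul, one_mul]
    linarith [norm_nonneg B]

/-- The total variation of the derivative of the base function outside of the cubes. -/
def Filling.defect {ι : Type*} [Fintype ι] {g : Vec (n + 1) → Vec d}
    {G : Vec (n + 1) → Mat d (n + 1)} (F : Filling b' b g G ι) : ℝ :=
  F.residual (fun T => ‖T‖) fun T => ‖T‖

lemma Filling.residual_le {ι : Type*} [Fintype ι] {g : Vec (n + 1) → Vec d}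
    {G : Vec (n + 1) → Mat d (n + 1)} (F : Filling b' b g G ι) (hg : HasSBVDerivative (cube b') g G)
    {w Ψ : Mat d (n + 1) → ℝ} (hw : IsJumpDensity w) (hΨ : IsJumpDensity Ψ) {C : ℝ}
    (hwC : ∀ T, w T ≤ C * ‖T‖) (hΨC : ∀ T, Ψ T ≤ C * ‖T‖) :
    F.residual w Ψ ≤ C * F.defect := by
  have h1 : IntegrableOn G (cube b' \ F.union) := hg.2.1.mono_set Set.sdiff_subset
  have h2 : IntegrableOn (jumpTensor g) ((cube b' \ F.union) ∩ jumpSet g) μHE[n + 1 - 1] :=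
    (hasSBVDerivative_iff.1 hg).2.2.1.mono_set (Set.inter_subset_inter_left _ Set.sdiff_subset)
  rw [Filling.defect, Filling.residual, Filling.residual, mul_add, ← integral_const_mul,
    ← integral_const_mul]
  exact add_le_add (integral_mono (hw.integrable h1) (h1.norm.const_mul C) fun x => hwC _)
    (integral_mono (hΨ.integrable h2) (h2.norm.const_mul C) fun x => hΨC _)

lemma Filling.norm_integral_le_defect {ι : Type*} [Fintype ι] {g : Vec (n + 1) → Vec d}
    {G : Vec (n + 1) → Mat d (n + 1)} (F : Filling b' b g G ι) :
    ‖∫ x in cube b' \ F.union, G x‖ ≤ F.defect :=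
  (norm_integral_le_integral_norm _).trans
    (le_add_of_nonneg_right (integral_nonneg fun _ => norm_nonneg _))

/-- Competitors are transplanted to all cubes of a filling but one, in which the mean of the
gradient is corrected. -/
theorem exists_transplant {w Ψ : Mat d (n + 1) → ℝ} (hw : IsRecession w) (hΨ : IsJumpDensity Ψ)
    (b : OrthonormalBasis (Fin (n + 1)) ℝ (Vec (n + 1))) :
    ∃ C : ℝ, 0 ≤ C ∧ ∀ (b' : OrthonormalBasis (Fin (n + 1)) ℝ (Vec (n + 1)))
      (ι : Type) [Fintype ι] [DecidableEq ι] (g : Vec (n + 1) → Vec d)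
      (G : Vec (n + 1) → Mat d (n + 1)) (F : Filling b' b g G ι) (k₀ : ι)
      (m : Vec (n + 1) → Vec d) (Gm : Vec (n + 1) → Mat d (n + 1)) (A₀ B : Mat d (n + 1))
      (g' m' : Vec (n + 1) → Vec d) (u : Vec (n + 1) → Vec d) (Gu : Vec (n + 1) → Mat d (n + 1)),
      HasSBVDerivative (cube b') g G →
      (∀ φ, IsTest φ → greenForm (cube b') g G φ = boundaryForm b' g' φ) →
      (∀ φ, IsTest φ → greenForm (cube b) m Gm φ = boundaryForm b m' φ) →
      (∀ k, k ≠ k₀ → F.m k = m ∧ F.Gm k = Gm) →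
      (F.m k₀ = fun x => mulVec A₀ x) → (F.Gm k₀ = fun _ => A₀) →
      IsCompetitor b m' B u Gu → ∃ v Gv, IsCompetitor b' g' B v Gv ∧
        densityEnergy w Ψ (cube b') v Gv ≤
          (∑ k ∈ Finset.univ.erase k₀, F.t k * F.r k ^ n) * densityEnergy w Ψ (cube b) u Gu +
          C * (F.defect + F.t k₀ * F.r k₀ ^ n * ‖A₀‖ +
            |1 - ∑ k ∈ Finset.univ.erase k₀, F.t k * F.r k ^ n| * ‖B‖) := by
  obtain ⟨C, hC, hex⟩ := exists_competitor (d := d) hw hΨ b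
  obtain ⟨_, C₂, -, hC₂, hw2⟩ := hw.growth
  obtain ⟨C₃, hC₃, hΨ3⟩ := hΨ.growth
  refine ⟨C + (C₂ + C₃), by positivity, ?_⟩
  intro b' ι _ _ g G F k₀ m Gm A₀ B g' m' u Gu hg hgt hmt hmain hm0 hGm0 hu
  set τ := ∑ k ∈ Finset.univ.erase k₀, F.t k * F.r k ^ n with hτ
  set l := F.t k₀ * F.r k₀ ^ n with hl
  have hl0 : 0 < l := mul_pos (F.ht k₀) (pow_pos (F.hr k₀) n)
  set R := ∫ x in cube b' \ F.union, G x with hR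
  -- The transplanted copies contribute τB to the mean gradient and the complement of the cells
  -- contributes R, so the exceptional cube has to supply (1 − τ)B − R. Its weight l cancels the
  -- factor 1/l in the energy bound, so the cost stays controlled however small that cube is.
  obtain ⟨v₀, G₀, hv₀, hE₀⟩ := hex A₀ (l⁻¹ • ((1 - τ) • B - R))
  let us : ι → Vec (n + 1) → Vec d := fun k => if k = k₀ then v₀ else u
  let Gs : ι → Vec (n + 1) → Mat d (n + 1) := fun k => if k = k₀ then G₀ else Gu
  have us0 : us k₀ = v₀ := if_pos rfl
  have Gs0 : Gs k₀ = G₀ := if_pos rfl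
  have us1 : ∀ k, k ≠ k₀ → us k = u := fun k hk => if_neg hk
  have Gs1 : ∀ k, k ≠ k₀ → Gs k = Gu := fun k hk => if_neg hk
  obtain ⟨v, Gv, h1, h2, h3, h4⟩ := F.exists_fill (u := us) (Gu := Gs) hg
    (fun k => by
      rcases eq_or_ne k k₀ with rfl | hk
      · rw [us0, Gs0]; exact hv₀.sbv
      · rw [us1 k hk, Gs1 k hk]; exact hu.sbv)
    (fun k φ hφ => by
      rcases eq_or_ne k k₀ with rfl | hk
      · rw [us0, Gs0, hm0, hGm0, hv₀.trace φ hφ, (isCompetitor_mulVec b A₀).trace φ hφ]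
      · rw [us1 k hk, Gs1 k hk, (hmain k hk).1, (hmain k hk).2, hu.trace φ hφ, hmt φ hφ])
  have hsplit : ∀ {E : Type} [AddCommMonoid E] (f : ι → E),
      ∑ k, f k = f k₀ + ∑ k ∈ Finset.univ.erase k₀, f k := fun f =>
    (Finset.add_sum_erase _ f (Finset.mem_univ k₀)).symm
  refine ⟨v, Gv, ⟨h1, fun φ hφ => by rw [h2 φ hφ, hgt φ hφ], ?_⟩, ?_⟩
  · rw [h3, hsplit]
    have e : ∑ k ∈ Finset.univ.erase k₀, (F.t k * F.r k ^ n) • ∫ x in cube b, Gs k x = τ • B := by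
      rw [hτ, Finset.sum_smul]
      refine Finset.sum_congr rfl fun k hk => ?_
      rw [Gs1 k (Finset.ne_of_mem_erase hk), hu.mean]
    rw [e, Gs0, hv₀.mean, smul_smul, mul_inv_cancel₀ hl0.ne', one_smul]
    module
  · rw [h4 w Ψ hw hΨ, hsplit]
    have e : ∑ k ∈ Finset.univ.erase k₀, F.t k * F.r k ^ n *
        densityEnergy w Ψ (cube b) (us k) (Gs k) = τ * densityEnergy w Ψ (cube b) u Gu := by
      rw [hτ, Finset.sum_mul]
      refine Finset.sum_congr rfl fun k hk => ?_
      rw [us1 k (Finset.ne_of_mem_erase hk), Gs1 k (Finset.ne_of_mem_erase hk)]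
    rw [e, us0, Gs0]
    have hres : F.residual w Ψ ≤ (C₂ + C₃) * F.defect :=
      F.residual_le hg hw.isJumpDensity hΨ
        (fun T => (hw2 T).2.trans (by gcongr; linarith))
        (fun T => (hΨ3 T).trans (by gcongr; linarith))
    have hRd : ‖R‖ ≤ F.defect := F.norm_integral_le_defect
    have hd0 : 0 ≤ F.defect := (norm_nonneg _).trans hRd
    have hB : l * ‖l⁻¹ • ((1 - τ) • B - R)‖ ≤ |1 - τ| * ‖B‖ + F.defect := by
      rw [norm_smul, norm_inv, Real.norm_of_nonneg hl0.le, ← mul_assoc, mul_inv_cancel₀ hl0.ne',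
        one_mul]
      refine (norm_sub_le _ _).trans ?_
      rw [norm_smul, Real.norm_eq_abs]
      linarith
    have hex' : l * densityEnergy w Ψ (cube b) v₀ G₀ ≤
        C * (l * ‖A₀‖ + (|1 - τ| * ‖B‖ + F.defect)) := by
      calc l * densityEnergy w Ψ (cube b) v₀ G₀
          ≤ l * (C * (‖A₀‖ + ‖l⁻¹ • ((1 - τ) • B - R)‖)) := by gcongr
        _ = C * (l * ‖A₀‖ + l * ‖l⁻¹ • ((1 - τ) • B - R)‖) := by ring
        _ ≤ _ := by gcongr
    have p1 : 0 ≤ (C₂ + C₃) * (l * ‖A₀‖) := by positivity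
    have p2 : 0 ≤ (C₂ + C₃) * (|1 - τ| * ‖B‖) := by positivity
    change F.residual w Ψ + (l * _ + _) ≤ _
    nlinarith

/-- Existence of fillings of arbitrarily small defect, with base functions of trace `g'` composed
of rescalings of a function of trace `m'`. -/
def HasFillings (b' b : OrthonormalBasis (Fin (n + 1)) ℝ (Vec (n + 1)))
    (g' m' : Vec (n + 1) → Vec d) : Prop :=
  ∀ η : ℝ, 0 < η → ∃ (ι : Type) (_ : Fintype ι) (_ : DecidableEq ι) (g : Vec (n + 1) → Vec d)
    (G : Vec (n + 1) → Mat d (n + 1)) (F : Filling b' b g G ι) (k₀ : ι)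
    (m : Vec (n + 1) → Vec d) (Gm : Vec (n + 1) → Mat d (n + 1)) (A₀ : Mat d (n + 1)),
    HasSBVDerivative (cube b') g G ∧
    (∀ φ, IsTest φ → greenForm (cube b') g G φ = boundaryForm b' g' φ) ∧
    (∀ φ, IsTest φ → greenForm (cube b) m Gm φ = boundaryForm b m' φ) ∧
    (∀ k, k ≠ k₀ → F.m k = m ∧ F.Gm k = Gm) ∧
    (F.m k₀ = fun x => mulVec A₀ x) ∧ (F.Gm k₀ = fun _ => A₀) ∧
    F.defect ≤ η ∧ F.t k₀ * F.r k₀ ^ n * ‖A₀‖ ≤ η ∧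
    ∑ k ∈ Finset.univ.erase k₀, F.t k * F.r k ^ n ≤ 1 ∧
    1 - ∑ k ∈ Finset.univ.erase k₀, F.t k * F.r k ^ n ≤ η

/-- Transplantation multiplies the nonnegative energy by a total weight at most 1 and adds an error
of order η. Each source competitor hence bounds the target infimum by its own energy as η → 0.
Nonemptiness is transferred too, which is how surface competitors are shown to exist. -/
theorem HasFillings.sInf_le {w Ψ : Mat d (n + 1) → ℝ} (hw : IsRecession w) (hΨ : IsJumpDensity Ψ)
    {g' m' : Vec (n + 1) → Vec d} (h : HasFillings b' b g' m') {B : Mat d (n + 1)}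
    (hne : (energies w Ψ b m' B).Nonempty) :
    (energies w Ψ b' g' B).Nonempty ∧
      sInf (energies w Ψ b' g' B) ≤ sInf (energies w Ψ b m' B) := by
  obtain ⟨C, hC, htr⟩ := exists_transplant (d := d) hw hΨ b
  have key : ∀ u Gu, IsCompetitor b m' B u Gu → ∀ η : ℝ, 0 < η → ∃ e ∈ energies w Ψ b' g' B,
      e ≤ densityEnergy w Ψ (cube b) u Gu + C * (2 + ‖B‖) * η := by
    intro u Gu hu η hη
    obtain ⟨ι, i1, i2, g, G, F, k₀, m, Gm, A₀, h1, h2, h3, h4, h5, h6, h7, h8, h9, h10⟩ := h η hη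
    obtain ⟨v, Gv, hv, hE⟩ := htr b' ι g G F k₀ m Gm A₀ B g' m' u Gu h1 h2 h3 h4 h5 h6 hu
    refine ⟨_, ⟨v, Gv, hv, rfl⟩, hE.trans ?_⟩
    have hE0 : 0 ≤ densityEnergy w Ψ (cube b) u Gu :=
      add_nonneg (integral_nonneg fun x => hw.nonneg _) (integral_nonneg fun x => hΨ.nonneg _)
    rw [abs_of_nonneg (by linarith), mul_assoc C]
    refine add_le_add (mul_le_of_le_one_left hE0 h9) (mul_le_mul_of_nonneg_left ?_ hC)
    have := mul_le_mul_of_nonneg_right h10 (norm_nonneg B)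
    linarith
  refine ⟨?_, le_csInf hne ?_⟩
  · obtain ⟨_, u, Gu, hu, rfl⟩ := hne
    obtain ⟨e, he, -⟩ := key u Gu hu 1 one_pos
    exact ⟨e, he⟩
  · rintro _ ⟨u, Gu, hu, rfl⟩
    have hle : ∀ η : ℝ, 0 < η → sInf (energies w Ψ b' g' B) ≤
        densityEnergy w Ψ (cube b) u Gu + C * (2 + ‖B‖) * η := by
      intro η hη
      obtain ⟨e, he, hle⟩ := key u Gu hu η hη
      exact (csInf_le (IsJumpDensity.bddBelow_energies hw.nonneg hΨ) he).trans hle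
    have lim : Tendsto (fun η => densityEnergy w Ψ (cube b) u Gu + C * (2 + ‖B‖) * η) (𝓝[>] 0)
        (𝓝 (densityEnergy w Ψ (cube b) u Gu + C * (2 + ‖B‖) * 0)) :=
      ((tendsto_id.const_mul _).const_add _).mono_left nhdsWithin_le_nhds
    rw [mul_zero, add_zero] at lim
    exact ge_of_tendsto lim (eventually_nhdsWithin_of_forall fun η hη => hle η hη)

end Recovery

/-! ### Lattices of cubes -/

section Lattice

variable {n : ℕ} {b b' : OrthonormalBasis (Fin (n + 1)) ℝ (Vec (n + 1))} {m : ℕ}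

/-- The points of the lattice of mesh size `1 / m` with frame `b`. -/
def latticePoint (b : OrthonormalBasis (Fin N) ℝ (Vec N)) (m : ℕ) (z : Fin N → ℤ) : Vec N :=
  ∑ i, ((z i : ℝ) / m) • b i

/-- The open lattice cubes. -/
def latticeCell (b : OrthonormalBasis (Fin N) ℝ (Vec N)) (m : ℕ) (z : Fin N → ℤ) : Set (Vec N) :=
  zoom (latticePoint b m z) (1 / m) ⁻¹' cube b

@[simp] lemma inner_latticePoint (b : OrthonormalBasis (Fin N) ℝ (Vec N)) (m : ℕ)
    (z : Fin N → ℤ) (i : Fin N) : inner ℝ (b i) (latticePoint b m z) = (z i : ℝ) / m := by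
  rw [latticePoint, b.orthonormal.inner_right_fintype]

lemma mem_latticeCell (hm : 0 < m) {z : Fin N → ℤ} {b : OrthonormalBasis (Fin N) ℝ (Vec N)}
    {y : Vec N} : y ∈ latticeCell b m z ↔ ∀ i, |inner ℝ (b i) y - (z i : ℝ) / m| < 1 / m / 2 := by
  have : (0 : ℝ) < m := by exact_mod_cast hm
  rw [latticeCell, mem_preimage_zoom_cube (by positivity)]
  simp

lemma isOpen_latticeCell (b : OrthonormalBasis (Fin N) ℝ (Vec N)) (m : ℕ) (z : Fin N → ℤ) :
    IsOpen (latticeCell b m z) := isOpen_preimage_zoom _ _ (isOpen_cube b)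

lemma disjoint_latticeCell (hm : 0 < m) (b : OrthonormalBasis (Fin N) ℝ (Vec N))
    {z z' : Fin N → ℤ} (h : z ≠ z') : Disjoint (latticeCell b m z) (latticeCell b m z') := by
  have hm' : (0 : ℝ) < m := by exact_mod_cast hm
  refine Set.disjoint_left.2 fun y hy hy' => h ?_
  ext i
  have h1 := (mem_latticeCell hm).1 hy i
  have h2 := (mem_latticeCell hm).1 hy' i
  have h3 : |(z i : ℝ) / m - z' i / m| < 1 / m := by
    rw [abs_lt] at h1 h2 ⊢
    constructor <;> linarith
  rw [← sub_div, abs_div, abs_of_pos hm', div_lt_div_iff_of_pos_right hm'] at h3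
  have h4 : |z i - z' i| < 1 := by exact_mod_cast h3
  rw [Int.abs_lt_one_iff] at h4
  omega

lemma volume_latticeCell (hm : 0 < m) (b : OrthonormalBasis (Fin (n + 1)) ℝ (Vec (n + 1)))
    (z : Fin (n + 1) → ℤ) : volume.real (latticeCell b m z) = (1 / m : ℝ) ^ (n + 1) := by
  have hm' : (0 : ℝ) < m := by exact_mod_cast hm
  rw [latticeCell, Measure.real, volume_preimage_zoom _ (by positivity), volume_cube, mul_one,
    ENNReal.toReal_ofReal (by positivity)]

lemma dist_latticePoint_le (hm : 0 < m) {b : OrthonormalBasis (Fin N) ℝ (Vec N)}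
    {z : Fin N → ℤ} {y : Vec N} (h : ∀ i, |inner ℝ (b i) y - (z i : ℝ) / m| ≤ 1 / m / 2) :
    ‖y - latticePoint b m z‖ ≤ N / m := by
  have hm' : (0 : ℝ) < m := by exact_mod_cast hm
  have h1 : zoom (latticePoint b m z) (1 / m) y ∈ closedCube b := by
    intro i
    rw [zoom, inner_smul_right, inner_sub_right, inner_latticePoint, abs_mul,
      abs_of_pos (by positivity), inv_mul_le_iff₀ (by positivity), mul_one_div]
    exact h i
  have h2 := norm_le_of_mem_closedCube h1
  rw [zoom, norm_smul, Real.norm_of_nonneg (by positivity), inv_mul_le_iff₀ (by positivity)] at h2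
  exact h2.trans (le_of_eq (by ring))

/-- The measure not covered by a disjoint family. -/
lemma measureReal_sdiff_le {X ι : Type*} [MeasurableSpace X] {ν : Measure X} {S P : Set X}
    (hS : ν S ≠ ⊤) {c : ι → Set X} {s : Finset ι} (hc : ∀ k, MeasurableSet (c k))
    (hd : Pairwise (Function.onFun Disjoint c)) (hcS : ∀ k ∈ s, c k ⊆ S)
    (hcP : ∀ k ∈ s, c k ⊆ P) {a : ℝ} (ha : ∀ k ∈ s, a ≤ ν.real (c k)) :
    ν.real (S \ P) ≤ ν.real S - s.card * a := by
  have hsub : (⋃ k ∈ s, c k) ⊆ S := Set.iUnion₂_subset hcS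
  have h1 : ν.real (S \ P) ≤ ν.real (S \ ⋃ k ∈ s, c k) :=
    measureReal_mono (Set.sdiff_subset_sdiff_right (Set.iUnion₂_subset hcP))
      (ne_top_of_le_ne_top hS (measure_mono Set.sdiff_subset))
  have hm : MeasurableSet (⋃ k ∈ s, c k) := Finset.measurableSet_biUnion _ fun k _ => hc k
  rw [measureReal_sdiff hsub hm hS,
    measureReal_biUnion_finset (fun k _ l _ hkl => hd hkl) (fun k _ => hc k)
      (fun k hk => ne_top_of_le_ne_top hS (measure_mono (hcS k hk)))] at h1
  have h2 := Finset.card_nsmul_le_sum s (fun k => ν.real (c k)) a ha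
  rw [nsmul_eq_mul] at h2
  linarith

/-- The lattice cubes in a cube fill it up to a set of small measure. -/
lemma exists_lattice_cover (b' b : OrthonormalBasis (Fin (n + 1)) ℝ (Vec (n + 1))) {m : ℕ}
    (hm : 4 * (n + 1) < m) : ∃ K : Finset (Fin (n + 1) → ℤ), 0 ∈ K ∧
      (∀ z ∈ K, latticeCell b m z ⊆ cube b') ∧
      (1 - 4 * (n + 1) / m : ℝ) ^ (n + 1) ≤ K.card * (1 / m : ℝ) ^ (n + 1) := by
  classical
  have hm0 : 0 < m := by omega
  have hm' : (0 : ℝ) < m := by exact_mod_cast hm0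
  have hmn : 4 * ((n : ℝ) + 1) < m := by exact_mod_cast hm
  -- Points of one closed cell are within 2(n+1)/m of each other. A cell meeting the concentric cube
  -- of side ρ therefore stays inside the unit cube, whatever the relative orientation.
  set ρ : ℝ := 1 - 4 * (n + 1) / m with hρ
  have hρ0 : 0 < ρ := by rw [hρ, sub_pos, div_lt_one hm']; exact hmn
  have hρ1 : ρ / 2 = 1 / 2 - 2 * ((n + 1) / m) := by rw [hρ]; ring
  -- The box serves only to make the index set finite: points of the unit cube have norm at most n +
  -- 1, which bounds the indices of the relevant cells.
  let box : Finset (Fin (n + 1) → ℤ) :=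
    Fintype.piFinset fun _ => Finset.Icc (-(m * (n + 2) : ℤ)) (m * (n + 2))
  let K := box.filter fun z => latticeCell b m z ⊆ cube b'
  have hQ : ∀ y, y ∈ zoom (0 : Vec (n + 1)) ρ ⁻¹' cube b' ↔ ∀ i, |inner ℝ (b' i) y| < ρ / 2 := by
    intro y
    rw [mem_preimage_zoom_cube hρ0]
    simp
  have hcell : ∀ z x, (∀ i, |inner ℝ (b i) x - (z i : ℝ) / m| ≤ 1 / m / 2) →
      x ∈ zoom (0 : Vec (n + 1)) ρ ⁻¹' cube b' → z ∈ K := by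
    intro z x hz hx
    rw [hQ] at hx
    have h1 := dist_latticePoint_le hm0 hz
    push_cast at h1
    refine Finset.mem_filter.2 ⟨Fintype.mem_piFinset.2 fun i => ?_, fun y hy i => ?_⟩
    · have hxn : ‖x‖ ≤ n + 1 := by
        have : x ∈ closedCube b' := fun i => (hx i).le.trans (by
          rw [hρ1]; have : 0 ≤ ((n : ℝ) + 1) / m := by positivity
          linarith)
        exact_mod_cast norm_le_of_mem_closedCube this
      have h2 := abs_inner_le_norm b i x
      have h3 : |(z i : ℝ) / m| ≤ n + 2 := by
        have h4 := abs_sub_abs_le_abs_sub ((z i : ℝ) / m) (inner ℝ (b i) x)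
        rw [abs_sub_comm] at h4
        have h5 : 1 / (m : ℝ) / 2 ≤ 1 := by
          rw [div_div, div_le_one (by positivity)]
          have : (1 : ℝ) ≤ m := by exact_mod_cast hm0
          linarith
        linarith [hz i]
      rw [abs_div, abs_of_pos hm', div_le_iff₀ hm'] at h3
      have h4 : |z i| ≤ (n + 2) * m := by exact_mod_cast h3
      rw [Finset.mem_Icc, ← abs_le]
      linarith
    · have h2 := dist_latticePoint_le hm0 fun i => ((mem_latticeCell hm0).1 hy i).le
      push_cast at h2
      have h3 : ‖y - x‖ ≤ 2 * ((n + 1) / m) := by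
        calc ‖y - x‖ = ‖(y - latticePoint b m z) - (x - latticePoint b m z)‖ := by
              rw [sub_sub_sub_cancel_right]
          _ ≤ _ := (norm_sub_le _ _).trans (by linarith)
      have h4 := abs_inner_le_norm b' i (y - x)
      rw [inner_sub_right] at h4
      have h5 := abs_sub_abs_le_abs_sub (inner ℝ (b' i) y) (inner ℝ (b' i) x)
      have h6 := hx i
      rw [hρ1] at h6
      linarith
  refine ⟨K, hcell 0 0 (fun i => ?_) ?_, fun z hz => (Finset.mem_filter.1 hz).2, ?_⟩
  · simp only [inner_zero_right, Pi.zero_apply, Int.cast_zero, zero_div, sub_zero, abs_zero]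
    positivity
  · rw [hQ]; intro i; simpa using half_pos hρ0
  -- Rounding the coordinates assigns a closed cell to each point; only points on the countably many
  -- hyperplanes carrying the faces of the lattice escape the open cells.
  · have hcover : zoom (0 : Vec (n + 1)) ρ ⁻¹' cube b' ⊆ (⋃ z ∈ K, latticeCell b m z) ∪
        ⋃ p : Fin (n + 1) × ℤ, plane b p.1 ((p.2 : ℝ) / m + 1 / m / 2) ∪
          plane b p.1 ((p.2 : ℝ) / m - 1 / m / 2) := by
      intro x hx
      let z : Fin (n + 1) → ℤ := fun i => round (m * inner ℝ (b i) x)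
      have hz : ∀ i, |inner ℝ (b i) x - (z i : ℝ) / m| ≤ 1 / m / 2 := by
        intro i
        have h1 := abs_sub_round (m * inner ℝ (b i) x)
        have h2 : inner ℝ (b i) x - (z i : ℝ) / m =
            (m * inner ℝ (b i) x - round (m * inner ℝ (b i) x)) / m := by
          rw [sub_div, mul_div_cancel_left₀ _ hm'.ne']
        rw [h2, abs_div, abs_of_pos hm', div_le_iff₀ hm']
        refine h1.trans (le_of_eq ?_)
        field_simp
      by_cases hxz : x ∈ latticeCell b m z
      · exact Or.inl (Set.mem_iUnion₂.2 ⟨z, hcell z x hz hx, hxz⟩)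
      · right
        rw [mem_latticeCell hm0] at hxz
        push Not at hxz
        obtain ⟨i, hi⟩ := hxz
        refine Set.mem_iUnion.2 ⟨(i, z i), ?_⟩
        have h1 := le_antisymm (hz i) hi
        rcases (abs_eq (by positivity)).1 h1 with h | h
        · left; change inner ℝ (b i) x = _; linarith
        · right; change inner ℝ (b i) x = _; linarith
    have hfin : volume (⋃ z ∈ K, latticeCell b m z) ≠ ⊤ :=
      ne_top_of_le_ne_top (by rw [volume_cube]; simp : volume (cube b') ≠ ⊤)
        (measure_mono (Set.iUnion₂_subset fun z hz => (Finset.mem_filter.1 hz).2))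
    have hnull : volume (⋃ p : Fin (n + 1) × ℤ, plane b p.1 ((p.2 : ℝ) / m + 1 / m / 2) ∪
          plane b p.1 ((p.2 : ℝ) / m - 1 / m / 2)) = 0 :=
      measure_iUnion_null fun p => measure_union_null (volume_plane b _ _) (volume_plane b _ _)
    have h1 := (measure_mono (μ := volume) hcover).trans (measure_union_le _ _)
    rw [hnull, add_zero, volume_preimage_zoom _ hρ0, volume_cube, mul_one] at h1
    have h2 := (ENNReal.ofReal_le_iff_le_toReal hfin).1 h1
    refine h2.trans (le_of_eq ?_)
    change volume.real (⋃ z ∈ K, latticeCell b m z) = _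
    rw [measureReal_biUnion_finset (fun k _ l _ hkl => disjoint_latticeCell hm0 b hkl)
      (fun k _ => (isOpen_latticeCell b m k).measurableSet)
      (fun k hk => ne_top_of_le_ne_top (by rw [volume_cube]; simp : volume (cube b') ≠ ⊤)
        (measure_mono (Finset.mem_filter.1 hk).2))]
    simp_rw [volume_latticeCell hm0]
    rw [Finset.sum_const, nsmul_eq_mul]

/-- Cubes can be filled with cubes of a different orientation. -/
theorem hasFillings_mulVec (b' b : OrthonormalBasis (Fin (n + 1)) ℝ (Vec (n + 1)))
    (A : Mat d (n + 1)) :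
    HasFillings b' b (fun x => mulVec A x) (fun x => mulVec A x) := by
  classical
  intro η hη
  -- One quantity dominates every error: the uncovered volume and the weight of the exceptional
  -- cell, each multiplied by |A|, and the missing total weight.
  have lim : Tendsto (fun m : ℕ => (1 + ‖A‖) *
      (1 - (1 - 4 * (n + 1) / m : ℝ) ^ (n + 1) + (1 / m : ℝ) ^ (n + 1))) atTop (𝓝 0) := by
    have h1 : Tendsto (fun m : ℕ => (4 * (n + 1) / m : ℝ)) atTop (𝓝 0) :=
      tendsto_const_div_atTop_nhds_zero_nat _
    have h2 : Tendsto (fun m : ℕ => (1 / m : ℝ)) atTop (𝓝 0) :=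
      tendsto_const_div_atTop_nhds_zero_nat _
    simpa using ((((h1.const_sub 1).pow (n + 1)).const_sub 1).add (h2.pow (n + 1))).const_mul
      (1 + ‖A‖)
  obtain ⟨m, hmη, hm⟩ := ((lim.eventually (gt_mem_nhds hη)).and
    (eventually_gt_atTop (4 * (n + 1)))).exists
  obtain ⟨K, h0, hK, hcard⟩ := exists_lattice_cover b' b hm
  have hm0 : 0 < m := by omega
  have hm' : (0 : ℝ) < m := by exact_mod_cast hm0
  -- The base function is affine on every cell, so any cell can serve as the exceptional one; the
  -- cell at the origin is used.
  let F : Filling b' b (fun x => mulVec A x) (fun _ => A) K :=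
    Filling.ofAffine A (fun k => latticePoint b m k) (fun _ => 1 / m) (fun _ => by positivity)
      (fun k => hK k k.2) fun k l hkl => disjoint_latticeCell hm0 b (by
        rwa [ne_eq, SetLike.coe_eq_coe])
  set a : ℝ := (1 / m : ℝ) ^ (n + 1) with ha
  have ha0 : 0 < a := by positivity
  have hvt : volume (cube b') ≠ ⊤ := by rw [volume_cube]; simp
  have hmeas : ∀ k : K, MeasurableSet (F.cell k) := fun k => (F.isOpen_cell k).measurableSet
  have hunc : volume.real (cube b' \ F.union) ≤ 1 - K.card * a := by
    have := measureReal_sdiff_le (ν := volume) (s := Finset.univ) hvt hmeas F.disjoint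
      (fun k _ => F.subset k) (fun k _ => Set.subset_iUnion F.cell k) (a := a)
      (fun k _ => (volume_latticeCell hm0 b k).ge)
    rw [Finset.card_univ, Fintype.card_coe] at this
    rwa [show volume.real (cube b') = 1 by rw [Measure.real, volume_cube]; simp] at this
  have hunc0 : 0 ≤ 1 - K.card * a := measureReal_nonneg.trans hunc
  have hw : ∀ k, F.t k * F.r k ^ n = a := fun k => by
    change (1 / m : ℝ) * (1 / m) ^ n = a
    rw [ha, pow_succ]; ring
  have hτ : ∑ k ∈ Finset.univ.erase (⟨0, h0⟩ : K), F.t k * F.r k ^ n = K.card * a - a := by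
    rw [Finset.sum_congr rfl fun k _ => hw k, Finset.sum_const,
      Finset.card_erase_of_mem (Finset.mem_univ _), Finset.card_univ, Fintype.card_coe,
      nsmul_eq_mul, Nat.cast_sub (Finset.card_pos.2 ⟨0, h0⟩)]
    push_cast; ring
  set e := 1 - (1 - 4 * (n + 1) / m : ℝ) ^ (n + 1) with he
  have he1 : 1 - K.card * a ≤ e := by rw [he]; linarith
  have hA := norm_nonneg A
  refine ⟨K, inferInstance, inferInstance, _, _, F, ⟨0, h0⟩, fun x => mulVec A x, fun _ => A, A,
    (isCompetitor_mulVec b' A).sbv, (isCompetitor_mulVec b' A).trace,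
    (isCompetitor_mulVec b A).trace, fun k _ => ⟨rfl, rfl⟩, rfl, rfl, ?_, ?_, ?_, ?_⟩
  · rw [Filling.defect, Filling.residual, jumpSet_mulVec, Set.inter_empty, setIntegral_empty,
      add_zero, setIntegral_const, smul_eq_mul]
    refine le_trans ?_ hmη.le
    have h1 := mul_le_mul_of_nonneg_right (hunc.trans he1) hA
    nlinarith [hunc0.trans he1]
  · rw [hw]
    refine le_trans ?_ hmη.le
    nlinarith [hunc0.trans he1, mul_nonneg hA (hunc0.trans he1)]
  · rw [hτ]; linarith
  · rw [hτ]
    refine le_trans ?_ hmη.le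
    nlinarith [mul_nonneg hA (hunc0.trans he1), mul_nonneg hA ha0.le]

end Lattice

/-! ### Laminates with values in a line -/

section Profile

variable {n : ℕ} {b : OrthonormalBasis (Fin (n + 1)) ℝ (Vec (n + 1))} {i : Fin (n + 1)}
  {θ : Vec (n + 1) → ℝ} {lam : Vec d}

/-- Interpolation between two affine functions of the coordinate in the direction `b i` by means
of the cutoff `θ`. -/
def profile (θ : Vec N → ℝ) (b : OrthonormalBasis (Fin N) ℝ (Vec N)) (i : Fin N)
    (μ ν α β : ℝ) (x : Vec N) : ℝ :=
  μ + ν * inner ℝ (b i) x + θ x * (α * inner ℝ (b i) x + β)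

lemma contDiff_profile (hθ : IsTest θ) (μ ν α β : ℝ) : ContDiff ℝ 1 (profile θ b i μ ν α β) := by
  have h1 : ContDiff ℝ 1 fun x : Vec (n + 1) => inner ℝ (b i) x := contDiff_const.inner ℝ contDiff_id
  exact (contDiff_const.add (contDiff_const.mul h1)).add
    (hθ.contDiff_one.mul ((contDiff_const.mul h1).add contDiff_const))

lemma gradient_profile (hθ : IsTest θ) (μ ν α β : ℝ) (x : Vec (n + 1)) :
    gradient (profile θ b i μ ν α β) x =
      (ν + θ x * α) • b i + (α * inner ℝ (b i) x + β) • gradient θ x := by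
  refine ext_inner_right ℝ fun v => ?_
  have ht : HasFDerivAt (fun x : Vec (n + 1) => inner ℝ (b i) x) (innerSL ℝ (b i)) x :=
    (innerSL ℝ (b i)).hasFDerivAt
  have h := ((ht.const_mul ν).const_add μ).add
    ((hθ.differentiable x).hasFDerivAt.mul ((ht.const_mul α).add_const β))
  rw [inner_gradient, show fderiv ℝ (profile θ b i μ ν α β) x = _ from h.fderiv, inner_add_left,
    inner_smul_left, inner_smul_left, inner_gradient]
  simp
  ring

/-- Laminates with values in a line. -/
def scalarLaminate {ι : Type*} [Fintype ι] (θ : Vec N → ℝ)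
    (b : OrthonormalBasis (Fin N) ℝ (Vec N)) (i : Fin N) (lam : Vec d) (s : ι → ℝ)
    (c₀ : Fin 4 → ℝ) (c : ι → Fin 4 → ℝ) : Vec N → Vec d :=
  laminate b i s (fun x => profile θ b i (c₀ 0) (c₀ 1) (c₀ 2) (c₀ 3) x • lam)
    fun k x => profile θ b i (c k 0) (c k 1) (c k 2) (c k 3) x • lam

/-- The gradient of a laminate with values in a line. -/
def scalarLaminateGradient {ι : Type*} [Fintype ι] (θ : Vec N → ℝ)
    (b : OrthonormalBasis (Fin N) ℝ (Vec N)) (i : Fin N) (lam : Vec d) (s : ι → ℝ)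
    (c₀ : Fin 4 → ℝ) (c : ι → Fin 4 → ℝ) : Vec N → Mat d N :=
  laminateGradient b i s (fun x => profile θ b i (c₀ 0) (c₀ 1) (c₀ 2) (c₀ 3) x • lam)
    fun k x => profile θ b i (c k 0) (c k 1) (c k 2) (c k 3) x • lam

variable {ι : Type*} [Fintype ι] {s : ι → ℝ} {c₀ : Fin 4 → ℝ} {c : ι → Fin 4 → ℝ}

lemma contDiff_profile_smul (hθ : IsTest θ) (lam : Vec d) (μ ν α β : ℝ) :
    ContDiff ℝ 1 fun x => profile θ b i μ ν α β x • lam :=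
  (contDiff_profile hθ μ ν α β).smul contDiff_const

lemma scalarLaminate_apply (x : Vec (n + 1)) : scalarLaminate θ b i lam s c₀ c x =
    (profile θ b i (c₀ 0) (c₀ 1) (c₀ 2) (c₀ 3) x + ∑ k, heav (inner ℝ (b i) x - s k) *
      profile θ b i (c k 0) (c k 1) (c k 2) (c k 3) x) • lam := by
  simp only [scalarLaminate, laminate, add_smul, Finset.sum_smul, mul_smul]

lemma scalarLaminateGradient_apply (hθ : IsTest θ) (x : Vec (n + 1)) :
    scalarLaminateGradient θ b i lam s c₀ c x = tensor lam
      (((c₀ 1 + ∑ k, heav (inner ℝ (b i) x - s k) * c k 1) +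
          θ x * (c₀ 2 + ∑ k, heav (inner ℝ (b i) x - s k) * c k 2)) • b i +
        ((c₀ 2 + ∑ k, heav (inner ℝ (b i) x - s k) * c k 2) * inner ℝ (b i) x +
          (c₀ 3 + ∑ k, heav (inner ℝ (b i) x - s k) * c k 3)) • gradient θ x) := by
  have hd : ∀ μ ν α β, DifferentiableAt ℝ (profile θ b i μ ν α β) x := fun μ ν α β =>
    ((contDiff_profile hθ μ ν α β).differentiable (by simp)) x
  simp only [scalarLaminateGradient, laminateGradient, jac_smul_const b (hd _ _ _ _),
    gradient_profile hθ, ← tensor_smul_right, ← tensor_sum_right, ← tensor_add_right]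
  congr 1
  simp only [smul_add, Finset.sum_add_distrib, smul_smul, ← Finset.sum_smul]
  have e1 : ∑ k, heav (inner ℝ (b i) x - s k) * (c k 1 + θ x * c k 2) =
      (∑ k, heav (inner ℝ (b i) x - s k) * c k 1) +
        θ x * ∑ k, heav (inner ℝ (b i) x - s k) * c k 2 := by
    rw [Finset.mul_sum, ← Finset.sum_add_distrib]
    exact Finset.sum_congr rfl fun k _ => by ring
  have e2 : ∑ k, heav (inner ℝ (b i) x - s k) * (c k 2 * inner ℝ (b i) x + c k 3) =
      (∑ k, heav (inner ℝ (b i) x - s k) * c k 2) * inner ℝ (b i) x +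
        ∑ k, heav (inner ℝ (b i) x - s k) * c k 3 := by
    rw [Finset.sum_mul, ← Finset.sum_add_distrib]
    exact Finset.sum_congr rfl fun k _ => by ring
  rw [e1, e2]
  module

lemma hasSBVDerivative_scalarLaminate (hθ : IsTest θ) (hs : ∀ k, |s k| < 1 / 2) :
    HasSBVDerivative (cube b) (scalarLaminate θ b i lam s c₀ c)
      (scalarLaminateGradient θ b i lam s c₀ c) :=
  hasSBVDerivative_laminate (contDiff_profile_smul hθ _ _ _ _ _)
    (fun _ => contDiff_profile_smul hθ _ _ _ _ _) hs

lemma greenForm_scalarLaminate (hθ : IsTest θ) (hs : ∀ k, |s k| < 1 / 2)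
    {φ : Vec (n + 1) → ℝ} (hφ : IsTest φ) :
    greenForm (cube b) (scalarLaminate θ b i lam s c₀ c)
      (scalarLaminateGradient θ b i lam s c₀ c) φ =
        boundaryForm b (scalarLaminate θ b i lam s c₀ c) φ :=
  greenForm_laminate (contDiff_profile_smul hθ _ _ _ _ _)
    (fun _ => contDiff_profile_smul hθ _ _ _ _ _) hs hφ

lemma scalarLaminate_jump (hθ : IsTest θ) (x : Vec (n + 1)) :
    (x ∈ jumpSet (scalarLaminate θ b i lam s c₀ c) ↔ laminateJump b i s
      (fun k x => profile θ b i (c k 0) (c k 1) (c k 2) (c k 3) x • lam) x ≠ 0) ∧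
    jumpTensor (scalarLaminate θ b i lam s c₀ c) x = tensor (laminateJump b i s
      (fun k x => profile θ b i (c k 0) (c k 1) (c k 2) (c k 3) x • lam) x) (b i) :=
  ⟨mem_jumpSet_laminate (contDiff_profile_smul hθ _ _ _ _ _).continuous
    (fun _ => (contDiff_profile_smul hθ _ _ _ _ _).continuous) x,
  jumpTensor_laminate (contDiff_profile_smul hθ _ _ _ _ _).continuous
    (fun _ => (contDiff_profile_smul hθ _ _ _ _ _).continuous) x⟩

lemma laminateJump_eq_zero {f : ι → Vec N → Vec d} {b : OrthonormalBasis (Fin N) ℝ (Vec N)}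
    {i : Fin N} {x : Vec N} (h : ∀ k, inner ℝ (b i) x = s k → f k x = 0) :
    laminateJump b i s f x = 0 :=
  Finset.sum_eq_zero fun k _ => Set.indicator_apply_eq_zero.2 fun hk => h k hk

/-- Distinct offsets give disjoint hyperplanes, so at most one summand is active at a given point.
-/
lemma norm_laminateJump_le {f : ι → Vec N → Vec d} {b : OrthonormalBasis (Fin N) ℝ (Vec N)}
    {i : Fin N} {x : Vec N} (hs : Function.Injective s) {C : ℝ} (hC : 0 ≤ C)
    (h : ∀ k, inner ℝ (b i) x = s k → ‖f k x‖ ≤ C) : ‖laminateJump b i s f x‖ ≤ C := by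
  by_cases hx : ∃ k, inner ℝ (b i) x = s k
  · obtain ⟨k, hk⟩ := hx
    rw [laminateJump, Finset.sum_eq_single k, Set.indicator_of_mem (show x ∈ plane b i (s k) from hk)]
    · exact h k hk
    · intro j _ hjk
      have hj : x ∉ plane b i (s j) := fun hj => hjk (hs (Eq.trans (Eq.symm hj) hk))
      exact Set.indicator_of_notMem hj (f j)
    · exact fun h => absurd (Finset.mem_univ k) h
  · have h0 : laminateJump b i s f x = 0 := laminateJump_eq_zero fun k hk => absurd ⟨k, hk⟩ hx
    rwa [h0, norm_zero]

lemma setIntegral_le_mul {X : Type*} [MeasurableSpace X] {μ : Measure X} {S : Set X}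
    {f : X → ℝ} {C : ℝ} (hS : MeasurableSet S) (hμ : μ S ≠ ⊤) (hC : 0 ≤ C)
    (hf : ∀ x ∈ S, f x ≤ C) : ∫ x in S, f x ∂μ ≤ C * μ.real S := by
  by_cases hi : IntegrableOn f S μ
  · calc ∫ x in S, f x ∂μ ≤ ∫ _x in S, C ∂μ :=
          setIntegral_mono_on hi (integrableOn_const hμ) hS hf
      _ = C * μ.real S := by rw [setIntegral_const, smul_eq_mul, mul_comm]
  · rw [integral_undef hi]; positivity

lemma volume_slab (b : OrthonormalBasis (Fin (n + 1)) ℝ (Vec (n + 1))) (i : Fin (n + 1)) {h : ℝ}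
    (hh0 : 0 ≤ h) (hh : h < 1 / 2) :
    volume.real {x ∈ cube b | |inner ℝ (b i) x| ≤ h} = 2 * h := by
  have hm : MeasurableSet {x ∈ cube b | |inner ℝ (b i) x| ≤ h} :=
    (isOpen_cube b).measurableSet.inter
      (show IsClosed {x : Vec (n + 1) | |inner ℝ (b i) x| ≤ h} from
        isClosed_le (by fun_prop) continuous_const).measurableSet
  rw [Measure.real, ← (measurePreserving_coord b i).measure_preimage hm.nullMeasurableSet]
  have e : (fun p : ℝ × Vec n => coord b i p.1 p.2) ⁻¹' {x ∈ cube b | |inner ℝ (b i) x| ≤ h} =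
      Set.Icc (-h) h ×ˢ unitCube n := by
    ext ⟨t, y⟩
    have := Set.ext_iff.1 (preimage_prod_cube b i) (t, y)
    simp only [Set.mem_preimage, Set.mem_prod] at this
    simp only [Set.mem_preimage, Set.mem_sep_iff, this, inner_coord_self, Set.mem_prod,
      Set.mem_Icc, Set.mem_Ioo, abs_le]
    constructor
    · rintro ⟨⟨_, h1⟩, h2⟩; exact ⟨h2, h1⟩
    · rintro ⟨h1, h2⟩; exact ⟨⟨⟨by linarith, by linarith⟩, h2⟩, h1⟩
  rw [e, Measure.prod_prod, volume_unitCube, mul_one, Real.volume_Icc, ENNReal.toReal_ofReal]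
  · ring
  · linarith

/-- Cells centred at integer points z/m with |z j| ≤ p fill, up to a null set, the cube of side
(2p+1)/m. Ratios of odd numbers are therefore the natural side lengths of the region where the
cutoff equals 1. -/
lemma tendsto_odd_ratio : Tendsto (fun q : ℕ => ((2 * q + 1) / (2 * q + 3) : ℝ)) atTop (𝓝 1) := by
  have h1 : Tendsto (fun q : ℕ => (2 * q + 3 : ℝ)) atTop atTop :=
    tendsto_atTop_add_const_right _ _
      (tendsto_natCast_atTop_atTop.const_mul_atTop two_pos)
  have h2 : Tendsto (fun q : ℕ => 1 - 2 / (2 * q + 3 : ℝ)) atTop (𝓝 (1 - 0)) :=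
    (tendsto_const_nhds.div_atTop h1).const_sub 1
  rw [sub_zero] at h2
  refine h2.congr fun q => ?_
  have : (2 * q + 3 : ℝ) ≠ 0 := by positivity
  field_simp
  ring

/-- Odd subdivisions compatible with a given ratio. -/
lemma exists_subdivision (q : ℕ) (C : ℝ) : ∃ m M p : ℕ, m = 2 * M + 1 ∧ 3 ≤ m ∧ C ≤ m ∧
    ((2 * p + 1) / m : ℝ) = (2 * q + 1) / (2 * q + 3) := by
  obtain ⟨l, hl⟩ := exists_nat_ge C
  -- The cutoff depends on the ratio, and m must then be large compared with its gradient.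
  -- Multiplying numerator and denominator by the odd number 2l + 1 refines the lattice while
  -- keeping the ratio: m = (2q+3)(2l+1) and 2p + 1 = (2q+1)(2l+1).
  refine ⟨(2 * q + 3) * (2 * l + 1), 2 * q * l + q + 3 * l + 1, 2 * q * l + q + l, by ring,
    by nlinarith [Nat.zero_le (q * l)], ?_, ?_⟩
  · push_cast
    have : (0 : ℝ) ≤ q * l := by positivity
    have : (0 : ℝ) ≤ l := by positivity
    have : (0 : ℝ) ≤ q := by positivity
    nlinarith
  · push_cast
    have : (2 * q + 3 : ℝ) ≠ 0 := by positivity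
    have : (2 * l + 1 : ℝ) ≠ 0 := by positivity
    field_simp
    ring

/-- A cutoff which is constant on a smaller cube. -/
lemma exists_cutoff_of_lt_one (b : OrthonormalBasis (Fin (n + 1)) ℝ (Vec (n + 1))) {ρ : ℝ}
    (hρ : ρ < 1) : ∃ (θ : Vec (n + 1) → ℝ) (C : ℝ), IsTest θ ∧ tsupport θ ⊆ cube b ∧ 0 ≤ C ∧
      (∀ x, θ x ∈ Set.Icc (0 : ℝ) 1) ∧ (∀ x, ‖gradient θ x‖ ≤ C) ∧
      ∀ x, (∀ i, |inner ℝ (b i) x| ≤ ρ / 2) → θ x = 1 ∧ gradient θ x = 0 := by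
  obtain ⟨θ, h1, h2, h3, h4⟩ := exists_cutoff b
    (K := {x | ∀ i, |inner ℝ (b i) x| ≤ ρ / 2}) (by
      rw [Set.ofPred_forall]
      exact isClosed_iInter fun i => isClosed_le (by fun_prop) continuous_const)
    (fun x hx i => (hx i).trans_lt (by linarith))
  obtain ⟨C, hC⟩ := h1.exists_gradient_bound
  refine ⟨θ, C, h1, h2, (norm_nonneg _).trans (hC 0), h4, hC, fun x hx => ?_⟩
  have h5 := h3 x hx
  exact ⟨h5.eq_of_nhds, by rw [gradient, h5.fderiv_eq, Pi.one_def, fderiv_const_apply, map_zero]⟩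

lemma heav_sub_of_mem {t s : ℝ} (h : s < t) : heav (t - s) = 1 := heav_of_pos (sub_pos.2 h)

lemma heav_sub_of_lt {t s : ℝ} (h : t < s) : heav (t - s) = 0 := heav_of_neg (sub_neg.2 h)

end Profile

/-! ### Fillings by lattice cubes -/

section LatticeFilling

variable {n : ℕ} {b : OrthonormalBasis (Fin (n + 1)) ℝ (Vec (n + 1))} {i : Fin (n + 1)} {m : ℕ}
  {g : Vec (n + 1) → Vec d} {G : Vec (n + 1) → Mat d (n + 1)}

/-- A filling which consists of lattice cubes, on which the base function is composed of
rescalings of one function, and one further cube, on which the base function is constant. -/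
def Filling.ofLattice (hm : 0 < m) (K : Finset (Fin (n + 1) → ℤ)) {t : ℝ} (ht : 0 < t)
    (c : (Fin (n + 1) → ℤ) → Vec d) {f : Vec (n + 1) → Vec d} {Gf : Vec (n + 1) → Mat d (n + 1)}
    (hf : IntegrableOn f (cube b)) {x₀ : Vec (n + 1)} {r₀ t₀ : ℝ} (hr₀ : 0 < r₀) (ht₀ : 0 < t₀)
    (c₀ : Vec d) (hsub : ∀ z ∈ K, latticeCell b m z ⊆ cube b)
    (hsub₀ : zoom x₀ r₀ ⁻¹' cube b ⊆ cube b)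
    (hdisj : ∀ z ∈ K, Disjoint (zoom x₀ r₀ ⁻¹' cube b) (latticeCell b m z))
    (hbase : ∀ z ∈ K, ∀ y ∈ latticeCell b m z,
      g y = rescale (latticePoint b m z) (1 / m) t (c z) f y ∧
        G y = rescaleGradient (latticePoint b m z) (1 / m) t Gf y)
    (hbase₀ : ∀ y ∈ zoom x₀ r₀ ⁻¹' cube b, g y = c₀ ∧ G y = 0)
    (hnull : ∀ z ∈ K, (μHE[n + 1 - 1] : Measure (Vec (n + 1)))
      (frontier (latticeCell b m z) ∩ jumpSet g) = 0)
    (hnull₀ : (μHE[n + 1 - 1] : Measure (Vec (n + 1)))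
      (frontier (zoom x₀ r₀ ⁻¹' cube b) ∩ jumpSet g) = 0) :
    Filling b b g G (Option K) where
  x k := k.elim x₀ fun z => latticePoint b m z
  r k := k.elim r₀ fun _ => 1 / m
  t k := k.elim t₀ fun _ => t
  c k := k.elim c₀ fun z => c z
  m k := k.elim (fun x => mulVec (0 : Mat d (n + 1)) x) fun _ => f
  Gm k := k.elim (fun _ => 0) fun _ => Gf
  hr := by
    have : (0 : ℝ) < m := by exact_mod_cast hm
    rintro (_ | z)
    · exact hr₀
    · exact one_div_pos.2 this
  ht := by
    rintro (_ | z)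
    · exact ht₀
    · exact ht
  hm := by
    rintro (_ | z)
    · exact Continuous.integrableOn_cube (continuous_mulVec 0)
    · exact hf
  subset := by
    rintro (_ | z)
    · exact hsub₀
    · exact hsub z z.2
  disjoint := by
    rintro (_ | z) (_ | z') hzz
    · exact absurd rfl hzz
    · exact hdisj z' z'.2
    · exact (hdisj z z.2).symm
    · exact disjoint_latticeCell hm b fun h => hzz (congrArg some (Subtype.ext h))
  base := by
    rintro (_ | z) y hy
    · change g y = t₀ • mulVec (0 : Mat d (n + 1)) _ + c₀
      rw [zero_mulVec, smul_zero, zero_add]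
      exact (hbase₀ y hy).1
    · exact (hbase z z.2 y hy).1
  base_gradient := by
    rintro (_ | z) y hy
    · change G y = (t₀ / r₀) • (0 : Mat d (n + 1))
      rw [smul_zero]
      exact (hbase₀ y hy).2
    · exact (hbase z z.2 y hy).2
  null := by
    rintro (_ | z)
    · exact hnull₀
    · exact hnull z z.2

lemma sum_erase_none {κ : Type*} [Fintype κ] [DecidableEq (Option κ)] (f : Option κ → ℝ) :
    ∑ k ∈ Finset.univ.erase none, f k = ∑ k, f (some k) := by
  have h1 := Finset.add_sum_erase Finset.univ f (Finset.mem_univ none)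
  rw [Fintype.sum_option] at h1
  exact add_left_cancel h1

/-- The gradient is supported in `S` and the jumps in `T`, so what the cells leave uncovered of
these two sets controls the variation. -/
lemma Filling.defect_le {κ : Type*} [Fintype κ] (F : Filling b b g G κ) {S T : Set (Vec (n + 1))}
    (hS : MeasurableSet S) (hT : MeasurableSet T) (hSb : S ⊆ cube b) (hTb : T ⊆ cube b)
    (hTt : (μHE[n + 1 - 1] : Measure (Vec (n + 1))) T ≠ ⊤) {C₁ C₂ : ℝ} (hC₁ : 0 ≤ C₁)
    (hC₂ : 0 ≤ C₂) (hG : ∀ x ∈ S, ‖G x‖ ≤ C₁) (hG0 : ∀ x ∈ cube b, x ∉ S → G x = 0)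
    (hJ : ∀ x ∈ T, ‖jumpTensor g x‖ ≤ C₂) (hJT : cube b ∩ jumpSet g ⊆ T) :
    F.defect ≤ C₁ * volume.real (S \ F.union) +
      C₂ * (μHE[n + 1 - 1] : Measure (Vec (n + 1))).real (T \ F.union) := by
  have hU := F.isOpen_union.measurableSet
  have hSt : volume S ≠ ⊤ :=
    ne_top_of_le_ne_top (by rw [volume_cube]; simp : volume (cube b) ≠ ⊤) (measure_mono hSb)
  rw [Filling.defect, Filling.residual]
  refine add_le_add ?_ ?_
  · rw [setIntegral_eq_of_subset_of_forall_sdiff_eq_zero (s := S \ F.union)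
      ((isOpen_cube b).measurableSet.diff hU) (Set.sdiff_subset_sdiff_left hSb)]
    · exact setIntegral_le_mul (hS.diff hU)
        (ne_top_of_le_ne_top hSt (measure_mono Set.sdiff_subset)) hC₁ fun x hx => hG x hx.1
    · rintro x ⟨hx, hxS⟩
      rw [hG0 x hx.1 fun h => hxS ⟨h, hx.2⟩, norm_zero]
  · rw [← setIntegral_eq_of_subset_of_forall_sdiff_eq_zero (t := T \ F.union) (hT.diff hU)]
    · exact setIntegral_le_mul (hT.diff hU)
        (ne_top_of_le_ne_top hTt (measure_mono Set.sdiff_subset)) hC₂ fun x hx => hJ x hx.1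
    · rintro x ⟨hx, hxJ⟩
      exact ⟨hJT ⟨hx.1, hxJ⟩, hx.2⟩
    · rintro x ⟨hx, hxS⟩
      rw [jumpTensor_of_notMem fun h => hxS ⟨⟨hTb hx.1, hx.2⟩, h⟩, norm_zero]

lemma inner_zoom_latticePoint (hm : 0 < m) (b : OrthonormalBasis (Fin N) ℝ (Vec N)) (i : Fin N)
    (z : Fin N → ℤ) (y : Vec N) : inner ℝ (b i) (zoom (latticePoint b m z) (1 / m) y) =
      m * inner ℝ (b i) y - z i := by
  have hm' : (m : ℝ) ≠ 0 := by exact_mod_cast hm.ne'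
  rw [zoom, inner_smul_right, inner_sub_right, inner_latticePoint]
  field_simp

lemma hausdorff_plane_inter_latticeCell (hm : 0 < m)
    (b : OrthonormalBasis (Fin (n + 1)) ℝ (Vec (n + 1))) (i : Fin (n + 1))
    (z : Fin (n + 1) → ℤ) : (μHE[n + 1 - 1] : Measure (Vec (n + 1))).real
      (plane b i ((z i : ℝ) / m) ∩ latticeCell b m z) = (1 / m : ℝ) ^ n := by
  have hm' : (0 : ℝ) < m := by exact_mod_cast hm
  have hr : (0 : ℝ) < 1 / m := by positivity
  have e : plane b i ((z i : ℝ) / m) ∩ latticeCell b m z =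
      zoom (latticePoint b m z) (1 / m) ⁻¹' (plane b i 0 ∩ cube b) := by
    rw [Set.preimage_inter]
    congr 1
    ext y
    change inner ℝ (b i) y = _ ↔ inner ℝ (b i) (zoom _ _ y) = 0
    rw [zoom, inner_smul_right, inner_sub_right, inner_latticePoint, mul_eq_zero,
      or_iff_right (inv_ne_zero hr.ne'), sub_eq_zero]
  rw [e, Measure.real, ← (measurableEmbedding_zoom _ hr).map_apply, map_zoom_hausdorff _ _ hr,
    Measure.smul_apply, hausdorff_plane_inter_cube_le b i (by norm_num : |(0 : ℝ)| < 1 / 2),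
    smul_eq_mul, mul_one, ENNReal.toReal_ofReal (by positivity), Nat.add_sub_cancel]

/-- The exceptional cell `none` is not counted; ignoring it only weakens the bound. -/
lemma measureReal_sdiff_union_le {κ : Type*} [Fintype κ] (F : Filling b b g G (Option κ))
    {ν : Measure (Vec (n + 1))} {S : Set (Vec (n + 1))} (hS : MeasurableSet S) (hSt : ν S ≠ ⊤)
    {a : ℝ} (ha : ∀ k, a ≤ ν.real (S ∩ F.cell (some k))) :
    ν.real (S \ F.union) ≤ ν.real S - Fintype.card κ * a := by
  rw [← Finset.card_univ]
  refine measureReal_sdiff_le (c := fun k => S ∩ F.cell (some k)) hSt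
    (fun k => hS.inter (F.isOpen_cell _).measurableSet) (fun k l hkl => ?_)
    (fun k _ => Set.inter_subset_left)
    (fun k _ => Set.inter_subset_right.trans (Set.subset_iUnion F.cell _)) fun k _ => ha k
  exact (F.disjoint (Option.some_injective _ |>.ne hkl)).mono
    Set.inter_subset_right Set.inter_subset_right

lemma abs_inner_le_of_abs_sub_le (hm : 0 < m) {z : Fin N → ℤ} {b : OrthonormalBasis (Fin N) ℝ (Vec N)}
    {y : Vec N} {ρ : ℝ} (hz : ∀ j, (2 * |z j| + 1 : ℝ) / m ≤ ρ)
    (hy : ∀ j, |inner ℝ (b j) y - (z j : ℝ) / m| ≤ 1 / m / 2) (j : Fin N) :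
    |inner ℝ (b j) y| ≤ ρ / 2 := by
  have hm' : (0 : ℝ) < m := by exact_mod_cast hm
  have h1 := abs_sub_abs_le_abs_sub (inner ℝ (b j) y) ((z j : ℝ) / m)
  rw [abs_div, abs_of_pos hm'] at h1
  have h2 : (2 * |z j| + 1 : ℝ) / m = 2 * (|(z j : ℝ)| / m) + 1 / m := by push_cast; ring
  linarith [hz j, hy j]

lemma abs_le_of_mem_frontier_latticeCell (hm : 0 < m) {z : Fin N → ℤ}
    {b : OrthonormalBasis (Fin N) ℝ (Vec N)} {y : Vec N} (hy : y ∈ frontier (latticeCell b m z))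
    (j : Fin N) : |inner ℝ (b j) y - (z j : ℝ) / m| ≤ 1 / m / 2 := by
  have hm' : (0 : ℝ) < m := by exact_mod_cast hm
  have := abs_le_of_mem_frontier_preimage_zoom (by positivity) hy j
  rwa [inner_latticePoint] at this

end LatticeFilling

/-! ### Approximation of jumps by affine functions -/

section Ramp

variable {n : ℕ} {b : OrthonormalBasis (Fin (n + 1)) ℝ (Vec (n + 1))} {i : Fin (n + 1)}

lemma elementaryJump_eq (lam : Vec d) (b : OrthonormalBasis (Fin N) ℝ (Vec N)) (i : Fin N)
    (x : Vec N) : elementaryJump lam (b i) x = heav (inner ℝ (b i) x) • lam := by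
  rw [elementaryJump, heav, real_inner_comm]

lemma cutoff_eq_zero {θ : Vec N → ℝ} {b : OrthonormalBasis (Fin N) ℝ (Vec N)}
    (h : tsupport θ ⊆ cube b) {x : Vec N} (hx : x ∉ cube b) : θ x = 0 :=
  image_eq_zero_of_notMem_tsupport fun hx' => hx (h hx')

/-- The offsets of the discontinuities of the ramp function. -/
def rampOffset (m : ℕ) : Fin 3 → ℝ := ![-(1 / m / 2), 0, 1 / m / 2]

/-- The coefficients of the ramp function. -/
def rampCoeff (m : ℕ) : Fin 3 → Fin 4 → ℝ := ![![0, 0, m, 1 / 2], ![1, 0, 0, -1], ![0, 0, -m, 1 / 2]]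

variable {θ : Vec (n + 1) → ℝ} {lam : Vec d} {m : ℕ}

/-- With t = x·b i, where θ = 1 this is the continuous ramp that rises from 0 to λ with slope m on
|t| ≤ 1/(2m). Where θ = 0 it is the elementary jump, which secures the trace. -/
lemma ramp_apply (x : Vec (n + 1)) : scalarLaminate θ b i lam (rampOffset m) 0 (rampCoeff m) x =
    (heav (inner ℝ (b i) x - -(1 / m / 2)) * (θ x * (m * inner ℝ (b i) x + 1 / 2)) +
      heav (inner ℝ (b i) x - 0) * (1 - θ x) +
      heav (inner ℝ (b i) x - 1 / m / 2) * (θ x * (-(m * inner ℝ (b i) x) + 1 / 2))) • lam := by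
  rw [scalarLaminate_apply, Fin.sum_univ_three]
  congr 1
  change profile θ b i 0 0 0 0 x +
    (heav (inner ℝ (b i) x - -(1 / m / 2)) * profile θ b i 0 0 m (1 / 2) x +
      heav (inner ℝ (b i) x - 0) * profile θ b i 1 0 0 (-1) x +
      heav (inner ℝ (b i) x - 1 / m / 2) * profile θ b i 0 0 (-m) (1 / 2) x) = _
  simp only [profile]
  ring

lemma rampGradient_apply (hθ : IsTest θ) (x : Vec (n + 1)) :
    scalarLaminateGradient θ b i lam (rampOffset m) 0 (rampCoeff m) x = tensor lam
      ((θ x * (m * (heav (inner ℝ (b i) x - -(1 / m / 2)) - heav (inner ℝ (b i) x - 1 / m / 2)))) •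
          b i +
        ((heav (inner ℝ (b i) x - -(1 / m / 2)) - heav (inner ℝ (b i) x - 1 / m / 2)) *
          (m * inner ℝ (b i) x) + (heav (inner ℝ (b i) x - -(1 / m / 2)) / 2 -
            heav (inner ℝ (b i) x - 0) + heav (inner ℝ (b i) x - 1 / m / 2) / 2)) •
          gradient θ x) := by
  rw [scalarLaminateGradient_apply hθ]
  simp [Fin.sum_univ_three, rampOffset, rampCoeff]
  congr 3 <;> ring

/-- The outer profiles vanish at the offsets ±1/(2m), where they are switched on and off. The
central one has height 1 − θ, so a jump survives only on the hyperplane t = 0 where θ ≠ 1. -/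
lemma ramp_jump_eq_zero (hm : 0 < m) {x : Vec (n + 1)} (h : inner ℝ (b i) x ≠ 0 ∨ θ x = 1) :
    laminateJump b i (rampOffset m) (fun k x => profile θ b i (rampCoeff m k 0) (rampCoeff m k 1)
      (rampCoeff m k 2) (rampCoeff m k 3) x • lam) x = 0 := by
  have hm' : (m : ℝ) ≠ 0 := by exact_mod_cast hm.ne'
  refine laminateJump_eq_zero fun k hk => ?_
  fin_cases k
  · have hk : inner ℝ (b i) x = -(1 / m / 2) := hk
    simp [profile, rampCoeff, hk]
    left; right; field_simp; ring
  · have hk : inner ℝ (b i) x = 0 := hk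
    rw [or_iff_right (not_not.2 hk)] at h
    simp [profile, rampCoeff, h]
  · have hk : inner ℝ (b i) x = 1 / m / 2 := hk
    simp [profile, rampCoeff, hk]
    left; right; field_simp; ring

lemma norm_ramp_jump_le (hm : 0 < m) (hθ : ∀ x, θ x ∈ Set.Icc (0 : ℝ) 1) (x : Vec (n + 1)) :
    ‖laminateJump b i (rampOffset m) (fun k x => profile θ b i (rampCoeff m k 0) (rampCoeff m k 1)
      (rampCoeff m k 2) (rampCoeff m k 3) x • lam) x‖ ≤ ‖lam‖ := by
  have hm' : (0 : ℝ) < m := by exact_mod_cast hm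
  by_cases h : inner ℝ (b i) x = 0
  · have h0 : (0 : ℝ) < 1 / m / 2 := by positivity
    have e1 : x ∉ plane b i (-(1 / m / 2)) := fun hx => by
      have hx : inner ℝ (b i) x = -(1 / m / 2) := hx
      linarith
    have e2 : x ∉ plane b i (1 / m / 2) := fun hx => by
      have hx : inner ℝ (b i) x = 1 / m / 2 := hx
      linarith
    rw [laminateJump, Fin.sum_univ_three]
    change ‖(plane b i (-(1 / m / 2))).indicator _ x + (plane b i 0).indicator _ x +
      (plane b i (1 / m / 2)).indicator _ x‖ ≤ _
    rw [Set.indicator_of_notMem e1, Set.indicator_of_notMem e2, zero_add, add_zero,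
      Set.indicator_of_mem (show x ∈ plane b i 0 from h), norm_smul]
    refine mul_le_of_le_one_left (norm_nonneg _) ?_
    simp [profile, rampCoeff]
    rw [abs_le]
    constructor <;> linarith [(hθ x).1, (hθ x).2]
  · rw [ramp_jump_eq_zero hm (Or.inl h), norm_zero]
    exact norm_nonneg _

/-- The steep part contributes at most m. The coefficient of the gradient of θ is at most 3, so the
condition 3C ≤ m absorbs the cutoff into a second m. -/
lemma norm_rampGradient_le (hm : 0 < m) (hθ : IsTest θ) (hθ1 : ∀ x, θ x ∈ Set.Icc (0 : ℝ) 1)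
    {C : ℝ} (hC : ∀ x, ‖gradient θ x‖ ≤ C) (hCm : 3 * C ≤ m) {x : Vec (n + 1)}
    (hx : |inner ℝ (b i) x| ≤ 1 / m / 2) :
    ‖scalarLaminateGradient θ b i lam (rampOffset m) 0 (rampCoeff m) x‖ ≤ ‖lam‖ * (2 * m) := by
  have hm' : (0 : ℝ) < m := by exact_mod_cast hm
  rw [rampGradient_apply hθ, norm_tensor]
  refine mul_le_mul_of_nonneg_left ((norm_add_le _ _).trans ?_) (norm_nonneg _)
  rw [norm_smul, norm_smul, b.orthonormal.1, mul_one, Real.norm_eq_abs, Real.norm_eq_abs]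
  have a1 := heav_nonneg (inner ℝ (b i) x - -(1 / m / 2))
  have a2 := heav_le_one (inner ℝ (b i) x - -(1 / m / 2))
  have a3 := heav_nonneg (inner ℝ (b i) x - 0)
  have a4 := heav_le_one (inner ℝ (b i) x - 0)
  have a5 := heav_nonneg (inner ℝ (b i) x - 1 / m / 2)
  have a6 := heav_le_one (inner ℝ (b i) x - 1 / m / 2)
  have ht : |m * inner ℝ (b i) x| ≤ 1 := by
    rw [abs_mul, abs_of_pos hm']
    calc (m : ℝ) * |inner ℝ (b i) x| ≤ m * (1 / m / 2) := by gcongr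
      _ ≤ 1 := by field_simp; norm_num
  generalize heav (inner ℝ (b i) x - -(1 / m / 2)) = h1 at *
  generalize heav (inner ℝ (b i) x - 0) = h2 at *
  generalize heav (inner ℝ (b i) x - 1 / m / 2) = h3 at *
  have hd : |h1 - h3| ≤ 1 := by rw [abs_le]; constructor <;> linarith
  have k1 : |θ x * (m * (h1 - h3))| ≤ m := by
    rw [abs_mul, abs_mul, abs_of_pos hm', abs_of_nonneg (hθ1 x).1]
    calc θ x * (m * |h1 - h3|) ≤ 1 * (m * 1) := by
          gcongr
          exact (hθ1 x).2
      _ = m := by ring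
  have k2 : |(h1 - h3) * (m * inner ℝ (b i) x) + (h1 / 2 - h2 + h3 / 2)| ≤ 3 := by
    refine (abs_add_le _ _).trans ?_
    have : |(h1 - h3) * (m * inner ℝ (b i) x)| ≤ 1 := by
      rw [abs_mul]; exact mul_le_one₀ hd (abs_nonneg _) ht
    have : |h1 / 2 - h2 + h3 / 2| ≤ 1 := by rw [abs_le]; constructor <;> linarith
    linarith
  have k3 := mul_le_mul k2 (hC x) (norm_nonneg _) (by norm_num)
  linarith

lemma rampGradient_eq_zero (hm : 0 < m) (hθ : IsTest θ) {x : Vec (n + 1)}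
    (hx : 1 / m / 2 < |inner ℝ (b i) x|) :
    scalarLaminateGradient θ b i lam (rampOffset m) 0 (rampCoeff m) x = 0 := by
  have hm' : (0 : ℝ) < m := by exact_mod_cast hm
  have h0 : (0 : ℝ) < 1 / m / 2 := by positivity
  rw [rampGradient_apply hθ]
  rcases lt_abs.1 hx with h | h
  · rw [heav_sub_of_mem (s := -(1 / m / 2)) (by linarith), heav_sub_of_mem (s := 0) (by linarith),
      heav_sub_of_mem h]
    norm_num
  · rw [heav_sub_of_lt (s := -(1 / m / 2)) (by linarith), heav_sub_of_lt (s := 0) (by linarith),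
      heav_sub_of_lt (s := 1 / m / 2) (by linarith)]
    norm_num

/-- Jumps can be approximated by steep affine functions. -/
theorem hasFillings_elementaryJump (b : OrthonormalBasis (Fin (n + 1)) ℝ (Vec (n + 1)))
    (i : Fin (n + 1)) (lam : Vec d) :
    HasFillings b b (elementaryJump lam (b i)) (fun x => mulVec (tensor lam (b i)) x) := by
  classical
  intro η hη
  -- With ρ the ratio, the bulk defect is 2|λ|(1 − ρⁿ), the surviving jump costs |λ|(1 − ρⁿ), and
  -- the missing weight is 1 − ρⁿ. The exponent is n because only one layer of cells is used.
  have lim : Tendsto (fun q : ℕ => (3 * ‖lam‖ + 1) *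
      (1 - ((2 * q + 1) / (2 * q + 3) : ℝ) ^ n)) atTop (𝓝 0) := by
    simpa using ((tendsto_odd_ratio.pow n).const_sub 1).const_mul (3 * ‖lam‖ + 1)
  obtain ⟨q, hq⟩ := (lim.eventually (gt_mem_nhds hη)).exists
  have hρ : ((2 * q + 1) / (2 * q + 3) : ℝ) < 1 := by
    rw [div_lt_one (by positivity)]; linarith
  have hρ0 : (0 : ℝ) < (2 * q + 1) / (2 * q + 3) := by positivity
  obtain ⟨θ, C, hθ, hsupp, hC0, hθ1, hC, hθρ⟩ := exists_cutoff_of_lt_one b hρ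
  obtain ⟨m, M, p, hmM, hm3, hCm, hmp⟩ := exists_subdivision q (3 * C)
  rw [← hmp] at hq hρ hρ0 hθρ
  set ρ : ℝ := (2 * p + 1) / m with hρdef
  have hm : 0 < m := by omega
  have hm' : (0 : ℝ) < m := by exact_mod_cast hm
  have hm3' : (3 : ℝ) ≤ m := by exact_mod_cast hm3
  have hε : (0 : ℝ) < 1 / m / 2 := by positivity
  have hε3 : 1 / m / 2 ≤ (1 / 6 : ℝ) := by
    rw [div_div, div_le_div_iff₀ (by positivity) (by norm_num)]; linarith
  have hs : ∀ k, |rampOffset m k| < 1 / 2 := by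
    intro k
    fin_cases k
    · change |(-(1 / m / 2) : ℝ)| < 1 / 2
      rw [abs_neg, abs_of_pos hε]; linarith
    · change |(0 : ℝ)| < 1 / 2
      norm_num
    · change |(1 / m / 2 : ℝ)| < 1 / 2
      rw [abs_of_pos hε]; linarith
  set g := scalarLaminate θ b i lam (rampOffset m) 0 (rampCoeff m) with hg
  set G := scalarLaminateGradient θ b i lam (rampOffset m) 0 (rampCoeff m) with hG
  have hJ : ∀ x, x ∈ jumpSet g → inner ℝ (b i) x = 0 ∧ θ x ≠ 1 := by
    intro x hx
    by_contra h
    exact ((scalarLaminate_jump hθ x).1.1 hx) (ramp_jump_eq_zero hm (by tauto))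
  -- A single layer of cells centred on the jump hyperplane, within the region where the cutoff
  -- equals 1; the thickness of a cell is exactly the width of the ramp.
  let K : Finset (Fin (n + 1) → ℤ) :=
    Fintype.piFinset fun j => if j = i then {0} else Finset.Icc (-(p : ℤ)) p
  have hKi : ∀ z ∈ K, z i = 0 := fun z hz => by
    simpa using Fintype.mem_piFinset.1 hz i
  have hKj : ∀ z ∈ K, ∀ j, (2 * |z j| + 1 : ℝ) / m ≤ ρ := fun z hz j => by
    have h1 := Fintype.mem_piFinset.1 hz j
    have h2 : |z j| ≤ p := by
      split_ifs at h1 with h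
      · rw [Finset.mem_singleton] at h1
        simp [h1]
      · exact abs_le.2 (Finset.mem_Icc.1 h1)
    rw [hρdef]
    gcongr
    exact_mod_cast h2
  have hKc : K.card = (2 * p + 1) ^ n := by
    rw [Fintype.card_piFinset, Fin.prod_univ_succAbove _ i]
    simp only [if_pos, Finset.card_singleton, one_mul, Fin.succAbove_ne, if_false, Int.card_Icc,
      Finset.prod_const, Finset.card_univ, Fintype.card_fin]
    congr 1
    omega
  -- The exceptional cube is the cell directly above the layer, inside the unit cube since m ≥ 3.
  -- There the ramp has the constant value λ, so the affine data are A₀ = 0 and the scaling `t₀`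
  -- does not matter.
  let e : Fin (n + 1) → ℤ := fun j => if j = i then 1 else 0
  have hei : e i = 1 := if_pos rfl
  have hfr : ∀ z ∈ K, ∀ x, (∀ j, |inner ℝ (b j) x - (z j : ℝ) / m| ≤ 1 / m / 2) →
      θ x = 1 ∧ gradient θ x = 0 := fun z hz x hx =>
    hθρ x (abs_inner_le_of_abs_sub_le hm (hKj z hz) hx)
  have hcell : ∀ z ∈ K, ∀ y ∈ latticeCell b m z, |inner ℝ (b i) y| < 1 / m / 2 :=
    fun z hz y hy => by
      have := (mem_latticeCell hm).1 hy i
      rwa [hKi z hz, Int.cast_zero, zero_div, sub_zero] at this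
  have hcell0 : ∀ y ∈ latticeCell b m e, 1 / m / 2 < inner ℝ (b i) y := fun y hy => by
    have := (mem_latticeCell hm).1 hy i
    rw [hei, Int.cast_one, abs_lt] at this
    linarith [this.1]
  have hsub : ∀ z ∈ K, latticeCell b m z ⊆ cube b := fun z hz y hy j =>
    (abs_inner_le_of_abs_sub_le hm (hKj z hz)
      (fun j => ((mem_latticeCell hm).1 hy j).le) j).trans_lt (by linarith)
  -- On a cell the ramp is the rescaling with t = 1 and r = 1/m of the affine function with gradient
  -- λ ⊗ b i, plus λ/2. The weight of a cell is (1/m)ⁿ, and the (2p+1)ⁿ cells have total weight ρⁿ.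
  let F : Filling b b g G (Option K) := Filling.ofLattice hm K one_pos
    (fun _ => (1 / 2 : ℝ) • lam) (f := fun x => mulVec (tensor lam (b i)) x)
    (Gf := fun _ => tensor lam (b i)) (Continuous.integrableOn_cube (continuous_mulVec _))
    (x₀ := latticePoint b m e) (r₀ := 1 / m) (t₀ := 1) (by positivity) one_pos lam hsub
    (fun y hy j => by
      have h1 := (mem_latticeCell hm).1 hy j
      have h2 : |(e j : ℝ) / m| ≤ 1 / m := by
        by_cases h : j = i
        · rw [h, hei, Int.cast_one, abs_of_pos (by positivity)]
        · rw [show e j = 0 from if_neg h, Int.cast_zero, zero_div, abs_zero]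
          positivity
      have h3 := abs_sub_abs_le_abs_sub (inner ℝ (b j) y) ((e j : ℝ) / m)
      linarith)
    (fun z hz => disjoint_latticeCell hm b fun h => by
      have := hKi z hz
      rw [← h, hei] at this
      exact one_ne_zero this)
    (fun z hz y hy => by
      obtain ⟨h1, h2⟩ := hfr z hz y fun j => ((mem_latticeCell hm).1 hy j).le
      have h3 := abs_lt.1 (hcell z hz y hy)
      constructor
      · rw [hg, ramp_apply, h1, heav_sub_of_mem h3.1, heav_sub_of_lt h3.2, rescale, mulVec_tensor,
          real_inner_comm (b i), inner_zoom_latticePoint hm, hKi z hz, Int.cast_zero]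
        module
      · rw [hG, rampGradient_apply hθ, h1, h2, heav_sub_of_mem h3.1, heav_sub_of_lt h3.2,
          rescaleGradient, smul_zero, add_zero, tensor_smul_right]
        simp)
    (fun y hy => by
      have h1 := hcell0 y hy
      constructor
      · rw [hg, ramp_apply, heav_sub_of_mem (s := -(1 / m / 2)) (by linarith),
          heav_sub_of_mem (s := 0) (by linarith), heav_sub_of_mem h1]
        module
      · exact rampGradient_eq_zero hm hθ (h1.trans_le (le_abs_self _)))
    (fun z hz => by
      rw [Set.disjoint_iff_inter_eq_empty.1, measure_empty]
      exact Set.disjoint_left.2 fun x hx hxJ => (hJ x hxJ).2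
        (hfr z hz x fun j => abs_le_of_mem_frontier_latticeCell hm hx j).1)
    (by
      rw [Set.disjoint_iff_inter_eq_empty.1, measure_empty]
      refine Set.disjoint_left.2 fun x hx hxJ => ?_
      have h1 := abs_le_of_mem_frontier_latticeCell hm hx i
      rw [(hJ x hxJ).1, hei, Int.cast_one, abs_le] at h1
      linarith [h1.1])
  have hcard : (Fintype.card K : ℝ) = (2 * p + 1) ^ n := by
    rw [Fintype.card_coe, hKc]; push_cast; rfl
  have hρn : ((2 * p + 1) ^ n * (1 / m) ^ n : ℝ) = ρ ^ n := by
    rw [← mul_pow, hρdef, mul_one_div]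
  have hρn1 : ρ ^ n ≤ 1 := pow_le_one₀ hρ0.le hρ.le
  have hτ : ∑ k ∈ Finset.univ.erase none, F.t k * F.r k ^ n = ρ ^ n := by
    rw [sum_erase_none]
    change ∑ _k : K, (1 : ℝ) * (1 / m) ^ n = _
    rw [Finset.sum_const, Finset.card_univ, nsmul_eq_mul, hcard, one_mul, hρn]
  have hlam := norm_nonneg lam
  have hS : MeasurableSet {x ∈ cube b | |inner ℝ (b i) x| ≤ 1 / m / 2} :=
    (isOpen_cube b).measurableSet.inter
      (show IsClosed {x : Vec (n + 1) | |inner ℝ (b i) x| ≤ 1 / m / 2} from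
        isClosed_le (by fun_prop) continuous_const).measurableSet
  have hH := hausdorff_plane_inter_cube_le b i (by norm_num : |(0 : ℝ)| < 1 / 2)
  have hT : MeasurableSet (plane b i 0 ∩ cube b) :=
    (measurableSet_plane b i 0).inter (isOpen_cube b).measurableSet
  have hdef := F.defect_le (S := {x ∈ cube b | |inner ℝ (b i) x| ≤ 1 / m / 2})
    (T := plane b i 0 ∩ cube b) hS hT
    (fun x hx => hx.1) Set.inter_subset_right (by rw [hH]; exact ENNReal.one_ne_top)
    (C₁ := ‖lam‖ * (2 * m)) (C₂ := ‖lam‖) (by positivity) hlam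
    (fun x hx => norm_rampGradient_le hm hθ hθ1 hC hCm hx.2)
    (fun x hx hxS => rampGradient_eq_zero hm hθ (not_le.1 fun h => hxS ⟨hx, h⟩))
    (fun x _ => by
      rw [(scalarLaminate_jump hθ x).2, norm_tensor, b.orthonormal.1, mul_one]
      exact norm_ramp_jump_le hm hθ1 x)
    (fun x hx => ⟨(hJ x hx.2).1, hx.1⟩)
  have hv := measureReal_sdiff_union_le F (ν := volume) hS
    (ne_top_of_le_ne_top (by rw [volume_cube]; simp : volume (cube b) ≠ ⊤)
      (measure_mono fun x hx => hx.1)) (a := (1 / m : ℝ) ^ (n + 1)) (fun z => by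
      have e1 : latticeCell b m z ⊆ {x ∈ cube b | |inner ℝ (b i) x| ≤ 1 / m / 2} :=
        fun y hy => ⟨hsub z z.2 hy, (hcell z z.2 y hy).le⟩
      exact (volume_latticeCell hm b z).ge.trans
        (congrArg volume.real (Set.inter_eq_right.2 e1)).ge)
  have hh := measureReal_sdiff_union_le F hT (by rw [hH]; exact ENNReal.one_ne_top)
    (a := (1 / m : ℝ) ^ n) (fun z => by
      have e1 : plane b i 0 ∩ cube b ∩ F.cell (some z) =
          plane b i (((z : Fin (n + 1) → ℤ) i : ℝ) / m) ∩ latticeCell b m z := by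
        rw [Set.inter_assoc, hKi z z.2, Int.cast_zero, zero_div]
        congr 1
        exact Set.inter_eq_right.2 (hsub z z.2)
      rw [e1, hausdorff_plane_inter_latticeCell hm])
  rw [volume_slab b i hε.le (by linarith), hcard] at hv
  rw [measureReal_def _ (plane b i 0 ∩ cube b), hH, ENNReal.toReal_one, hcard, hρn] at hh
  have hv' : (2 * m : ℝ) * (2 * (1 / m / 2) - (2 * p + 1) ^ n * (1 / m) ^ (n + 1)) =
      2 * (1 - ρ ^ n) := by
    have hm1 : (m : ℝ) * (1 / m) = 1 := mul_one_div_cancel hm'.ne'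
    rw [← hρn, pow_succ]
    linear_combination (2 - 2 * ((2 * p + 1) ^ n * (1 / m) ^ n : ℝ)) * hm1
  refine ⟨Option K, inferInstance, inferInstance, g, G, F, none, _, _, 0,
    hasSBVDerivative_scalarLaminate hθ hs, fun φ hφ => ?_,
    (isCompetitor_mulVec b (tensor lam (b i))).trace, ?_, rfl, rfl, ?_, ?_, ?_, ?_⟩
  · rw [greenForm_scalarLaminate hθ hs hφ]
    refine boundaryForm_congr (fun x hx => ?_) φ
    rw [ramp_apply, cutoff_eq_zero hsupp hx, elementaryJump_eq, sub_zero (inner ℝ (b i) x)]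
    congr 1; ring
  · rintro (_ | k) hk
    · exact absurd rfl hk
    · exact ⟨rfl, rfl⟩
  · refine hdef.trans (le_trans ?_ hq.le)
    have h1 := mul_le_mul_of_nonneg_left hv (by positivity : 0 ≤ ‖lam‖ * (2 * m))
    rw [mul_assoc ‖lam‖ _ (_ - _), hv'] at h1
    have h2 := mul_le_mul_of_nonneg_left hh hlam
    linarith
  · rw [norm_zero, mul_zero]; exact hη.le
  · rw [hτ]; exact hρn1
  · rw [hτ]
    refine le_trans ?_ hq.le
    have : 0 ≤ 3 * ‖lam‖ * (1 - ρ ^ n) := mul_nonneg (by positivity) (by linarith)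
    linarith

end Ramp

/-! ### The staircase function -/

section Staircase

variable {n : ℕ} {b : OrthonormalBasis (Fin (n + 1)) ℝ (Vec (n + 1))} {i : Fin (n + 1)}

lemma heav_mul {c t : ℝ} (hc : 0 < c) : heav (c * t) = heav t := by
  rcases lt_trichotomy t 0 with h | rfl | h
  · rw [heav_of_neg h, heav_of_neg (mul_neg_of_pos_of_neg hc h)]
  · rw [mul_zero]
  · rw [heav_of_pos h, heav_of_pos (mul_pos hc h)]

/-- Elementary jumps are laminates. -/
lemma elementaryJump_eq_laminate (lam : Vec d) (b : OrthonormalBasis (Fin N) ℝ (Vec N))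
    (i : Fin N) : elementaryJump lam (b i) =
      laminate b i (fun _ : Unit => 0) (fun _ => 0) fun _ _ => lam := by
  ext1 x
  rw [elementaryJump_eq, laminate]
  simp

lemma jac_const (b : OrthonormalBasis (Fin N) ℝ (Vec N)) (a : Vec d) (x : Vec N) :
    jac b (fun _ => a) x = 0 := by
  simp [jac]

lemma greenForm_elementaryJump (lam : Vec d) (b : OrthonormalBasis (Fin (n + 1)) ℝ (Vec (n + 1)))
    (i : Fin (n + 1)) {φ : Vec (n + 1) → ℝ} (hφ : IsTest φ) :
    greenForm (cube b) (elementaryJump lam (b i)) (fun _ => 0) φ =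
      boundaryForm b (elementaryJump lam (b i)) φ := by
  have h := greenForm_laminate (b := b) (i := i) (s := fun _ : Unit => 0) (f₀ := fun _ => (0 : Vec d))
    (f := fun _ _ => lam) contDiff_const (fun _ => contDiff_const) (fun _ => by norm_num) hφ
  have e : laminateGradient b i (fun _ : Unit => 0) (fun _ => (0 : Vec d)) (fun _ _ => lam) =
      fun _ => 0 := by
    ext1 x
    simp [laminateGradient, jac_const]
  rwa [e, ← elementaryJump_eq_laminate] at h

lemma integrableOn_elementaryJump (lam : Vec d)
    (b : OrthonormalBasis (Fin (n + 1)) ℝ (Vec (n + 1))) (i : Fin (n + 1)) :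
    IntegrableOn (elementaryJump lam (b i)) (cube b) := by
  rw [elementaryJump_eq_laminate]
  exact integrableOn_laminate continuous_const fun _ => continuous_const

/-- The offsets of the discontinuities of the staircase function. -/
def stairOffset (M : ℕ) (j : Fin (2 * M + 1)) : ℝ := ((j : ℝ) - M) / ((2 * M + 1 : ℕ) : ℝ)

/-- The staircase function approximating the identity. -/
def stair (M : ℕ) (t : ℝ) : ℝ :=
  -(1 / 2) + ∑ j, heav (t - stairOffset M j) * (1 / ((2 * M + 1 : ℕ) : ℝ))

lemma stairOffset_injective (M : ℕ) : Function.Injective (stairOffset M) := by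
  intro j k h
  have hm : ((2 * M + 1 : ℕ) : ℝ) ≠ 0 := by positivity
  rw [stairOffset, stairOffset, div_left_inj' hm, sub_left_inj] at h
  exact Fin.ext (by exact_mod_cast h)

lemma abs_stairOffset_lt {M : ℕ} (j : Fin (2 * M + 1)) : |stairOffset M j| < 1 / 2 := by
  have hm : (0 : ℝ) < ((2 * M + 1 : ℕ) : ℝ) := by positivity
  have hj : (j : ℝ) < ((2 * M + 1 : ℕ) : ℝ) := by exact_mod_cast j.2
  have hj' : (j : ℝ) ≤ 2 * M := by exact_mod_cast Nat.lt_succ_iff.1 j.2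
  have h0 : (0 : ℝ) ≤ j := by positivity
  rw [stairOffset, abs_div, abs_of_pos hm, div_lt_iff₀ hm, abs_lt]
  push_cast
  constructor <;> linarith

/-- The steps sit at the midpoints k/m of the lattice intervals, m = 2M + 1. On the closed interval
of index k exactly k + M steps are complete, and −1/2 + (k+M)/m = (k − 1/2)/m; only the step in the
middle of the interval remains. -/
lemma stair_eq {M : ℕ} {k : ℤ} (hk : |k| ≤ M) {t : ℝ}
    (ht : |t - k / ((2 * M + 1 : ℕ) : ℝ)| ≤ 1 / ((2 * M + 1 : ℕ) : ℝ) / 2) :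
    stair M t = ((k : ℝ) - 1 / 2) / ((2 * M + 1 : ℕ) : ℝ) +
      1 / ((2 * M + 1 : ℕ) : ℝ) * heav (t - k / ((2 * M + 1 : ℕ) : ℝ)) := by
  set m : ℝ := ((2 * M + 1 : ℕ) : ℝ) with hmdef
  have hm : 0 < m := by rw [hmdef]; positivity
  have hm2 : m = 2 * M + 1 := by rw [hmdef]; push_cast; ring
  have hε : 0 < 1 / m := by positivity
  rw [abs_le] at hk ht
  obtain ⟨l, hl⟩ : ∃ l : ℕ, (l : ℤ) = k + M := ⟨(k + M).toNat, by omega⟩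
  have hlM : l < 2 * M + 1 := by omega
  have hl' : (k : ℝ) = l - M := by
    have : ((l : ℤ) : ℝ) = k + M := by rw [hl]; push_cast; ring
    rw [Int.cast_natCast] at this
    linarith
  have hval : ∀ j : ℕ, ((j : ℝ) - M) / m = k / m + ((j : ℝ) - l) * (1 / m) := by
    intro j; rw [hl']; ring
  have hsum : ∑ j, heav (t - stairOffset M j) = l + heav (t - k / m) := by
    change ∑ j : Fin (2 * M + 1), (fun j : ℕ => heav (t - ((j : ℝ) - M) / m)) j = _
    rw [Fin.sum_univ_eq_sum_range (fun j : ℕ => heav (t - ((j : ℝ) - M) / m)),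
      ← Finset.sum_subset (s₁ := Finset.range (l + 1)), Finset.sum_range_succ]
    · congr 1
      · rw [Finset.sum_congr rfl (g := fun _ => (1 : ℝ)), Finset.sum_const, Finset.card_range,
          nsmul_eq_mul, mul_one]
        intro j hj
        refine heav_sub_of_mem ?_
        have : (j : ℝ) + 1 ≤ l := by exact_mod_cast Finset.mem_range.1 hj
        rw [hval]
        nlinarith
      · rw [hval, sub_self, zero_mul, add_zero]
    · exact Finset.range_subset_range.2 hlM
    · intro j _ hj
      refine heav_sub_of_lt ?_
      have : (l : ℝ) + 1 ≤ j := by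
        have := Finset.mem_range.not.1 hj
        exact_mod_cast not_lt.1 this
      rw [hval]
      nlinarith
  rw [stair, ← Finset.sum_mul, hsum]
  change -(1 / 2) + (l + heav (t - k / m)) * (1 / m) = _
  generalize heav (t - k / m) = h
  have hM : (M : ℝ) = (m - 1) / 2 := by rw [hm2]; ring
  clear_value m
  rw [hl', hM]
  field_simp
  ring

lemma abs_stair_sub_le {M : ℕ} {t : ℝ} (ht : |t| < 1 / 2) :
    |stair M t - t| ≤ 1 / ((2 * M + 1 : ℕ) : ℝ) := by
  set m : ℝ := ((2 * M + 1 : ℕ) : ℝ) with hmdef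
  have hm : 0 < m := by rw [hmdef]; positivity
  have hm2 : m = 2 * M + 1 := by rw [hmdef]; push_cast; ring
  have h1 := abs_sub_round (m * t)
  have h2 : |t - (round (m * t) : ℝ) / m| ≤ 1 / m / 2 := by
    have : t - (round (m * t) : ℝ) / m = (m * t - round (m * t)) / m := by
      rw [sub_div, mul_div_cancel_left₀ _ hm.ne']
    rw [this, abs_div, abs_of_pos hm, div_le_iff₀ hm]
    refine h1.trans (le_of_eq ?_)
    field_simp
  have h3 : |round (m * t)| ≤ (M : ℤ) := by
    have h4 : |m * t| < M + 1 / 2 := by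
      rw [abs_mul, abs_of_pos hm]
      nlinarith
    have h5 := abs_sub_abs_le_abs_sub (round (m * t) : ℝ) (m * t)
    rw [abs_sub_comm] at h5
    have h6 : |(round (m * t) : ℝ)| < M + 1 := by linarith
    have h7 : |round (m * t)| < (M : ℤ) + 1 := by exact_mod_cast h6
    omega
  rw [stair_eq h3 h2]
  generalize (round (m * t) : ℤ) = k at *
  have a1 := heav_nonneg (t - k / m)
  have a2 := heav_le_one (t - k / m)
  have hε : 0 < 1 / m := by positivity
  have e : ((k : ℝ) - 1 / 2) / m + 1 / m * heav (t - k / m) - t =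
      1 / m * (heav (t - k / m) - 1 / 2) - (t - k / m) := by ring
  rw [e]
  rw [abs_le] at h2 ⊢
  constructor <;> nlinarith

/-- The coefficients of the staircase function. -/
def stairCoeff (M : ℕ) (_ : Fin (2 * M + 1)) : Fin 4 → ℝ := ![0, 0, 0, 1 / ((2 * M + 1 : ℕ) : ℝ)]

/-- The coefficients of the continuous part of the staircase function. -/
def stairCoeffZero : Fin 4 → ℝ := ![0, 1, -1, -(1 / 2)]

variable {θ : Vec (n + 1) → ℝ} {lam : Vec d} {M : ℕ}

/-- The cutoff interpolates between the linear function, which has the required trace, and the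
staircase. The difference between the two is at most 1/m in the cube, so the gradient of the cutoff
does little harm once m is large. -/
lemma staircase_apply (x : Vec (n + 1)) :
    scalarLaminate θ b i lam (stairOffset M) stairCoeffZero (stairCoeff M) x =
      (inner ℝ (b i) x + θ x * (stair M (inner ℝ (b i) x) - inner ℝ (b i) x)) • lam := by
  rw [scalarLaminate_apply]
  congr 1
  change profile θ b i 0 1 (-1) (-(1 / 2)) x + ∑ j, heav (inner ℝ (b i) x - stairOffset M j) *
    profile θ b i 0 0 0 (1 / ((2 * M + 1 : ℕ) : ℝ)) x = _
  rw [stair, ← Finset.sum_mul, ← Finset.sum_mul]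
  simp only [profile]
  ring

lemma staircaseGradient_apply (hθ : IsTest θ) (x : Vec (n + 1)) :
    scalarLaminateGradient θ b i lam (stairOffset M) stairCoeffZero (stairCoeff M) x =
      tensor lam ((1 - θ x) • b i +
        (stair M (inner ℝ (b i) x) - inner ℝ (b i) x) • gradient θ x) := by
  rw [scalarLaminateGradient_apply hθ]
  change tensor lam (((1 + ∑ j, heav (inner ℝ (b i) x - stairOffset M j) * 0) +
    θ x * (-1 + ∑ j, heav (inner ℝ (b i) x - stairOffset M j) * 0)) • b i +
    ((-1 + ∑ j, heav (inner ℝ (b i) x - stairOffset M j) * 0) * inner ℝ (b i) x +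
      (-(1 / 2) + ∑ j, heav (inner ℝ (b i) x - stairOffset M j) *
        (1 / ((2 * M + 1 : ℕ) : ℝ)))) • gradient θ x) = _
  simp only [mul_zero, Finset.sum_const_zero]
  rw [← stair]
  congr 3 <;> ring

lemma norm_staircase_jump_le (hθ : ∀ x, θ x ∈ Set.Icc (0 : ℝ) 1) (x : Vec (n + 1)) :
    ‖laminateJump b i (stairOffset M) (fun k x => profile θ b i (stairCoeff M k 0)
      (stairCoeff M k 1) (stairCoeff M k 2) (stairCoeff M k 3) x • lam) x‖ ≤
        1 / ((2 * M + 1 : ℕ) : ℝ) * ‖lam‖ := by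
  have hm : (0 : ℝ) < 1 / ((2 * M + 1 : ℕ) : ℝ) := by positivity
  refine norm_laminateJump_le (stairOffset_injective M) (by positivity) fun k _ => ?_
  change ‖profile θ b i 0 0 0 (1 / ((2 * M + 1 : ℕ) : ℝ)) x • lam‖ ≤ _
  rw [norm_smul, profile, Real.norm_eq_abs, zero_mul, zero_add, zero_add, zero_add,
    abs_mul, abs_of_pos hm, abs_of_nonneg (hθ x).1]
  gcongr
  exact mul_le_of_le_one_left hm.le (hθ x).2

lemma norm_staircaseGradient_le (hθ : IsTest θ) (hθ1 : ∀ x, θ x ∈ Set.Icc (0 : ℝ) 1)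
    {C : ℝ} (hC : ∀ x, ‖gradient θ x‖ ≤ C) (hCm : C ≤ ((2 * M + 1 : ℕ) : ℝ)) {x : Vec (n + 1)}
    (hx : x ∈ cube b) :
    ‖scalarLaminateGradient θ b i lam (stairOffset M) stairCoeffZero (stairCoeff M) x‖ ≤
      ‖lam‖ * 2 := by
  have hm : (0 : ℝ) < ((2 * M + 1 : ℕ) : ℝ) := by positivity
  rw [staircaseGradient_apply hθ, norm_tensor]
  refine mul_le_mul_of_nonneg_left ((norm_add_le _ _).trans ?_) (norm_nonneg _)
  rw [norm_smul, norm_smul, b.orthonormal.1, mul_one, Real.norm_eq_abs, Real.norm_eq_abs,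
    abs_of_nonneg (sub_nonneg.2 (hθ1 x).2)]
  have h1 := mul_le_mul (abs_stair_sub_le (M := M) (hx i)) ((hC x).trans hCm) (norm_nonneg _)
    (by positivity)
  rw [one_div_mul_cancel hm.ne'] at h1
  linarith [(hθ1 x).1]

end Staircase

/-! ### Approximation of affine functions by staircases -/

section StaircaseFilling

variable {n : ℕ}

lemma exists_int_of_mem_jumpSet_staircase {b : OrthonormalBasis (Fin (n + 1)) ℝ (Vec (n + 1))}
    {i : Fin (n + 1)} {θ : Vec (n + 1) → ℝ} {lam : Vec d} {M : ℕ} (hθ : IsTest θ)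
    {x : Vec (n + 1)} (hx : x ∈ jumpSet
      (scalarLaminate θ b i lam (stairOffset M) stairCoeffZero (stairCoeff M))) :
    ∃ j, inner ℝ (b i) x = stairOffset M j := by
  by_contra h
  push Not at h
  exact ((scalarLaminate_jump hθ x).1.1 hx) (laminateJump_eq_zero fun k hk => absurd hk (h k))

/-- Affine functions can be approximated by piecewise constant functions. -/
theorem hasFillings_mulVec_tensor (b : OrthonormalBasis (Fin (n + 1)) ℝ (Vec (n + 1)))
    (i : Fin (n + 1)) (lam : Vec d) :
    HasFillings b b (fun x => mulVec (tensor lam (b i)) x) (elementaryJump lam (b i)) := by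
  classical
  intro η hη
  have hlam := norm_nonneg lam
  have lim : Tendsto (fun q : ℕ => (3 * ‖lam‖ + 1) *
      (1 - ((2 * q + 1) / (2 * q + 3) : ℝ) ^ (n + 1))) atTop (𝓝 0) := by
    simpa using ((tendsto_odd_ratio.pow (n + 1)).const_sub 1).const_mul (3 * ‖lam‖ + 1)
  -- Half of η is kept for the cell at the origin, which will be removed from the filling; its
  -- weight ε^(n+1) is made small by the choice of m below.
  obtain ⟨q, hq⟩ := (lim.eventually (gt_mem_nhds (half_pos hη))).exists
  have hρ : ((2 * q + 1) / (2 * q + 3) : ℝ) < 1 := by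
    rw [div_lt_one (by positivity)]; linarith
  have hρ0 : (0 : ℝ) < (2 * q + 1) / (2 * q + 3) := by positivity
  obtain ⟨θ, C, hθ, hsupp, hC0, hθ1, hC, hθρ⟩ := exists_cutoff_of_lt_one b hρ
  have hD0 : 0 ≤ (3 * ‖lam‖ + 1) / (η / 2) := by positivity
  obtain ⟨m, M, p, rfl, hm3, hCm, hmp⟩ :=
    exists_subdivision q (C + (3 * ‖lam‖ + 1) / (η / 2))
  rw [← hmp] at hq hρ hρ0 hθρ
  have hm : 0 < 2 * M + 1 := by omega
  have hm' : (0 : ℝ) < ((2 * M + 1 : ℕ) : ℝ) := by positivity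
  have hm1 : (1 : ℝ) ≤ ((2 * M + 1 : ℕ) : ℝ) := by exact_mod_cast hm
  set ρ : ℝ := (2 * p + 1) / ((2 * M + 1 : ℕ) : ℝ) with hρdef
  set ε : ℝ := 1 / ((2 * M + 1 : ℕ) : ℝ) with hε
  have hε0 : 0 < ε := by positivity
  have hεm : ((2 * M + 1 : ℕ) : ℝ) * ε = 1 := mul_one_div_cancel hm'.ne'
  have hε1 : ε ≤ 1 := by rw [hε, div_le_one hm']; exact hm1
  have hpM : p ≤ M := by
    rw [hρdef, div_lt_one hm'] at hρ
    have : 2 * p + 1 < 2 * M + 1 := by exact_mod_cast hρ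
    omega
  set g := scalarLaminate θ b i lam (stairOffset M) stairCoeffZero (stairCoeff M) with hg
  set G := scalarLaminateGradient θ b i lam (stairOffset M) stairCoeffZero (stairCoeff M) with hG
  let box : Finset (Fin (n + 1) → ℤ) := Fintype.piFinset fun _ => Finset.Icc (-(p : ℤ)) p
  have hbox : ∀ z ∈ box, ∀ j, |z j| ≤ p := fun z hz j =>
    abs_le.2 (Finset.mem_Icc.1 (Fintype.mem_piFinset.1 hz j))
  have hbox0 : 0 ∈ box := Fintype.mem_piFinset.2 fun j => by simp
  -- All directions are filled this time, since the whole cube carries jumps. The cell at the origin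
  -- is left out to make room for the exceptional cube.
  let K := box.erase 0
  have hKb : ∀ z ∈ K, z ∈ box := fun z hz => Finset.mem_of_mem_erase hz
  have hKj : ∀ z ∈ box, ∀ j, (2 * |z j| + 1 : ℝ) / ((2 * M + 1 : ℕ) : ℝ) ≤ ρ := fun z hz j => by
    rw [hρdef]
    gcongr
    exact_mod_cast hbox z hz j
  have hKc : K.card + 1 = (2 * p + 1) ^ (n + 1) := by
    rw [Finset.card_erase_add_one hbox0, Fintype.card_piFinset]
    simp only [Int.card_Icc, Finset.prod_const, Finset.card_univ, Fintype.card_fin]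
    congr 1
    omega
  have hfr : ∀ z ∈ box, ∀ x, (∀ j, |inner ℝ (b j) x - (z j : ℝ) / ((2 * M + 1 : ℕ) : ℝ)| ≤ ε / 2) →
      g x = ((z i - 1 / 2) / ((2 * M + 1 : ℕ) : ℝ) + ε * heav (inner ℝ (b i) x - z i / ((2 * M + 1 : ℕ) : ℝ))) • lam ∧ G x = 0 := by
    intro z hz x hx
    obtain ⟨h1, h2⟩ := hθρ x (abs_inner_le_of_abs_sub_le hm (hKj z hz) hx)
    constructor
    · rw [hg, staircase_apply, h1, one_mul, add_sub_cancel,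
        stair_eq ((hbox z hz i).trans (by exact_mod_cast hpM)) (hx i)]
    · rw [hG, staircaseGradient_apply hθ, h1, h2, sub_self, zero_smul, smul_zero, add_zero,
        tensor_zero_right]
  have hcell : ∀ z, ∀ y ∈ latticeCell b (2 * M + 1) z, ∀ j, |inner ℝ (b j) y - (z j : ℝ) / ((2 * M + 1 : ℕ) : ℝ)| ≤ ε / 2 :=
    fun z y hy j => ((mem_latticeCell hm).1 hy j).le
  have hsub : ∀ z ∈ box, latticeCell b (2 * M + 1) z ⊆ cube b := fun z hz y hy j =>
    (abs_inner_le_of_abs_sub_le hm (hKj z hz) (hcell z y hy) j).trans_lt (by linarith)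
  -- The exceptional cube has centre (ε/4) b i and side ε/4. It lies in the upper half of the cell
  -- at the origin, between heights ε/8 and 3ε/8, where the staircase is constantly (ε/2) λ.
  have hx₀ : ∀ j, inner ℝ (b j) ((ε / 4) • b i) = if j = i then ε / 4 else 0 := by
    intro j
    rw [inner_smul_right]
    split_ifs with h
    · rw [h, orthonormal_inner_self, mul_one]
    · rw [b.orthonormal.2 h, mul_zero]
  have hr₀ : 0 < ε / 4 := by positivity
  have hin : zoom ((ε / 4) • b i) (ε / 4) ⁻¹' cube b ⊆ latticeCell b (2 * M + 1) 0 := by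
    refine fun y hy => (mem_latticeCell hm).2 fun j => ?_
    have h1 := (mem_preimage_zoom_cube hr₀).1 hy j
    rw [hx₀] at h1
    rw [Pi.zero_apply, Int.cast_zero, zero_div, sub_zero]
    change _ < ε / 2
    rw [abs_lt] at h1 ⊢
    split_ifs at h1 <;> constructor <;> linarith
  -- Each cell sees one jump of height ελ across its middle, that is, an elementary jump rescaled
  -- with t = r = ε; its weight is ε·εⁿ.
  let F : Filling b b g G (Option K) := Filling.ofLattice hm K hε0
    (fun z => (((z i : ℝ) - 1 / 2) / ((2 * M + 1 : ℕ) : ℝ)) • lam) (f := elementaryJump lam (b i))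
    (Gf := fun _ => 0) (integrableOn_elementaryJump lam b i)
    (x₀ := (ε / 4) • b i) (r₀ := ε / 4) (t₀ := 1) hr₀ one_pos ((ε / 2) • lam)
    (fun z hz => hsub z (hKb z hz)) (hin.trans (hsub 0 hbox0))
    (fun z hz => (disjoint_latticeCell hm b (Finset.ne_of_mem_erase hz).symm).mono_left hin)
    (fun z hz y hy => by
      obtain ⟨h1, h2⟩ := hfr z (hKb z hz) y (hcell z y hy)
      constructor
      · have h3 : ((2 * M + 1 : ℕ) : ℝ) * inner ℝ (b i) y - z i = ((2 * M + 1 : ℕ) : ℝ) * (inner ℝ (b i) y - z i / ((2 * M + 1 : ℕ) : ℝ)) := by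
          field_simp
        rw [h1, rescale, elementaryJump_eq, inner_zoom_latticePoint hm, h3, heav_mul hm']
        module
      · rw [h2, rescaleGradient, smul_zero])
    (fun y hy => by
      obtain ⟨h1, h2⟩ := hfr 0 hbox0 y (hcell 0 y (hin hy))
      refine ⟨?_, h2⟩
      have h3 := (mem_preimage_zoom_cube hr₀).1 hy i
      rw [hx₀, if_pos rfl, abs_lt] at h3
      rw [h1, heav_sub_of_mem (by
        rw [Pi.zero_apply, Int.cast_zero, zero_div]; linarith [h3.1]), Pi.zero_apply, Int.cast_zero]
      congr 1
      rw [hε]; ring)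
    (fun z hz => by
      -- Unlike for the ramp, the jump set does meet the frontiers of the cells. The jump planes
      -- pass through the middles of cells, so a jump point on a frontier lies on a face orthogonal
      -- to another direction, and hence in the intersection of two different hyperplanes.
      refine measure_mono_null (t := ⋃ j : {j : Fin (n + 1) // i ≠ j} × Bool,
        plane b i ((z i : ℝ) / ((2 * M + 1 : ℕ) : ℝ)) ∩ plane b j.1 ((z j.1 : ℝ) / ((2 * M + 1 : ℕ) : ℝ) + ε * faceSign j.2)) ?_
        (measure_iUnion_null fun j => hausdorff_plane_inter_plane b j.1.2 _ _)
      rintro x ⟨hx, hxJ⟩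
      have h1 := abs_le_of_mem_frontier_latticeCell hm hx
      obtain ⟨k, hk⟩ := exists_int_of_mem_jumpSet_staircase hθ hxJ
      have hki : (z i : ℝ) / ((2 * M + 1 : ℕ) : ℝ) = inner ℝ (b i) x := by
        have h2 := h1 i
        rw [hk, stairOffset, ← sub_div, abs_div, abs_of_pos hm', div_div, div_le_div_iff₀ hm'
          (by positivity)] at h2
        have h3 : |(k : ℝ) - M - z i| * 2 ≤ 1 := by
          refine le_of_mul_le_mul_right (a := ((2 * M + 1 : ℕ) : ℝ)) ?_ hm'
          linarith
        have h4 : |(k : ℤ) - M - z i| * 2 ≤ 1 := by exact_mod_cast h3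
        have h5 : (k : ℤ) - M - z i = 0 := abs_eq_zero.1 (by
          have := abs_nonneg ((k : ℤ) - M - z i)
          omega)
        have h6 : (k : ℝ) - M - z i = 0 := by exact_mod_cast h5
        rw [hk, stairOffset]
        congr 1
        linarith
      have hxc : x ∉ latticeCell b (2 * M + 1) z := by
        rw [(isOpen_latticeCell b _ z).frontier_eq] at hx
        exact hx.2
      rw [mem_latticeCell hm] at hxc
      push Not at hxc
      obtain ⟨j, hj⟩ := hxc
      have hj' := le_antisymm (h1 j) hj
      have hij : i ≠ j := by
        rintro rfl
        rw [← hki, sub_self, abs_zero] at hj'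
        exact absurd hj' (by positivity)
      obtain ⟨σ, hσ⟩ := (abs_eq_half_iff (((2 * M + 1 : ℕ) : ℝ) * (inner ℝ (b j) x - (z j : ℝ) / ((2 * M + 1 : ℕ) : ℝ)))).1 (by
        rw [abs_mul, abs_of_pos hm', hj']
        field_simp)
      refine Set.mem_iUnion.2 ⟨(⟨j, hij⟩, σ), hki.symm, ?_⟩
      change inner ℝ (b j) x = _
      rw [← hσ, ← mul_assoc, mul_comm ε, hεm]
      ring)
    (by
      rw [Set.disjoint_iff_inter_eq_empty.1, measure_empty]
      refine Set.disjoint_left.2 fun x hx hxJ => ?_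
      obtain ⟨k, hk⟩ := exists_int_of_mem_jumpSet_staircase hθ hxJ
      have h1 := abs_le_of_mem_frontier_preimage_zoom hr₀ hx i
      rw [hx₀, if_pos rfl, hk, stairOffset, div_eq_mul_one_div, abs_le] at h1
      change _ ≤ _ * ε - _ ∧ _ * ε - _ ≤ _ at h1
      have h2 : (0 : ℝ) < (k : ℝ) - M := by
        refine lt_of_mul_lt_mul_right (a := ε) ?_ hε0.le
        linarith [h1.1]
      have h3 : (k : ℝ) - M < 1 := by
        refine lt_of_mul_lt_mul_right (a := ε) ?_ hε0.le
        linarith [h1.2]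
      have h4 : (0 : ℤ) < (k : ℤ) - M := by exact_mod_cast h2
      have h5 : (k : ℤ) - M < 1 := by exact_mod_cast h3
      omega)
  have hcard : (Fintype.card K : ℝ) = (2 * p + 1) ^ (n + 1) - 1 := by
    rw [Fintype.card_coe, eq_sub_iff_add_eq]
    exact_mod_cast hKc
  have hρn : (Fintype.card K : ℝ) * ε ^ (n + 1) = ρ ^ (n + 1) - ε ^ (n + 1) := by
    rw [hcard, sub_mul, one_mul, ← mul_pow, hρdef, hε, mul_one_div]
  have hρn1 : ρ ^ (n + 1) ≤ 1 := pow_le_one₀ hρ0.le hρ.le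
  have hεn : 0 < ε ^ (n + 1) := by positivity
  have hτ : ∑ k ∈ Finset.univ.erase none, F.t k * F.r k ^ n = ρ ^ (n + 1) - ε ^ (n + 1) := by
    rw [sum_erase_none, ← hρn]
    change ∑ _k : K, ε * ε ^ n = _
    rw [Finset.sum_const, Finset.card_univ, nsmul_eq_mul, pow_succ']
  have hsmall : (3 * ‖lam‖ + 1) * (1 - (ρ ^ (n + 1) - ε ^ (n + 1))) ≤ η := by
    have h1 : (3 * ‖lam‖ + 1) * ε ^ (n + 1) ≤ η / 2 := by
      have h2 : ε ^ (n + 1) ≤ ε := pow_le_of_le_one hε0.le hε1 (by omega)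
      have h3 : (3 * ‖lam‖ + 1) / (η / 2) ≤ ((2 * M + 1 : ℕ) : ℝ) := by linarith
      rw [div_le_iff₀ (half_pos hη)] at h3
      calc (3 * ‖lam‖ + 1) * ε ^ (n + 1) ≤ (((2 * M + 1 : ℕ) : ℝ) * (η / 2)) * ε := by gcongr
        _ = η / 2 := by rw [mul_right_comm, hεm, one_mul]
    linarith
  -- All 2M + 1 sections of the cube have total area at most m. With jumps of height at most ε|λ|
  -- and εm = 1, this bounds the total jump variation by |λ|.
  let T := ⋃ j, plane b i (stairOffset M j) ∩ cube b
  have hT : MeasurableSet T := MeasurableSet.iUnion fun j =>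
    (measurableSet_plane b i _).inter (isOpen_cube b).measurableSet
  have hTm : (μHE[n + 1 - 1] : Measure (Vec (n + 1))) T ≤ ((2 * M + 1 : ℕ) : ℝ≥0∞) := by
    refine (measure_iUnion_fintype_le _ _).trans ?_
    rw [Finset.sum_congr rfl fun j _ => hausdorff_plane_inter_cube_le b i (abs_stairOffset_lt j)]
    simp
  have hTt : (μHE[n + 1 - 1] : Measure (Vec (n + 1))) T ≠ ⊤ :=
    ne_top_of_le_ne_top (ENNReal.natCast_ne_top _) hTm
  have hTr : (μHE[n + 1 - 1] : Measure (Vec (n + 1))).real T ≤ ((2 * M + 1 : ℕ) : ℝ) :=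
    ENNReal.toReal_le_of_le_ofReal hm'.le (by rwa [ENNReal.ofReal_natCast])
  have hvt : volume (cube b) ≠ ⊤ := by rw [volume_cube]; simp
  have hdef := F.defect_le (S := cube b) (T := T) (isOpen_cube b).measurableSet hT subset_rfl
    (Set.iUnion_subset fun j => Set.inter_subset_right) hTt
    (C₁ := ‖lam‖ * 2) (C₂ := ε * ‖lam‖) (by positivity) (by positivity)
    (fun x hx => norm_staircaseGradient_le hθ hθ1 hC (by linarith) hx)
    (fun x hx hxS => absurd hx hxS)
    (fun x _ => by
      rw [(scalarLaminate_jump hθ x).2, norm_tensor, b.orthonormal.1, mul_one]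
      exact norm_staircase_jump_le hθ1 x)
    (fun x hx => by
      obtain ⟨j, hj⟩ := exists_int_of_mem_jumpSet_staircase hθ hx.2
      exact Set.mem_iUnion.2 ⟨j, hj, hx.1⟩)
  have hv := measureReal_sdiff_union_le F (ν := volume) (isOpen_cube b).measurableSet hvt
    (a := ε ^ (n + 1)) (fun z =>
      (volume_latticeCell hm b z).ge.trans
        (congrArg volume.real (Set.inter_eq_right.2 (hsub z (hKb z z.2)))).ge)
  have hh := measureReal_sdiff_union_le F hT hTt (a := ε ^ n) (fun z => by
    rw [hε, ← hausdorff_plane_inter_latticeCell hm b i z]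
    refine measureReal_mono ?_ (ne_top_of_le_ne_top hTt (measure_mono Set.inter_subset_left))
    rintro x ⟨hx, hxz⟩
    refine ⟨?_, hxz⟩
    have h1 := abs_le.1 (hbox z (hKb z z.2) i)
    have h2 : ((z : Fin (n + 1) → ℤ) i + M).toNat < 2 * M + 1 := by omega
    refine Set.mem_iUnion.2 ⟨⟨_, h2⟩, ?_, hsub z (hKb z z.2) hxz⟩
    change inner ℝ (b i) x = _
    rw [show inner ℝ (b i) x = _ from hx, stairOffset]
    congr 1
    have h3 : ((((z : Fin (n + 1) → ℤ) i + M).toNat : ℤ) : ℝ) = (z : Fin (n + 1) → ℤ) i + M := by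
      rw [Int.toNat_of_nonneg (by omega)]; push_cast; ring
    rw [Int.cast_natCast] at h3
    change _ = ((((z : Fin (n + 1) → ℤ) i + M).toNat : ℕ) : ℝ) - M
    rw [h3]; ring)
  rw [measureReal_def _ (cube b), volume_cube, ENNReal.toReal_one, hρn] at hv
  -- After multiplication by the step height, uncovered area becomes uncovered weight: ε(m −
  -- card·εⁿ) = 1 − card·ε^(n+1).
  have hh' : ε * (μHE[n + 1 - 1] : Measure (Vec (n + 1))).real (T \ F.union) ≤
      1 - (ρ ^ (n + 1) - ε ^ (n + 1)) := by
    have h1 := mul_le_mul_of_nonneg_left (hh.trans (sub_le_sub_right hTr _)) hε0.le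
    refine h1.trans (le_of_eq ?_)
    rw [← hρn, mul_sub, mul_comm ε, hεm, pow_succ]
    ring
  refine ⟨Option K, inferInstance, inferInstance, g, G, F, none, elementaryJump lam (b i),
    fun _ => 0, 0, hasSBVDerivative_scalarLaminate hθ abs_stairOffset_lt, fun φ hφ => ?_,
    fun φ hφ => greenForm_elementaryJump lam b i hφ, ?_, rfl, rfl, ?_, ?_, ?_, ?_⟩
  · rw [greenForm_scalarLaminate hθ abs_stairOffset_lt hφ]
    refine boundaryForm_congr (fun x hx => ?_) φ
    rw [staircase_apply, cutoff_eq_zero hsupp hx, zero_mul, add_zero, mulVec_tensor,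
      real_inner_comm]
  · rintro (_ | k) hk
    · exact absurd rfl hk
    · exact ⟨rfl, rfl⟩
  · refine hdef.trans (le_trans ?_ hsmall)
    have h1 := mul_le_mul_of_nonneg_left hv (by positivity : 0 ≤ ‖lam‖ * 2)
    have h2 := mul_le_mul_of_nonneg_left hh' hlam
    linarith
  · rw [norm_zero, mul_zero]; exact hη.le
  · rw [hτ]; linarith
  · rw [hτ]
    have : 0 ≤ 3 * ‖lam‖ * (1 - (ρ ^ (n + 1) - ε ^ (n + 1))) :=
      mul_nonneg (by positivity) (by linarith)
    linarith

end StaircaseFilling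

end StructuredDeformation

end

/-! ### Assembly of the three claims -/

theorem proposition3p1 {d N : ℕ} (hN : 1 ≤ N)
    (W : Mat d N → ℝ) (ψ : Vec d → Vec N → ℝ)
    (hW : IsBulkDensity W) (hψ : IsSurfaceDensity ψ) :
    (∀ A B : Mat d N,
      Tendsto (fun t : ℝ => bulkDensity W ψ (t • A) (t • B) / t) atTop
        (𝓝 (cantorDensity W ψ A B))) ∧
    (∀ (b : OrthonormalBasis (Fin N) ℝ (Vec N)) (A B : Mat d N),
      cantorDensity W ψ A B = cantorDensityOn b W ψ A B) ∧
    (∀ (lam : Vec d) (ν : Vec N) (B : Mat d N) (b : OrthonormalBasis (Fin N) ℝ (Vec N)),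
      ‖ν‖ = 1 → (∃ i, b i = ν) →
        cantorDensity W ψ (tensor lam ν) B = cantorDensityOn b W ψ (tensor lam ν) B ∧
        cantorDensityOn b W ψ (tensor lam ν) B = jumpDensityOn b W ψ lam B ν) := by
  -- A positive dimension allows one coordinate to be split off, as all the slicing arguments
  -- require.
  obtain ⟨n, rfl⟩ : ∃ n, N = n + 1 := ⟨N - 1, by omega⟩
  have hw := isRecession_recession hW
  have hΨ := isJumpDensity_rankOneDensity hψ
  have hne : ∀ (b : OrthonormalBasis (Fin (n + 1)) ℝ (Vec (n + 1))) (A B : Mat d (n + 1)),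
      (energies (recession W) (rankOneDensity ψ) b (fun x => mulVec A x) B).Nonempty := by
    intro b A B
    obtain ⟨_, -, h⟩ := exists_competitor hw hΨ b
    obtain ⟨u, G, hu, -⟩ := h A B
    exact ⟨_, u, G, hu, rfl⟩
  have hframe : ∀ (b : OrthonormalBasis (Fin (n + 1)) ℝ (Vec (n + 1))) (A B : Mat d (n + 1)),
      cantorDensity W ψ A B = cantorDensityOn b W ψ A B := by
    intro b A B
    rw [cantorDensity, cantorDensityOn_eq hψ, cantorDensityOn_eq hψ]
    -- The filling result is symmetric in the two frames, so each inequality is the other one with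
    -- the frames exchanged.
    exact le_antisymm ((hasFillings_mulVec _ b A).sInf_le hw hΨ (hne b A B)).2
      ((hasFillings_mulVec b _ A).sInf_le hw hΨ (hne _ A B)).2
  refine ⟨fun A B => ?_, hframe, ?_⟩
  · simp_rw [bulkDensity_eq hψ]
    rw [cantorDensity, cantorDensityOn_eq hψ]
    exact tendsto_sInf_energies hW hΨ (hne _ A B)
  · rintro lam _ B b - ⟨i, rfl⟩
    refine ⟨hframe b _ B, ?_⟩
    rw [cantorDensityOn_eq hψ, jumpDensityOn_eq hψ]
    -- The ramp gives one inequality and, through `h1`, the existence of surface competitors, which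
    -- the staircase argument needs for the reverse inequality.
    obtain ⟨h1, h2⟩ := (hasFillings_elementaryJump b i lam).sInf_le hw hΨ (hne b _ B)
    exact le_antisymm ((hasFillings_mulVec_tensor b i lam).sInf_le hw hΨ h1).2 h2
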